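/- **Setting.** Formulas are formulas of the language $\{\in\}$ of set theory. A formula is $\Delta_0$ if all its quantifiers are bounded; $\Sigma_k$ and $\Pi_k$ are the usual prenex classes over $\Delta_0$. $\mathrm{KP}\ell$, the set theory for limits of admissible sets, has the axioms Extensionality, Pairing, Union, Infinity, $\Delta_0$-Separation, Foundation for all formulas, and $\forall x\exists y\,(x\in y\wedge y\text{ is admissible})$; here a set $y$ is *admissible* if it is transitive, $\omega\in y$, and $(y,\in)$ satisfies Pairing, Union, $\Delta_0$-Separation and $\Delta_0$-Collection. $\mathrm L$ denotes the universe of all sets. Below, $P$ ranges over the elements of $\mathrm L\cup\{\mathrm L\}$ that are $\mathrm L$ itself or admissible, $Q$ over the transitive sets with $\omega\in Q$, and $U$ stands for a $P$ or a $Q$. $U\models\varphi$ means $(U,\in)\models\varphi$. For a formula defining a relation $\prec$ put $x\prec^U y:\Leftrightarrow U\models x\prec y$. *Mahlo operations.* Let $\Pi_i(b)$ be the universal $\Pi_i$-formula: $b=\langle e,c\rangle$, and the $\Pi_i$-formula with code $e$ holds of $c$. For a class $\mathcal X$ and $i\ge 2$, $$U\in M_i(\mathcal X)\ :\Leftrightarrow\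 \forall b\in U\,[\,U\models\Pi_i(b)\to\exists Q\in\mathcal X\cap U\,(b\in Q\ \&\ Q\models\Pi_i(b))\,].$$ For a definable relation $\prec$, by recursion on $\in$, $$U\in M_i(a;\prec)\ :\Leftrightarrow\ U\in M_i(M_i(b;\prec))\text{ for all } b\prec^U a .$$ *Exponential ordering.* Let $<_1,<_0$ be definable relations on $\omega$. $dom(<_E^U)$ is the set of finite sequences $\alpha=\langle(n^1_j,n^0_j):j<\ell\rangle$ of pairs of natural numbers with $n^1_{j+1}<_1^U n^1_j$ for $j+1<\ell$. For $\alpha$ as above and $\beta=\langle(m^1_j,m^0_j):j<\ell'\rangle$ in $dom(<_E^U)$, $\alpha<_E^U\beta$ holds iff either there is a $k<\min(\ell,\ell')$ such that $(n^1_j,n^0_j)=(m^1_j,m^0_j)$ for all $j<k$ and [$n^1_k<_1^U m^1_k$, or $n^1_k=m^1_k$ and $n^0_k<_0^U m^0_k$], or else $\ell<\ell'$ and $(n^1_j,n^0_j)=(m^1_j,m^0_j)$ for all $j<\ell$. Let $W^U(<_0)$ be the set of those $x\in\omega$ such that there is no $f\in{}^\omega\omega\cap U$ with $f(0)=x$ and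 $f(k+1)<_0^U f(k)$ for all $k\in\omega$. Then $\alpha<_{EW}^U\beta$ iff $\alpha<_E^U\beta$ and all second components $n^0_j$, $m^0_j$ of $\alpha$ and $\beta$ are in $W^U(<_0)$. For $a\in\omega$ and $\alpha\in dom(<_E^U)$, $\alpha<^U a$ means that $\alpha$ is empty or $n^1_0<_1^U a$. **Lemma.** Let $<_1$ and $<_0$ be relations on $\omega$ that are transitive provably in $\mathrm{KP}\ell$, where $<_1$ is $\Delta_2$ (defined by a $\Sigma_2$-formula that on $\omega$ is equivalent, provably in $\mathrm{KP}\ell$, to a $\Pi_2$-formula; $<_1^U$ is computed with the $\Sigma_2$-formula) and $<_0$ is $\Sigma_1$ (defined by a $\Sigma_1$-formula). Then for each $i\ge 2$, $\mathrm{KP}\ell$ proves $$\forall P\in\mathrm L\cup\{\mathrm L\}\ \forall a\in\omega\ \forall\alpha<^P a\ [\,P\in M_{i+1}(M_{i+1}(a;<_1))\ \to\ P\in M_i(\alpha;<_{EW})\,].$$ -/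

import Mathlib

open FirstOrder FirstOrder.Language

namespace SetTh

/-! ### The language of set theory and the Lévy hierarchy -/

/-- The only non-logical symbol: the binary relation symbol for membership. -/
inductive SetRel : ℕ → Type
  | mem : SetRel 2

/-- The first-order language `{∈}` of set theory. -/
def setLang : Language := ⟨fun _ => Empty, SetRel⟩

/-- The membership symbol. -/
def memSym : setLang.Relations 2 := SetRel.mem

/-- The atomic formula `t ∈ u` for variables `t`, `u` (free: `inl`, bound: `inr`). -/
def memVar {α : Type} {n : ℕ} (t u : α ⊕ Fin n) : setLang.BoundedFormula α n :=
  memSym.boundedFormula₂ (Term.var t) (Term.var u)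

/-- `Δ₀`-formulas: all quantifiers are of the form `∀ x ∈ u` (hence also `∃ x ∈ u`). -/
inductive IsDelta0 {α : Type} : ∀ {n : ℕ}, setLang.BoundedFormula α n → Prop
  | falsum {n : ℕ} : IsDelta0 (BoundedFormula.falsum (n := n))
  | equal {n : ℕ} (t u : setLang.Term (α ⊕ Fin n)) : IsDelta0 (BoundedFormula.equal t u)
  | rel {n l : ℕ} (R : setLang.Relations l) (ts : Fin l → setLang.Term (α ⊕ Fin n)) :
      IsDelta0 (BoundedFormula.rel R ts)
  | imp {n : ℕ} {φ ψ : setLang.BoundedFormula α n} :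
      IsDelta0 φ → IsDelta0 ψ → IsDelta0 (φ.imp ψ)
  | ball {n : ℕ} (u : α ⊕ Fin n) {φ : setLang.BoundedFormula α (n + 1)} :
      IsDelta0 φ →
      IsDelta0 (∀' (memVar (Sum.inr (Fin.last n)) (Sum.map id Fin.castSucc u) ⟹ φ))

mutual
/-- `Σₖ`-formulas: a block of existential quantifiers in front of a `Πₖ₋₁`-formula. -/
inductive IsSigma {α : Type} : ∀ {n : ℕ}, ℕ → setLang.BoundedFormula α n → Prop
  | delta0 {n : ℕ} {φ : setLang.BoundedFormula α n} : IsDelta0 φ → IsSigma 0 φ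
  | ofPi {n k : ℕ} {φ : setLang.BoundedFormula α n} : IsPi k φ → IsSigma (k + 1) φ
  | ex {n k : ℕ} {φ : setLang.BoundedFormula α (n + 1)} :
      IsSigma (k + 1) φ → IsSigma (k + 1) (∃' φ)

/-- `Πₖ`-formulas: a block of universal quantifiers in front of a `Σₖ₋₁`-formula. -/
inductive IsPi {α : Type} : ∀ {n : ℕ}, ℕ → setLang.BoundedFormula α n → Prop
  | delta0 {n : ℕ} {φ : setLang.BoundedFormula α n} : IsDelta0 φ → IsPi 0 φ
  | ofSigma {n k : ℕ} {φ : setLang.BoundedFormula α n} : IsSigma k φ → IsPi (k + 1) φ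
  | all {n k : ℕ} {φ : setLang.BoundedFormula α (n + 1)} :
      IsPi (k + 1) φ → IsPi (k + 1) (∀' φ)
end

/-! ### Writing formulas

A formula in the variables `x₀, …, xₙ₋₁` is an element of `Fm n`; a variable is an element of
`Fin n`.  A variable stays the same variable under further quantifiers; the inclusion
`Fin n → Fin (n + 1)` is inserted silently. -/

abbrev Fm (n : ℕ) : Type := setLang.BoundedFormula Empty n

instance liftVar {n : ℕ} : Coe (Fin n) (Fin (n + 1)) := ⟨Fin.castSucc⟩

/-- An element of `L ∪ {L}`: either the class `L` of all sets, or a set `p`. -/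
inductive Univ (n : ℕ) : Type
  | L : Univ n
  | set (p : Fin n) : Univ n

/-- Renaming of variables. -/
def Univ.map {m n : ℕ} (f : Fin m → Fin n) : Univ m → Univ n
  | L => L
  | set p => set (f p)

instance liftUniv {n : ℕ} : Coe (Univ n) (Univ (n + 1)) := ⟨Univ.map Fin.castSucc⟩

section Logic
variable {n : ℕ}

def mem (x y : Fin n) : Fm n := memVar (Sum.inr x) (Sum.inr y)
def eq (x y : Fin n) : Fm n := BoundedFormula.equal (Term.var (Sum.inr x)) (Term.var (Sum.inr y))
def neg (φ : Fm n) : Fm n := φ.not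
def and (φ ψ : Fm n) : Fm n := φ ⊓ ψ
def or (φ ψ : Fm n) : Fm n := φ ⊔ ψ
def imp (φ ψ : Fm n) : Fm n := φ.imp ψ
def iff (φ ψ : Fm n) : Fm n := φ.iff ψ

/-- `∀ x, φ x` -/
def all (φ : Fin (n + 1) → Fm (n + 1)) : Fm n := (φ (Fin.last n)).all
/-- `∃ x, φ x` -/
def ex (φ : Fin (n + 1) → Fm (n + 1)) : Fm n := (φ (Fin.last n)).ex
/-- `∀ x ∈ a, φ x` -/
def allIn (a : Fin n) (φ : Fin (n + 1) → Fm (n + 1)) : Fm n := all fun x => imp (mem x a) (φ x)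
/-- `∃ x ∈ a, φ x` -/
def exIn (a : Fin n) (φ : Fin (n + 1) → Fm (n + 1)) : Fm n := ex fun x => and (mem x a) (φ x)

/-- `∀ x ∈ U, φ x` for `U ∈ L ∪ {L}` -/
def allU : Univ n → (Fin (n + 1) → Fm (n + 1)) → Fm n
  | Univ.L, φ => all φ
  | Univ.set p, φ => allIn p φ
/-- `∃ x ∈ U, φ x` for `U ∈ L ∪ {L}` -/
def exU : Univ n → (Fin (n + 1) → Fm (n + 1)) → Fm n
  | Univ.L, φ => ex φ
  | Univ.set p, φ => exIn p φ

end Logic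

infixr:58 " ⋏ " => and
infixr:57 " ⋎ " => or
infixr:56 " ⟶ᶠ " => imp
infix:55 " ⟷ᶠ " => iff

/-- Auxiliary to `relTo`: the free variables of `φ` become `v`, its bound variables come after
the first `n` variables, and its quantifiers are restricted to `U`. -/
def relAux {α : Type} {n : ℕ} (U : Univ n) (v : α → Fin n) :
    ∀ {k : ℕ}, setLang.BoundedFormula α k → Fm (n + k)
  | _, BoundedFormula.falsum => BoundedFormula.falsum
  | k, BoundedFormula.equal t u =>
      BoundedFormula.equal
        (t.relabel (fun z => Sum.inr (Sum.elim (fun a => Fin.castAdd k (v a)) (Fin.natAdd n) z)))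
        (u.relabel (fun z => Sum.inr (Sum.elim (fun a => Fin.castAdd k (v a)) (Fin.natAdd n) z)))
  | k, BoundedFormula.rel R ts =>
      BoundedFormula.rel R fun j => (ts j).relabel
        (fun z => Sum.inr (Sum.elim (fun a => Fin.castAdd k (v a)) (Fin.natAdd n) z))
  | _, BoundedFormula.imp φ ψ => (relAux U v φ).imp (relAux U v ψ)
  | k, BoundedFormula.all φ =>
      allU (U.map (Fin.castAdd k)) fun _ => (relAux U v φ : Fm (n + k + 1))

/-- `U ⊨ φ(v)`, i.e. `(U, ∈) ⊨ φ(v)`: the formula `φ` with its free variables replaced by the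
variables `v` and all its quantifiers restricted to `U`. -/
def relTo {α : Type} {n : ℕ} (U : Univ n) (φ : setLang.Formula α) (v : α → Fin n) : Fm n :=
  relAux U v (k := 0) φ

/-! ### Basic set theory -/

section Basic
variable {n : ℕ}

/-- `x` is transitive. -/
def isTrans (x : Fin n) : Fm n := allIn x fun y => allIn y fun z => mem z x

def isEmpty (x : Fin n) : Fm n := all fun y => neg (mem y x)

/-- `y = x ∪ {x}` -/
def isSucc (x y : Fin n) : Fm n := all fun z => mem z y ⟷ᶠ (mem z x ⋎ eq z x)

/-- `z = {x, y}` -/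
def isPair (z x y : Fin n) : Fm n := all fun u => mem u z ⟷ᶠ (eq u x ⋎ eq u y)

/-- `z = ⟨x, y⟩ = {{x}, {x, y}}` -/
def isOPair (z x y : Fin n) : Fm n :=
  ex fun u => ex fun v => isPair u x x ⋏ isPair v x y ⋏ isPair z u v

/-- `⟨x, y⟩ ∈ r` -/
def pairIn (r x y : Fin n) : Fm n := exIn r fun z => isOPair z x y

def isZeroOrSucc (x : Fin n) : Fm n := isEmpty x ⋎ exIn x fun y => isSucc y x

/-- `x ∈ ω`: `x` is an ordinal (a transitive set of transitive sets), and every member of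
`x ∪ {x}` is zero or a successor. -/
def isNat (x : Fin n) : Fm n :=
  isTrans x ⋏ allIn x (fun y => isTrans y) ⋏ isZeroOrSucc x ⋏ allIn x (fun y => isZeroOrSucc y)

/-- `w = ω` -/
def isOmega (w : Fin n) : Fm n := all fun x => mem x w ⟷ᶠ isNat x

/-- `s` is a finite sequence of length `l ∈ ω`: a function with domain `l`. -/
def isSeq (s l : Fin n) : Fm n :=
  isNat l ⋏ allIn s (fun z => exIn l fun i => ex fun x => isOPair z i x) ⋏
    allIn l (fun i => ex fun x => all fun y => pairIn s i y ⟷ᶠ eq y x)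

/-- `t = s ⌢ ⟨x⟩` for a finite sequence `s`. -/
def isSnoc (t s x : Fin n) : Fm n :=
  ex fun l => ex fun q => isSeq s l ⋏ isOPair q l x ⋏ all fun z => mem z t ⟷ᶠ (mem z s ⋎ eq z q)

/-- `t = ⟨x⟩` -/
def isSeq1 (t x : Fin n) : Fm n := ex fun s => isEmpty s ⋏ isSnoc t s x
/-- `t = ⟨x, y⟩` as a sequence -/
def isSeq2 (t x y : Fin n) : Fm n := ex fun s => isSeq1 s x ⋏ isSnoc t s y
/-- `t = ⟨x, y, z⟩` as a sequence -/
def isSeq3 (t x y z : Fin n) : Fm n := ex fun s => isSeq2 s x y ⋏ isSnoc t s z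

/-- `s` is a finite sequence of elements of `T`. -/
def isSeqIn (s T : Fin n) : Fm n :=
  ex fun l => isSeq s l ⋏ allIn l fun i => exIn T fun x => pairIn s i x

/-- `f ∈ {}^ω ω` -/
def isBaire (f : Fin n) : Fm n :=
  allIn f (fun z => ex fun k => ex fun m => isNat k ⋏ isNat m ⋏ isOPair z k m) ⋏
    all (fun k => isNat k ⟶ᶠ ex fun m => all fun y => pairIn f k y ⟷ᶠ eq y m)

end Basic

/-! ### Codes of `Δ₀`-formulas and their truth

`Δ₀`-formulas are coded by hereditarily finite sets:
`⟨0, ⟨i, j⟩⟩` codes `xᵢ ∈ xⱼ`, `⟨1, ⟨a, b⟩⟩` codes `¬ (a ∧ b)`, and `⟨2, ⟨j, a⟩⟩` codes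
`∀ y ∈ xⱼ, a`, where the new variable `y` of `a` is the one whose index is the length of the
current assignment.  (These suffice, equality being expressible by extensionality.)  A set that is
not of one of these forms counts as a code of a false formula. -/

section Truth
variable {n : ℕ}

def isOne (x : Fin n) : Fm n := ex fun z => isEmpty z ⋏ isSucc z x
def isTwo (x : Fin n) : Fm n := ex fun z => isOne z ⋏ isSucc z x

/-- `e = ⟨t, ⟨x, y⟩⟩` -/
def isTriple (e t x y : Fin n) : Fm n := ex fun p => isOPair p x y ⋏ isOPair e t p

/-- `e` codes `xᵢ ∈ xⱼ` -/
def isMemCode (e i j : Fin n) : Fm n := ex fun t => isEmpty t ⋏ isTriple e t i j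
/-- `e` codes `¬ (a ∧ b)` -/
def isNandCode (e a b : Fin n) : Fm n := ex fun t => isOne t ⋏ isTriple e t a b
/-- `e` codes `∀ y ∈ xⱼ, a` -/
def isBallCode (e j a : Fin n) : Fm n := ex fun t => isTwo t ⋏ isTriple e t j a

/-- Tarski's clauses for the truth of `e` under the assignment `s`, where `S` is the relation
"`a` is true under the assignment `s`". -/
def satClause (S e s : Fin n) : Fm n :=
  (ex fun i => ex fun j => ex fun u => ex fun v =>
    isMemCode e i j ⋏ pairIn s i u ⋏ pairIn s j v ⋏ mem u v) ⋎
  (ex fun a => ex fun b => isNandCode e a b ⋏ neg (pairIn S a s ⋏ pairIn S b s)) ⋎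
  (ex fun j => ex fun a => ex fun v => isBallCode e j a ⋏ pairIn s j v ⋏
    allIn v fun x => ex fun t => isSnoc t s x ⋏ pairIn S a t)

/-- `S` is a satisfaction relation for the codes in `T` and the finite sequences of elements
of `T`. -/
def isSat (T S : Fin n) : Fm n :=
  allIn T fun e => all fun s => isSeqIn s T ⟶ᶠ (pairIn S e s ⟷ᶠ satClause S e s)

/-- The `Δ₀`-formula coded by `e` is true under the assignment `s`. -/
def isTrue (e s : Fin n) : Fm n :=
  ex fun T => ex fun S => isTrans T ⋏ mem e T ⋏ isSeqIn s T ⋏ isSat T S ⋏ pairIn S e s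

end Truth

/-- `t` is a finite sequence of length `m` of elements of `U`, and `t` extends the sequence `s`. -/
def isExtension {n : ℕ} (U : Univ n) (t m s : Fin n) : Fm n :=
  isSeq t m ⋏ (allIn m fun j => exU U fun x => pairIn t j x) ⋏ allIn s fun z => mem z t

/-! A prenex formula with `k` alternating blocks of quantifiers and a `Δ₀`-matrix is coded by
`⟨m₁, ⟨m₂, … ⟨m_k, e⟩ …⟩⟩`, where `e` codes the matrix and `m_j` is the number of all variables up
to and including the `j`-th block, so that the `j`-th block quantifies the variables `x_r` with
`m_{j-1} ≤ r < m_j`, `m₀` being the length of the given assignment `s`. -/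

mutual
/-- `U ⊨ φ(s)` for the `Π_k`-formula `φ` coded by `e`. -/
def piTrue : ∀ {n : ℕ}, ℕ → Univ n → Fin n → Fin n → Fm n
  | _, 0, _, e, s => isTrue e s
  | _, k + 1, U, e, s => ex fun m => ex fun e' => isOPair e m e' ⋏
      all fun t => isExtension U t m s ⟶ᶠ sigmaTrue k U e' t
/-- `U ⊨ φ(s)` for the `Σ_k`-formula `φ` coded by `e`. -/
def sigmaTrue : ∀ {n : ℕ}, ℕ → Univ n → Fin n → Fin n → Fm n
  | _, 0, _, e, s => isTrue e s
  | _, k + 1, U, e, s => ex fun m => ex fun e' => isOPair e m e' ⋏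
      ex fun t => isExtension U t m s ⋏ piTrue k U e' t
end

/-- `U ⊨ Πᵢ(b)` for the universal `Πᵢ`-formula `Πᵢ(b)`: `b = ⟨e, c⟩`, and `U ⊨ φ(c)`, where `φ` is
the `Πᵢ`-formula coded by `e`. -/
def univPi {n : ℕ} (i : ℕ) (U : Univ n) (b : Fin n) : Fm n :=
  ex fun e => ex fun c => ex fun s => isOPair b e c ⋏ isSeq1 s c ⋏ piTrue i U e s

/-! ### Admissible sets and the theory `KPℓ` -/

/-- `y` is an admissible set: it is transitive, contains `ω`, and satisfies Pairing, Union,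
`Δ₀`-Separation and `Δ₀`-Collection (`S` being the truth relation for `Δ₀`-formulas on `y`). -/
def isAdm {n : ℕ} (y : Fin n) : Fm n :=
  isTrans y ⋏
  (exIn y fun w => isOmega w) ⋏
  (allIn y fun a => allIn y fun b => exIn y fun c => isPair c a b) ⋏
  (allIn y fun a => exIn y fun c => all fun x => mem x c ⟷ᶠ exIn a fun u => mem x u) ⋏
  ex fun S => isSat y S ⋏
    (allIn y fun e => allIn y fun p => allIn y fun a => exIn y fun c => all fun x =>
      mem x c ⟷ᶠ (mem x a ⋏ ex fun s => isSeq2 s p x ⋏ pairIn S e s)) ⋏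
    (allIn y fun e => allIn y fun p => allIn y fun a =>
      (allIn a fun x => exIn y fun z => ex fun s => isSeq3 s p x z ⋏ pairIn S e s) ⟶ᶠ
      exIn y fun c => allIn a fun x => exIn c fun z => ex fun s =>
        isSeq3 s p x z ⋏ pairIn S e s)

def extAx : setLang.Sentence :=
  (all fun x => all fun y => (all fun z => mem z x ⟷ᶠ mem z y) ⟶ᶠ eq x y : Fm 0)

def pairAx : setLang.Sentence :=
  (all fun x => all fun y => ex fun z => isPair z x y : Fm 0)

def unionAx : setLang.Sentence :=
  (all fun x => ex fun z => all fun u => mem u z ⟷ᶠ exIn x fun v => mem u v : Fm 0)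

def infAx : setLang.Sentence := (ex fun w => isOmega w : Fm 0)

/-- The universe is a limit of admissible sets: `∀ x ∃ y (x ∈ y and y is admissible)`. -/
def limAx : setLang.Sentence := (all fun x => ex fun y => mem x y ⋏ isAdm y : Fm 0)

/-- The instance of `Δ₀`-Separation for `φ(x, p₁, …, p_k)`:
`∀ p ∀ a ∃ c ∀ x (x ∈ c ↔ x ∈ a ∧ φ(x, p))`. -/
def sepAx {k : ℕ} (φ : setLang.Formula (Fin (k + 1))) : setLang.Sentence :=
  BoundedFormula.alls (n := k) (all fun a => ex fun c => all fun x =>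
    mem x c ⟷ᶠ (mem x a ⋏ relTo Univ.L φ (Fin.cons x fun j : Fin k => (j : Fin (k + 1 + 1 + 1)))))

/-- The instance of Foundation for `φ(x, p₁, …, p_k)`:
`∀ p (∀ x ((∀ y ∈ x, φ(y, p)) → φ(x, p)) → ∀ x φ(x, p))`. -/
def foundAx {k : ℕ} (φ : setLang.Formula (Fin (k + 1))) : setLang.Sentence :=
  BoundedFormula.alls (n := k)
    ((all fun x =>
        (allIn x fun y => relTo Univ.L φ (Fin.cons y fun j : Fin k => (j : Fin (k + 1 + 1)))) ⟶ᶠ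
        relTo Univ.L φ (Fin.cons x fun j : Fin k => (j : Fin (k + 1)))) ⟶ᶠ
      all fun x => relTo Univ.L φ (Fin.cons x fun j : Fin k => (j : Fin (k + 1))))

/-- The set theory `KPℓ` for limits of admissible sets. -/
def KPl : setLang.Theory :=
  {extAx, pairAx, unionAx, infAx, limAx} ∪
  {ψ | ∃ (k : ℕ) (φ : setLang.Formula (Fin (k + 1))), IsDelta0 φ ∧ ψ = sepAx φ} ∪
  {ψ | ∃ (k : ℕ) (φ : setLang.Formula (Fin (k + 1))), ψ = foundAx φ}

/-! ### Mahlo operations and their iterations -/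

/-- A definable relation `≺`, given by the formulas that express `x ≺^U y` for
`U ∈ L ∪ {L}`. -/
abbrev DefRel : Type := ∀ n : ℕ, Univ n → Fin n → Fin n → Fm n

/-- The relation on `ω` defined by `φ`: `x ≺^U y` iff `x, y ∈ ω` and `U ⊨ φ(x, y)`. -/
def natRel (φ : setLang.Formula (Fin 2)) : DefRel :=
  fun _ U x y => isNat x ⋏ isNat y ⋏ relTo U φ ![x, y]

/-- `Q` is a transitive set with `ω ∈ Q`. -/
def isUniv {n : ℕ} (Q : Fin n) : Fm n := isTrans Q ⋏ exIn Q fun w => isOmega w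

/-- `U ∈ Mᵢ(X)`: for all `b ∈ U`, if `U ⊨ Πᵢ(b)`, then there is a `Q ∈ X ∩ U` such that
`b ∈ Q ⊨ Πᵢ(b)`. -/
def mahlo {n : ℕ} (i : ℕ) (U : Univ n) (X : Fin (n + 1 + 1) → Fm (n + 1 + 1)) : Fm n :=
  allU U fun b => univPi i U b ⟶ᶠ
    exU U fun Q => isUniv Q ⋏ X Q ⋏ mem b Q ⋏ univPi i (Univ.set Q) b

/-- `H` is, on `D × I`, the relation `Q ∈ Mᵢ(c; ≺)` between sets `Q ∈ D` and indices `c ∈ I`,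
where `D` is transitive and `I` is closed under `≺^Q`-predecessors for `Q ∈ D`: it
satisfies the recursion `Q ∈ Mᵢ(c; ≺) ↔ Q ∈ ⋂ {Mᵢ(Mᵢ(d; ≺)) : d ≺^Q c}`. -/
def isHier {n : ℕ} (i : ℕ) (R : DefRel) (D I H : Fin n) : Fm n :=
  isTrans D ⋏
  (allIn D fun Q => isUniv Q ⟶ᶠ allIn I fun c => all fun d => R _ (Univ.set Q) d c ⟶ᶠ mem d I) ⋏
  (allIn D fun Q => isUniv Q ⟶ᶠ allIn I fun c => pairIn H Q c ⟷ᶠ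
    all fun d => R _ (Univ.set (Q : Fin (n + 1 + 1 + 1))) d c ⟶ᶠ
      mahlo i (Univ.set (Q : Fin (n + 1 + 1 + 1))) fun Q' => pairIn H Q' d)

/-- `P ∈ Mᵢ(a; ≺)` for a set `P`, by recursion on `∈`. -/
def iterMahloSet {n : ℕ} (i : ℕ) (R : DefRel) (P a : Fin n) : Fm n :=
  ex fun D => ex fun I => ex fun H => isHier i R D I H ⋏ mem P D ⋏ mem a I ⋏ pairIn H P a

/-- `U ∈ Mᵢ(a; ≺)` for `U ∈ L ∪ {L}`. -/
def iterMahlo {n : ℕ} (i : ℕ) (R : DefRel) : Univ n → Fin n → Fm n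
  | Univ.set P, a => iterMahloSet i R P a
  | Univ.L, a => all fun d => R _ Univ.L d a ⟶ᶠ mahlo i Univ.L fun Q => iterMahloSet i R Q d

/-! ### The exponential ordering -/

section Exp
variable {n : ℕ}

/-- `U ⊨ a ∈ W(≺)`: no `f ∈ {}^ω ω ∩ U` with `f(0) = a` is a `≺^U`-descending sequence. -/
def wfPart (R : DefRel) (U : Univ n) (a : Fin n) : Fm n :=
  isNat a ⋏ allU U fun f => isBaire f ⟶ᶠ
    ex fun k => isNat k ⋏
      ((ex fun z => isEmpty z ⋏ pairIn f z a) ⟶ᶠ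
        ex fun k' => ex fun u => ex fun v =>
          isSucc k k' ⋏ pairIn f k u ⋏ pairIn f k' v ⋏ neg (R _ U v u))

/-- `α(j) = (x, y)` for a sequence `α` of pairs. -/
def entry (α j x y : Fin n) : Fm n := ex fun p => isOPair p x y ⋏ pairIn α j p

/-- `α ∈ dom(<_E^U)`: `α = ⟨(n¹ⱼ, n⁰ⱼ) : j < ℓ⟩` is a finite sequence of pairs of natural numbers
with `<₁^U`-decreasing first components. -/
def isExpSeq (R1 : DefRel) (U : Univ n) (α : Fin n) : Fm n :=
  (ex fun l => isSeq α l ⋏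
    allIn l fun j => ex fun x => ex fun y => isNat x ⋏ isNat y ⋏ entry α j x y) ⋏
  all fun j => all fun j' => all fun x => all fun y => all fun x' => all fun y' =>
    (isSucc j j' ⋏ entry α j x y ⋏ entry α j' x' y') ⟶ᶠ R1 _ U x' x

/-- `α(j) = β(j)` (both being defined). -/
def agreeAt (α β j : Fin n) : Fm n := ex fun p => pairIn α j p ⋏ pairIn β j p

/-- The lexicographic ordering: `(x₁, x₀) <_L^U (y₁, y₀)`. -/
def lexRel (R1 R0 : DefRel) (U : Univ n) (x₁ x₀ y₁ y₀ : Fin n) : Fm n :=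
  R1 _ U x₁ y₁ ⋎ (eq x₁ y₁ ⋏ R0 _ U x₀ y₀)

/-- The exponential ordering `α <_E^U β`, where `<_E = E(<₁, <₀)`. -/
def expRel (R1 R0 : DefRel) (U : Univ n) (α β : Fin n) : Fm n :=
  isExpSeq R1 U α ⋏ isExpSeq R1 U β ⋏
  ((ex fun k => (allIn k fun j => agreeAt α β j) ⋏
      ex fun x₁ => ex fun x₀ => ex fun y₁ => ex fun y₀ =>
        entry α k x₁ x₀ ⋏ entry β k y₁ y₀ ⋏ lexRel R1 R0 U x₁ x₀ y₁ y₀) ⋎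
   (ex fun l => ex fun m => isSeq α l ⋏ isSeq β m ⋏ mem l m ⋏ allIn l fun j => agreeAt α β j))

/-- All second components of `α` are in the wellfounded part of `<₀`, in the sense of `U`. -/
def secondsWf (R0 : DefRel) (U : Univ n) (α : Fin n) : Fm n :=
  all fun j => all fun x => all fun y => entry α j x y ⟶ᶠ wfPart R0 U y

/-- `α <^U a` for `α ∈ dom(<_E^U)`: the first component of the first pair of `α` is `<₁^U a`
(no condition if `α` is the empty sequence). -/
def expBelow (R1 : DefRel) (U : Univ n) (α a : Fin n) : Fm n :=
  isExpSeq R1 U α ⋏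
  all fun z => all fun x => all fun y => (isEmpty z ⋏ entry α z x y) ⟶ᶠ R1 _ U x a

end Exp

/-- `<_EW`: the restriction of `<_E` to the wellfounded part in the second components. -/
def expWRel (R1 R0 : DefRel) : DefRel :=
  fun _ U α β => expRel R1 R0 U α β ⋏ secondsWf R0 U α ⋏ secondsWf R0 U β

/-! ### The sentences -/

/-- The relation defined by `φ` on `ω` is transitive. -/
def transSentence (φ : setLang.Formula (Fin 2)) : setLang.Sentence :=
  (all fun x => all fun y => all fun z =>
    (natRel φ _ Univ.L x y ⋏ natRel φ _ Univ.L y z) ⟶ᶠ natRel φ _ Univ.L x z : Fm 0)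

/-- `φ` and `ψ` define the same relation on `ω`. -/
def sameRelSentence (φ ψ : setLang.Formula (Fin 2)) : setLang.Sentence :=
  (all fun x => all fun y => natRel φ _ Univ.L x y ⟷ᶠ natRel ψ _ Univ.L x y : Fm 0)

/-- For `U ∈ L ∪ {L}`:
`∀ a ∈ ω ∀ α <^U a [U ∈ M_{i+1}(M_{i+1}(a; <₁)) → U ∈ Mᵢ(α; <_EW)]`. -/
def exponentFormula {n : ℕ} (i : ℕ) (R1 R0 : DefRel) (U : Univ n) : Fm n :=
  all fun a => isNat a ⟶ᶠ all fun α => expBelow R1 U α a ⟶ᶠ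
    (mahlo (i + 1) U fun Q => iterMahlo (i + 1) R1 (Univ.set Q) a) ⟶ᶠ
    iterMahlo i (expWRel R1 R0) U α

/-- The above for the class `L` and for all admissible sets `P ∈ L`. -/
def exponentSentence (i : ℕ) (R1 R0 : DefRel) : setLang.Sentence :=
  (exponentFormula i R1 R0 Univ.L ⋏
    all fun P => isAdm P ⟶ᶠ exponentFormula i R1 R0 (Univ.set P) : Fm 0)

end SetTh

-- By completeness it suffices to argue in an arbitrary, possibly nonstandard, model `M` of KPℓ.
-- Foundation then applies only to predicates definable in `M`, which is why definability is carried
-- along in every induction.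
--
-- The heart of the proof is the statement `Extends` for `U`. Let Q ∈ U be a limit of admissible
-- sets with Q ∈ M_{i+1}(a; <₁), and let γ be an initial segment of β with Q ∈ M_i(γ; <_EW). If the
-- remaining entries (n, x) of β satisfy n <₁^Q a and x ∈ W^U(<₀), then Q ∈ M_i(β; <_EW). It is
-- proved by ∈-induction on U, appending the entries one at a time. To append (n, x), note that Q ∈
-- M_{i+1}(M_{i+1}(n; <₁)), and let δ <_EW^Q γ⌢(n, x). Either δ <_EW^Q γ, or δ end-extends γ' by
-- entries with first components <₁^Q n, where γ' is γ or γ⌢(n, y) for some y <₀^Q x (`EW.cases`).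
-- If Q ∈ M_i(γ'), then Q reflects this fact together with a given Π_i-sentence to some R ∈ Q with R
-- ∈ M_{i+1}(n; <₁), and `Extends` for Q turns R ∈ M_i(γ') into R ∈ M_i(δ) (`Extends.iter_ap`). The
-- case γ' = γ⌢(n, y) calls for an induction along <₀. The counterexamples y form a set in U; if x
-- were one, then choosing ∈-least smaller counterexamples again and again would produce a
-- descending sequence in U, against x ∈ W^U(<₀) (`Extends.iter_ap_of_wf`). The lemma follows by
-- reflecting from P once more and applying `Extends` with γ empty (`Mahlo.exponent`).
--
-- The reflection needs "U ∈ M_i(γ; <_EW)" to be Π_{i+1}. As literally written it is too complex,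
-- because W^U(<₀) occurs in a premise. It is replaced by `IterB`, in which descending sequences are
-- refuted only for the relations <₀^c with c ∈ U. The two versions agree at reflecting universes,
-- since <₀ is Σ₁ and a descending sequence in U reflects to some c ∈ U (`pi_iterB`, `Iter.iterB`,
-- `IterB.iter`).
--
-- All this presupposes that truth for Π_i-formulas and the iterations M_i(·; ≺) are computed
-- correctly inside U. Over limits of admissible sets this holds, because satisfaction relations and
-- Mahlo hierarchies are obtained by recursion in a next admissible set (`exists_recursion`,
-- `Adm.exists_isSat`, `Lim.exists_hier`). The class L is such a limit by an axiom. An admissible P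
-- is one because M_{i+1}-reflection with i + 1 ≥ 3 yields admissible elements of P (`Adm.lim`).

set_option linter.unusedSectionVars false
set_option linter.unusedSimpArgs false
set_option linter.unusedVariables false

namespace SetTh

-- Truth of formulas in a structure.

section Logic
variable {N : Type} [setLang.Structure N]

/-- Membership in a structure for the language of set theory. -/
def Mem (x y : N) : Prop := Structure.RelMap memSym ![x, y]

/-- Truth of a formula under an assignment. -/
def Tr {n : ℕ} (φ : Fm n) (v : Fin n → N) : Prop := BoundedFormula.Realize φ default v

variable {n : ℕ} {v : Fin n → N}

@[simp] theorem tr_mem {x y : Fin n} : Tr (mem x y) v ↔ Mem (v x) (v y) := by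
  simp [Tr, mem, memVar, Mem, BoundedFormula.realize_rel₂]

@[simp] theorem tr_eq {x y : Fin n} : Tr (eq x y) v ↔ v x = v y := by
  simp [Tr, eq, BoundedFormula.Realize]

@[simp] theorem tr_neg {φ : Fm n} : Tr (neg φ) v ↔ ¬ Tr φ v := by simp [Tr, neg]

@[simp] theorem tr_and {φ ψ : Fm n} : Tr (φ ⋏ ψ) v ↔ Tr φ v ∧ Tr ψ v := by simp [Tr, and]

@[simp] theorem tr_or {φ ψ : Fm n} : Tr (φ ⋎ ψ) v ↔ Tr φ v ∨ Tr ψ v := by simp [Tr, or]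

@[simp] theorem tr_imp {φ ψ : Fm n} : Tr (φ ⟶ᶠ ψ) v ↔ (Tr φ v → Tr ψ v) := by simp [Tr, imp]

@[simp] theorem tr_iff {φ ψ : Fm n} : Tr (φ ⟷ᶠ ψ) v ↔ (Tr φ v ↔ Tr ψ v) := by simp [Tr, iff]

@[simp] theorem tr_all {φ : Fin (n + 1) → Fm (n + 1)} :
    Tr (all φ) v ↔ ∀ x : N, Tr (φ (Fin.last n)) (Fin.snoc v x) := by
  simp [Tr, all]

@[simp] theorem tr_ex {φ : Fin (n + 1) → Fm (n + 1)} :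
    Tr (ex φ) v ↔ ∃ x : N, Tr (φ (Fin.last n)) (Fin.snoc v x) := by
  simp [Tr, ex]

@[simp] theorem tr_allIn {a : Fin n} {φ : Fin (n + 1) → Fm (n + 1)} :
    Tr (allIn a φ) v ↔ ∀ x : N, Mem x (v a) → Tr (φ (Fin.last n)) (Fin.snoc v x) := by
  simp [allIn]

@[simp] theorem tr_exIn {a : Fin n} {φ : Fin (n + 1) → Fm (n + 1)} :
    Tr (exIn a φ) v ↔ ∃ x : N, Mem x (v a) ∧ Tr (φ (Fin.last n)) (Fin.snoc v x) := by
  simp [exIn]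

end Logic

-- Truth in subclasses and relativized formulas.

section Relativization
variable {M : Type} [setLang.Structure M]

/-- There are no function symbols, so every subset carries the induced structure. -/
instance subStructure (U : Set M) : setLang.Structure ↥U where
  funMap := fun f => f.elim
  RelMap := fun r x => Structure.RelMap r (fun i => (x i : M))

@[simp] theorem mem_coe {U : Set M} {x y : ↥U} : Mem x y ↔ Mem (x : M) (y : M) := by
  show Structure.RelMap memSym (fun i => ((![x, y] : Fin 2 → ↥U) i : M)) ↔ _
  unfold Mem
  apply iff_of_eq
  congr 1
  funext i
  fin_cases i <;> rfl

/-- The members of `p`. -/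
def ext (p : M) : Set M := {x | Mem x p}

@[simp] theorem mem_ext {x p : M} : x ∈ ext p ↔ Mem x p := Iff.rfl

/-- Truth of a formula with all quantifiers restricted to the class `W`. -/
def EvB (W : Set M) {α : Type} (w : α → M) :
    ∀ {k : ℕ}, setLang.BoundedFormula α k → (Fin k → M) → Prop
  | _, .falsum, _ => False
  | _, .equal t u, xs => t.realize (Sum.elim w xs) = u.realize (Sum.elim w xs)
  | _, .rel R ts, xs => Structure.RelMap R fun i => (ts i).realize (Sum.elim w xs)
  | _, .imp φ ψ, xs => EvB W w φ xs → EvB W w ψ xs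
  | _, .all φ, xs => ∀ x ∈ W, EvB W w φ (Fin.snoc xs x)

def Ev (W : Set M) {α : Type} (φ : setLang.Formula α) (w : α → M) : Prop := EvB W w φ default

theorem coe_realize {U : Set M} {β : Type} (t : setLang.Term β) (w : β → ↥U) :
    ((t.realize w : ↥U) : M) = t.realize (fun b => (w b : M)) := by
  cases t with
  | var => rfl
  | func f => exact f.elim

theorem evB_coe {W : Set M} {α : Type} (w : α → ↥W) {k : ℕ} (φ : setLang.BoundedFormula α k)
    (xs : Fin k → ↥W) :
    EvB W (fun a => (w a : M)) φ (fun i => (xs i : M)) ↔ φ.Realize w xs := by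
  have hs : ∀ {k : ℕ} (xs : Fin k → ↥W), (fun b => ((Sum.elim w xs b : ↥W) : M)) =
      Sum.elim (fun a => (w a : M)) (fun i => (xs i : M)) := by
    intro k xs
    funext b
    cases b <;> rfl
  induction φ with
  | falsum => rfl
  | equal t u =>
    simp only [EvB, BoundedFormula.Realize, Subtype.ext_iff, coe_realize, hs]
  | rel R ts =>
    simp only [EvB, BoundedFormula.Realize, ← hs, ← coe_realize]
    rfl
  | imp φ ψ h1 h2 => simp only [EvB, BoundedFormula.Realize, h1, h2]
  | all φ h =>
    simp only [EvB, BoundedFormula.Realize, ← h]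
    constructor
    · intro H x
      convert H x x.2 using 1
      funext i
      refine Fin.lastCases ?_ (fun j => ?_) i <;> simp
    · intro H x hx
      convert H ⟨x, hx⟩ using 1
      funext i
      refine Fin.lastCases ?_ (fun j => ?_) i <;> simp

theorem ev_coe {W : Set M} {α : Type} (φ : setLang.Formula α) (w : α → ↥W) :
    Ev W φ (fun a => (w a : M)) ↔ φ.Realize w := by
  rw [Formula.Realize, ← evB_coe]
  unfold Ev
  have : (fun i => ((default : Fin 0 → ↥W) i : M)) = default := Subsingleton.elim _ _
  rw [this]

/-- The class denoted by a `Univ` term when the universe is `U`. -/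
def Univ.sem {U : Set M} {n : ℕ} (v : Fin n → ↥U) : Univ n → Set M
  | .L => U
  | .set p => ext (v p : M)

variable {U : Set M} {n : ℕ}

@[simp] theorem sem_L {v : Fin n → ↥U} : Univ.sem v .L = U := rfl
@[simp] theorem sem_set {v : Fin n → ↥U} {p : Fin n} : Univ.sem v (.set p) = ext (v p : M) := rfl

@[simp] theorem sem_map {m : ℕ} {v : Fin n → ↥U} {f : Fin m → Fin n} {V : Univ m} :
    Univ.sem v (V.map f) = Univ.sem (v ∘ f) V := by
  cases V <;> rfl

@[simp] theorem snoc_comp_castSucc {N : Type} {v : Fin n → N} {x : N} :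
    (Fin.snoc v x : Fin (n + 1) → N) ∘ Fin.castSucc = v := by
  funext i; simp

theorem tr_allU {v : Fin n → ↥U} {V : Univ n} {φ : Fin (n + 1) → Fm (n + 1)} :
    Tr (allU V φ) v ↔ ∀ x : ↥U, (x : M) ∈ Univ.sem v V → Tr (φ (Fin.last n)) (Fin.snoc v x) := by
  cases V <;> simp [allU]

theorem tr_exU {v : Fin n → ↥U} {V : Univ n} {φ : Fin (n + 1) → Fm (n + 1)} :
    Tr (exU V φ) v ↔ ∃ x : ↥U, (x : M) ∈ Univ.sem v V ∧ Tr (φ (Fin.last n)) (Fin.snoc v x) := by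
  cases V <;> simp [exU]

/-- `U` is a transitive class. -/
def TransC (U : Set M) : Prop := ∀ x ∈ U, ∀ y, Mem y x → y ∈ U

theorem sem_subset (hU : TransC U) (v : Fin n → ↥U) (V : Univ n) : Univ.sem v V ⊆ U := by
  cases V with
  | L => exact subset_rfl
  | set p => exact fun x hx => hU _ (v p).2 x hx

/-- Transitivity puts every element of the class denoted by `V` into `U`, so quantifiers restricted
to `V` range over the same objects whether evaluated in `U` or in `M`. -/
theorem tr_relAux {α : Type} (hU : TransC U) (V : Univ n) (f : α → Fin n) {k : ℕ}
    (φ : setLang.BoundedFormula α k) (v : Fin (n + k) → ↥U) :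
    Tr (relAux V f φ) v ↔
      EvB (Univ.sem (v ∘ Fin.castAdd k) V) (fun a => (v (Fin.castAdd k (f a)) : M)) φ
        (fun i => (v (Fin.natAdd n i) : M)) := by
  have hs : ∀ {k : ℕ} (v : Fin (n + k) → ↥U),
      (fun b => (((Sum.elim (default : Empty → ↥U) v ∘
        fun z : α ⊕ Fin k => Sum.inr (Sum.elim (fun a => Fin.castAdd k (f a)) (Fin.natAdd n) z)) b :
          ↥U) : M)) =
      Sum.elim (fun a => (v (Fin.castAdd k (f a)) : M)) (fun i => (v (Fin.natAdd n i) : M)) := by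
    intro k v
    funext b
    cases b <;> rfl
  induction φ with
  | falsum => rfl
  | equal t u =>
    simp only [relAux, EvB, Tr, BoundedFormula.Realize, Subtype.ext_iff, coe_realize,
      Term.realize_relabel, hs]
  | rel R ts =>
    simp only [relAux, EvB, Tr, BoundedFormula.Realize]
    show Structure.RelMap R (fun i => (((ts i).relabel _).realize _ : ↥U).1) ↔ _
    simp only [coe_realize, Term.realize_relabel, hs]
  | imp φ ψ h1 h2 =>
    have h1 := h1 v
    have h2 := h2 v
    simp only [Tr] at h1 h2
    simp only [relAux, EvB, Tr, BoundedFormula.realize_imp, h1, h2]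
  | @all k φ h =>
    rw [relAux, tr_allU, EvB, sem_map]
    have key : ∀ x : ↥U,
        Tr (relAux V f φ) (Fin.snoc v x : Fin (n + (k + 1)) → ↥U) ↔
        EvB (Univ.sem (v ∘ Fin.castAdd k) V) (fun a => (v (Fin.castAdd k (f a)) : M)) φ
          (Fin.snoc (fun i => (v (Fin.natAdd n i) : M)) (x : M)) := by
      intro x
      refine (h _).trans ?_
      have e1 : (Fin.snoc v x : Fin (n + (k + 1)) → ↥U) ∘ Fin.castAdd (k + 1) =
          v ∘ Fin.castAdd k := by
        funext i
        exact Fin.snoc_castSucc (α := fun _ => ↥U) x v (Fin.castAdd k i)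
      have e2 : ∀ a, (Fin.snoc v x : Fin (n + (k + 1)) → ↥U) (Fin.castAdd (k + 1) (f a)) =
          v (Fin.castAdd k (f a)) := fun a => congrFun e1 (f a)
      have e3 : (fun i => ((Fin.snoc v x : Fin (n + (k + 1)) → ↥U) (Fin.natAdd n i) : M)) =
          Fin.snoc (fun i => (v (Fin.natAdd n i) : M)) (x : M) := by
        funext i
        refine Fin.lastCases ?_ (fun j => ?_) i
        · rw [Fin.snoc_last]
          exact congrArg Subtype.val (Fin.snoc_last (α := fun _ => ↥U) x v)
        · rw [Fin.snoc_castSucc]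
          exact congrArg Subtype.val (Fin.snoc_castSucc (α := fun _ => ↥U) x v (Fin.natAdd n j))
      rw [e1, e3]
      simp only [e2]
    constructor
    · intro H x hx
      exact (key ⟨x, sem_subset hU _ _ hx⟩).1 (H ⟨x, sem_subset hU _ _ hx⟩ hx)
    · intro H x hx
      exact (key x).2 (H x hx)

theorem tr_relTo {α : Type} (hU : TransC U) (V : Univ n) (φ : setLang.Formula α) (f : α → Fin n)
    (v : Fin n → ↥U) :
    Tr (relTo V φ f) v ↔ Ev (Univ.sem v V) φ (fun a => (v (f a) : M)) := by
  unfold relTo Ev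
  rw [tr_relAux hU]
  have : (fun i : Fin 0 => (v (Fin.natAdd n i : Fin (n + 0)) : M)) = (default : Fin 0 → M) := Subsingleton.elim _ _
  rw [this]
  rfl

/-- The universe is handled as the class `Set.univ`, so that the same evaluation lemmas serve L and
its elements; this leads back to truth in `M` itself. -/
theorem tr_univ_coe {n : ℕ} (φ : Fm n) (v : Fin n → ↥(Set.univ : Set M)) :
    Tr φ v ↔ Tr φ (fun i => (v i : M)) := by
  have h1 : ∀ {k : ℕ} (φ : Fm k) (xs : Fin k → M),
      EvB Set.univ (default : Empty → M) φ xs ↔ φ.Realize default xs := by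
    intro k φ
    induction φ with
    | falsum => intro; rfl
    | equal t u => intro; rfl
    | rel R ts => intro; rfl
    | imp φ ψ h1 h2 => intro xs; simp only [EvB, BoundedFormula.Realize, h1, h2]
    | all φ h => intro xs; simp only [EvB, BoundedFormula.Realize, h, Set.mem_univ, true_imp_iff]
  unfold Tr
  rw [← h1, ← evB_coe]
  have : (fun a => ((default : Empty → ↥(Set.univ : Set M)) a : M)) = default :=
    Subsingleton.elim _ _
  rw [this]

end Relativization

end SetTh

-- Models of KPℓ: definable induction and elementary sets.

namespace SetTh

/-- Models of `KPℓ`. -/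
class KPM (M : Type) [setLang.Structure M] : Prop where
  ax : ∀ ψ ∈ KPl, Sentence.Realize M ψ

variable {M : Type} [setLang.Structure M] [KPM M]

theorem sentence_iff_tr {N : Type} [setLang.Structure N] (ψ : setLang.Sentence) (v : Fin 0 → N) :
    Sentence.Realize N ψ ↔ Tr (ψ : Fm 0) v := by
  have : v = default := Subsingleton.elim _ _
  rw [this]; rfl

theorem KPM.tr {ψ : setLang.Sentence} (h : ψ ∈ KPl) : Tr (ψ : Fm 0) (default : Fin 0 → M) :=
  (sentence_iff_tr ψ _).1 (KPM.ax ψ h)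

theorem KPM.tr_univ {ψ : setLang.Sentence} (h : ψ ∈ KPl) :
    Tr (ψ : Fm 0) (default : Fin 0 → ↥(Set.univ : Set M)) :=
  (tr_univ_coe _ _).2 ((sentence_iff_tr ψ _).1 (KPM.ax ψ h))

theorem transC_univ : TransC (Set.univ : Set M) := fun _ _ _ _ => trivial

theorem Mem.ext {x y : M} (h : ∀ z, Mem z x ↔ Mem z y) : x = y := by
  have := KPM.tr (M := M) (ψ := extAx) (by simp [KPl])
  simp only [extAx, tr_all, tr_imp, tr_iff, tr_mem, tr_eq, Fin.snoc_castSucc, Fin.snoc_last] at this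
  exact this x y h

/-- The formula `φ(x₀, …, xₙ)` with the last variable moved to the front. -/
def frontFormula {n : ℕ} (φ : Fm (n + 1)) : setLang.Formula (Fin (n + 1)) :=
  φ.toFormula.relabel (Sum.elim Empty.elim (Fin.snoc (α := fun _ => Fin (n + 1)) Fin.succ 0))

theorem ev_frontFormula {n : ℕ} (φ : Fm (n + 1)) {U : Set M} (x : ↥U) (v : Fin n → ↥U) :
    Ev U (frontFormula φ) (fun i => ((Fin.cons x v : Fin (n + 1) → ↥U) i : M)) ↔
      Tr φ (Fin.snoc v x) := by
  rw [ev_coe, frontFormula, Formula.realize_relabel, BoundedFormula.realize_toFormula, Tr]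
  have h1 : ∀ w : Empty → ↥U, w = default := fun w => Subsingleton.elim _ _
  rw [h1 (_ ∘ Sum.inl)]
  have h2 : (((Fin.cons x v : Fin (n + 1) → ↥U) ∘ Sum.elim Empty.elim
      (Fin.snoc (α := fun _ => Fin (n + 1)) Fin.succ 0)) ∘ Sum.inr : Fin (n + 1) → ↥U) =
      Fin.snoc v x := by
    funext i
    refine Fin.lastCases ?_ (fun j => ?_) i <;> simp
  rw [h2]

theorem tr_foundAx {U : Set M} (hU : TransC U) {k : ℕ} (φ : setLang.Formula (Fin (k + 1))) :
    Tr (foundAx φ : Fm 0) (default : Fin 0 → ↥U) ↔ ∀ v : Fin k → ↥U,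
      (∀ x : ↥U, (∀ y : ↥U, Mem y x →
          Ev U φ (fun i => ((Fin.cons y v : Fin (k + 1) → ↥U) i : M))) →
        Ev U φ (fun i => ((Fin.cons x v : Fin (k + 1) → ↥U) i : M))) →
      ∀ x : ↥U, Ev U φ (fun i => ((Fin.cons x v : Fin (k + 1) → ↥U) i : M)) := by
  rw [← sentence_iff_tr, Sentence.Realize, foundAx, BoundedFormula.realize_alls]
  refine forall_congr' fun v => ?_
  rw [← Tr]
  simp only [tr_imp, tr_all, tr_allIn, tr_relTo hU, sem_L, Fin.snoc_last]
  have e1 : ∀ x : ↥U, (fun i => ((Fin.snoc v x : Fin (k + 1) → ↥U)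
      ((Fin.cons (α := fun _ => Fin (k + 1)) (Fin.last k) fun j : Fin k => j.castSucc) i) : M)) =
      fun i => ((Fin.cons x v : Fin (k + 1) → ↥U) i : M) := by
    intro x; funext i; refine Fin.cases ?_ (fun j => ?_) i <;> simp
  have e2 : ∀ x y : ↥U, (fun i => ((Fin.snoc (Fin.snoc v x : Fin (k + 1) → ↥U) y :
      Fin (k + 1 + 1) → ↥U)
      ((Fin.cons (α := fun _ => Fin (k + 1 + 1)) (Fin.last (k + 1)) fun j : Fin k => j.castSucc.castSucc) i) : M)) =
      fun i => ((Fin.cons y v : Fin (k + 1) → ↥U) i : M) := by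
    intro x y; funext i; refine Fin.cases ?_ (fun j => ?_) i <;> simp
  simp only [e1, e2]

/-- A predicate defined by a formula with parameters. -/
def Dfb (p : M → Prop) : Prop :=
  ∃ (n : ℕ) (φ : Fm (n + 1)) (v : Fin n → ↥(Set.univ : Set M)),
    ∀ x : ↥(Set.univ : Set M), p x ↔ Tr φ (Fin.snoc v x)

/-- The formula is given for every number of variables and every choice among them, so definability
follows from a single evaluation lemma; the later variants add parameters. -/
theorem Dfb.mk1 {p : M → Prop} (φ : ∀ n : ℕ, Fin n → Fm n)
    (h : ∀ (n : ℕ) (v : Fin n → ↥(Set.univ : Set M)) (x : Fin n), Tr (φ n x) v ↔ p (v x)) :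
    Dfb p :=
  ⟨0, φ 1 0, default, fun x => (h 1 (Fin.snoc default x) 0).symm⟩

theorem Dfb.mk2 {p : M → M → Prop} (φ : ∀ n : ℕ, Fin n → Fin n → Fm n)
    (h : ∀ (n : ℕ) (v : Fin n → ↥(Set.univ : Set M)) (a x : Fin n),
      Tr (φ n a x) v ↔ p (v a) (v x)) (a : M) : Dfb (p a) :=
  ⟨1, φ 2 0 1, ![⟨a, trivial⟩], fun x => (h 2 (Fin.snoc ![⟨a, trivial⟩] x) 0 1).symm⟩

theorem Dfb.mk3 {p : M → M → M → Prop} (φ : ∀ n : ℕ, Fin n → Fin n → Fin n → Fm n)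
    (h : ∀ (n : ℕ) (v : Fin n → ↥(Set.univ : Set M)) (a b x : Fin n),
      Tr (φ n a b x) v ↔ p (v a) (v b) (v x)) (a b : M) : Dfb (p a b) :=
  ⟨2, φ 3 0 1 2, ![⟨a, trivial⟩, ⟨b, trivial⟩],
    fun x => (h 3 (Fin.snoc ![⟨a, trivial⟩, ⟨b, trivial⟩] x) 0 1 2).symm⟩

theorem Dfb.mk4 {p : M → M → M → M → Prop} (φ : ∀ n : ℕ, Fin n → Fin n → Fin n → Fin n → Fm n)
    (h : ∀ (n : ℕ) (v : Fin n → ↥(Set.univ : Set M)) (a b c x : Fin n),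
      Tr (φ n a b c x) v ↔ p (v a) (v b) (v c) (v x)) (a b c : M) : Dfb (p a b c) :=
  ⟨3, φ 4 0 1 2 3, ![⟨a, trivial⟩, ⟨b, trivial⟩, ⟨c, trivial⟩],
    fun x => (h 4 (Fin.snoc ![⟨a, trivial⟩, ⟨b, trivial⟩, ⟨c, trivial⟩] x) 0 1 2 3).symm⟩

theorem Dfb.mk5 {p : M → M → M → M → M → Prop}
    (φ : ∀ n : ℕ, Fin n → Fin n → Fin n → Fin n → Fin n → Fm n)
    (h : ∀ (n : ℕ) (v : Fin n → ↥(Set.univ : Set M)) (a b c d x : Fin n),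
      Tr (φ n a b c d x) v ↔ p (v a) (v b) (v c) (v d) (v x)) (a b c d : M) : Dfb (p a b c d) :=
  ⟨4, φ 5 0 1 2 3 4, ![⟨a, trivial⟩, ⟨b, trivial⟩, ⟨c, trivial⟩, ⟨d, trivial⟩],
    fun x => (h 5 (Fin.snoc ![⟨a, trivial⟩, ⟨b, trivial⟩, ⟨c, trivial⟩, ⟨d, trivial⟩] x)
      0 1 2 3 4).symm⟩

/-- `∈`-induction for predicates defined by a formula with parameters. -/
theorem mem_induction {p : M → Prop} (hp : Dfb p)
    (h : ∀ x, (∀ y, Mem y x → p y) → p x) : ∀ x, p x := by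
  obtain ⟨n, φ, v, hp⟩ := hp
  have key := KPM.tr_univ (M := M) (ψ := foundAx (frontFormula φ))
    (Or.inr ⟨n, frontFormula φ, rfl⟩)
  rw [tr_foundAx transC_univ] at key
  have := key v
  simp only [ev_frontFormula, ← hp] at this
  exact fun x => this (fun x hx => h x fun y hy => hx ⟨y, trivial⟩ (mem_coe.2 hy)) ⟨x, trivial⟩

theorem Dfb.and {p q : M → Prop} (hp : Dfb p) (hq : Dfb q) : Dfb (fun x => p x ∧ q x) := by
  obtain ⟨n, φ, v, hp⟩ := hp
  obtain ⟨m, ψ, w, hq⟩ := hq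
  refine ⟨n + m, relTo .L (frontFormula φ) (Fin.cons (α := fun _ => Fin (n + m + 1))
      (Fin.last (n + m)) fun i => (Fin.castAdd m i).castSucc) ⋏
    relTo .L (frontFormula ψ) (Fin.cons (α := fun _ => Fin (n + m + 1))
      (Fin.last (n + m)) fun i => (Fin.natAdd n i).castSucc), Fin.append v w, fun x => ?_⟩
  simp only [tr_and, tr_relTo transC_univ, sem_L, hp, hq, ← ev_frontFormula]
  have e1 : ∀ i, ((Fin.cons x v : Fin (n + 1) → ↥(Set.univ : Set M)) i) =
      (Fin.snoc (Fin.append v w) x : Fin (n + m + 1) → ↥(Set.univ : Set M))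
        ((Fin.cons (α := fun _ => Fin (n + m + 1))
      (Fin.last (n + m)) fun i => (Fin.castAdd m i).castSucc) i) := by
    intro i; refine Fin.cases ?_ (fun j => ?_) i <;> simp
  have e2 : ∀ i, ((Fin.cons x w : Fin (m + 1) → ↥(Set.univ : Set M)) i) =
      (Fin.snoc (Fin.append v w) x : Fin (n + m + 1) → ↥(Set.univ : Set M))
        ((Fin.cons (α := fun _ => Fin (n + m + 1))
      (Fin.last (n + m)) fun i => (Fin.natAdd n i).castSucc) i) := by
    intro i
    refine Fin.cases ?_ (fun j => ?_) i
    · simp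
    · simp [-Fin.castSucc_natAdd]
  simp only [e1, e2]

theorem Dfb.allMem {p : M → Prop} (hp : Dfb p) : Dfb (fun x => ∀ y, Mem y x → p y) := by
  obtain ⟨n, φ, v, hp⟩ := hp
  refine ⟨n, allIn (Fin.last n) fun y => relTo .L (frontFormula φ)
    (Fin.cons (α := fun _ => Fin (n + 1 + 1)) y fun i => i.castSucc.castSucc), v, fun x => ?_⟩
  simp only [tr_allIn, tr_relTo transC_univ, sem_L, mem_coe, Fin.snoc_last]
  have e1 : ∀ y : ↥(Set.univ : Set M), (fun i => (((Fin.snoc (Fin.snoc v x :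
      Fin (n + 1) → ↥(Set.univ : Set M)) y : Fin (n + 1 + 1) → ↥(Set.univ : Set M))
        ((Fin.cons (α := fun _ => Fin (n + 1 + 1)) (Fin.last (n + 1))
          fun i => i.castSucc.castSucc) i) : ↥(Set.univ : Set M)) : M)) =
      fun i => ((Fin.cons y v : Fin (n + 1) → ↥(Set.univ : Set M)) i : M) := by
    intro y; funext i; refine Fin.cases ?_ (fun j => ?_) i <;> simp
  simp only [e1, ev_frontFormula, ← hp]
  exact ⟨fun h y hy => h y hy, fun h y hy => h ⟨y, trivial⟩ hy⟩

/-- `y` is obtained from `x` by going down at most four times along `∈`. -/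
def Below (y x : M) : Prop :=
  Mem y x ∨ (∃ z, Mem z x ∧ Mem y z) ∨ (∃ z, Mem z x ∧ ∃ w, Mem w z ∧ Mem y w) ∨
    ∃ z, Mem z x ∧ ∃ w, Mem w z ∧ ∃ u, Mem u w ∧ Mem y u

/-- Three nested bounded quantifiers are built into the induction predicate; ∈-induction contributes
the fourth level. Four levels are what separates a code ⟨t, ⟨a, b⟩⟩ from its components `a` and `b`.
-/
theorem below_induction {p : M → Prop} (hp : Dfb p)
    (h : ∀ x, (∀ y, Below y x → p y) → p x) : ∀ x, p x := by
  have d1 := hp.and hp.allMem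
  have d2 := hp.and d1.allMem
  have d3 := hp.and d2.allMem
  intro x
  refine (mem_induction d3 ?_ x).1
  intro x hx
  refine ⟨h x ?_, fun y hy => ⟨(hx y hy).1, fun z hz => ⟨((hx y hy).2 z hz).1, fun w hw =>
    (((hx y hy).2 z hz).2 w hw).1⟩⟩⟩
  rintro y (hy | ⟨z, hz, hy⟩ | ⟨z, hz, w, hw, hy⟩ | ⟨z, hz, w, hw, u, hu, hy⟩)
  · exact (hx y hy).1
  · exact ((hx z hz).2 y hy).1
  · exact (((hx z hz).2 w hw).2 y hy).1
  · exact (((hx z hz).2 w hw).2 u hu).2 y hy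

theorem exists_pair (x y : M) : ∃ z : M, ∀ u, Mem u z ↔ u = x ∨ u = y := by
  have := KPM.tr (M := M) (ψ := pairAx) (by simp [KPl])
  simp only [pairAx, isPair, tr_all, tr_ex, tr_or, tr_iff, tr_mem, tr_eq, Fin.snoc_castSucc,
    Fin.snoc_last] at this
  exact this x y

theorem exists_sUnion (x : M) : ∃ z : M, ∀ u, Mem u z ↔ ∃ v, Mem v x ∧ Mem u v := by
  have := KPM.tr (M := M) (ψ := unionAx) (by simp [KPl])
  simp only [unionAx, tr_all, tr_ex, tr_exIn, tr_iff, tr_mem, Fin.snoc_castSucc,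
    Fin.snoc_last] at this
  exact this x

/-- If every set had an element, then the predicate that is always false would be progressive,
against Foundation. -/
theorem exists_empty [Nonempty M] : ∃ z : M, ∀ u, ¬ Mem u z := by
  by_contra hne
  push Not at hne
  exact mem_induction (M := M) (p := fun _ => False)
    (Dfb.mk1 (fun _ x => neg (eq x x)) (by simp))
    (fun x hx => (hne x).elim hx) (Classical.arbitrary M)

/-- The unordered pair `{x, y}`. -/
noncomputable def pr (x y : M) : M := (exists_pair x y).choose
@[simp] theorem mem_pr {x y u : M} : Mem u (pr x y) ↔ u = x ∨ u = y :=
  (exists_pair x y).choose_spec u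

/-- The union `⋃ x`. -/
noncomputable def sU (x : M) : M := (exists_sUnion x).choose
@[simp] theorem mem_sU {x u : M} : Mem u (sU x) ↔ ∃ v, Mem v x ∧ Mem u v :=
  (exists_sUnion x).choose_spec u

/-- The union `x ∪ y`. -/
noncomputable def un (x y : M) : M := sU (pr x y)
@[simp] theorem mem_un {x y u : M} : Mem u (un x y) ↔ Mem u x ∨ Mem u y := by simp [un]

/-- The ordered pair `⟨x, y⟩`. -/
noncomputable def op (x y : M) : M := pr (pr x x) (pr x y)
/-- The successor `x ∪ {x}`. -/
noncomputable def sc (x : M) : M := un x (pr x x)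
@[simp] theorem mem_sc {x u : M} : Mem u (sc x) ↔ Mem u x ∨ u = x := by simp [sc]

theorem pr_inj_right {x y z : M} (h : pr x y = pr x z) : y = z := by
  have h1 := mem_pr (x := x) (y := y) (u := y)
  have h2 := mem_pr (x := x) (y := z) (u := z)
  have h3 := mem_pr (x := x) (y := y) (u := z)
  have h4 := mem_pr (x := x) (y := z) (u := y)
  rw [h] at h1 h3
  grind

@[simp] theorem op_inj {x y x' y' : M} : op x y = op x' y' ↔ x = x' ∧ y = y' := by
  constructor
  · intro h
    have hx : x = x' := by
      have h1 : Mem (pr x' x') (op x y) := by rw [h]; simp [op]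
      have h2 : Mem x (pr x' x') ∨ Mem (pr x x) (op x' y') := by right; rw [← h]; simp [op]
      have h3 : Mem x' (pr x' x') := by simp
      rcases mem_pr.1 h1 with h1 | h1
      · rw [h1] at h3; exact (by simpa using h3 : x' = x).symm
      · have : Mem x (pr x' x') := by rw [h1]; simp
        simpa using this
    subst hx
    exact ⟨rfl, pr_inj_right (pr_inj_right h)⟩
  · rintro ⟨rfl, rfl⟩; rfl

/-- A transitive set. -/
def IsTr (x : M) : Prop := ∀ y, Mem y x → ∀ z, Mem z y → Mem z x

/-- `x` is zero or a successor. -/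
def ZeroOrSucc (x : M) : Prop := (∀ y, ¬ Mem y x) ∨ ∃ y, Mem y x ∧ x = sc y

def NatD (x : M) : Prop :=
  IsTr x ∧ (∀ y, Mem y x → IsTr y) ∧ ZeroOrSucc x ∧ ∀ y, Mem y x → ZeroOrSucc y

-- Absoluteness of elementary notions for transitive classes.

section Transitive
variable {U : Set M} {n : ℕ} {v : Fin n → ↥U}

theorem forall_mem_coe (hU : TransC U) {a : M} (ha : a ∈ U) {p : M → Prop} :
    (∀ x : ↥U, Mem (x : M) a → p x) ↔ ∀ x, Mem x a → p x :=
  ⟨fun h x hx => h ⟨x, hU a ha x hx⟩ hx, fun h x hx => h x hx⟩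

theorem exists_mem_coe (hU : TransC U) {a : M} (ha : a ∈ U) {p : M → Prop} :
    (∃ x : ↥U, Mem (x : M) a ∧ p x) ↔ ∃ x, Mem x a ∧ p x :=
  ⟨fun ⟨x, hx⟩ => ⟨x, hx⟩, fun ⟨x, hx, h⟩ => ⟨⟨x, hU a ha x hx⟩, hx, h⟩⟩

theorem forall_iff_coe (hU : TransC U) {a : M} (ha : a ∈ U) {p : M → Prop}
    (hp : ∀ x, p x → x ∈ U) :
    (∀ x : ↥U, Mem (x : M) a ↔ p x) ↔ ∀ x, Mem x a ↔ p x :=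
  ⟨fun h x => ⟨fun hx => (h ⟨x, hU a ha x hx⟩).1 hx, fun hx => (h ⟨x, hp x hx⟩).2 hx⟩,
    fun h x => h x⟩

theorem tr_isTrans' (hU : TransC U) {x : Fin n} : Tr (isTrans x) v ↔ IsTr (v x : M) := by
  simp only [isTrans, tr_allIn, tr_mem, mem_coe, Fin.snoc_castSucc, Fin.snoc_last]
  rw [forall_mem_coe hU (v x).2 (p := fun y => ∀ z : ↥U, Mem (z : M) y → Mem (z : M) (v x))]
  refine forall₂_congr fun y hy => ?_
  exact forall_mem_coe hU (hU _ (v x).2 y hy) (p := fun z => Mem z _)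

theorem tr_isEmpty' (hU : TransC U) {x : Fin n} : Tr (isEmpty x) v ↔ ∀ y, ¬ Mem y (v x : M) := by
  simp only [isEmpty, tr_all, tr_neg, tr_mem, mem_coe, Fin.snoc_castSucc, Fin.snoc_last]
  exact forall_mem_coe hU (v x).2 (p := fun _ => False)

theorem tr_isSucc' (hU : TransC U) {x y : Fin n} : Tr (isSucc x y) v ↔ (v y : M) = sc (v x : M) := by
  simp only [isSucc, tr_all, tr_iff, tr_or, tr_eq, tr_mem, mem_coe, Fin.snoc_castSucc,
    Fin.snoc_last, Subtype.ext_iff]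
  rw [forall_iff_coe hU (v y).2 (p := fun z => Mem z _ ∨ z = _)]
  · constructor
    · intro h; apply Mem.ext; simpa using h
    · intro h; simp [h]
  · rintro z (hz | rfl)
    · exact hU _ (v x).2 z hz
    · exact (v x).2

theorem tr_isZeroOrSucc' (hU : TransC U) {x : Fin n} :
    Tr (isZeroOrSucc x) v ↔ ZeroOrSucc (v x : M) := by
  simp only [isZeroOrSucc, tr_or, tr_isEmpty' hU, tr_exIn, tr_isSucc' hU, mem_coe,
    Fin.snoc_castSucc, Fin.snoc_last]
  rw [exists_mem_coe hU (v x).2 (p := fun y => _ = sc y)]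
  rfl

theorem tr_isNat' (hU : TransC U) {x : Fin n} : Tr (isNat x) v ↔ NatD (v x : M) := by
  simp only [isNat, tr_and, tr_isTrans' hU, tr_isZeroOrSucc' hU, tr_allIn, mem_coe, Fin.snoc_last]
  rw [forall_mem_coe hU (v x).2 (p := IsTr), forall_mem_coe hU (v x).2 (p := ZeroOrSucc)]
  rfl

theorem tr_isPair' (hU : TransC U) {z x y : Fin n} :
    Tr (isPair z x y) v ↔ (v z : M) = pr (v x : M) (v y : M) := by
  simp only [isPair, tr_all, tr_iff, tr_or, tr_eq, tr_mem, mem_coe, Fin.snoc_castSucc,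
    Fin.snoc_last, Subtype.ext_iff]
  rw [forall_iff_coe hU (v z).2 (p := fun u => u = _ ∨ u = _)]
  · constructor
    · intro h; apply Mem.ext; simpa using h
    · intro h; simp [h]
  · rintro u (rfl | rfl)
    exacts [(v x).2, (v y).2]

end Transitive

theorem exists_omega : ∃ w : M, ∀ x, Mem x w ↔ NatD x := by
  have := KPM.tr_univ (M := M) (ψ := infAx) (by simp [KPl])
  simp only [infAx, isOmega, tr_all, tr_ex, tr_iff, tr_mem, tr_isNat' transC_univ,
    Fin.snoc_castSucc, Fin.snoc_last, mem_coe] at this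
  obtain ⟨w, hw⟩ := this
  exact ⟨w, fun x => hw ⟨x, trivial⟩⟩

variable (M) in
/-- The set `ω`. -/
noncomputable def om : M := (exists_omega (M := M)).choose
theorem mem_om {x : M} : Mem x (om M) ↔ NatD x := (exists_omega (M := M)).choose_spec x

instance : Nonempty M := ⟨om M⟩

variable (M) in
/-- The empty set. -/
noncomputable def zero : M := (exists_empty (M := M)).choose
@[simp] theorem not_mem_zero {x : M} : ¬ Mem x (zero M) := (exists_empty (M := M)).choose_spec x

theorem eq_zero {x : M} : x = zero M ↔ ∀ y, ¬ Mem y x :=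
  ⟨fun h => by simp [h], fun h => Mem.ext fun z => by simp [h]⟩

variable (M) in
noncomputable def one : M := sc (zero M)
variable (M) in
noncomputable def two : M := sc (one M)

@[simp] theorem zero_mem_om : Mem (zero M) (om M) := by
  rw [mem_om]
  exact ⟨fun y hy => by simp at hy, fun y hy => by simp at hy, Or.inl (by simp),
    fun y hy => by simp at hy⟩

theorem IsTr.sc {x : M} (h : IsTr x) : IsTr (sc x) := by
  intro y hy z hz
  rw [mem_sc] at hy ⊢
  rcases hy with hy | rfl
  · exact Or.inl (h y hy z hz)
  · exact Or.inl hz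

@[simp] theorem sc_mem_om {x : M} (h : Mem x (om M)) : Mem (sc x) (om M) := by
  rw [mem_om] at h ⊢
  obtain ⟨h1, h2, h3, h4⟩ := h
  refine ⟨h1.sc, ?_, Or.inr ⟨x, by simp, rfl⟩, ?_⟩
  · intro y hy
    rcases mem_sc.1 hy with hy | rfl
    exacts [h2 y hy, h1]
  · intro y hy
    rcases mem_sc.1 hy with hy | rfl
    exacts [h4 y hy, h3]

@[simp] theorem one_mem_om : Mem (one M) (om M) := sc_mem_om zero_mem_om
@[simp] theorem two_mem_om : Mem (two M) (om M) := sc_mem_om one_mem_om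

theorem mem_om_of_mem {x y : M} (h : Mem x (om M)) (hy : Mem y x) : Mem y (om M) := by
  rw [mem_om] at h ⊢
  obtain ⟨h1, h2, h3, h4⟩ := h
  exact ⟨h2 y hy, fun z hz => h2 z (h1 y hy z hz), h4 y hy, fun z hz => h4 z (h1 y hy z hz)⟩

theorem IsTr.of_om {x : M} (h : Mem x (om M)) : IsTr x := (mem_om.1 h).1

theorem zero_or_sc {x : M} (h : Mem x (om M)) : x = zero M ∨ ∃ y, Mem y (om M) ∧ x = sc y := by
  rcases (mem_om.1 h).2.2.1 with h0 | ⟨y, hy, e⟩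
  · exact Or.inl (eq_zero.2 h0)
  · exact Or.inr ⟨y, mem_om_of_mem h hy, e⟩

/-- Induction on `ω` for definable predicates. -/
theorem nat_induction {p : M → Prop} (hp : Dfb p)
    (h0 : p (zero M)) (hs : ∀ x, Mem x (om M) → p x → p (sc x)) : ∀ x, Mem x (om M) → p x := by
  refine mem_induction (p := fun x => Mem x (om M) → p x) ?_ ?_
  · obtain ⟨n, φ, v, hp⟩ := hp
    refine ⟨n, isNat (Fin.last n) ⟶ᶠ φ, v, fun x => ?_⟩
    simp only [tr_imp, tr_isNat' transC_univ, Fin.snoc_last, mem_om, hp]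
  · intro x hx hxo
    rcases zero_or_sc hxo with rfl | ⟨y, hy, rfl⟩
    · exact h0
    · exact hs y hy (hx y (by simp) hy)

theorem not_mem_self (x : M) : ¬ Mem x x :=
  mem_induction (p := fun x => ¬ Mem x x) (Dfb.mk1 (fun _ x => neg (mem x x)) (by simp))
    (fun x hx h => hx x h h) x

theorem not_mem_mem (x y : M) : ¬ (Mem x y ∧ Mem y x) :=
  mem_induction (p := fun x => ∀ y, ¬ (Mem x y ∧ Mem y x))
    (Dfb.mk1 (fun _ x => all fun y => neg (mem x y ⋏ mem y x)) (by simp))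
    (fun x hx y h => hx y h.2 x ⟨h.2, h.1⟩) x y

end SetTh

-- Worlds, and what is absolute between them.

namespace SetTh

variable {M : Type} [setLang.Structure M] [KPM M]

/-- A transitive set or the whole universe, closed under pairing and union, with `ω` as an
element. -/
class World (U : Set M) : Prop where
  cls : U = Set.univ ∨ ∃ P, U = ext P
  trans : TransC U
  pr_mem : ∀ x ∈ U, ∀ y ∈ U, pr x y ∈ U
  sU_mem : ∀ x ∈ U, sU x ∈ U
  om_mem : om M ∈ U

instance : World (Set.univ : Set M) :=
  ⟨Or.inl rfl, transC_univ, fun _ _ _ _ => trivial, fun _ _ => trivial, trivial⟩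

section Closure
variable {U : Set M} [hU : World U]

theorem World.un_mem {x y : M} (hx : x ∈ U) (hy : y ∈ U) : un x y ∈ U :=
  hU.sU_mem _ (hU.pr_mem _ hx _ hy)

theorem World.op_mem {x y : M} (hx : x ∈ U) (hy : y ∈ U) : op x y ∈ U :=
  hU.pr_mem _ (hU.pr_mem _ hx _ hx) _ (hU.pr_mem _ hx _ hy)

theorem World.sc_mem {x : M} (hx : x ∈ U) : sc x ∈ U := World.un_mem hx (hU.pr_mem _ hx _ hx)

theorem World.nat_mem {x : M} (hx : Mem x (om M)) : x ∈ U := hU.trans _ hU.om_mem _ hx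

theorem World.zero_mem : zero M ∈ U := World.nat_mem zero_mem_om

end Closure

theorem TransC.left_mem {U : Set M} (hU : TransC U) {x y : M} (h : op x y ∈ U) : x ∈ U :=
  hU (pr x x) (hU _ h _ (by simp [op])) x (by simp)

theorem TransC.right_mem {U : Set M} (hU : TransC U) {x y : M} (h : op x y ∈ U) : y ∈ U :=
  hU (pr x y) (hU _ h _ (by simp [op])) y (by simp)

theorem IsTr.transC {x : M} (h : IsTr x) : TransC (ext x) := fun y hy z hz => h y hy z hz

/-! ### Finite sequences -/

/-- `s` is a sequence of length `l`. -/
def IsSeq (s l : M) : Prop :=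
  Mem l (om M) ∧ (∀ z, Mem z s → ∃ i, Mem i l ∧ ∃ x, z = op i x) ∧
    ∀ i, Mem i l → ∃ x, ∀ y, Mem (op i y) s ↔ y = x

/-- The sequence `s` of length `l` with `x` appended. -/
noncomputable def ap (s l x : M) : M := un s (pr (op l x) (op l x))

@[simp] theorem mem_ap {s l x z : M} : Mem z (ap s l x) ↔ Mem z s ∨ z = op l x := by simp [ap]

def IsSnoc (t s x : M) : Prop := ∃ l, IsSeq s l ∧ t = ap s l x

noncomputable def seq1 (x : M) : M := ap (zero M) (zero M) x
noncomputable def seq2 (x y : M) : M := ap (seq1 x) (one M) y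
noncomputable def seq3 (x y z : M) : M := ap (seq2 x y) (two M) z

/-- `s` is a finite sequence of elements of `T`. -/
def SeqIn (s : M) (T : Set M) : Prop := ∃ l, IsSeq s l ∧ ∀ i, Mem i l → ∃ x ∈ T, Mem (op i x) s

def Baire (f : M) : Prop :=
  (∀ z, Mem z f → ∃ k m, Mem k (om M) ∧ Mem m (om M) ∧ z = op k m) ∧
    ∀ k, Mem k (om M) → ∃ m, ∀ y, Mem (op k y) f ↔ y = m

theorem IsSeq.zero : IsSeq (zero M) (zero M) :=
  ⟨zero_mem_om, fun z hz => by simp at hz, fun z hz => by simp at hz⟩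

theorem IsSeq.ap {s l : M} (h : IsSeq s l) (x : M) : IsSeq (ap s l x) (sc l) := by
  obtain ⟨h1, h2, h3⟩ := h
  have hn : ∀ y, ¬ Mem (op l y) s := by
    intro y hy
    obtain ⟨i, hi, z, e⟩ := h2 _ hy
    rw [op_inj] at e
    rw [← e.1] at hi
    exact not_mem_self _ hi
  refine ⟨sc_mem_om h1, ?_, ?_⟩
  · intro z hz
    rcases mem_ap.1 hz with hz | rfl
    · obtain ⟨i, hi, y, e⟩ := h2 z hz
      exact ⟨i, by simp [hi], y, e⟩
    · exact ⟨l, by simp, x, rfl⟩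
  · intro i hi
    rcases mem_sc.1 hi with hi | rfl
    · obtain ⟨y, hy⟩ := h3 i hi
      refine ⟨y, fun z => ?_⟩
      rw [mem_ap, hy, op_inj]
      constructor
      · rintro (h | ⟨rfl, -⟩)
        · exact h
        · exact (not_mem_self _ hi).elim
      · exact Or.inl
    · exact ⟨x, fun z => by simp [hn]⟩

theorem isSnoc_zero {t x : M} : IsSnoc t (zero M) x ↔ t = seq1 x := by
  constructor
  · rintro ⟨l, hl, rfl⟩
    rcases zero_or_sc hl.1 with rfl | ⟨y, hy, rfl⟩
    · rfl
    · obtain ⟨z, hz⟩ := hl.2.2 y (by simp)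
      simpa using (hz z).2 rfl
  · rintro rfl
    exact ⟨_, IsSeq.zero, rfl⟩

theorem IsSeq.len_subset {s l l' : M} (h : IsSeq s l) (h' : IsSeq s l') {i : M} (hi : Mem i l) :
    Mem i l' := by
  obtain ⟨x, hx⟩ := h.2.2 i hi
  obtain ⟨j, hj, y, e⟩ := h'.2.1 _ ((hx x).2 rfl)
  rw [op_inj] at e
  rw [e.1]; exact hj

theorem IsSeq.len_unique {s l l' : M} (h : IsSeq s l) (h' : IsSeq s l') : l = l' :=
  Mem.ext fun _ => ⟨h.len_subset h', h'.len_subset h⟩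

theorem IsSeq.isSnoc_iff {s l t x : M} (h : IsSeq s l) : IsSnoc t s x ↔ t = SetTh.ap s l x := by
  constructor
  · rintro ⟨l', h', rfl⟩; rw [h.len_unique h']
  · rintro rfl; exact ⟨l, h, rfl⟩

theorem isSeq_seq1 (x : M) : IsSeq (seq1 x) (one M) := IsSeq.zero.ap x
theorem isSeq_seq2 (x y : M) : IsSeq (seq2 x y) (two M) := (isSeq_seq1 x).ap y

-- Absoluteness of sequences and codes for worlds.

section Abs
variable {U : Set M} [hU : World U] {n : ℕ} {v : Fin n → ↥U}

@[simp] theorem tr_isTrans {x : Fin n} : Tr (isTrans x) v ↔ IsTr (v x : M) := tr_isTrans' hU.trans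

@[simp] theorem tr_isEmpty {x : Fin n} : Tr (isEmpty x) v ↔ (v x : M) = zero M := by
  rw [eq_zero]; exact tr_isEmpty' hU.trans

@[simp] theorem tr_isSucc {x y : Fin n} : Tr (isSucc x y) v ↔ (v y : M) = sc (v x : M) :=
  tr_isSucc' hU.trans

@[simp] theorem tr_isNat {x : Fin n} : Tr (isNat x) v ↔ Mem (v x : M) (om M) := by
  rw [mem_om]; exact tr_isNat' hU.trans

@[simp] theorem tr_isPair {z x y : Fin n} :
    Tr (isPair z x y) v ↔ (v z : M) = pr (v x : M) (v y : M) := tr_isPair' hU.trans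

@[simp] theorem tr_isOPair {z x y : Fin n} :
    Tr (isOPair z x y) v ↔ (v z : M) = op (v x : M) (v y : M) := by
  simp only [isOPair, tr_ex, tr_and, tr_isPair, Fin.snoc_castSucc, Fin.snoc_last]
  constructor
  · rintro ⟨a, b, ha, hb, hz⟩; rw [hz, ha, hb]; rfl
  · intro h
    exact ⟨⟨_, hU.pr_mem _ (v x).2 _ (v x).2⟩, ⟨_, hU.pr_mem _ (v x).2 _ (v y).2⟩, rfl, rfl, h⟩

@[simp] theorem tr_pairIn {r x y : Fin n} :
    Tr (pairIn r x y) v ↔ Mem (op (v x : M) (v y : M)) (v r : M) := by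
  simp only [pairIn, tr_exIn, tr_isOPair, mem_coe, Fin.snoc_castSucc, Fin.snoc_last]
  constructor
  · rintro ⟨a, h1, h2⟩; rwa [← h2]
  · intro h; exact ⟨⟨_, hU.trans _ (v r).2 _ h⟩, h, rfl⟩

@[simp] theorem tr_isOmega {w : Fin n} : Tr (isOmega w) v ↔ (v w : M) = om M := by
  simp only [isOmega, tr_all, tr_iff, tr_isNat, tr_mem, mem_coe, Fin.snoc_castSucc, Fin.snoc_last]
  rw [forall_iff_coe hU.trans (v w).2 (p := fun u => Mem u (om M)) (fun x hx => World.nat_mem hx)]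
  constructor
  · intro h; exact Mem.ext h
  · intro h; simp [h]

@[simp] theorem tr_isSeq {s l : Fin n} : Tr (isSeq s l) v ↔ IsSeq (v s : M) (v l : M) := by
  simp only [isSeq, tr_and, tr_isNat, tr_allIn, tr_exIn, tr_ex, tr_all, tr_iff, tr_isOPair,
    tr_pairIn, tr_eq, mem_coe, Fin.snoc_castSucc, Fin.snoc_last, Subtype.ext_iff]
  refine and_congr_right fun hl => and_congr ?_ ?_
  · constructor
    · intro h z hz
      obtain ⟨i, hi, x, e⟩ := h ⟨z, hU.trans _ (v s).2 z hz⟩ hz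
      exact ⟨i, hi, x, e⟩
    · intro h z hz
      obtain ⟨i, hi, x, e⟩ := h z hz
      have : x ∈ U := hU.trans.right_mem (e ▸ z.2)
      exact ⟨⟨i, hU.trans _ (v l).2 i hi⟩, hi, ⟨x, this⟩, e⟩
  · constructor
    · intro h i hi
      obtain ⟨x, hx⟩ := h ⟨i, hU.trans _ (v l).2 i hi⟩ hi
      refine ⟨x, fun y => ⟨fun hy => ?_, fun hy => ?_⟩⟩
      · exact (hx ⟨y, hU.trans.right_mem (hU.trans _ (v s).2 _ hy)⟩).1 hy
      · rw [hy]; exact (hx x).2 rfl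
    · intro h i hi
      obtain ⟨x, hx⟩ := h i hi
      exact ⟨⟨x, hU.trans.right_mem (hU.trans _ (v s).2 _ ((hx x).2 rfl))⟩, fun y => hx y⟩

theorem World.ap_mem {s l x : M} (hs : s ∈ U) (hl : l ∈ U) (hx : x ∈ U) : ap s l x ∈ U :=
  World.un_mem hs (hU.pr_mem _ (World.op_mem hl hx) _ (World.op_mem hl hx))

@[simp] theorem tr_isSnoc {t s x : Fin n} :
    Tr (isSnoc t s x) v ↔ IsSnoc (v t : M) (v s : M) (v x : M) := by
  simp only [isSnoc, tr_and, tr_ex, tr_all, tr_iff, tr_isOPair, tr_isSeq, tr_mem, tr_or,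
    tr_eq, mem_coe, Fin.snoc_castSucc, Fin.snoc_last, Subtype.ext_iff]
  constructor
  · rintro ⟨l, q, h1, h2, h3⟩
    refine ⟨l, h1, Mem.ext ?_⟩
    rw [forall_iff_coe hU.trans (v t).2 (p := fun u => Mem u _ ∨ u = _)] at h3
    · simpa [h2] using h3
    · rintro z (hz | rfl)
      exacts [hU.trans _ (v s).2 z hz, q.2]
  · rintro ⟨l, h1, h2⟩
    have hl : l ∈ U := World.nat_mem h1.1
    exact ⟨⟨l, hl⟩, ⟨_, World.op_mem hl (v x).2⟩, h1, rfl, fun z => by rw [h2]; simp⟩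

@[simp] theorem tr_isSeq1 {t x : Fin n} : Tr (isSeq1 t x) v ↔ (v t : M) = seq1 (v x : M) := by
  simp only [isSeq1, tr_and, tr_ex, tr_isEmpty, tr_isSnoc, Fin.snoc_castSucc, Fin.snoc_last]
  constructor
  · rintro ⟨s, hs, h⟩; rw [hs] at h; exact isSnoc_zero.1 h
  · intro h; exact ⟨⟨zero M, World.zero_mem⟩, rfl, isSnoc_zero.2 h⟩

theorem World.seq1_mem {x : M} (hx : x ∈ U) : seq1 x ∈ U :=
  World.ap_mem World.zero_mem World.zero_mem hx
theorem World.seq2_mem {x y : M} (hx : x ∈ U) (hy : y ∈ U) : seq2 x y ∈ U :=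
  World.ap_mem (World.seq1_mem hx) (World.nat_mem one_mem_om) hy
theorem World.seq3_mem {x y z : M} (hx : x ∈ U) (hy : y ∈ U) (hz : z ∈ U) : seq3 x y z ∈ U :=
  World.ap_mem (World.seq2_mem hx hy) (World.nat_mem two_mem_om) hz

@[simp] theorem tr_isSeq2 {t x y : Fin n} :
    Tr (isSeq2 t x y) v ↔ (v t : M) = seq2 (v x : M) (v y : M) := by
  simp only [isSeq2, tr_and, tr_ex, tr_isSeq1, tr_isSnoc, Fin.snoc_castSucc, Fin.snoc_last]
  constructor
  · rintro ⟨s, hs, h⟩; rw [hs] at h; exact (isSeq_seq1 _).isSnoc_iff.1 h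
  · intro h; exact ⟨⟨_, World.seq1_mem (v x).2⟩, rfl, (isSeq_seq1 _).isSnoc_iff.2 h⟩

@[simp] theorem tr_isSeq3 {t x y z : Fin n} :
    Tr (isSeq3 t x y z) v ↔ (v t : M) = seq3 (v x : M) (v y : M) (v z : M) := by
  simp only [isSeq3, tr_and, tr_ex, tr_isSeq2, tr_isSnoc, Fin.snoc_castSucc, Fin.snoc_last]
  constructor
  · rintro ⟨s, hs, h⟩; rw [hs] at h; exact (isSeq_seq2 _ _).isSnoc_iff.1 h
  · intro h; exact ⟨⟨_, World.seq2_mem (v x).2 (v y).2⟩, rfl, (isSeq_seq2 _ _).isSnoc_iff.2 h⟩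

@[simp] theorem tr_isSeqIn {s T : Fin n} :
    Tr (isSeqIn s T) v ↔ SeqIn (v s : M) (ext (v T : M)) := by
  simp only [isSeqIn, tr_and, tr_ex, tr_allIn, tr_exIn, tr_isSeq, tr_pairIn, mem_coe,
    Fin.snoc_castSucc, Fin.snoc_last]
  constructor
  · rintro ⟨l, h1, h2⟩
    refine ⟨l, h1, fun i hi => ?_⟩
    obtain ⟨x, hx, h⟩ := h2 ⟨i, hU.trans _ l.2 i hi⟩ hi
    exact ⟨x, hx, h⟩
  · rintro ⟨l, h1, h2⟩
    refine ⟨⟨l, World.nat_mem h1.1⟩, h1, fun i hi => ?_⟩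
    obtain ⟨x, hx, h⟩ := h2 i hi
    exact ⟨⟨x, hU.trans _ (v T).2 x hx⟩, hx, h⟩

@[simp] theorem tr_isBaire {f : Fin n} : Tr (isBaire f) v ↔ Baire (v f : M) := by
  simp only [isBaire, tr_and, tr_ex, tr_all, tr_imp, tr_iff, tr_eq, tr_allIn, tr_isNat, tr_isOPair,
    tr_pairIn, mem_coe, Fin.snoc_castSucc, Fin.snoc_last, Subtype.ext_iff]
  refine and_congr ?_ ?_
  · constructor
    · intro h z hz
      obtain ⟨k, m, h⟩ := h ⟨z, hU.trans _ (v f).2 z hz⟩ hz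
      exact ⟨k, m, h⟩
    · intro h z hz
      obtain ⟨k, m, hk, hm, h⟩ := h z hz
      exact ⟨⟨k, World.nat_mem hk⟩, ⟨m, World.nat_mem hm⟩, hk, hm, h⟩
  · constructor
    · intro h i hi
      obtain ⟨x, hx⟩ := h ⟨i, World.nat_mem hi⟩ hi
      refine ⟨x, fun y => ⟨fun hy => ?_, fun hy => ?_⟩⟩
      · exact (hx ⟨y, hU.trans.right_mem (hU.trans _ (v f).2 _ hy)⟩).1 hy
      · rw [hy]; exact (hx x).2 rfl
    · intro h i hi
      obtain ⟨x, hx⟩ := h i hi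
      exact ⟨⟨x, hU.trans.right_mem (hU.trans _ (v f).2 _ ((hx x).2 rfl))⟩, fun y => hx y⟩

@[simp] theorem tr_isOne {x : Fin n} : Tr (isOne x) v ↔ (v x : M) = one M := by
  simp only [isOne, tr_ex, tr_and, tr_isEmpty, tr_isSucc, Fin.snoc_castSucc, Fin.snoc_last]
  constructor
  · rintro ⟨z, hz, h⟩; rw [h, hz]; rfl
  · intro h; exact ⟨⟨_, World.zero_mem⟩, rfl, h⟩

@[simp] theorem tr_isTwo {x : Fin n} : Tr (isTwo x) v ↔ (v x : M) = two M := by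
  simp only [isTwo, tr_ex, tr_and, tr_isOne, tr_isSucc, Fin.snoc_castSucc, Fin.snoc_last]
  constructor
  · rintro ⟨z, hz, h⟩; rw [h, hz]; rfl
  · intro h; exact ⟨⟨_, World.nat_mem one_mem_om⟩, rfl, h⟩

@[simp] theorem tr_isTriple {e t x y : Fin n} :
    Tr (isTriple e t x y) v ↔ (v e : M) = op (v t : M) (op (v x : M) (v y : M)) := by
  simp only [isTriple, tr_ex, tr_and, tr_isOPair, Fin.snoc_castSucc, Fin.snoc_last]
  constructor
  · rintro ⟨z, hz, h⟩; rw [h, hz]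
  · intro h; exact ⟨⟨_, World.op_mem (v x).2 (v y).2⟩, rfl, h⟩

@[simp] theorem tr_isMemCode {e x y : Fin n} :
    Tr (isMemCode e x y) v ↔ (v e : M) = op (zero M) (op (v x : M) (v y : M)) := by
  simp only [isMemCode, tr_ex, tr_and, tr_isEmpty, tr_isTriple, Fin.snoc_castSucc, Fin.snoc_last]
  constructor
  · rintro ⟨z, hz, h⟩; rw [h, hz]
  · intro h; exact ⟨⟨_, World.zero_mem⟩, rfl, h⟩

@[simp] theorem tr_isNandCode {e x y : Fin n} :
    Tr (isNandCode e x y) v ↔ (v e : M) = op (one M) (op (v x : M) (v y : M)) := by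
  simp only [isNandCode, tr_ex, tr_and, tr_isOne, tr_isTriple, Fin.snoc_castSucc, Fin.snoc_last]
  constructor
  · rintro ⟨z, hz, h⟩; rw [h, hz]
  · intro h; exact ⟨⟨_, World.nat_mem one_mem_om⟩, rfl, h⟩

@[simp] theorem tr_isBallCode {e x y : Fin n} :
    Tr (isBallCode e x y) v ↔ (v e : M) = op (two M) (op (v x : M) (v y : M)) := by
  simp only [isBallCode, tr_ex, tr_and, tr_isTwo, tr_isTriple, Fin.snoc_castSucc, Fin.snoc_last]
  constructor
  · rintro ⟨z, hz, h⟩; rw [h, hz]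
  · intro h; exact ⟨⟨_, World.nat_mem two_mem_om⟩, rfl, h⟩

end Abs

/-! ### Restriction of finite sequences, closure of worlds under finite sequences -/

theorem lt_or_eq_of_mem_sc_trans {x y : M} (hy : Mem y (om M)) (h : Mem (sc x) (sc y)) :
    Mem x y := by
  rcases mem_sc.1 h with h | h
  · exact IsTr.of_om hy _ h _ (by simp)
  · rw [← h]; simp

theorem zero_mem_sc {x : M} (hx : Mem x (om M)) : Mem (zero M) (sc x) := by
  refine nat_induction (p := fun x => Mem (zero M) (sc x))
    (Dfb.mk1 (fun _ x => ex fun z => isEmpty z ⋏ ((mem z x) ⋎ eq z x)) ?_) ?_ ?_ x hx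
  · simp [Subtype.ext_iff]
  · simp
  · intro x hx h; rw [mem_sc]; exact Or.inl h

theorem sc_mem_sc {x y : M} (hx : Mem x (om M)) (h : Mem y x) : Mem (sc y) (sc x) := by
  refine nat_induction (p := fun x => ∀ y, Mem y x → Mem (sc y) (sc x))
    (Dfb.mk1 (fun _ x => allIn x fun y => ex fun z => isSucc y z ⋏ (mem z x ⋎ eq z x)) ?_)
    ?_ ?_ x hx y h
  · simp [Subtype.ext_iff]
  · simp
  · intro x hx h y hy
    rw [mem_sc]
    rcases mem_sc.1 hy with hy | rfl
    · exact Or.inl (h y hy)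
    · exact Or.inr rfl

theorem nat_trichotomy {x y : M} (hx : Mem x (om M)) (hy : Mem y (om M)) :
    Mem x y ∨ x = y ∨ Mem y x := by
  refine nat_induction (p := fun x => Mem x y ∨ x = y ∨ Mem y x)
    (Dfb.mk2 (p := fun y x => Mem x y ∨ x = y ∨ Mem y x)
      (fun _ y x => mem x y ⋎ eq x y ⋎ mem y x) ?_ y) ?_ ?_ x hx
  · simp [Subtype.ext_iff]
  · rcases mem_sc.1 (zero_mem_sc hy) with h | h
    exacts [Or.inl h, Or.inr (Or.inl h)]
  · intro z hz h
    rcases h with h | h | h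
    · rcases mem_sc.1 (sc_mem_sc hy h) with h | h
      exacts [Or.inl h, Or.inr (Or.inl h)]
    · right; right; simp [h]
    · right; right; simp [h]

end SetTh

namespace SetTh

variable {M : Type} [setLang.Structure M] [KPM M]

theorem IsSeq.mem_len {s l i x : M} (h : IsSeq s l) (hx : Mem (op i x) s) : Mem i l := by
  obtain ⟨j, hj, y, e⟩ := h.2.1 _ hx
  rw [op_inj] at e
  rw [e.1]; exact hj

theorem IsSeq.val_unique {s l i x y : M} (h : IsSeq s l) (hx : Mem (op i x) s)
    (hy : Mem (op i y) s) : x = y := by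
  obtain ⟨z, hz⟩ := h.2.2 i (h.mem_len hx)
  rw [(hz x).1 hx, (hz y).1 hy]

theorem IsSeq.exists_val {s l i : M} (h : IsSeq s l) (hi : Mem i l) : ∃ x, Mem (op i x) s := by
  obtain ⟨z, hz⟩ := h.2.2 i hi
  exact ⟨z, (hz z).2 rfl⟩

/-- A sequence that is contained in another one of the same length is equal to it. -/
theorem IsSeq.eq_of_subset {s t l : M} (hs : IsSeq s l) (ht : IsSeq t l)
    (h : ∀ z, Mem z t → Mem z s) : t = s := by
  refine Mem.ext fun z => ⟨h z, fun hz => ?_⟩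
  obtain ⟨i, hi, x, rfl⟩ := hs.2.1 z hz
  obtain ⟨y, hy⟩ := ht.exists_val hi
  rwa [hs.val_unique hz (h _ hy)]

theorem mem_of_mem_sc {k l i : M} (hl : Mem l (om M)) (hk : Mem k (sc l)) (hi : Mem i k) :
    Mem i l := by
  rcases mem_sc.1 hk with hk | rfl
  · exact IsTr.of_om hl _ hk _ hi
  · exact hi

/-- The sequence is finite only in the sense of `M`, so its initial segments are put into `U` one
after the other by induction on ω. -/
theorem World.exists_restrict {U : Set M} [hU : World U] {s l : M} (hs : IsSeq s l)
    (hv : ∀ i x, Mem (op i x) s → x ∈ U) {k : M} (hk : Mem k (sc l)) :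
    ∃ t ∈ U, IsSeq t k ∧ ∀ z, Mem z t → Mem z s := by
  have hko : Mem k (om M) := mem_om_of_mem (sc_mem_om hs.1) hk
  refine nat_induction (p := fun k => Mem k (sc l) → ∃ t ∈ U, IsSeq t k ∧ ∀ z, Mem z t → Mem z s)
    ?_ ?_ ?_ k hko hk
  -- The induction predicate mentions `U`. It is definable because `U` is either everything or the
  -- extension of a parameter `P`.
  · rcases hU.cls with rfl | ⟨P, rfl⟩
    · refine Dfb.mk3 (p := fun s l k => Mem k (sc l) → ∃ t ∈ Set.univ, IsSeq t k ∧
        ∀ z, Mem z t → Mem z s) (fun _ s l k => (mem k l ⋎ eq k l) ⟶ᶠ ex fun t => isSeq t k ⋏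
          allIn t fun z => mem z s) ?_ s l
      simp [Subtype.ext_iff]
    · refine Dfb.mk4 (p := fun P s l k => Mem k (sc l) → ∃ t ∈ ext P, IsSeq t k ∧
        ∀ z, Mem z t → Mem z s) (fun _ P s l k => (mem k l ⋎ eq k l) ⟶ᶠ exIn P fun t => isSeq t k ⋏
          allIn t fun z => mem z s) ?_ P s l
      simp [Subtype.ext_iff]
  · exact fun _ => ⟨_, World.zero_mem, IsSeq.zero, fun z hz => by simp at hz⟩
  · intro j hj ih hjl
    obtain ⟨t, ht, h1, h2⟩ := ih (by
      rw [mem_sc]; exact Or.inl (lt_or_eq_of_mem_sc_trans hs.1 hjl))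
    obtain ⟨x, hx⟩ := hs.exists_val (mem_of_mem_sc hs.1 hjl (by simp : Mem j (sc j)))
    refine ⟨ap t j x, World.ap_mem ht (World.nat_mem hj) (hv _ _ hx), h1.ap x, fun z hz => ?_⟩
    rcases mem_ap.1 hz with hz | rfl
    exacts [h2 z hz, hx]

theorem SeqIn.val_mem {s : M} {T : Set M} (h : SeqIn s T) {i x : M} (hx : Mem (op i x) s) :
    x ∈ T := by
  obtain ⟨l, h1, h2⟩ := h
  obtain ⟨y, hy, h⟩ := h2 i (h1.mem_len hx)
  rwa [h1.val_unique hx h]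

theorem IsSeq.seqIn {s l : M} {T : Set M} (h : IsSeq s l) (hT : ∀ i x, Mem (op i x) s → x ∈ T) :
    SeqIn s T :=
  ⟨l, h, fun i hi => by obtain ⟨x, hx⟩ := h.exists_val hi; exact ⟨x, hT _ _ hx, hx⟩⟩

/-- Worlds are closed under finite sequences. -/
theorem World.seq_mem {U : Set M} [hU : World U] {s : M} (h : SeqIn s U) : s ∈ U := by
  have h' := h
  obtain ⟨l, hs, -⟩ := h
  obtain ⟨t, ht, h1, h2⟩ := World.exists_restrict hs (fun i x => h'.val_mem) (k := l) (by simp)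
  rw [← hs.eq_of_subset h1 h2]; exact ht

theorem SeqIn.mono {s : M} {T T' : Set M} (h : SeqIn s T) (hT : T ⊆ T') : SeqIn s T' := by
  obtain ⟨l, h1, h2⟩ := h
  exact ⟨l, h1, fun i hi => by obtain ⟨x, hx, h⟩ := h2 i hi; exact ⟨x, hT hx, h⟩⟩

theorem SeqIn.ap {s l x : M} {T : Set M} (h : SeqIn s T) (hl : IsSeq s l) (hx : x ∈ T) :
    SeqIn (ap s l x) T := by
  refine (hl.ap x).seqIn fun i y hy => ?_
  rcases mem_ap.1 hy with hy | hy
  · exact h.val_mem hy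
  · rw [op_inj] at hy; rw [hy.2]; exact hx

theorem seqIn_of_mem_world {U : Set M} [hU : World U] {s l : M} (hs : s ∈ U) (h : IsSeq s l) :
    SeqIn s U := h.seqIn fun _ _ hx => hU.trans.right_mem (hU.trans _ hs _ hx)

theorem seqIn_zero {T : Set M} : SeqIn (zero M) T := IsSeq.zero.seqIn (by simp)
theorem seqIn_seq1 {T : Set M} {x : M} (hx : x ∈ T) : SeqIn (seq1 x) T :=
  seqIn_zero.ap IsSeq.zero hx
theorem seqIn_seq2 {T : Set M} {x y : M} (hx : x ∈ T) (hy : y ∈ T) : SeqIn (seq2 x y) T :=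
  (seqIn_seq1 hx).ap (isSeq_seq1 x) hy
theorem seqIn_seq3 {T : Set M} {x y z : M} (hx : x ∈ T) (hy : y ∈ T) (hz : z ∈ T) :
    SeqIn (seq3 x y z) T :=
  (seqIn_seq2 hx hy).ap (isSeq_seq2 x y) hz

/-! ### Satisfaction relations and admissible sets -/

def SatC (S e s : M) : Prop :=
  (∃ i j u v, e = op (zero M) (op i j) ∧ Mem (op i u) s ∧ Mem (op j v) s ∧ Mem u v) ∨
  (∃ a b, e = op (one M) (op a b) ∧ ¬ (Mem (op a s) S ∧ Mem (op b s) S)) ∨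
  (∃ j a v, e = op (two M) (op j a) ∧ Mem (op j v) s ∧
    ∀ x, Mem x v → ∃ t, IsSnoc t s x ∧ Mem (op a t) S)

/-- `S` is a satisfaction relation on `T`. -/
def IsSat (T S : M) : Prop :=
  ∀ e, Mem e T → ∀ s, SeqIn s (ext T) → (Mem (op e s) S ↔ SatC S e s)

/-- The code `e` is true of `s`, as witnessed in `U`. -/
def TrueIn (U : Set M) (e s : M) : Prop :=
  ∃ T ∈ U, ∃ S ∈ U, IsTr T ∧ Mem e T ∧ SeqIn s (ext T) ∧ IsSat T S ∧ Mem (op e s) S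

/-- `A` is admissible, with satisfaction relation `S`. -/
structure Adm (A S : M) : Prop where
  tr : IsTr A
  om : Mem (om M) A
  pr : ∀ a, Mem a A → ∀ b, Mem b A → Mem (pr a b) A
  sU : ∀ a, Mem a A → Mem (sU a) A
  sat : IsSat A S
  sep : ∀ e, Mem e A → ∀ p, Mem p A → ∀ a, Mem a A → ∃ c, Mem c A ∧
    ∀ x, Mem x c ↔ Mem x a ∧ Mem (op e (seq2 p x)) S
  coll : ∀ e, Mem e A → ∀ p, Mem p A → ∀ a, Mem a A →
    (∀ x, Mem x a → ∃ z, Mem z A ∧ Mem (op e (seq3 p x z)) S) →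
    ∃ c, Mem c A ∧ ∀ x, Mem x a → ∃ z, Mem z c ∧ Mem (op e (seq3 p x z)) S

theorem Adm.world {A S : M} (h : Adm A S) : World (ext A) where
  cls := Or.inr ⟨A, rfl⟩
  trans := h.tr.transC
  pr_mem := h.pr
  sU_mem := h.sU
  om_mem := h.om

section Abs
variable {U : Set M} [hU : World U] {n : ℕ} {v : Fin n → ↥U}

/-- All witnesses in Tarski's clauses are components of `e`, of elements of `s` or of elements of
`S`, hence belong to the transitive class `U`. -/
theorem tr_satClause {S e s : Fin n} :
    Tr (satClause S e s) v ↔ SatC (v S : M) (v e : M) (v s : M) := by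
  simp only [satClause, tr_or, tr_ex, tr_and, tr_neg, tr_isMemCode, tr_isNandCode, tr_isBallCode,
    tr_pairIn, tr_mem, tr_allIn, tr_isSnoc, mem_coe, Fin.snoc_castSucc, Fin.snoc_last]
  have hs : ∀ {i x}, Mem (op i x) (v s : M) → i ∈ U ∧ x ∈ U := fun h =>
    ⟨hU.trans.left_mem (hU.trans _ (v s).2 _ h), hU.trans.right_mem (hU.trans _ (v s).2 _ h)⟩
  refine or_congr ?_ (or_congr ?_ ?_)
  · constructor
    · rintro ⟨i, j, u, w, h⟩; exact ⟨i, j, u, w, h⟩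
    · rintro ⟨i, j, u, w, h1, h2, h3, h4⟩
      exact ⟨⟨i, (hs h2).1⟩, ⟨j, (hs h3).1⟩, ⟨u, (hs h2).2⟩, ⟨w, (hs h3).2⟩, h1, h2, h3, h4⟩
  · constructor
    · rintro ⟨a, b, h⟩; exact ⟨a, b, h⟩
    · rintro ⟨a, b, h1, h2⟩
      have h3 : op a b ∈ U := hU.trans.right_mem (h1 ▸ (v e).2)
      exact ⟨⟨a, hU.trans.left_mem h3⟩, ⟨b, hU.trans.right_mem h3⟩, h1, h2⟩
  · constructor
    · rintro ⟨j, a, w, h1, h2, h3⟩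
      refine ⟨j, a, w, h1, h2, fun x hx => ?_⟩
      obtain ⟨t, ht⟩ := h3 ⟨x, hU.trans _ w.2 x hx⟩ hx
      exact ⟨t, ht⟩
    · rintro ⟨j, a, w, h1, h2, h3⟩
      have h4 : op j a ∈ U := hU.trans.right_mem (h1 ▸ (v e).2)
      refine ⟨⟨j, (hs h2).1⟩, ⟨a, hU.trans.right_mem h4⟩, ⟨w, (hs h2).2⟩, h1, h2, fun x hx => ?_⟩
      obtain ⟨t, ht⟩ := h3 x hx
      exact ⟨⟨t, hU.trans.right_mem (hU.trans _ (v S).2 _ ht.2)⟩, ht⟩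

-- The quantifier over assignments is unbounded, but a world contains all finite sequences of its
-- elements, so no assignment in `T` is lost.
@[simp] theorem tr_isSat {T S : Fin n} : Tr (isSat T S) v ↔ IsSat (v T : M) (v S : M) := by
  simp only [isSat, tr_allIn, tr_all, tr_imp, tr_iff, tr_isSeqIn, tr_pairIn, tr_satClause,
    mem_coe, Fin.snoc_castSucc, Fin.snoc_last]
  constructor
  · intro h e he s hs
    exact h ⟨e, hU.trans _ (v T).2 e he⟩ he
      ⟨s, World.seq_mem (hs.mono fun x hx => hU.trans _ (v T).2 x hx)⟩ hs
  · intro h e he s hs; exact h e he s hs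

@[simp] theorem tr_isTrue {e s : Fin n} : Tr (isTrue e s) v ↔ TrueIn U (v e : M) (v s : M) := by
  simp only [isTrue, tr_ex, tr_and, tr_mem, tr_isTrans, tr_isSeqIn, tr_isSat, tr_pairIn,
    mem_coe, Fin.snoc_castSucc, Fin.snoc_last]
  constructor
  · rintro ⟨T, S, h⟩; exact ⟨T, T.2, S, S.2, h⟩
  · rintro ⟨T, hT, S, hS, h⟩; exact ⟨⟨T, hT⟩, ⟨S, hS⟩, h⟩

-- The satisfaction relation is the only witness not bounded by `y`, hence the only place where `U`
-- matters.
@[simp] theorem tr_isAdm {y : Fin n} : Tr (isAdm y) v ↔ ∃ S ∈ U, Adm (v y : M) S := by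
  have hy : ∀ {a}, Mem a (v y : M) → a ∈ U := fun h => hU.trans _ (v y).2 _ h
  simp only [isAdm, tr_and, tr_isTrans, tr_exIn, tr_isOmega, tr_allIn, tr_isPair, tr_all, tr_iff,
    tr_mem, tr_ex, tr_isSat, tr_isSeq2, tr_isSeq3, tr_pairIn, tr_imp,
    mem_coe, Fin.snoc_castSucc, Fin.snoc_last]
  constructor
  · rintro ⟨h1, ⟨w, hw, hw'⟩, h3, h4, S, h5, h6, h7⟩
    refine ⟨S, S.2, h1, ?_, ?_, ?_, h5, ?_, ?_⟩
    · rwa [← hw']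
    · intro a ha b hb
      obtain ⟨c, hc, e⟩ := h3 ⟨a, hy ha⟩ ha ⟨b, hy hb⟩ hb
      rwa [← e]
    · intro a ha
      obtain ⟨c, hc, e⟩ := h4 ⟨a, hy ha⟩ ha
      convert hc using 1
      refine Mem.ext fun z => ?_
      rw [mem_sU]
      constructor
      · rintro ⟨u, hu, hz⟩
        have : u ∈ U := hU.trans _ (hy ha) _ hu
        exact (e ⟨z, hU.trans _ this _ hz⟩).2 ⟨⟨u, this⟩, hu, hz⟩
      · intro hz
        obtain ⟨u, hu⟩ := (e ⟨z, hU.trans _ c.2 _ hz⟩).1 hz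
        exact ⟨u, hu⟩
    · intro e he p hp a ha
      obtain ⟨c, hc, h⟩ := h6 ⟨e, hy he⟩ he ⟨p, hy hp⟩ hp ⟨a, hy ha⟩ ha
      refine ⟨c, hc, fun x => ⟨fun hx => ?_, fun hx => ?_⟩⟩
      · obtain ⟨h1, s, h2, h3⟩ := (h ⟨x, hU.trans _ c.2 _ hx⟩).1 hx
        rw [h2] at h3
        exact ⟨h1, h3⟩
      · have hxU := hU.trans _ (hy ha) _ hx.1
        exact (h ⟨x, hxU⟩).2 ⟨hx.1, ⟨_, World.seq2_mem (hy hp) hxU⟩, rfl, hx.2⟩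
    · intro e he p hp a ha H
      obtain ⟨c, hc, h⟩ := h7 ⟨e, hy he⟩ he ⟨p, hy hp⟩ hp ⟨a, hy ha⟩ ha (by
        intro x hx
        obtain ⟨z, hz, h⟩ := H x hx
        exact ⟨⟨z, hy hz⟩, hz, ⟨_, World.seq3_mem (hy hp) x.2 (hy hz)⟩, rfl, h⟩)
      refine ⟨c, hc, fun x hx => ?_⟩
      obtain ⟨z, hz, s, hs, h⟩ := h ⟨x, hU.trans _ (hy ha) _ hx⟩ hx
      rw [hs] at h
      exact ⟨z, hz, h⟩
  · rintro ⟨S, hS, h⟩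
    refine ⟨h.tr, ⟨⟨_, hU.om_mem⟩, h.om, rfl⟩, ?_, ?_, ⟨S, hS⟩, h.sat, ?_, ?_⟩
    · intro a ha b hb
      exact ⟨⟨_, hU.pr_mem _ a.2 _ b.2⟩, h.pr a ha b hb, rfl⟩
    · intro a ha
      refine ⟨⟨_, hU.sU_mem _ a.2⟩, h.sU a ha, fun x => ?_⟩
      rw [mem_sU]
      constructor
      · rintro ⟨u, hu, hx⟩; exact ⟨⟨u, hU.trans _ a.2 _ hu⟩, hu, hx⟩
      · rintro ⟨u, hu⟩; exact ⟨u, hu⟩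
    · intro e he p hp a ha
      obtain ⟨c, hc, hh⟩ := h.sep e he p hp a ha
      refine ⟨⟨c, hy hc⟩, hc, fun x => ?_⟩
      rw [hh]
      refine and_congr_right fun _ => ⟨fun H => ?_, ?_⟩
      · exact ⟨⟨_, World.seq2_mem p.2 x.2⟩, rfl, H⟩
      · rintro ⟨s, hs, H⟩; rwa [← hs]
    · intro e he p hp a ha H
      obtain ⟨c, hc, hh⟩ := h.coll e he p hp a ha (by
        intro x hx
        obtain ⟨z, hz, s, hs, h⟩ := H ⟨x, hU.trans _ a.2 _ hx⟩ hx
        rw [hs] at h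
        exact ⟨z, hz, h⟩)
      refine ⟨⟨c, hy hc⟩, hc, fun x hx => ?_⟩
      obtain ⟨z, hz, H⟩ := hh x hx
      have hzU := hU.trans _ (hy hc) _ hz
      exact ⟨⟨z, hzU⟩, hz, ⟨_, World.seq3_mem p.2 x.2 hzU⟩, rfl, H⟩

end Abs

/-- Every set is an element of an admissible set. -/
theorem exists_adm (x : M) : ∃ A S, Mem x A ∧ Adm A S := by
  have := KPM.tr_univ (M := M) (ψ := limAx) (by simp [KPl])
  simp only [limAx, tr_all, tr_ex, tr_and, tr_mem, tr_isAdm, Fin.snoc_castSucc, Fin.snoc_last,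
    mem_coe] at this
  obtain ⟨A, h1, S, -, h2⟩ := this ⟨x, trivial⟩
  exact ⟨A, S, h1, h2⟩

end SetTh

-- `Δ₀`-formulas as a data type.

namespace SetTh

/-- `Δ₀`-formulas in the variables `x₀, …, xₙ₋₁`, built as the codes are. -/
inductive D0 : ℕ → Type
  | mem {n : ℕ} (i j : Fin n) : D0 n
  | nand {n : ℕ} (a b : D0 n) : D0 n
  | ball {n : ℕ} (j : Fin n) (a : D0 (n + 1)) : D0 n

namespace D0
variable {n m : ℕ}

def neg (a : D0 n) : D0 n := nand a a
def and (a b : D0 n) : D0 n := neg (nand a b)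
def or (a b : D0 n) : D0 n := nand (neg a) (neg b)
def imp (a b : D0 n) : D0 n := nand a (neg b)
def iff (a b : D0 n) : D0 n := and (imp a b) (imp b a)
/-- `∀ x ∈ j, a x` -/
def allIn (j : Fin n) (a : Fin (n + 1) → D0 (n + 1)) : D0 n := ball j (a (Fin.last n))
/-- `∃ x ∈ j, a x` -/
def exIn (j : Fin n) (a : Fin (n + 1) → D0 (n + 1)) : D0 n := neg (ball j (neg (a (Fin.last n))))
def eq (i j : Fin n) : D0 n := and (allIn i fun z => mem z j) (allIn j fun z => mem z i)
/-- `z = {x, y}` -/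
def pair (z x y : Fin n) : D0 n := and (mem x z) (and (mem y z) (allIn z fun u => or (eq u x) (eq u y)))
/-- `z = ⟨x, y⟩` -/
def opair (z x y : Fin n) : D0 n :=
  exIn z fun u => exIn z fun w => and (pair u x x) (and (pair w x y) (pair z u w))
/-- `⟨x, y⟩ ∈ r` -/
def pairIn (r x y : Fin n) : D0 n := exIn r fun z => opair z x y

/-- Renaming of variables. -/
def rename : ∀ {n m : ℕ}, (Fin n → Fin m) → D0 n → D0 m
  | _, _, f, mem i j => mem (f i) (f j)
  | _, _, f, nand a b => nand (rename f a) (rename f b)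
  | _, m, f, ball j a =>
      ball (f j) (rename (Fin.snoc (α := fun _ => Fin (m + 1)) (Fin.castSucc ∘ f) (Fin.last m)) a)

end D0

variable {M : Type} [setLang.Structure M]

/-- Truth of a `Δ₀`-formula. -/
def DR : ∀ {n : ℕ}, D0 n → (Fin n → M) → Prop
  | _, .mem i j, v => Mem (v i) (v j)
  | _, .nand a b, v => ¬ (DR a v ∧ DR b v)
  | _, .ball j a, v => ∀ x, Mem x (v j) → DR a (Fin.snoc v x)

section
variable {n : ℕ} {v : Fin n → M}

@[simp] theorem dr_mem {i j : Fin n} : DR (.mem i j) v ↔ Mem (v i) (v j) := Iff.rfl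
@[simp] theorem dr_nand {a b : D0 n} : DR (.nand a b) v ↔ ¬ (DR a v ∧ DR b v) := Iff.rfl
@[simp] theorem dr_neg {a : D0 n} : DR a.neg v ↔ ¬ DR a v := by simp [D0.neg]
@[simp] theorem dr_and {a b : D0 n} : DR (a.and b) v ↔ DR a v ∧ DR b v := by simp [D0.and]
@[simp] theorem dr_or {a b : D0 n} : DR (a.or b) v ↔ DR a v ∨ DR b v := by simp [D0.or]; tauto
@[simp] theorem dr_imp {a b : D0 n} : DR (a.imp b) v ↔ (DR a v → DR b v) := by simp [D0.imp]
@[simp] theorem dr_iff {a b : D0 n} : DR (a.iff b) v ↔ (DR a v ↔ DR b v) := by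
  simp [D0.iff]; tauto
@[simp] theorem dr_allIn {j : Fin n} {a : Fin (n + 1) → D0 (n + 1)} :
    DR (.allIn j a) v ↔ ∀ x, Mem x (v j) → DR (a (Fin.last n)) (Fin.snoc v x) := Iff.rfl
@[simp] theorem dr_exIn {j : Fin n} {a : Fin (n + 1) → D0 (n + 1)} :
    DR (.exIn j a) v ↔ ∃ x, Mem x (v j) ∧ DR (a (Fin.last n)) (Fin.snoc v x) := by
  simp [D0.exIn, DR]

theorem dr_rename {m : ℕ} (f : Fin n → Fin m) (d : D0 n) (w : Fin m → M) :
    DR (d.rename f) w ↔ DR d (w ∘ f) := by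
  induction d generalizing m with
  | mem i j => rfl
  | nand a b h1 h2 => simp [D0.rename, h1, h2]
  | ball j a h =>
    simp only [D0.rename, DR, h, Function.comp]
    refine forall₂_congr fun x _ => ?_
    apply iff_of_eq
    congr 1
    funext i
    refine Fin.lastCases ?_ (fun j => ?_) i <;> simp

end

variable [KPM M]

section
variable {n : ℕ} {v : Fin n → M}

@[simp] theorem dr_eq {i j : Fin n} : DR (.eq i j) v ↔ v i = v j := by
  simp only [D0.eq, dr_and, dr_allIn, dr_mem, Fin.snoc_last, Fin.snoc_castSucc]
  exact ⟨fun h => Mem.ext fun z => ⟨h.1 z, h.2 z⟩, fun h => by simp [h]⟩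

@[simp] theorem dr_pair {z x y : Fin n} : DR (.pair z x y) v ↔ v z = pr (v x) (v y) := by
  simp only [D0.pair, dr_and, dr_allIn, dr_or, dr_eq, dr_mem, Fin.snoc_last, Fin.snoc_castSucc]
  refine ⟨fun h => Mem.ext fun z => ?_, fun h => by simp [h]⟩
  rw [mem_pr]
  refine ⟨h.2.2 z, ?_⟩
  rintro (rfl | rfl)
  exacts [h.1, h.2.1]

@[simp] theorem dr_opair {z x y : Fin n} : DR (.opair z x y) v ↔ v z = op (v x) (v y) := by
  simp only [D0.opair, dr_exIn, dr_and, dr_pair, Fin.snoc_last, Fin.snoc_castSucc]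
  constructor
  · rintro ⟨u, hu, w, hw, rfl, rfl, h⟩; exact h
  · intro h
    exact ⟨_, by rw [h]; simp [op], _, by rw [h]; simp [op], rfl, rfl, h⟩

@[simp] theorem dr_pairIn {r x y : Fin n} : DR (.pairIn r x y) v ↔ Mem (op (v x) (v y)) (v r) := by
  simp [D0.pairIn]

end

/-! ### Relativized formulas are `Δ₀` -/

/-- The variable that a term is. -/
def tvar {β : Type} : setLang.Term β → β
  | .var b => b
  | .func f _ => f.elim

theorem realize_tvar {β : Type} (t : setLang.Term β) (w : β → M) : t.realize w = w (tvar t) := by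
  cases t with
  | var => rfl
  | func f => exact f.elim

theorem relMap_setRel (ts : Fin 2 → M) :
    Structure.RelMap (L := setLang) (M := M) (SetRel.mem : setLang.Relations 2) ts ↔ Mem (ts 0) (ts 1) := by
  unfold Mem memSym
  apply iff_of_eq
  congr 1
  funext i
  fin_cases i <;> rfl

/-- `φ` with its quantifiers restricted to the elements of `p`. -/
def relD0 {α : Type} : ∀ {m k : ℕ} (_ : Fin m) (_ : α → Fin m) (_ : Fin k → Fin m),
    setLang.BoundedFormula α k → D0 m
  -- `D0` has no constant for falsity; `p ∈ p` is false by Foundation.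
  | _, _, p, _, _, .falsum => .mem p p
  | _, _, _, f, g, .equal t u => .eq (Sum.elim f g (tvar t)) (Sum.elim f g (tvar u))
  | _, _, _, f, g, .rel SetRel.mem ts =>
      .mem (Sum.elim f g (tvar (ts 0))) (Sum.elim f g (tvar (ts 1)))
  | _, _, p, f, g, .imp φ ψ => .imp (relD0 p f g φ) (relD0 p f g ψ)
  | m, _, p, f, g, .all φ => .ball p (relD0 (Fin.castSucc p) (Fin.castSucc ∘ f)
      (Fin.snoc (α := fun _ => Fin (m + 1)) (Fin.castSucc ∘ g) (Fin.last m)) φ)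

theorem comp_sumElim {α β γ N : Type} (v : γ → N) (f : α → γ) (g : β → γ) (x : α ⊕ β) :
    Sum.elim (v ∘ f) (v ∘ g) x = v (Sum.elim f g x) := by
  cases x <;> rfl

theorem snoc_comp_snoc {N : Type} {m k : ℕ} (v : Fin m → N) (g : Fin k → Fin m) (x : N) :
    (Fin.snoc v x : Fin (m + 1) → N) ∘
      (Fin.snoc (α := fun _ => Fin (m + 1)) (Fin.castSucc ∘ g) (Fin.last m) : Fin (k + 1) → _) =
    Fin.snoc (v ∘ g) x := by
  funext i
  refine Fin.lastCases ?_ (fun j => ?_) i <;> simp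

theorem snoc_comp_castSucc' {N : Type} {α : Type} {m : ℕ} (v : Fin m → N) (f : α → Fin m) (x : N) :
    (Fin.snoc v x : Fin (m + 1) → N) ∘ (Fin.castSucc ∘ f) = v ∘ f := by
  funext i; simp

theorem dr_relD0 {α : Type} {m k : ℕ} (p : Fin m) (f : α → Fin m) (g : Fin k → Fin m)
    (φ : setLang.BoundedFormula α k) (v : Fin m → M) :
    DR (relD0 p f g φ) v ↔ EvB (ext (v p)) (v ∘ f) φ (v ∘ g) := by
  induction φ generalizing m with
  | falsum => simp [relD0, EvB, not_mem_self]
  | equal t u => simp only [relD0, EvB, dr_eq, realize_tvar, comp_sumElim]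
  | rel R ts =>
    cases R
    simp only [relD0, EvB, dr_mem, realize_tvar, comp_sumElim]
    exact (relMap_setRel (M := M) fun i => v (Sum.elim f g (tvar (ts i)))).symm
  | imp φ ψ h1 h2 => simp only [relD0, EvB, dr_imp, h1, h2]
  | all φ h =>
    simp only [relD0, EvB, DR, h, snoc_comp_snoc, snoc_comp_castSucc']
    simp

/-- Syntactic `Δ₀`-formulas are `Δ₀` over every transitive class. -/
theorem IsDelta0.exists_D0 {α : Type} {k : ℕ} {φ : setLang.BoundedFormula α k} (h : IsDelta0 φ) :
    ∀ {m : ℕ} (_ : Fin m) (f : α → Fin m) (g : Fin k → Fin m), ∃ d : D0 m,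
      ∀ U : Set M, TransC U → ∀ v : Fin m → M, (∀ i, v i ∈ U) →
        (EvB U (v ∘ f) φ (v ∘ g) ↔ DR d v) := by
  induction h with
  | falsum => exact fun i0 f g => ⟨.mem i0 i0, fun U _ v _ => by simp [EvB, not_mem_self]⟩
  | equal t u =>
    exact fun i0 f g => ⟨.eq (Sum.elim f g (tvar t)) (Sum.elim f g (tvar u)), fun U _ v _ => by
      simp only [EvB, dr_eq, realize_tvar, comp_sumElim]⟩
  | rel R ts =>
    intro m i0 f g
    cases R
    refine ⟨.mem (Sum.elim f g (tvar (ts 0))) (Sum.elim f g (tvar (ts 1))), fun U _ v _ => ?_⟩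
    simp only [EvB, dr_mem, realize_tvar, comp_sumElim]
    exact relMap_setRel _
  | imp _ _ h1 h2 =>
    intro m i0 f g
    obtain ⟨d1, h1⟩ := h1 i0 f g
    obtain ⟨d2, h2⟩ := h2 i0 f g
    exact ⟨.imp d1 d2, fun U hU v hv => by simp only [EvB, dr_imp, h1 U hU v hv, h2 U hU v hv]⟩
  | @ball _ u φ _ h =>
    intro m i0 f g
    obtain ⟨d, h⟩ := h (Fin.castSucc i0) (Fin.castSucc ∘ f)
      (Fin.snoc (α := fun _ => Fin (m + 1)) (Fin.castSucc ∘ g) (Fin.last m))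
    refine ⟨.ball (Sum.elim f g u) d, fun U hU v hv => ?_⟩
    have hm : ∀ x, (EvB U (v ∘ f) (memVar (Sum.inr (Fin.last _)) (Sum.map id Fin.castSucc u))
        (Fin.snoc (v ∘ g) x) ↔ Mem x (v (Sum.elim f g u))) := by
      intro x
      simp only [memVar, Relations.boundedFormula₂, Relations.boundedFormula, EvB]
      refine (relMap_setRel _).trans ?_
      cases u <;> simp
    show (∀ x ∈ U, (EvB U (v ∘ f) (memVar _ _) (Fin.snoc (v ∘ g) x) → EvB U (v ∘ f) _ _)) ↔ _
    simp only [hm, DR]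
    have key : ∀ x ∈ U, (EvB U (v ∘ f) φ (Fin.snoc (v ∘ g) x) ↔ DR d (Fin.snoc v x)) := by
      intro x hx
      have := h U hU (Fin.snoc v x) (fun i => by
        refine Fin.lastCases ?_ (fun j => ?_) i <;> simp [hx, hv])
      rwa [snoc_comp_snoc, snoc_comp_castSucc'] at this
    constructor
    · intro H x hx
      have hxU := hU _ (hv _) x hx
      exact (key x hxU).1 (H x hxU hx)
    · intro H x hxU hx
      exact (key x hxU).2 (H x hx)

/-! ### Codes -/

variable (M) in
/-- The natural number `k` of the model. -/
noncomputable def num : ℕ → M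
  | 0 => zero M
  | k + 1 => sc (num k)

theorem num_mem_om (k : ℕ) : Mem (num M k) (om M) := by
  induction k with
  | zero => exact zero_mem_om
  | succ k h => exact sc_mem_om h

/-- Numerals of standard numbers have only standard elements, even if `M` has nonstandard natural
numbers. This keeps codes of actual formulas under external control. -/
theorem mem_num {x : M} {k : ℕ} : Mem x (num M k) ↔ ∃ j < k, x = num M j := by
  induction k with
  | zero => simp [num]
  | succ k h =>
    simp only [num, mem_sc, h]
    constructor
    · rintro (⟨j, hj, rfl⟩ | rfl)
      exacts [⟨j, by omega, rfl⟩, ⟨k, by omega, rfl⟩]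
    · rintro ⟨j, hj, rfl⟩
      rcases Nat.lt_succ_iff_lt_or_eq.1 hj with h | rfl
      exacts [Or.inl ⟨j, h, rfl⟩, Or.inr rfl]

theorem num_mem_num {j k : ℕ} (h : j < k) : Mem (num M j) (num M k) := mem_num.2 ⟨j, h, rfl⟩

@[simp] theorem num_inj {j k : ℕ} : num M j = num M k ↔ j = k := by
  refine ⟨fun h => ?_, fun h => by rw [h]⟩
  rcases lt_trichotomy j k with hl | hl | hl
  · exact (not_mem_self (num M k) (by have := num_mem_num (M := M) hl; rwa [h] at this)).elim
  · exact hl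
  · exact (not_mem_self (num M k) (by have := num_mem_num (M := M) hl; rwa [h] at this)).elim

variable (M) in
/-- The code of a `Δ₀`-formula. -/
noncomputable def D0.code : ∀ {n : ℕ}, D0 n → M
  | _, .mem i j => op (zero M) (op (num M i) (num M j))
  | _, .nand a b => op (one M) (op a.code b.code)
  | _, .ball j a => op (two M) (op (num M j) a.code)

/-- The finite sequence of the values of `v`. -/
noncomputable def seqOf : ∀ {n : ℕ}, (Fin n → M) → M
  | 0, _ => zero M
  | n + 1, v => ap (seqOf (fun i : Fin n => v i.castSucc)) (num M n) (v (Fin.last n))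

theorem seqOf_snoc {n : ℕ} (v : Fin n → M) (x : M) :
    seqOf (Fin.snoc v x : Fin (n + 1) → M) = ap (seqOf v) (num M n) x := by
  simp [seqOf]

theorem isSeq_seqOf {n : ℕ} (v : Fin n → M) : IsSeq (seqOf v) (num M n) := by
  induction n with
  | zero => exact IsSeq.zero
  | succ n h => exact (h _).ap _

theorem op_mem_seqOf {n : ℕ} {v : Fin n → M} {i : Fin n} {x : M} :
    Mem (op (num M i) x) (seqOf v) ↔ x = v i := by
  induction n with
  | zero => exact i.elim0
  | succ n h =>
    rw [seqOf, mem_ap, op_inj, num_inj]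
    refine Fin.lastCases ?_ (fun j => ?_) i
    · simp only [Fin.val_last, true_and]
      constructor
      · rintro (h' | h')
        · exact (not_mem_self _ ((isSeq_seqOf _).mem_len h')).elim
        · exact h'
      · exact Or.inr
    · rw [Fin.val_castSucc, h]
      constructor
      · rintro (h' | ⟨h', -⟩)
        · exact h'
        · exact (j.2.ne h').elim
      · exact Or.inl

theorem mem_seqOf {n : ℕ} {v : Fin n → M} {z : M} :
    Mem z (seqOf v) ↔ ∃ i : Fin n, z = op (num M i) (v i) := by
  constructor
  · intro h
    obtain ⟨i, hi, x, rfl⟩ := (isSeq_seqOf v).2.1 z h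
    obtain ⟨j, hj, rfl⟩ := mem_num.1 hi
    exact ⟨⟨j, hj⟩, by rw [(op_mem_seqOf (i := ⟨j, hj⟩)).1 h]⟩
  · rintro ⟨i, rfl⟩; exact op_mem_seqOf.2 rfl

theorem seqIn_seqOf {n : ℕ} {v : Fin n → M} {T : Set M} (h : ∀ i, v i ∈ T) : SeqIn (seqOf v) T := by
  refine (isSeq_seqOf v).seqIn fun i x hx => ?_
  obtain ⟨j, e⟩ := mem_seqOf.1 hx
  rw [op_inj] at e
  rw [e.2]; exact h j

theorem World.code_mem {U : Set M} [hU : World U] {n : ℕ} (d : D0 n) : d.code M ∈ U := by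
  induction d with
  | mem i j => exact World.op_mem World.zero_mem (World.op_mem (World.nat_mem (num_mem_om _))
      (World.nat_mem (num_mem_om _)))
  | nand a b h1 h2 => exact World.op_mem (World.nat_mem one_mem_om) (World.op_mem h1 h2)
  | ball j a h =>
    exact World.op_mem (World.nat_mem two_mem_om)
      (World.op_mem (World.nat_mem (num_mem_om _)) h)

theorem zero_ne_one : zero M ≠ one M := fun h => by
  simpa using (num_inj (M := M) (j := 0) (k := 1)).1 h
theorem zero_ne_two : zero M ≠ two M := fun h => by
  simpa using (num_inj (M := M) (j := 0) (k := 2)).1 h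
theorem one_ne_two : one M ≠ two M := fun h => by
  simpa using (num_inj (M := M) (j := 1) (k := 2)).1 h

theorem satC_mem {S i j s : M} : SatC S (op (zero M) (op i j)) s ↔
    ∃ u v, Mem (op i u) s ∧ Mem (op j v) s ∧ Mem u v := by
  simp [SatC, zero_ne_one, zero_ne_two]

theorem satC_nand {S a b s : M} : SatC S (op (one M) (op a b)) s ↔
    ¬ (Mem (op a s) S ∧ Mem (op b s) S) := by
  simp [SatC, zero_ne_one.symm, one_ne_two]

theorem satC_ball {S j a s : M} : SatC S (op (two M) (op j a)) s ↔
    ∃ v, Mem (op j v) s ∧ ∀ x, Mem x v → ∃ t, IsSnoc t s x ∧ Mem (op a t) S := by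
  simp [SatC, zero_ne_two.symm, one_ne_two.symm]

/-- Satisfaction relations are correct for the codes of `Δ₀`-formulas. -/
theorem IsSat.code_iff {T S : M} (h : IsSat T S) (hT : IsTr T) {n : ℕ} (d : D0 n)
    (hd : Mem (d.code M) T) (v : Fin n → M) (hv : ∀ i, Mem (v i) T) :
    Mem (op (d.code M) (seqOf v)) S ↔ DR d v := by
  induction d with
  | mem i j =>
    rw [h _ hd _ (seqIn_seqOf hv), D0.code, satC_mem]
    simp [op_mem_seqOf]
  | nand a b h1 h2 =>
    rw [h _ hd _ (seqIn_seqOf hv), D0.code, satC_nand]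
    have := hT.transC.right_mem hd
    rw [h1 (hT.transC.left_mem this) v hv, h2 (hT.transC.right_mem this) v hv]
    rfl
  | ball j a ha =>
    rw [h _ hd _ (seqIn_seqOf hv), D0.code, satC_ball]
    have hc := hT.transC.right_mem (hT.transC.right_mem hd)
    simp only [op_mem_seqOf, exists_eq_left, (isSeq_seqOf v).isSnoc_iff, DR, ← seqOf_snoc]
    refine forall₂_congr fun x hx => ?_
    refine ha hc (Fin.snoc v x) fun i => ?_
    refine Fin.lastCases ?_ (fun j => ?_) i
    · simpa using hT _ (hv j) x hx
    · simpa using hv j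

/-! ### Packing parameters; separation and collection in admissible sets -/

/-- The tuple `⟨v₀, ⟨v₁, … vₙ⟩⟩`. -/
noncomputable def tup : ∀ {n : ℕ}, (Fin (n + 1) → M) → M
  | 0, v => v 0
  | n + 1, v => tup (n := n) (Fin.snoc (fun i : Fin n => v i.castSucc.castSucc)
      (op (v (Fin.last n).castSucc) (v (Fin.last (n + 1)))))

theorem World.tup_mem {U : Set M} [hU : World U] {n : ℕ} {v : Fin (n + 1) → M} (h : ∀ i, v i ∈ U) :
    tup v ∈ U := by
  induction n with
  | zero => exact h 0
  | succ n ih =>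
    refine ih fun i => ?_
    refine Fin.lastCases ?_ (fun j => ?_) i
    · simpa using World.op_mem (h _) (h _)
    · simpa using h _

theorem TransC.of_tup {U : Set M} (hU : TransC U) {n : ℕ} {v : Fin (n + 1) → M} (h : tup v ∈ U) :
    ∀ i, v i ∈ U := by
  induction n with
  | zero => intro i; rw [Fin.fin_one_eq_zero i]; exact h
  | succ n ih =>
    have key := ih h
    have h1 := key (Fin.last n)
    rw [Fin.snoc_last] at h1
    intro i
    refine Fin.lastCases (hU.right_mem h1) (fun j => ?_) i
    refine Fin.lastCases (hU.left_mem h1) (fun j => ?_) j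
    have := key j.castSucc
    rwa [Fin.snoc_castSucc] at this

/-- The renaming used by `D0.pack`. -/
def packMap (n : ℕ) : Fin (n + 2) → Fin (n + 4) :=
  Fin.snoc (α := fun _ => Fin (n + 4)) (Fin.snoc (α := fun _ => Fin (n + 4))
    (fun i : Fin n => i.castSucc.castSucc.castSucc.castSucc) (Fin.last (n + 2)).castSucc)
    (Fin.last (n + 3))

/-- Replaces the last two variables by their ordered pair. -/
def D0.pack {n : ℕ} (d : D0 (n + 2)) : D0 (n + 1) :=
  exIn (Fin.last n) fun u => exIn u fun x => exIn u fun y =>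
    and (opair (Fin.last n).castSucc.castSucc.castSucc x y) (d.rename (packMap n))

theorem dr_pack {n : ℕ} (d : D0 (n + 2)) (v : Fin n → M) (x y : M) :
    DR d.pack (Fin.snoc v (op x y)) ↔ DR d (Fin.snoc (Fin.snoc v x : Fin (n + 1) → M) y) := by
  have key : ∀ c u x' y' : M, ((Fin.snoc (Fin.snoc (Fin.snoc (Fin.snoc v c : Fin (n + 1) → M) u :
      Fin (n + 2) → M) x' : Fin (n + 3) → M) y' : Fin (n + 4) → M) ∘ packMap n) =
      Fin.snoc (Fin.snoc v x' : Fin (n + 1) → M) y' := by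
    intro c u x' y'
    funext i
    refine Fin.lastCases ?_ (fun j => ?_) i
    · simp [packMap]
    · refine Fin.lastCases ?_ (fun j => ?_) j
      · simp [packMap]
      · simp [packMap]
  simp only [D0.pack, dr_exIn, dr_and, dr_opair, dr_rename, key, Fin.snoc_castSucc, Fin.snoc_last,
    op_inj]
  constructor
  · rintro ⟨u, -, x', -, y', -, ⟨rfl, rfl⟩, h⟩; exact h
  · intro h
    exact ⟨pr x y, by simp [op], x, by simp, y, by simp, ⟨rfl, rfl⟩, h⟩

/-- Separation and Collection in an admissible set are formulated for codes with a single parameter.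
Several parameters are folded into nested pairs, and unfolding a pair costs only bounded
quantifiers. -/
theorem D0.exists_pack {r k : ℕ} (d : D0 (r + (k + 1))) : ∃ d' : D0 (r + 1),
    ∀ (w : Fin r → M) (v : Fin (k + 1) → M),
      DR d' (Fin.snoc w (tup v)) ↔ DR d (Fin.append w v) := by
  induction k with
  | zero =>
    refine ⟨d, fun w v => ?_⟩
    apply iff_of_eq
    congr 1
    rw [tup, Fin.append_right_eq_snoc]
  | succ k ih =>
    obtain ⟨d', h⟩ := ih (D0.pack (n := r + k) d)
    refine ⟨d', fun w v => ?_⟩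
    rw [tup, h]
    have e1 : (Fin.append w (Fin.snoc (fun i : Fin k => v i.castSucc.castSucc)
        (op (v (Fin.last k).castSucc) (v (Fin.last (k + 1))))) : Fin (r + (k + 1)) → M) =
        Fin.snoc (Fin.append w fun i : Fin k => v i.castSucc.castSucc)
          (op (v (Fin.last k).castSucc) (v (Fin.last (k + 1)))) := Fin.append_snoc _ _ _
    have e2 : (Fin.append w v : Fin (r + (k + 1 + 1)) → M) =
        Fin.snoc (Fin.snoc (Fin.append w fun i : Fin k => v i.castSucc.castSucc)
          (v (Fin.last k).castSucc) : Fin (r + (k + 1)) → M) (v (Fin.last (k + 1))) := by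
      rw [← Fin.append_snoc, ← Fin.append_snoc]
      congr 1
      funext i
      refine Fin.lastCases ?_ (fun j => ?_) i
      · simp
      · refine Fin.lastCases ?_ (fun j => ?_) j <;> simp
    rw [e1, e2]
    exact dr_pack _ _ _ _

theorem Adm.exists_sep {A S : M} (h : Adm A S) {n : ℕ} (d : D0 (n + 1)) (v : Fin n → M)
    (hv : ∀ i, Mem (v i) A) {a : M} (ha : Mem a A) :
    ∃ c, Mem c A ∧ ∀ x, Mem x c ↔ Mem x a ∧ DR d (Fin.snoc v x) := by
  have := h.world
  obtain ⟨d', hd'⟩ := D0.exists_pack (M := M) (r := 1) (k := n) (d.rename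
    (Fin.snoc (α := fun _ => Fin (1 + (n + 1))) (fun j => Fin.natAdd 1 j.castSucc) 0))
  -- The set `a` is appended as a dummy parameter, so that the tuple is nonempty even for `n = 0`.
  have hp : tup (Fin.snoc v a : Fin (n + 1) → M) ∈ ext A := World.tup_mem fun i => by
    refine Fin.lastCases ?_ (fun j => ?_) i
    · simpa using ha
    · simpa using hv j
  -- The renaming exchanges the two variables: `seq2` lists the parameter before the element, while
  -- `d'` expects it last.
  obtain ⟨c, hc, h1⟩ := h.sep ((d'.rename (![1, 0] : Fin 2 → Fin 2)).code M) (World.code_mem (U := ext A) _)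
    (tup (Fin.snoc v a : Fin (n + 1) → M)) hp a ha
  refine ⟨c, hc, fun x => ?_⟩
  rw [h1]
  refine and_congr_right fun hx => ?_
  have e : seq2 (tup (Fin.snoc v a : Fin (n + 1) → M)) x =
      seqOf ![tup (Fin.snoc v a : Fin (n + 1) → M), x] := rfl
  rw [e, h.sat.code_iff h.tr _ (World.code_mem (U := ext A) _), dr_rename]
  · have e2 : (![tup (Fin.snoc v a : Fin (n + 1) → M), x] ∘ ![1, 0] : Fin 2 → M) =
        Fin.snoc (fun _ : Fin 1 => x) (tup (Fin.snoc v a : Fin (n + 1) → M)) := by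
      funext i; fin_cases i <;> rfl
    rw [e2, hd', dr_rename]
    apply iff_of_eq
    congr 1
    funext i
    refine Fin.lastCases ?_ (fun j => ?_) i
    · simp only [Function.comp, Fin.snoc_last]
      exact Fin.append_left (fun _ : Fin 1 => x) _ (0 : Fin 1)
    · simp [Fin.append_right]
  · intro i
    fin_cases i
    · exact hp
    · exact h.tr _ ha _ hx

theorem Adm.exists_coll {A S : M} (h : Adm A S) {n : ℕ} (d : D0 (n + 2)) (v : Fin n → M)
    (hv : ∀ i, Mem (v i) A) {a : M} (ha : Mem a A)
    (H : ∀ x, Mem x a → ∃ z, Mem z A ∧ DR d (Fin.snoc (Fin.snoc v x : Fin (n + 1) → M) z)) :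
    ∃ c, Mem c A ∧ ∀ x, Mem x a → ∃ z, Mem z c ∧
      DR d (Fin.snoc (Fin.snoc v x : Fin (n + 1) → M) z) := by
  have := h.world
  obtain ⟨d', hd'⟩ := D0.exists_pack (M := M) (r := 2) (k := n) (d.rename
    (Fin.snoc (α := fun _ => Fin (2 + (n + 1))) (Fin.snoc (α := fun _ => Fin (2 + (n + 1)))
      (fun j => Fin.natAdd 2 j.castSucc) (Fin.castAdd (n + 1) (0 : Fin 2)))
      (Fin.castAdd (n + 1) (1 : Fin 2))))
  set p := tup (Fin.snoc v a : Fin (n + 1) → M) with hpdef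
  have hp : p ∈ ext A := World.tup_mem fun i => by
    refine Fin.lastCases ?_ (fun j => ?_) i
    · simpa using ha
    · simpa using hv j
  have key : ∀ x, Mem x a → ∀ z, Mem z A → (Mem (op ((d'.rename (![1, 2, 0] : Fin 3 → Fin 3)).code M) (seq3 p x z)) S ↔
      DR d (Fin.snoc (Fin.snoc v x : Fin (n + 1) → M) z)) := by
    intro x hx z hz
    have e : seq3 p x z = seqOf ![p, x, z] := rfl
    rw [e, h.sat.code_iff h.tr _ (World.code_mem (U := ext A) _), dr_rename]
    · have e2 : (![p, x, z] ∘ (![1, 2, 0] : Fin 3 → Fin 3) : Fin 3 → M) = Fin.snoc ![x, z] p := by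
        funext i; fin_cases i <;> rfl
      rw [e2, hd', dr_rename]
      apply iff_of_eq
      congr 1
      funext i
      refine Fin.lastCases ?_ (fun j => ?_) i
      · simp only [Function.comp, Fin.snoc_last]
        exact Fin.append_left ![x, z] _ (1 : Fin 2)
      · refine Fin.lastCases ?_ (fun j => ?_) j
        · simp only [Function.comp, Fin.snoc_last, Fin.snoc_castSucc]
          exact Fin.append_left ![x, z] _ (0 : Fin 2)
        · simp [Fin.append_right]
    · intro i
      fin_cases i
      · exact hp
      · exact h.tr _ ha _ hx
      · exact hz
  obtain ⟨c, hc, h1⟩ := h.coll ((d'.rename (![1, 2, 0] : Fin 3 → Fin 3)).code M)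
    (World.code_mem (U := ext A) _) p hp a ha fun x hx => by
      obtain ⟨z, hz, hd⟩ := H x hx
      exact ⟨z, hz, (key x hx z hz).2 hd⟩
  refine ⟨c, hc, fun x hx => ?_⟩
  obtain ⟨z, hz, hd⟩ := h1 x hx
  exact ⟨z, hz, (key x hx z (h.tr _ hc _ hz)).1 hd⟩

end SetTh

namespace SetTh

variable {M : Type} [setLang.Structure M] [KPM M]

/-! ### Evaluating formulas in a world that is a parameter -/

def D0.allMem {m : ℕ} (p : Fin m) : ∀ {k : ℕ}, (Fin k → Fin m) → D0 m
  | 0, _ => .neg (.mem p p)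
  | _ + 1, g => .and (.mem (g (Fin.last _)) p) (D0.allMem p fun i => g i.castSucc)

theorem dr_allMem {m k : ℕ} (p : Fin m) (g : Fin k → Fin m) (v : Fin m → M) :
    DR (.allMem p g) v ↔ ∀ i, Mem (v (g i)) (v p) := by
  induction k with
  | zero => simp [D0.allMem, not_mem_self]
  | succ k h => simp [D0.allMem, h, Fin.forall_fin_succ', and_comm]

theorem dr_rel {m k : ℕ} (p : Fin m) (g : Fin k → Fin m) (φ : Fm k) (v : Fin m → M)
    (h : ∀ i, Mem (v (g i)) (v p)) :
    DR (relD0 p Empty.elim g φ) v ↔ Tr φ (fun i => (⟨v (g i), h i⟩ : ↥(ext (v p)))) := by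
  rw [dr_relD0, Tr, ← evB_coe]
  have : ∀ w w' : Empty → M, w = w' := fun w w' => Subsingleton.elim _ _
  rw [this (v ∘ Empty.elim)]
  rfl

/-- The empty set is required separately because the set called ω in `K` must be shown to contain
all natural numbers, by an induction that starts at 0. -/
def worldSent : Fm 0 :=
  (pairAx : Fm 0) ⋏ (unionAx : Fm 0) ⋏ (infAx : Fm 0) ⋏ ex fun z => isEmpty z

theorem tr_unionEq {U : Set M} (hU : TransC U) {n : ℕ} {v : Fin n → ↥U} {z x : Fin n} :
    Tr (all fun u => mem u z ⟷ᶠ exIn x fun w => mem u w) v ↔ (v z : M) = sU (v x : M) := by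
  simp only [tr_all, tr_iff, tr_mem, tr_exIn, mem_coe, Fin.snoc_castSucc, Fin.snoc_last]
  have e : ∀ u : M, (∃ w : ↥U, Mem (w : M) (v x) ∧ Mem u w) ↔ ∃ w, Mem w (v x : M) ∧ Mem u w :=
    fun u => exists_mem_coe hU (v x).2 (p := fun w => Mem u w)
  simp only [e]
  rw [forall_iff_coe hU (v z).2 (p := fun u => ∃ w, Mem w (v x : M) ∧ Mem u w)]
  · constructor
    · intro h; apply Mem.ext; simpa using h
    · intro h; simp [h]
  · rintro u ⟨w, hw, hu⟩; exact hU _ (hU _ (v x).2 _ hw) _ hu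

theorem world_ext_iff {K : M} :
    World (ext K) ↔ IsTr K ∧ Tr worldSent (default : Fin 0 → ↥(ext K)) := by
  constructor
  · intro h
    refine ⟨fun x hx y hy => h.trans x hx y hy, ?_⟩
    simp only [worldSent, tr_and, pairAx, unionAx, infAx, tr_all, tr_ex, tr_isPair, tr_isOmega,
      tr_isEmpty, Fin.snoc_castSucc, Fin.snoc_last]
    refine ⟨fun x y => ⟨⟨_, h.pr_mem _ x.2 _ y.2⟩, rfl⟩, fun x => ⟨⟨_, h.sU_mem _ x.2⟩, ?_⟩,
      ⟨⟨_, h.om_mem⟩, rfl⟩, ⟨⟨_, World.zero_mem⟩, rfl⟩⟩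
    simpa using (tr_unionEq h.trans (v := Fin.snoc (Fin.snoc default x : Fin 1 → _)
      (⟨_, h.sU_mem _ x.2⟩ : ↥(ext K))) (z := 1) (x := 0)).2 rfl
  · rintro ⟨hK, h⟩
    have hT := hK.transC
    simp only [worldSent, tr_and] at h
    obtain ⟨h1, h2, h3, h4⟩ := h
    have hpr : ∀ x ∈ ext K, ∀ y ∈ ext K, pr x y ∈ ext K := by
      intro x hx y hy
      simp only [pairAx, tr_all, tr_ex, tr_isPair' hT, Fin.snoc_castSucc, Fin.snoc_last] at h1
      obtain ⟨z, hz⟩ := h1 ⟨x, hx⟩ ⟨y, hy⟩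
      have := z.2
      rwa [hz] at this
    have hsU : ∀ x ∈ ext K, sU x ∈ ext K := by
      intro x hx
      rw [unionAx, tr_all] at h2
      have h2 := h2 ⟨x, hx⟩
      rw [tr_ex] at h2
      obtain ⟨z, hz⟩ := h2
      have hz := (tr_unionEq hT (v := Fin.snoc (Fin.snoc default (⟨x, hx⟩ : ↥(ext K)) :
        Fin 1 → _) z) (z := 1) (x := 0)).1 hz
      have := z.2
      have e : (z : M) = sU x := hz
      rwa [e] at this
    -- The relativized axiom of infinity only says that the natural numbers lying in `K` form an
    -- element of `K`. Closure under successor puts all of them into `K`.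
    have hnat : ∀ x, Mem x (om M) → Mem x K := by
      refine nat_induction (p := fun x => Mem x K) 
        (Dfb.mk2 (p := fun K x => Mem x K) (fun _ K x => mem x K) (by simp) K) ?_ ?_
      · simp only [tr_ex, tr_isEmpty' hT, Fin.snoc_last, ← eq_zero] at h4
        obtain ⟨z, hz⟩ := h4
        rw [← hz]; exact z.2
      · intro x hx h
        exact hsU _ (hpr _ h _ (hpr _ h _ h))
    refine ⟨Or.inr ⟨K, rfl⟩, hT, hpr, hsU, ?_⟩
    simp only [infAx, isOmega, tr_ex, tr_all, tr_iff, tr_mem, tr_isNat' hT, mem_coe,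
      Fin.snoc_castSucc, Fin.snoc_last, ← mem_om] at h3
    obtain ⟨w, hw⟩ := h3
    have : (w : M) = om M := Mem.ext fun x =>
      ⟨fun hx => (hw ⟨x, hK _ w.2 _ hx⟩).1 hx, fun hx => (hw ⟨x, hnat x hx⟩).2 hx⟩
    rw [← this]; exact w.2

/-- `K` is a transitive set closed under pairing and union with `ω ∈ K`. -/
def D0.world {m : ℕ} (K : Fin m) : D0 m :=
  .and (.allIn K fun x => .allIn x fun y => .mem y K) (relD0 K Empty.elim Fin.elim0 worldSent)

@[simp] theorem dr_world {m : ℕ} {K : Fin m} {v : Fin m → M} :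
    DR (.world K) v ↔ World (ext (v K)) := by
  rw [world_ext_iff, D0.world, dr_and]
  refine and_congr ?_ ?_
  · simp [IsTr]
  · rw [dr_rel (M := M) K Fin.elim0 worldSent v (fun i => i.elim0)]
    apply iff_of_eq
    congr 1
    exact Subsingleton.elim _ _

/-- `K` is a world with the elements `xᵢ`, `i ∈ g`, and `φ(xᵢ)` is true in `K`. -/
def D0.wAt {m k : ℕ} (K : Fin m) (g : Fin k → Fin m) (φ : Fm k) : D0 m :=
  .and (.world K) (.and (.allMem K g) (relD0 K Empty.elim g φ))

theorem dr_wAt {m k : ℕ} {K : Fin m} {g : Fin k → Fin m} {φ : Fm k} {v : Fin m → M} :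
    DR (.wAt K g φ) v ↔ World (ext (v K)) ∧ ∃ h : ∀ i, Mem (v (g i)) (v K),
      Tr φ (fun i => (⟨v (g i), h i⟩ : ↥(ext (v K)))) := by
  rw [D0.wAt, dr_and, dr_and, dr_world, dr_allMem]
  refine and_congr_right fun _ => ?_
  constructor
  · rintro ⟨h, ht⟩; exact ⟨h, (dr_rel _ _ _ _ h).1 ht⟩
  · rintro ⟨h, ht⟩; exact ⟨h, (dr_rel _ _ _ _ h).2 ht⟩

/-! ### `Δ₀`-predicates are definable -/

def D0.toFm : ∀ {n : ℕ}, D0 n → Fm n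
  | _, .mem i j => SetTh.mem i j
  | _, .nand a b => SetTh.neg (SetTh.and a.toFm b.toFm)
  | _, .ball j a => SetTh.allIn j fun _ => a.toFm

theorem tr_toFm {n : ℕ} (d : D0 n) (v : Fin n → ↥(Set.univ : Set M)) :
    Tr d.toFm v ↔ DR d (fun i => (v i : M)) := by
  induction d with
  | mem i j => simp [D0.toFm]
  | nand a b h1 h2 => simp [D0.toFm, h1, h2]
  | ball j a h =>
    simp only [D0.toFm, tr_allIn, DR, h, mem_coe]
    have e : ∀ x : ↥(Set.univ : Set M), (fun i => ((Fin.snoc v x : Fin (_ + 1) →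
        ↥(Set.univ : Set M)) i : M)) = Fin.snoc (fun i => (v i : M)) (x : M) := by
      intro x; funext i; refine Fin.lastCases ?_ (fun j => ?_) i <;> simp
    simp only [e]
    exact ⟨fun H x hx => H ⟨x, trivial⟩ hx, fun H x hx => H x hx⟩

theorem Dfb.of_D0 {n : ℕ} (d : D0 (n + 1)) (v : Fin n → M) : Dfb (fun x => DR d (Fin.snoc v x)) := by
  refine ⟨n, d.toFm, fun i => ⟨v i, trivial⟩, fun x => ?_⟩
  rw [tr_toFm]
  have e : (fun i => ((Fin.snoc (fun i => ⟨v i, trivial⟩) x : Fin (n + 1) →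
      ↥(Set.univ : Set M)) i : M)) = Fin.snoc v (x : M) := by
    funext i; refine Fin.lastCases ?_ (fun j => ?_) i <;> simp
  rw [e]

/-! ### Definition by recursion in admissible sets -/

def D0.belowF {n : ℕ} (y x : Fin n) : D0 n :=
  .or (.mem y x) (.or (.exIn x fun z => .mem y z) (.or (.exIn x fun z => .exIn z fun w => .mem y w)
    (.exIn x fun z => .exIn z fun w => .exIn w fun u => .mem y u)))

@[simp] theorem dr_belowF {n : ℕ} {y x : Fin n} {v : Fin n → M} :
    DR (.belowF y x) v ↔ Below (v y) (v x) := by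
  simp [D0.belowF, Below]

/-- The step formula with its parameters and arguments renamed. -/
def D0.stepAt {n m : ℕ} (step : D0 (n + 1 + 1 + 1)) (f : Fin n → Fin m) (Q c h : Fin m) : D0 m :=
  step.rename (Fin.snoc (α := fun _ => Fin m) (Fin.snoc (α := fun _ => Fin m)
    (Fin.snoc (α := fun _ => Fin m) f Q) c) h)

/-- The value of the step formula. -/
def Step {n : ℕ} (step : D0 (n + 1 + 1 + 1)) (v : Fin n → M) (Q c h : M) : Prop :=
  DR step (Fin.snoc (Fin.snoc (Fin.snoc v Q : Fin (n + 1) → M) c : Fin (n + 1 + 1) → M) h)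

theorem dr_stepAt {n m : ℕ} {step : D0 (n + 1 + 1 + 1)} {f : Fin n → Fin m} {Q c h : Fin m}
    {w : Fin m → M} :
    DR (step.stepAt f Q c h) w ↔ Step step (w ∘ f) (w Q) (w c) (w h) := by
  rw [D0.stepAt, dr_rename, Step]
  apply iff_of_eq
  congr 1
  funext i
  refine Fin.lastCases ?_ (fun j => ?_) i
  · simp
  refine Fin.lastCases ?_ (fun j => ?_) j
  · simp
  refine Fin.lastCases ?_ (fun j => ?_) j <;> simp

section Recursion
variable {n : ℕ} (step : D0 (n + 1 + 1 + 1)) (v : Fin n → M) (D I : M)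

/-- `h` satisfies the recursion on `d`, and `d` is closed under predecessors in `D`. -/
def Corr (d h : M) : Prop :=
  ∀ Q, Mem Q d → Mem Q D ∧ (∀ Q', Mem Q' D → Below Q' Q → Mem Q' d) ∧
    ∀ c, Mem c I → (Mem (op Q c) h ↔ Step step v Q c h)

def D0.corr {m : ℕ} (f : Fin n → Fin m) (D I d h : Fin m) : D0 m :=
  .allIn d fun Q => .and (.mem Q D) (.and (.allIn D fun Q' => .imp (.belowF Q' Q) (.mem Q' d))
    (.allIn I fun c => .iff (.pairIn h Q c) (step.stepAt (fun i => (f i).castSucc.castSucc) Q c h)))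

theorem dr_corr {m : ℕ} {f : Fin n → Fin m} {D I d h : Fin m} {w : Fin m → M} :
    DR (D0.corr step f D I d h) w ↔ Corr step (w ∘ f) (w D) (w I) (w d) (w h) := by
  have e : ∀ x y : M, ((Fin.snoc (Fin.snoc w x : Fin (m + 1) → M) y : Fin (m + 2) → M) ∘
      fun i => (f i).castSucc.castSucc) = w ∘ f := by
    intro x y; funext i; simp
  simp [D0.corr, Corr, dr_stepAt, e]

/-- The step at `Q` depends only on the values at predecessors of `Q` in `D`. -/
def Local : Prop := ∀ Q, Mem Q D → ∀ c, Mem c I → ∀ h h', (∀ Q', Mem Q' D → Below Q' Q →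
  ∀ c', Mem c' I → (Mem (op Q' c') h ↔ Mem (op Q' c') h')) →
    (Step step v Q c h ↔ Step step v Q c h')

variable {step v D I}

/-- Both domains are closed under predecessors and the step depends only on values at predecessors,
so two approximations agree by induction along `Below`. -/
theorem Corr.unique (loc : Local step v D I) {d h d' h' : M} (hd : Corr step v D I d h) (hd' : Corr step v D I d' h') :
    ∀ Q, Mem Q d → Mem Q d' → ∀ c, Mem c I → (Mem (op Q c) h ↔ Mem (op Q c) h') := by
  refine below_induction (p := fun Q => Mem Q d → Mem Q d' → ∀ c, Mem c I →
    (Mem (op Q c) h ↔ Mem (op Q c) h')) ?_ ?_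
  · have := Dfb.of_D0 (M := M) (n := 5) (.imp (.mem 5 0) (.imp (.mem 5 1) (.allIn 2 fun c =>
      .iff (.pairIn (3 : Fin 6).castSucc (5 : Fin 6).castSucc c)
        (.pairIn (4 : Fin 6).castSucc (5 : Fin 6).castSucc c)))) ![d, d', I, h, h']
    simp only [dr_imp, dr_mem, dr_allIn, dr_iff, dr_pairIn, Fin.snoc_castSucc, Fin.snoc_last] at this
    exact this
  · intro Q ih hQ hQ' c hc
    obtain ⟨hQD, h1, h2⟩ := hd Q hQ
    obtain ⟨-, h1', h2'⟩ := hd' Q hQ'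
    rw [h2 c hc, h2' c hc]
    refine loc Q hQD c hc h h' fun Q' hQ'D hb c' hc' => ?_
    exact ih Q' hb (h1 Q' hQ'D hb) (h1' Q' hQ'D hb) c' hc'

/-- `Δ₀`-Collection in `B` bounds a family of approximations, and their union is again one because
any two of them agree where both are defined. -/
theorem exists_glue (loc : Local step v D I) {A B SB : M} (hB : Adm B SB) [hA : World (ext A)]
    (hAB : Mem A B) (hv : ∀ i, Mem (v i) B) (hD : Mem D A) (hIB : Mem I B)
    (hI : ∀ c, Mem c I → Mem c A) {a : M} (ha : Mem a B)
    (H : ∀ y, Mem y a → ∃ d, Mem d B ∧ ∃ h, Mem h B ∧ Mem y d ∧ Corr step v D I d h) :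
    ∃ W, Mem W B ∧ ∃ G, Mem G B ∧ (∀ y, Mem y a → Mem y W) ∧
      Corr step v D I W G ∧ ∀ Q c, Mem (op Q c) G → Mem Q W := by
  have hBw := hB.world
  have hDB : Mem D B := hB.tr _ hAB _ hD
  let par : Fin (n + 1 + 1) → M := Fin.snoc (Fin.snoc v D : Fin (n + 1) → M) I
  have hpar : ∀ i, Mem (par i) B := by
    intro i
    refine Fin.lastCases ?_ (fun j => ?_) i
    · simpa [par] using hIB
    refine Fin.lastCases ?_ (fun j => ?_) j
    · simpa [par] using hDB
    · simpa [par] using hv j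
  -- What is collected is the pair ⟨d, h⟩; the quantifier over its element {d, h} makes both
  -- components accessible in a bounded way.
  obtain ⟨C, hC, h1⟩ := hB.exists_coll (n := n + 1 + 1)
    (.exIn (Fin.last (n + 3)) fun u => .exIn u fun d => .exIn u fun h =>
      .and (.mem (Fin.last (n + 2)).castSucc.castSucc.castSucc.castSucc d)
      (D0.corr step (fun i => i.castSucc.castSucc.castSucc.castSucc.castSucc.castSucc.castSucc)
        (Fin.last n).castSucc.castSucc.castSucc.castSucc.castSucc.castSucc
        (Fin.last (n + 1)).castSucc.castSucc.castSucc.castSucc.castSucc d h)) par hpar ha (by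
    intro y hy
    obtain ⟨d, hd, h, hh, hyd, hc⟩ := H y hy
    refine ⟨op d h, World.op_mem (U := ext B) hd hh, ?_⟩
    simp only [dr_exIn, dr_and, dr_mem, dr_corr, Fin.snoc_last, Fin.snoc_castSucc]
    refine ⟨pr d h, by simp [op], d, by simp, h, by simp, hyd, ?_⟩
    convert hc using 1
    · funext i; simp [par]
    · simp [par]
    · simp [par])
  have h1' : ∀ y, Mem y a → ∃ z, Mem z C ∧ ∃ u, Mem u z ∧ ∃ d, Mem d u ∧ ∃ h, Mem h u ∧
      Mem y d ∧ Corr step v D I d h := by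
    intro y hy
    obtain ⟨z, hz, h2⟩ := h1 y hy
    simp only [dr_exIn, dr_and, dr_mem, dr_corr, Fin.snoc_last, Fin.snoc_castSucc] at h2
    obtain ⟨u, hu, d, hd, h, hh, hyd, hc⟩ := h2
    refine ⟨z, hz, u, hu, d, hd, h, hh, hyd, ?_⟩
    convert hc using 1
    · funext i; simp [par]
    · simp [par]
    · simp [par]
  let par' : Fin (n + 1 + 1 + 1) → M := Fin.snoc par C
  have hpar' : ∀ i, Mem (par' i) B := by
    intro i
    refine Fin.lastCases ?_ (fun j => ?_) i
    · simpa [par'] using hC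
    · simpa [par'] using hpar j
  obtain ⟨W, hW, hWm⟩ := hB.exists_sep (n := n + 1 + 1 + 1)
    (.exIn (Fin.last (n + 2)).castSucc fun z => .exIn z fun u => .exIn u fun d => .exIn u fun h =>
      .and (.mem (Fin.last (n + 3)).castSucc.castSucc.castSucc.castSucc d)
      (D0.corr step
        (fun i => i.castSucc.castSucc.castSucc.castSucc.castSucc.castSucc.castSucc.castSucc)
        (Fin.last n).castSucc.castSucc.castSucc.castSucc.castSucc.castSucc.castSucc
        (Fin.last (n + 1)).castSucc.castSucc.castSucc.castSucc.castSucc.castSucc d h)) par' hpar' hDB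
  -- The union is separated from `A`. Since `D ∈ A`, `I ⊆ A` and `A` is closed under pairing, `A`
  -- contains every pair ⟨Q, c⟩ and no product of sets is needed.
  obtain ⟨G, hG, hGm⟩ := hB.exists_sep (n := n + 1 + 1 + 1)
    (.exIn (Fin.last n).castSucc.castSucc.castSucc fun Q =>
      .exIn (Fin.last (n + 1)).castSucc.castSucc.castSucc fun c =>
      .and (.opair (Fin.last (n + 3)).castSucc.castSucc Q c) (
      .exIn (Fin.last (n + 2)).castSucc.castSucc.castSucc fun z =>
      .exIn z fun u => .exIn u fun d => .exIn u fun h =>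
      .and (.mem Q d) (.and
        (.mem (Fin.last (n + 3)).castSucc.castSucc.castSucc.castSucc.castSucc.castSucc h)
      (D0.corr step
        (fun i => i.castSucc.castSucc.castSucc.castSucc.castSucc.castSucc.castSucc.castSucc.castSucc.castSucc)
        (Fin.last n).castSucc.castSucc.castSucc.castSucc.castSucc.castSucc.castSucc.castSucc.castSucc
        (Fin.last (n + 1)).castSucc.castSucc.castSucc.castSucc.castSucc.castSucc.castSucc.castSucc
        d h)))) par' hpar' hAB
  have hWm' : ∀ Q, Mem Q W ↔ Mem Q D ∧ ∃ z, Mem z C ∧ ∃ u, Mem u z ∧ ∃ d, Mem d u ∧ ∃ h, Mem h u ∧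
      Mem Q d ∧ Corr step v D I d h := by
    intro Q
    rw [hWm]
    simp only [dr_exIn, dr_and, dr_mem, dr_corr, Fin.snoc_last, Fin.snoc_castSucc, par', par,
      Function.comp_def]
  have hGm' : ∀ z', Mem z' G ↔ Mem z' A ∧ ∃ Q, Mem Q D ∧ ∃ c, Mem c I ∧ z' = op Q c ∧
      ∃ z, Mem z C ∧ ∃ u, Mem u z ∧ ∃ d, Mem d u ∧ ∃ h, Mem h u ∧
      Mem Q d ∧ Mem z' h ∧ Corr step v D I d h := by
    intro Q
    rw [hGm]
    simp only [dr_exIn, dr_and, dr_mem, dr_corr, dr_opair, Fin.snoc_last, Fin.snoc_castSucc, par',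
      par, Function.comp_def]
  clear hWm hGm h1
  have agree : ∀ d h, Corr step v D I d h → (∀ Q, Mem Q d → Mem Q W) → ∀ z, Mem z C →
      ∀ u, Mem u z → Mem d u → Mem h u → ∀ Q, Mem Q d → ∀ c, Mem c I →
        (Mem (op Q c) G ↔ Mem (op Q c) h) := by
    intro d h hc hdW z hz u hu hd hh Q hQ c hcI
    rw [hGm']
    constructor
    · rintro ⟨-, Q', -, c', -, e, z', hz', u', hu', d', hd', h', hh', hQ', hm, hc'⟩
      rw [op_inj] at e
      obtain ⟨rfl, rfl⟩ := e
      exact (Corr.unique loc hc' hc Q hQ' hQ c hcI).1 hm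
    · intro hm
      have hQD := (hc Q hQ).1
      exact ⟨World.op_mem (U := ext A) (hA.trans _ hD _ hQD) (hI _ hcI), Q, hQD, c, hcI,
        rfl, z, hz, u, hu, d, hd, h, hh, hQ, hm, hc⟩
  refine ⟨W, hW, G, hG, fun y hy => ?_, fun Q hQ => ?_, fun Q c hm => ?_⟩
  · obtain ⟨z, hz, u, hu, d, hd, h, hh, hyd, hc⟩ := h1' y hy
    exact (hWm' y).2 ⟨(hc y hyd).1, z, hz, u, hu, d, hd, h, hh, hyd, hc⟩
  · obtain ⟨hQD, z, hz, u, hu, d, hd, h, hh, hQd, hc⟩ := (hWm' Q).1 hQ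
    have hdW : ∀ Q', Mem Q' d → Mem Q' W := fun Q' hQ' =>
      (hWm' Q').2 ⟨(hc Q' hQ').1, z, hz, u, hu, d, hd, h, hh, hQ', hc⟩
    have hag := agree d h hc hdW z hz u hu hd hh
    refine ⟨hQD, fun Q' hQ' hb => hdW _ ((hc Q hQd).2.1 Q' hQ' hb), fun c hcI => ?_⟩
    rw [hag Q hQd c hcI, (hc Q hQd).2.2 c hcI]
    refine (loc Q hQD c hcI G h fun Q' hQ' hb c' hc' => ?_).symm
    exact hag Q' ((hc Q hQd).2.1 Q' hQ' hb) c' hc'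
  · obtain ⟨-, Q', hQ', c', hc', e, z, hz, u, hu, d, hd, h, hh, hQ, -, hc⟩ := (hGm' _).1 hm
    rw [op_inj] at e
    rw [e.1]
    exact (hWm' Q').2 ⟨hQ', z, hz, u, hu, d, hd, h, hh, hQ, hc⟩

/-- Definition by recursion along `∈` in an admissible set. -/
theorem exists_recursion (loc : Local step v D I) {A B SB : M} (hB : Adm B SB)
    [hA : World (ext A)] (hAB : Mem A B) (hv : ∀ i, Mem (v i) B) (hD : Mem D A)
    (hIB : Mem I B) (hI : ∀ c, Mem c I → Mem c A) :
    ∃ H, Mem H B ∧ ∀ Q, Mem Q D → ∀ c, Mem c I → (Mem (op Q c) H ↔ Step step v Q c H) := by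
  have hBw := hB.world
  have hDB : Mem D B := hB.tr _ hAB _ hD
  have claim : ∀ x, Mem x D → ∃ d, Mem d B ∧ ∃ h, Mem h B ∧ Mem x d ∧ Corr step v D I d h := by
    refine below_induction (p := fun x => Mem x D → ∃ d, Mem d B ∧ ∃ h, Mem h B ∧ Mem x d ∧
      Corr step v D I d h) ?_ ?_
    · have := Dfb.of_D0 (M := M) (n := n + 1 + 1 + 1)
        (.imp (.mem (Fin.last (n + 3)) (Fin.last n).castSucc.castSucc.castSucc)
          (.exIn (Fin.last (n + 2)).castSucc fun d =>
            .exIn (Fin.last (n + 2)).castSucc.castSucc fun h =>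
            .and (.mem (Fin.last (n + 3)).castSucc.castSucc d)
            (D0.corr step (fun i => i.castSucc.castSucc.castSucc.castSucc.castSucc.castSucc)
            (Fin.last n).castSucc.castSucc.castSucc.castSucc.castSucc
            (Fin.last (n + 1)).castSucc.castSucc.castSucc.castSucc d h)))
        (Fin.snoc (Fin.snoc (Fin.snoc v D : Fin (n + 1) → M) I : Fin (n + 1 + 1) → M) B)
      simpa only [dr_imp, dr_exIn, dr_and, dr_mem, dr_corr, Fin.snoc_last, Fin.snoc_castSucc,
        Function.comp_def] using this
    · intro x ih hx
      -- `a` collects the predecessors of `x` in `D`; the approximations for them are glued, and the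
      -- result is extended by the values at `x`.
      obtain ⟨a, ha, hm⟩ := hB.exists_sep (n := 1) (.belowF 1 0) ![x]
        (fun i => by fin_cases i; exact hB.tr _ hDB _ hx) hDB
      have hm' : ∀ y, Mem y a ↔ Mem y D ∧ Below y x := fun y => (hm y).trans
        (and_congr_right fun _ => dr_belowF)
      obtain ⟨W, hW, G, hG, h1, h2, h3⟩ := exists_glue loc hB hAB hv hD hIB hI ha (fun y hy =>
        ih y ((hm' y).1 hy).2 ((hm' y).1 hy).1)
      -- One of the glued approximations may already be defined at `x`. Otherwise new pairs ⟨x, c⟩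
      -- can be added without conflict.
      by_cases hxW : Mem x W
      · exact ⟨W, hW, G, hG, hxW, h2⟩
      have hxB : Mem x B := hB.tr _ hDB _ hx
      obtain ⟨H, hH, hHm⟩ := hB.exists_sep (n := n + 1 + 1 + 1)
        (.or (.mem (Fin.last (n + 3)) (Fin.last (n + 2)).castSucc)
          (.exIn (Fin.last (n + 1)).castSucc.castSucc fun c =>
            .and (.opair (Fin.last (n + 3)).castSucc
              (Fin.last n).castSucc.castSucc.castSucc.castSucc c)
            (step.stepAt (fun i => i.castSucc.castSucc.castSucc.castSucc.castSucc)
              (Fin.last n).castSucc.castSucc.castSucc.castSucc c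
              (Fin.last (n + 2)).castSucc.castSucc)))
        (Fin.snoc (Fin.snoc (Fin.snoc v x : Fin (n + 1) → M) I : Fin (n + 1 + 1) → M) G) (by
          intro i
          refine Fin.lastCases ?_ (fun j => ?_) i
          · simpa using hG
          refine Fin.lastCases ?_ (fun j => ?_) j
          · simpa using hIB
          refine Fin.lastCases ?_ (fun j => ?_) j
          · simpa using hxB
          · simpa using hv j) hAB
      simp only [dr_or, dr_exIn, dr_and, dr_mem, dr_opair, dr_stepAt, Fin.snoc_last,
        Fin.snoc_castSucc, Function.comp_def] at hHm
      have old : ∀ Q, Mem Q W → ∀ c, Mem c I → (Mem (op Q c) H ↔ Mem (op Q c) G) := by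
        intro Q hQ c hc
        have hQA := hA.trans _ hD _ (h2 Q hQ).1
        rw [hHm]
        constructor
        · rintro ⟨-, h | ⟨c', -, e, -⟩⟩
          · exact h
          · rw [op_inj] at e
            exact (hxW (e.1 ▸ hQ)).elim
        · intro h
          exact ⟨World.op_mem (U := ext A) hQA (hI _ hc), Or.inl h⟩
      have new : ∀ c, Mem c I → (Mem (op x c) H ↔ Step step v x c G) := by
        intro c hc
        rw [hHm]
        constructor
        · rintro ⟨-, h | ⟨c', -, e, h⟩⟩
          · exact (hxW (h3 _ _ h)).elim
          · rw [op_inj] at e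
            rw [e.2]; exact h
        · intro h
          exact ⟨World.op_mem (U := ext A) (hA.trans _ hD _ hx) (hI _ hc),
            Or.inr ⟨c, hc, rfl, h⟩⟩
      have below_mem : ∀ Q, (Mem Q W ∨ Q = x) → ∀ Q', Mem Q' D → Below Q' Q → Mem Q' W := by
        rintro Q (hQ | rfl) Q' hQ' hb
        · exact (h2 Q hQ).2.1 Q' hQ' hb
        · exact h1 _ ((hm' Q').2 ⟨hQ', hb⟩)
      have hstep : ∀ Q, Mem Q D → (Mem Q W ∨ Q = x) → ∀ c, Mem c I →
          (Step step v Q c H ↔ Step step v Q c G) := fun Q hQD hQ c hc =>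
        loc Q hQD c hc H G fun Q' hQ' hb c' hc' => old Q' (below_mem Q hQ Q' hQ' hb) c' hc'
      refine ⟨un W (pr x x), World.un_mem (U := ext B) hW (hB.pr _ hxB _ hxB), H, hH, by simp,
        fun Q hQ => ?_⟩
      have hQ' : Mem Q W ∨ Q = x := by simpa using hQ
      have hQD : Mem Q D := hQ'.elim (fun h => (h2 Q h).1) (fun h => h ▸ hx)
      refine ⟨hQD, fun Q' hQ'' hb => ?_, fun c hc => ?_⟩
      · rw [mem_un]; exact Or.inl (below_mem Q hQ' Q' hQ'' hb)
      · rw [hstep Q hQD hQ' c hc]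
        rcases hQ' with hQ' | rfl
        · rw [old Q hQ' c hc, (h2 Q hQ').2.2 c hc]
        · exact new c hc
  obtain ⟨W, hW, G, hG, h1, h2, -⟩ := exists_glue loc hB hAB hv hD hIB hI hDB claim
  exact ⟨G, hG, fun Q hQ => (h2 Q (h1 Q hQ)).2.2⟩

end Recursion

end SetTh

namespace SetTh

variable {M : Type} [setLang.Structure M] [KPM M]

/-! ### Uniqueness and existence of satisfaction relations -/

theorem below_left (t a b : M) : Below a (op t (op a b)) :=
  Or.inr (Or.inr (Or.inr ⟨pr t (op a b), by simp [op], op a b, by simp, pr a b, by simp [op],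
    by simp⟩))

theorem below_right (t a b : M) : Below b (op t (op a b)) :=
  Or.inr (Or.inr (Or.inr ⟨pr t (op a b), by simp [op], op a b, by simp, pr a b, by simp [op],
    by simp⟩))

/-- Tarski's clauses consult `S` only at components of `e`, under `s` or an extension of `s` by one
element. -/
theorem satC_congr {S S' e s : M} (h : ∀ a, Below a e → ∀ t,
    (t = s ∨ ∃ j v x, Mem (op j v) s ∧ Mem x v ∧ IsSnoc t s x) →
      (Mem (op a t) S ↔ Mem (op a t) S')) : SatC S e s ↔ SatC S' e s := by
  refine or_congr Iff.rfl (or_congr ?_ ?_)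
  · refine exists₂_congr fun a b => and_congr_right ?_
    rintro rfl
    rw [h a (below_left _ _ _) s (Or.inl rfl), h b (below_right _ _ _) s (Or.inl rfl)]
  · refine exists₃_congr fun j a v => and_congr_right ?_
    rintro rfl
    refine and_congr_right fun hv => forall₂_congr fun x hx => exists_congr fun t =>
      and_congr_right fun ht => ?_
    exact h a (below_right _ _ _) t (Or.inr ⟨j, v, x, hv, hx, ht⟩)

theorem IsTr.below {T x y : M} (hT : IsTr T) (hx : Mem x T) (h : Below y x) : Mem y T := by
  rcases h with h | ⟨z, hz, h⟩ | ⟨z, hz, w, hw, h⟩ | ⟨z, hz, w, hw, u, hu, h⟩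
  · exact hT _ hx _ h
  · exact hT _ (hT _ hx _ hz) _ h
  · exact hT _ (hT _ (hT _ hx _ hz) _ hw) _ h
  · exact hT _ (hT _ (hT _ (hT _ hx _ hz) _ hw) _ hu) _ h

theorem SeqIn.of_snoc {s t x v j : M} {T : Set M} (hT : TransC T) (hs : SeqIn s T)
    (hv : Mem (op j v) s) (hx : Mem x v) (ht : IsSnoc t s x) : SeqIn t T := by
  obtain ⟨l, hl, rfl⟩ := ht
  exact hs.ap hl (hT _ (hs.val_mem hv) _ hx)

/-- By induction on the code, satisfaction relations agree on what they have in common, so truth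
does not depend on the witnessing relation. -/
theorem IsSat.unique {T S T' S' : M} (hT : IsTr T) (hT' : IsTr T') (h : IsSat T S)
    (h' : IsSat T' S') : ∀ e, Mem e T → Mem e T' → ∀ s, SeqIn s (ext T) → SeqIn s (ext T') →
      (Mem (op e s) S ↔ Mem (op e s) S') := by
  refine below_induction (p := fun e => Mem e T → Mem e T' → ∀ s, SeqIn s (ext T) →
    SeqIn s (ext T') → (Mem (op e s) S ↔ Mem (op e s) S')) ?_ ?_
  · refine Dfb.mk5 (p := fun T T' S S' e => Mem e T → Mem e T' → ∀ s, SeqIn s (ext T) →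
      SeqIn s (ext T') → (Mem (op e s) S ↔ Mem (op e s) S'))
      (fun _ T T' S S' e => mem e T ⟶ᶠ mem e T' ⟶ᶠ all fun s => isSeqIn s T ⟶ᶠ isSeqIn s T' ⟶ᶠ
        (pairIn S e s ⟷ᶠ pairIn S' e s)) ?_ T T' S S'
    simp
  · intro e ih he he' s hs hs'
    rw [h e he s hs, h' e he' s hs']
    refine satC_congr fun a ha t ht => ?_
    have : SeqIn t (ext T) ∧ SeqIn t (ext T') := by
      rcases ht with rfl | ⟨j, v, x, h1, h2, h3⟩
      · exact ⟨hs, hs'⟩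
      · exact ⟨hs.of_snoc hT.transC h1 h2 h3, hs'.of_snoc hT'.transC h1 h2 h3⟩
    exact ih a ha (hT.below he ha) (hT'.below he' ha) t this.1 this.2

/-- The code `e` is true of `s`. -/
def Tru (e s : M) : Prop := TrueIn Set.univ e s

theorem IsSat.tru_iff {T S e s : M} (h : IsSat T S) (hT : IsTr T) (he : Mem e T)
    (hs : SeqIn s (ext T)) : Mem (op e s) S ↔ Tru e s := by
  constructor
  · intro hm; exact ⟨T, trivial, S, trivial, hT, he, hs, h, hm⟩
  · rintro ⟨T', -, S', -, hT', he', hs', h', hm⟩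
    exact (h.unique hT hT' h' e he he' s hs hs').2 hm

theorem TrueIn.tru {U : Set M} {e s : M} (h : TrueIn U e s) : Tru e s := by
  obtain ⟨T, -, S, -, h⟩ := h
  exact ⟨T, trivial, S, trivial, h⟩

theorem tru_code {n : ℕ} (d : D0 n) (v : Fin n → M) : Tru (d.code M) (seqOf v) ↔ DR d v := by
  obtain ⟨A, S, hx, hA⟩ := exists_adm (op (d.code M) (seqOf v))
  have := hA.world
  have h1 := hA.tr.transC.left_mem hx
  have h2 := hA.tr.transC.right_mem hx
  have h3 := seqIn_of_mem_world (U := ext A) h2 (isSeq_seqOf v)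
  rw [← hA.sat.tru_iff hA.tr h1 h3, hA.sat.code_iff hA.tr d h1]
  intro i
  exact h3.val_mem (op_mem_seqOf.2 rfl)

/-- The Tarski clauses with the quantifiers bounded by `A`. -/
def D0.satStep {m : ℕ} (A e s S : Fin m) : D0 m :=
  .or (relD0 A Empty.elim ![e, s] (SetTh.ex fun i => SetTh.ex fun j => SetTh.ex fun u =>
      SetTh.ex fun v => isMemCode ((0 : Fin 2) : Fin 3).castSucc.castSucc.castSucc i j ⋏
        SetTh.pairIn ((1 : Fin 2) : Fin 3).castSucc.castSucc.castSucc i u ⋏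
        SetTh.pairIn ((1 : Fin 2) : Fin 3).castSucc.castSucc.castSucc j v ⋏ SetTh.mem u v))
  (.or (.exIn A fun a => .exIn A fun b =>
    .and (relD0 (A : Fin (m + 1)).castSucc Empty.elim ![(e : Fin (m + 1)).castSucc, a.castSucc, b]
      (isNandCode (0 : Fin 3) 1 2)) (.neg (.and (.pairIn S a s) (.pairIn S b s))))
    (.exIn A fun j => .exIn A fun a => .exIn A fun v =>
      .and (relD0 (A : Fin (m + 1)).castSucc.castSucc Empty.elim
        ![(e : Fin (m + 1)).castSucc.castSucc, (s : Fin (m + 1)).castSucc.castSucc,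
          j.castSucc.castSucc, a.castSucc, v]
        (isBallCode (0 : Fin 5) 2 3 ⋏ SetTh.pairIn (1 : Fin 5) 2 4))
      (.allIn v fun x => .exIn A fun t =>
        .and (relD0 (A : Fin (m + 1)).castSucc.castSucc.castSucc.castSucc Empty.elim
          ![t, (s : Fin (m + 1)).castSucc.castSucc.castSucc.castSucc, x.castSucc]
          (isSnoc (0 : Fin 3) 1 2)) (.pairIn S a t))))

theorem dr_satStep {m : ℕ} {A e s S : Fin m} {w : Fin m → M} [hA : World (ext (w A))]
    (he : Mem (w e) (w A)) (hs : Mem (w s) (w A)) :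
    DR (.satStep A e s S) w ↔ SatC (w S) (w e) (w s) := by
  have hss : ∀ {i x}, Mem (op i x) (w s) → Mem i (w A) ∧ Mem x (w A) := fun h =>
    ⟨hA.trans.left_mem (hA.trans _ hs _ h), hA.trans.right_mem (hA.trans _ hs _ h)⟩
  simp only [D0.satStep, dr_or, dr_exIn, dr_and, dr_neg, dr_pairIn, dr_allIn, Fin.snoc_castSucc,
    Fin.snoc_last]
  refine or_congr ?_ (or_congr ?_ ?_)
  · rw [dr_rel (M := M) A ![e, s] _ w (fun i => by fin_cases i <;> assumption)]
    simp only [tr_ex, tr_and, tr_isMemCode, tr_pairIn, tr_mem, Fin.snoc_castSucc, Fin.snoc_last,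
      mem_coe]
    constructor
    · rintro ⟨i, j, u, v, h⟩; exact ⟨i, j, u, v, h⟩
    · rintro ⟨i, j, u, v, h1, h2, h3, h4⟩
      exact ⟨⟨i, (hss h2).1⟩, ⟨j, (hss h3).1⟩, ⟨u, (hss h2).2⟩, ⟨v, (hss h3).2⟩, h1, h2, h3, h4⟩
  · have key : ∀ a b, Mem a (w A) → Mem b (w A) → (DR (relD0 (A : Fin (m + 1)).castSucc Empty.elim
        ![(e : Fin (m + 1)).castSucc, (Fin.last m).castSucc, Fin.last (m + 1)]
        (isNandCode (0 : Fin 3) 1 2)) (Fin.snoc (Fin.snoc w a : Fin (m + 1) → M) b) ↔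
        w e = op (one M) (op a b)) := by
      intro a b ha hb
      rw [dr_rel (M := M) _ _ _ _ (fun i => by fin_cases i <;> simp [he, ha, hb])]
      have : World (ext ((Fin.snoc (Fin.snoc w a : Fin (m + 1) → M) b : Fin (m + 2) → M)
        (A : Fin (m + 1)).castSucc)) := by simpa using hA
      rw [tr_isNandCode]
      simp
    constructor
    · rintro ⟨a, ha, b, hb, h1, h2⟩
      exact ⟨a, b, (key a b ha hb).1 h1, h2⟩
    · rintro ⟨a, b, h1, h2⟩
      have h3 := hA.trans.right_mem (h1 ▸ he : op _ _ ∈ ext (w A))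
      have ha := hA.trans.left_mem h3
      have hb := hA.trans.right_mem h3
      exact ⟨a, ha, b, hb, (key a b ha hb).2 h1, h2⟩
  · have key : ∀ j a v, Mem j (w A) → Mem a (w A) → Mem v (w A) →
        (DR (relD0 (A : Fin (m + 1)).castSucc.castSucc Empty.elim
        ![(e : Fin (m + 1)).castSucc.castSucc, (s : Fin (m + 1)).castSucc.castSucc,
          (Fin.last m).castSucc.castSucc, (Fin.last (m + 1)).castSucc, Fin.last (m + 2)]
        (isBallCode (0 : Fin 5) 2 3 ⋏ SetTh.pairIn (1 : Fin 5) 2 4))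
        (Fin.snoc (Fin.snoc (Fin.snoc w j : Fin (m + 1) → M) a : Fin (m + 2) → M) v) ↔
        w e = op (two M) (op j a) ∧ Mem (op j v) (w s)) := by
      intro j a v hj ha hv
      rw [dr_rel (M := M) _ _ _ _ (fun i => by fin_cases i <;> simp [he, hs, ha, hj, hv])]
      have : World (ext ((Fin.snoc (Fin.snoc (Fin.snoc w j : Fin (m + 1) → M) a :
        Fin (m + 2) → M) v : Fin (m + 3) → M)
        (A : Fin (m + 1)).castSucc.castSucc)) := by simpa using hA
      rw [tr_and, tr_isBallCode, tr_pairIn]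
      simp
    have key2 : ∀ j a v x t, Mem x (w A) → Mem t (w A) →
        (DR (relD0 (A : Fin (m + 1)).castSucc.castSucc.castSucc.castSucc Empty.elim
          ![Fin.last (m + 4), (s : Fin (m + 1)).castSucc.castSucc.castSucc.castSucc,
            (Fin.last (m + 3)).castSucc]
          (isSnoc (0 : Fin 3) 1 2)) (Fin.snoc (Fin.snoc (Fin.snoc (Fin.snoc (Fin.snoc w j :
            Fin (m + 1) → M) a : Fin (m + 2) → M) v : Fin (m + 3) → M) x : Fin (m + 4) → M) t) ↔
        IsSnoc t (w s) x) := by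
      intro j a v x t hx ht
      rw [dr_rel (M := M) _ _ _ _ (fun i => by fin_cases i <;> simp [hs, hx, ht])]
      have : World (ext ((Fin.snoc (Fin.snoc (Fin.snoc (Fin.snoc (Fin.snoc w j :
            Fin (m + 1) → M) a : Fin (m + 2) → M) v : Fin (m + 3) → M) x : Fin (m + 4) → M) t :
            Fin (m + 5) → M)
        (A : Fin (m + 1)).castSucc.castSucc.castSucc.castSucc)) := by simpa using hA
      rw [tr_isSnoc]
      simp
    constructor
    · rintro ⟨j, hj, a, ha, v, hv, h1, h2⟩
      obtain ⟨h3, h4⟩ := (key j a v hj ha hv).1 h1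
      refine ⟨j, a, v, h3, h4, fun x hx => ?_⟩
      obtain ⟨t, ht, h5, h6⟩ := h2 x hx
      exact ⟨t, (key2 j a v x t (hA.trans _ hv _ hx) ht).1 h5, h6⟩
    · rintro ⟨j, a, v, h1, h2, h3⟩
      have hj := (hss h2).1
      have hv := (hss h2).2
      have ha := hA.trans.right_mem (hA.trans.right_mem (h1 ▸ he : op _ _ ∈ ext (w A)))
      refine ⟨j, hj, a, ha, v, hv, (key j a v hj ha hv).2 ⟨h1, h2⟩, fun x hx => ?_⟩
      obtain ⟨t, ht, h4⟩ := h3 x hx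
      have hxA := hA.trans _ hv _ hx
      have htA : Mem t (w A) := by
        obtain ⟨l, hl, rfl⟩ := ht
        exact World.ap_mem (U := ext (w A)) hs (World.nat_mem hl.1) hxA
      exact ⟨t, htA, (key2 j a v x t hxA htA).2 ht, h4⟩

/-- Satisfaction relations exist in admissible sets. -/
theorem Adm.exists_isSat {A B SB T : M} (hB : Adm B SB) [hA : World (ext A)] (hAB : Mem A B)
    (hT : IsTr T) (hTA : Mem T A) : ∃ S, Mem S B ∧ IsSat T S := by
  have hTT : ext T ⊆ ext A := fun x hx => hA.trans _ hTA _ hx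
  -- The assignments in `T` are elements of the world `A` and hence form a set `F` in `B`. The
  -- recursion runs over the codes in `T`, with `F` as the index set.
  obtain ⟨F, hF, hFm⟩ := hB.exists_sep (n := 2)
    (relD0 0 Empty.elim ![2, 1] (isSeqIn (0 : Fin 2) 1)) ![A, T]
    (fun i => by fin_cases i; exacts [hAB, hB.tr _ hAB _ hTA]) hAB
  have hFm' : ∀ s, Mem s F ↔ SeqIn s (ext T) := by
    intro s
    rw [hFm]
    have key : ∀ hs : Mem s A, DR (relD0 (0 : Fin 3) Empty.elim ![2, 1] (isSeqIn (0 : Fin 2) 1))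
        (Fin.snoc ![A, T] s) ↔ SeqIn s (ext T) := by
      intro hs
      rw [dr_rel (M := M) _ _ _ _ (fun i => by fin_cases i; exacts [hs, hTA])]
      have : World (ext ((Fin.snoc ![A, T] s : Fin 3 → M) 0)) := hA
      rw [tr_isSeqIn]
      rfl
    constructor
    · rintro ⟨hs, h⟩; exact (key hs).1 h
    · intro h
      have hs : Mem s A := World.seq_mem (U := ext A) (h.mono hTT)
      exact ⟨hs, (key hs).2 h⟩
  have hstep : ∀ e, Mem e T → ∀ s, Mem s F → ∀ S,
      (Step (D0.satStep (0 : Fin 4) 1 2 3) ![A] e s S ↔ SatC S e s) := by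
    intro e he s hs S
    have : World (ext ((Fin.snoc (Fin.snoc (Fin.snoc ![A] e : Fin 2 → M) s : Fin 3 → M) S :
      Fin 4 → M) 0)) := hA
    exact dr_satStep (M := M) (hTT he) (World.seq_mem (U := ext A) (((hFm' s).1 hs).mono hTT))
  obtain ⟨H, hH, h⟩ := exists_recursion (step := D0.satStep (0 : Fin 4) 1 2 3) (v := ![A])
    (D := T) (I := F) (by
      intro e he s hs S S' hSS
      rw [hstep e he s hs, hstep e he s hs]
      refine satC_congr fun a ha t ht => hSS a (hT.below he ha) ha t ((hFm' t).2 ?_)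
      rcases ht with rfl | ⟨j, v, x, h1, h2, h3⟩
      · exact (hFm' _).1 hs
      · exact ((hFm' _).1 hs).of_snoc hT.transC h1 h2 h3) hB hAB
    (fun i => by fin_cases i; exact hAB) hTA hF
    (fun s hs => World.seq_mem (U := ext A) (((hFm' s).1 hs).mono hTT))
  exact ⟨H, hH, fun e he s hs => (h e he s ((hFm' s).2 hs)).trans (hstep e he s ((hFm' s).2 hs) H)⟩

end SetTh

namespace SetTh

variable {M : Type} [setLang.Structure M] [KPM M]

/-! ### The classes of `Πₖ`-predicates, up to equivalence over a class of universes -/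

/-- `U` is a transitive class with `ω ∈ U`. -/
structure UnivC (U : Set M) : Prop where
  trans : TransC U
  om_mem : om M ∈ U

variable (M) in
/-- Predicates of a universe and finitely many of its elements. -/
abbrev UPred (n : ℕ) : Type := Set M → (Fin n → M) → Prop

/-- `p` is equivalent to a `Πₖ`-formula, for all universes in the class `C`. -/
inductive PiP (C : Set M → Prop) : ℕ → ∀ n : ℕ, UPred M n → Prop
  | d0 {n : ℕ} {p : UPred M n} (d : D0 n)
      (h : ∀ U, C U → ∀ v : Fin n → M, (∀ i, v i ∈ U) → (p U v ↔ DR d v)) : PiP C 0 n p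
  | neg {k n : ℕ} {p q : UPred M n} (hq : PiP C k n q)
      (h : ∀ U, C U → ∀ v : Fin n → M, (∀ i, v i ∈ U) → (p U v ↔ ¬ q U v)) : PiP C (k + 1) n p
  | allC {k n : ℕ} {p : UPred M n} {q : UPred M (n + 1)} (hq : PiP C (k + 1) (n + 1) q)
      (h : ∀ U, C U → ∀ v : Fin n → M, (∀ i, v i ∈ U) →
        (p U v ↔ ∀ x ∈ U, q U (Fin.snoc v x))) : PiP C (k + 1) n p

/-- `p` is equivalent to a `Σₖ`-formula, for all universes in the class `C`. -/
def SiP (C : Set M → Prop) (k n : ℕ) (p : UPred M n) : Prop := PiP C k n fun U v => ¬ p U v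

theorem forall_snoc_mem {U : Set M} {n : ℕ} {v : Fin n → M} (hv : ∀ i, v i ∈ U) {x : M}
    (hx : x ∈ U) : ∀ i, (Fin.snoc v x : Fin (n + 1) → M) i ∈ U := by
  intro i
  refine Fin.lastCases ?_ (fun j => ?_) i <;> simp [hx, hv]

section Calculus
variable {C C' : Set M → Prop} {k l n : ℕ} {p q : UPred M n}

theorem PiP.congr (hp : PiP C k n p)
    (h : ∀ U, C U → ∀ v : Fin n → M, (∀ i, v i ∈ U) → (q U v ↔ p U v)) : PiP C k n q := by
  cases hp with
  | d0 d hd => exact .d0 d fun U hU v hv => (h U hU v hv).trans (hd U hU v hv)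
  | neg hp hd => exact .neg hp fun U hU v hv => (h U hU v hv).trans (hd U hU v hv)
  | allC hp hd => exact .allC hp fun U hU v hv => (h U hU v hv).trans (hd U hU v hv)

theorem SiP.congr (hp : SiP C k n p)
    (h : ∀ U, C U → ∀ v : Fin n → M, (∀ i, v i ∈ U) → (q U v ↔ p U v)) : SiP C k n q :=
  PiP.congr hp fun U hU v hv => not_congr (h U hU v hv)

theorem PiP.mono (hp : PiP C k n p) (hC : ∀ U, C' U → C U) : PiP C' k n p := by
  induction hp with
  | d0 d hd => exact .d0 d fun U hU v hv => hd U (hC U hU) v hv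
  | neg hp hd ih => exact .neg ih fun U hU v hv => hd U (hC U hU) v hv
  | allC hp hd ih => exact .allC ih fun U hU v hv => hd U (hC U hU) v hv

theorem PiP.rename (hp : PiP C k n p) {m : ℕ} (f : Fin n → Fin m) :
    PiP C k m fun U v => p U (v ∘ f) := by
  induction hp generalizing m with
  | d0 d hd =>
    refine .d0 (d.rename f) fun U hU v hv => ?_
    rw [dr_rename]
    exact hd U hU (v ∘ f) fun i => hv _
  | neg hp hd ih => exact .neg (ih f) fun U hU v hv => hd U hU (v ∘ f) fun i => hv _
  | allC hp hd ih =>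
    refine .allC (ih (Fin.snoc (α := fun _ => Fin (m + 1)) (Fin.castSucc ∘ f) (Fin.last m)))
      fun U hU v hv => ?_
    rw [hd U hU (v ∘ f) fun i => hv _]
    simp only [snoc_comp_snoc]

theorem SiP.rename (hp : SiP C k n p) {m : ℕ} (f : Fin n → Fin m) :
    SiP C k m fun U v => p U (v ∘ f) := PiP.rename hp f

theorem PiP.succ (hp : PiP C k n p) : PiP C (k + 1) n p := by
  induction hp with
  | d0 d hd =>
    refine .neg (.d0 (p := fun _ v => DR d.neg v) d.neg fun U hU v hv => Iff.rfl) fun U hU v hv => ?_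
    rw [hd U hU v hv, dr_neg, not_not]
  | neg hp hd ih => exact .neg ih hd
  | allC hp hd ih => exact .allC ih hd

theorem PiP.le (hp : PiP C k n p) (h : k ≤ l) : PiP C l n p := by
  induction h with
  | refl => exact hp
  | step _ ih => exact ih.succ

theorem SiP.le (hp : SiP C k n p) (h : k ≤ l) : SiP C l n p := PiP.le hp h

theorem SiP.pi (hp : SiP C k n p) (h : k < l) : PiP C l n p := by
  refine PiP.le (.neg hp fun U hU v hv => ?_) h
  rw [not_not]

theorem PiP.si (hp : PiP C k n p) (h : k < l) : SiP C l n p :=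
  PiP.le (.neg hp fun U hU v hv => Iff.rfl) h

theorem PiP.not (hp : PiP C k n p) : SiP C k n fun U v => ¬ p U v :=
  hp.congr fun U hU v hv => not_not

theorem SiP.not (hp : SiP C k n p) : PiP C k n fun U v => ¬ p U v := hp

/-- Conjunction and disjunction are treated together because negation exchanges them. The outer
quantifiers of `p` are pulled out before those of `q`; moving a vacuous quantifier needs `U` to be
nonempty. -/
theorem PiP.andOr (hC : ∀ U, C U → UnivC U) :
    ∀ {n : ℕ} {p q : UPred M n}, PiP C k n p → PiP C k n q →
      PiP C k n (fun U v => p U v ∧ q U v) ∧ PiP C k n (fun U v => p U v ∨ q U v) := by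
  induction k with
  | zero =>
    intro n p q hp hq
    cases hp with | d0 d hd =>
    cases hq with | d0 d' hd' =>
    exact ⟨.d0 (d.and d') fun U hU v hv => by rw [hd U hU v hv, hd' U hU v hv, dr_and],
      .d0 (d.or d') fun U hU v hv => by rw [hd U hU v hv, hd' U hU v hv, dr_or]⟩
  | succ k ih =>
    have key : ∀ {j n : ℕ} {p q : UPred M n}, PiP C j n p → j = k + 1 → PiP C (k + 1) n q →
      PiP C (k + 1) n (fun U v => p U v ∧ q U v) ∧
      PiP C (k + 1) n (fun U v => p U v ∨ q U v) := by
      intro j n p q hp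
      induction hp with
      | d0 => intro h; omega
      | @neg j n p r hr hd =>
        intro e hq
        obtain rfl : j = k := by omega
        -- The leading block of `p` is exhausted; the same is now done for `q`.
        have key' : ∀ {j' n : ℕ} {q p r : UPred M n}, PiP C j' n q → j' = j + 1 → PiP C j n r →
          (∀ U, C U → ∀ v : Fin n → M, (∀ i, v i ∈ U) → (p U v ↔ ¬ r U v)) →
          PiP C (j + 1) n (fun U v => p U v ∧ q U v) ∧
          PiP C (j + 1) n (fun U v => p U v ∨ q U v) := by
          intro j' n q p r hq
          induction hq with
          | d0 => intro h; omega
          | @neg j' n q s hs hd' =>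
            intro e hr hd
            obtain rfl : j' = j := by omega
            obtain ⟨h1, h2⟩ := ih hr hs
            refine ⟨.neg h2 fun U hU v hv => ?_, .neg h1 fun U hU v hv => ?_⟩
            · rw [hd U hU v hv, hd' U hU v hv]; tauto
            · rw [hd U hU v hv, hd' U hU v hv]; tauto
          | @allC j' n q s hs hd' ih' =>
            intro e hr hd
            obtain ⟨h1, h2⟩ := ih' (p := fun U v => p U (v ∘ Fin.castSucc)) e
              (hr.rename Fin.castSucc) (fun U hU v hv => hd U hU _ fun i => hv _)
            refine ⟨.allC h1 fun U hU v hv => ?_, .allC h2 fun U hU v hv => ?_⟩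
            · simp only [snoc_comp_castSucc]
              rw [hd' U hU v hv]
              exact ⟨fun h x hx => ⟨h.1, h.2 x hx⟩, fun h => ⟨(h _ (hC U hU).om_mem).1,
                fun x hx => (h x hx).2⟩⟩
            · simp only [snoc_comp_castSucc]
              rw [hd' U hU v hv]
              constructor
              · rintro (h | h) x hx
                exacts [Or.inl h, Or.inr (h x hx)]
              · intro h
                by_cases hp : p U v
                · exact Or.inl hp
                · exact Or.inr fun x hx => (h x hx).resolve_left hp
        exact key' hq rfl hr hd
      | @allC j n p r hr hd ih' =>
        intro e hq
        obtain ⟨h1, h2⟩ := ih' e (hq.rename Fin.castSucc)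
        refine ⟨.allC h1 fun U hU v hv => ?_, .allC h2 fun U hU v hv => ?_⟩
        · simp only [snoc_comp_castSucc]
          rw [hd U hU v hv]
          exact ⟨fun h x hx => ⟨h.1 x hx, h.2⟩, fun h => ⟨fun x hx => (h x hx).1,
            (h _ (hC U hU).om_mem).2⟩⟩
        · simp only [snoc_comp_castSucc]
          rw [hd U hU v hv]
          constructor
          · rintro (h | h) x hx
            exacts [Or.inl (h x hx), Or.inr h]
          · intro h
            by_cases hp : q U v
            · exact Or.inr hp
            · exact Or.inl fun x hx => (h x hx).resolve_right hp
    exact fun _ _ _ hp hq => key hp rfl hq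

theorem PiP.and (hC : ∀ U, C U → UnivC U) (hp : PiP C k n p) (hq : PiP C k n q) :
    PiP C k n (fun U v => p U v ∧ q U v) := (PiP.andOr hC hp hq).1

theorem PiP.or (hC : ∀ U, C U → UnivC U) (hp : PiP C k n p) (hq : PiP C k n q) :
    PiP C k n (fun U v => p U v ∨ q U v) := (PiP.andOr hC hp hq).2

theorem SiP.and (hC : ∀ U, C U → UnivC U) (hp : SiP C k n p) (hq : SiP C k n q) :
    SiP C k n (fun U v => p U v ∧ q U v) :=
  (PiP.or hC hp hq).congr fun U hU v hv => by tauto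

theorem SiP.or (hC : ∀ U, C U → UnivC U) (hp : SiP C k n p) (hq : SiP C k n q) :
    SiP C k n (fun U v => p U v ∨ q U v) :=
  (PiP.and hC hp hq).congr fun U hU v hv => by tauto

theorem PiP.imp (hC : ∀ U, C U → UnivC U) (hp : SiP C k n p) (hq : PiP C k n q) :
    PiP C k n (fun U v => p U v → q U v) :=
  (PiP.or hC hp hq).congr fun U hU v hv => by tauto

theorem PiP.all {r : Set M → (Fin n → M) → M → Prop} (hk : 0 < k)
    (h : PiP C k (n + 1) fun U v => r U (Fin.init v) (v (Fin.last n))) :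
    PiP C k n fun U v => ∀ x ∈ U, r U v x := by
  obtain ⟨k, rfl⟩ : ∃ j, k = j + 1 := ⟨k - 1, by omega⟩
  refine .allC h fun U hU v hv => ?_
  simp

theorem SiP.ex {r : Set M → (Fin n → M) → M → Prop} (hk : 0 < k)
    (h : SiP C k (n + 1) fun U v => r U (Fin.init v) (v (Fin.last n))) :
    SiP C k n fun U v => ∃ x ∈ U, r U v x :=
  (PiP.all (r := fun U v x => ¬ r U v x) hk h).congr fun U hU v hv => by simp

/-- A predicate that is `Πₖ` over `C` agrees on `C` with one that is `Πₖ` over all universes. -/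
theorem PiP.exists_extension (hp : PiP C k n p) : ∃ p' : UPred M n,
    PiP UnivC k n p' ∧ ∀ U, C U → ∀ v : Fin n → M, (∀ i, v i ∈ U) → (p U v ↔ p' U v) := by
  induction hp with
  | d0 d hd => exact ⟨fun U v => DR d v, .d0 d fun U hU v hv => Iff.rfl, hd⟩
  | neg hq hd ih =>
    obtain ⟨q', h1, h2⟩ := ih
    exact ⟨_, .neg h1 fun U hU v hv => Iff.rfl, fun U hU v hv => by
      rw [hd U hU v hv, h2 U hU v hv]⟩
  | allC hq hd ih =>
    obtain ⟨q', h1, h2⟩ := ih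
    exact ⟨_, .allC h1 fun U hU v hv => Iff.rfl, fun U hU v hv => by
      rw [hd U hU v hv]
      exact forall₂_congr fun x hx => h2 U hU _ (forall_snoc_mem hv hx)⟩

end Calculus

/-! ### The universal `Πₖ`-formula -/

/-- `t` is a finite sequence of length `m` in `W` that extends `s`. -/
def Ext (W : Set M) (t m s : M) : Prop :=
  IsSeq t m ∧ (∀ j, Mem j m → ∃ x ∈ W, Mem (op j x) t) ∧ ∀ z, Mem z s → Mem z t

mutual
def PiT : ℕ → Set M → M → M → Prop
  | 0, _, e, s => Tru e s
  | k + 1, W, e, s => ∃ m e', e = op m e' ∧ ∀ t, Ext W t m s → SigT k W e' t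
def SigT : ℕ → Set M → M → M → Prop
  | 0, _, e, s => Tru e s
  | k + 1, W, e, s => ∃ m d, e = op m d ∧ ∃ t, Ext W t m s ∧ PiT k W d t
end

/-- `W ⊨ Πᵢ(b)` -/
def UPi (i : ℕ) (W : Set M) (b : M) : Prop := ∃ e c, b = op e c ∧ PiT i W e (seq1 c)

/-- `e` is an element of all worlds. -/
def Std (e : M) : Prop := ∀ W : Set M, World W → e ∈ W

theorem Std.num (k : ℕ) : Std (num M k) := fun _ _ => World.nat_mem (num_mem_om k)

theorem Std.op {x y : M} (hx : Std x) (hy : Std y) : Std (op x y) :=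
  fun W hW => World.op_mem (hx W hW) (hy W hW)

theorem ext_seqOf_self {W : Set M} {n : ℕ} {v : Fin n → M} (hv : ∀ i, v i ∈ W) {t : M} :
    Ext W t (num M n) (seqOf v) ↔ t = seqOf v := by
  constructor
  · rintro ⟨h1, -, h3⟩; exact (h1.eq_of_subset (isSeq_seqOf v) h3).symm
  · rintro rfl
    refine ⟨isSeq_seqOf v, fun j hj => ?_, fun z hz => hz⟩
    obtain ⟨i, hi, rfl⟩ := mem_num.1 hj
    exact ⟨v ⟨i, hi⟩, hv _, (op_mem_seqOf (i := ⟨i, hi⟩)).2 rfl⟩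

/-- Extending an assignment to length `N` amounts to choosing its next value and then extending
further. This is how consecutive quantifiers of the same kind merge into one block. -/
theorem ext_seqOf_iff {W : Set M} {n N : ℕ} (hn : n < N) {v : Fin n → M} {t : M} :
    Ext W t (num M N) (seqOf v) ↔
      ∃ x ∈ W, Ext W t (num M N) (seqOf (Fin.snoc v x : Fin (n + 1) → M)) := by
  constructor
  · rintro ⟨h1, h2, h3⟩
    obtain ⟨x, hx, hm⟩ := h2 _ (num_mem_num hn)
    refine ⟨x, hx, h1, h2, fun z hz => ?_⟩
    rw [seqOf_snoc, mem_ap] at hz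
    rcases hz with hz | rfl
    exacts [h3 z hz, hm]
  · rintro ⟨x, hx, h1, h2, h3⟩
    refine ⟨h1, h2, fun z hz => h3 z ?_⟩
    rw [seqOf_snoc, mem_ap]; exact Or.inl hz

/-- Codes are prenex with alternating blocks, whereas `PiP` is built quantifier by quantifier. The
codes obtained come from actual formulas, so they lie in all worlds. -/
theorem PiP.exists_code {C : Set M → Prop} {k n : ℕ} {p : UPred M n} (hp : PiP C k n p) :
    (∃ e, Std e ∧ ∀ U, C U → ∀ v : Fin n → M, (∀ i, v i ∈ U) → (p U v ↔ PiT k U e (seqOf v))) ∧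
    (∃ e, Std e ∧ ∀ U, C U → ∀ v : Fin n → M, (∀ i, v i ∈ U) →
      (¬ p U v ↔ SigT k U e (seqOf v))) := by
  -- For positive `k` the code of the body and the length `N` of the leading block are kept apart,
  -- so that a further quantifier of the same kind can be absorbed into the block.
  have main : (k = 0 → (∃ e, Std e ∧ ∀ U, C U → ∀ v : Fin n → M, (∀ i, v i ∈ U) →
        (p U v ↔ PiT k U e (seqOf v))) ∧
      (∃ e, Std e ∧ ∀ U, C U → ∀ v : Fin n → M, (∀ i, v i ∈ U) →
        (¬ p U v ↔ SigT k U e (seqOf v)))) ∧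
    ∀ j, k = j + 1 → ∃ N, n ≤ N ∧
      (∃ e, Std e ∧ ∀ U, C U → ∀ v : Fin n → M, (∀ i, v i ∈ U) →
        (p U v ↔ ∀ t, Ext U t (num M N) (seqOf v) → SigT j U e t)) ∧
      (∃ e, Std e ∧ ∀ U, C U → ∀ v : Fin n → M, (∀ i, v i ∈ U) →
        (¬ p U v ↔ ∃ t, Ext U t (num M N) (seqOf v) ∧ PiT j U e t)) := by
    induction hp with
    | d0 d hd =>
      refine ⟨fun _ => ⟨⟨d.code M, fun W hW => World.code_mem d, fun U hU v hv => ?_⟩,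
        ⟨d.neg.code M, fun W hW => World.code_mem _, fun U hU v hv => ?_⟩⟩, fun j h => by omega⟩
      · rw [hd U hU v hv, PiT, tru_code]
      · rw [hd U hU v hv, SigT, tru_code, dr_neg]
    | @neg k n p q hq hd ih =>
      refine ⟨fun h => by omega, fun j h => ?_⟩
      obtain rfl : j = k := by omega
      have key : (∃ e, Std e ∧ ∀ U, C U → ∀ v : Fin n → M, (∀ i, v i ∈ U) →
          (q U v ↔ PiT j U e (seqOf v))) ∧ (∃ e, Std e ∧ ∀ U, C U → ∀ v : Fin n → M,
          (∀ i, v i ∈ U) → (¬ q U v ↔ SigT j U e (seqOf v))) := by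
        cases j with
        | zero => exact ih.1 rfl
        | succ j =>
          obtain ⟨N, hN, ⟨e, he, h1⟩, ⟨e', he', h2⟩⟩ := ih.2 j rfl
          refine ⟨⟨op (num M N) e, (Std.num N).op he, fun U hU v hv => ?_⟩,
            ⟨op (num M N) e', (Std.num N).op he', fun U hU v hv => ?_⟩⟩
          · rw [h1 U hU v hv, PiT]; simp
          · rw [h2 U hU v hv, SigT]; simp
      obtain ⟨⟨e, he, h1⟩, ⟨e', he', h2⟩⟩ := key
      -- A negation opens a new leading block, which is empty for the time being: with `N = n`, the
      -- only extension of the assignment is the assignment itself.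
      refine ⟨n, le_rfl, ⟨e', he', fun U hU v hv => ?_⟩, ⟨e, he, fun U hU v hv => ?_⟩⟩
      · rw [hd U hU v hv, h2 U hU v hv]; simp [ext_seqOf_self hv]
      · rw [hd U hU v hv, not_not, h1 U hU v hv]; simp [ext_seqOf_self hv]
    | allC hq hd ih =>
      refine ⟨fun h => by omega, fun j h => ?_⟩
      obtain ⟨N, hN, ⟨e, he, h1⟩, ⟨e', he', h2⟩⟩ := ih.2 j h
      refine ⟨N, by omega, ⟨e, he, fun U hU v hv => ?_⟩, ⟨e', he', fun U hU v hv => ?_⟩⟩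
      · rw [hd U hU v hv]
        simp only [ext_seqOf_iff (W := U) (t := _) (v := v) hN]
        constructor
        · rintro H t ⟨x, hx, ht⟩
          exact (h1 U hU _ (forall_snoc_mem hv hx)).1 (H x hx) t ht
        · intro H x hx
          exact (h1 U hU _ (forall_snoc_mem hv hx)).2 fun t ht => H t ⟨x, hx, ht⟩
      · rw [hd U hU v hv]
        simp only [ext_seqOf_iff (W := U) (t := _) (v := v) hN]
        push Not
        constructor
        · rintro ⟨x, hx, H⟩
          obtain ⟨t, ht, H⟩ := (h2 U hU _ (forall_snoc_mem hv hx)).1 H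
          exact ⟨t, ⟨x, hx, ht⟩, H⟩
        · rintro ⟨t, ⟨x, hx, ht⟩, H⟩
          exact ⟨x, hx, (h2 U hU _ (forall_snoc_mem hv hx)).2 ⟨t, ht, H⟩⟩
  cases k with
  | zero => exact main.1 rfl
  | succ j =>
    obtain ⟨N, hN, ⟨e, he, h1⟩, ⟨e', he', h2⟩⟩ := main.2 j rfl
    refine ⟨⟨op (num M N) e, (Std.num N).op he, fun U hU v hv => ?_⟩,
      ⟨op (num M N) e', (Std.num N).op he', fun U hU v hv => ?_⟩⟩
    · rw [h1 U hU v hv, PiT]; simp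
    · rw [h2 U hU v hv, SigT]; simp

/-! ### Reflection -/

/-- `U ∈ Mᵢ(X)` -/
def Mahlo (i : ℕ) (U : Set M) (X : M → Prop) : Prop :=
  ∀ b ∈ U, UPi i U b → ∃ Q ∈ U, UnivC (ext Q) ∧ X Q ∧ Mem b Q ∧ UPi i (ext Q) b

/-- The Mahlo property is applied to ⟨e, v 0⟩, where `e` codes `p`. Only ⟨e, v 0⟩ ∈ Q is gained
directly, and transitivity of `Q` gives the parameter. -/
theorem Mahlo.reflect_one {k : ℕ} {U : Set M} {X : M → Prop} (h : Mahlo k U X) [hU : World U]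
    {p : UPred M 1} (hp : PiP UnivC k 1 p) {v : Fin 1 → M} (hv : ∀ i, v i ∈ U) (hpv : p U v) :
    ∃ Q ∈ U, UnivC (ext Q) ∧ X Q ∧ (∀ i, Mem (v i) Q) ∧ p (ext Q) v := by
  obtain ⟨⟨e, he, H⟩, -⟩ := hp.exists_code
  have hs : seqOf v = seq1 (v 0) := rfl
  have hUU : UnivC U := ⟨hU.trans, hU.om_mem⟩
  obtain ⟨Q, hQ, h1, h2, h3, h4⟩ := h (op e (v 0)) (World.op_mem (he U hU) (hv 0))
    ⟨e, v 0, rfl, hs ▸ (H U hUU v hv).1 hpv⟩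
  have hvQ : ∀ i, v i ∈ ext Q := fun i => by
    rw [Fin.fin_one_eq_zero i]; exact h1.trans.right_mem h3
  refine ⟨Q, hQ, h1, h2, hvQ, (H _ h1 v hvQ).2 ?_⟩
  obtain ⟨e', c', e0, h5⟩ := h4
  rw [op_inj] at e0
  rw [hs, e0.1, e0.2]; exact h5

theorem D0.isOp {n : ℕ} (z x y : Fin n) : PiP (M := M) UnivC 0 n fun _ v => v z = op (v x) (v y) :=
  .d0 (.opair z x y) fun U hU v hv => by simp

theorem univC_self : ∀ U : Set M, UnivC U → UnivC U := fun _ h => h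

/-- Several parameters are reduced to one by pairing the last two. -/
theorem Mahlo.reflect_univ {k : ℕ} (hk : 0 < k) {U : Set M} {X : M → Prop} (h : Mahlo k U X)
    [hU : World U] {n : ℕ} {p : UPred M n} (hp : PiP UnivC k n p) {v : Fin n → M}
    (hv : ∀ i, v i ∈ U) (hpv : p U v) :
    ∃ Q ∈ U, UnivC (ext Q) ∧ X Q ∧ (∀ i, Mem (v i) Q) ∧ p (ext Q) v := by
  have main : ∀ {n : ℕ} {p : UPred M (n + 1)}, PiP UnivC k (n + 1) p → ∀ {v : Fin (n + 1) → M},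
      (∀ i, v i ∈ U) → p U v →
      ∃ Q ∈ U, UnivC (ext Q) ∧ X Q ∧ (∀ i, Mem (v i) Q) ∧ p (ext Q) v := by
    intro n
    induction n with
    | zero => exact fun hp v hv hpv => h.reflect_one hp hv hpv
    | succ n ih =>
      intro p hp v hv hpv
      -- The pair is unpacked by universal quantifiers, which keeps the predicate `Πₖ`. They are not
      -- vacuous in `Q`, since a transitive `Q` contains the components of its pairs.
      have hp' : PiP UnivC k (n + 1) fun U w => ∀ x ∈ U, ∀ y ∈ U, w (Fin.last n) = op x y →
          p U (Fin.snoc (Fin.snoc (Fin.init w) x : Fin (n + 1) → M) y) := by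
        refine PiP.all hk (PiP.all hk (PiP.imp univC_self ?_ ?_))
        · exact ((D0.isOp (Fin.last n).castSucc.castSucc (Fin.last (n + 1)).castSucc
            (Fin.last (n + 2))).si zero_lt_one).le hk
        · refine (hp.rename (Fin.snoc (α := fun _ => Fin (n + 3)) (Fin.snoc
            (α := fun _ => Fin (n + 3)) (fun i => i.castSucc.castSucc.castSucc)
            (Fin.last (n + 1)).castSucc) (Fin.last (n + 2)))).congr fun U _ w _ => ?_
          apply iff_of_eq
          congr 1
          funext i
          refine Fin.lastCases ?_ (fun j => ?_) i
          · simp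
          · refine Fin.lastCases ?_ (fun j => ?_) j <;> simp [Fin.init]
      have hinit : Fin.snoc (Fin.snoc (fun i : Fin n => v i.castSucc.castSucc)
          (v (Fin.last n).castSucc) : Fin (n + 1) → M) (v (Fin.last (n + 1))) = v := by
        funext i
        refine Fin.lastCases ?_ (fun j => ?_) i
        · simp
        · refine Fin.lastCases ?_ (fun j => ?_) j <;> simp
      obtain ⟨Q, hQ, h1, h2, h3, h4⟩ := ih hp' (v := Fin.snoc (fun i : Fin n => v i.castSucc.castSucc)
        (op (v (Fin.last n).castSucc) (v (Fin.last (n + 1)))))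
        (forall_snoc_mem (fun i => hv _) (World.op_mem (hv _) (hv _))) (by
          intro x hx y hy e
          rw [Fin.snoc_last, op_inj] at e
          rw [Fin.init_snoc, ← e.1, ← e.2, hinit]
          exact hpv)
      have hop := h3 (Fin.last n)
      rw [Fin.snoc_last] at hop
      have hQ1 := h1.trans.left_mem hop
      have hQ2 := h1.trans.right_mem hop
      refine ⟨Q, hQ, h1, h2, fun i => ?_, ?_⟩
      · refine Fin.lastCases hQ2 (fun j => ?_) i
        refine Fin.lastCases hQ1 (fun j => ?_) j
        have := h3 j.castSucc
        rwa [Fin.snoc_castSucc] at this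
      · have := h4 _ hQ1 _ hQ2 (by rw [Fin.snoc_last])
        rwa [Fin.init_snoc, hinit] at this
  cases n with
  | succ n => exact main hp hv hpv
  | zero =>
    -- Without parameters, ω serves as a dummy.
    obtain ⟨Q, h1, h2, h3, -, h4⟩ := main (n := 0) (hp.rename Fin.elim0)
      (v := fun _ => om M) (fun _ => hU.om_mem) (by convert hpv using 1)
    exact ⟨Q, h1, h2, h3, fun i => i.elim0, by convert h4 using 1⟩

end SetTh

namespace SetTh

variable {M : Type} [setLang.Structure M] [KPM M]

/-! ### Limits of admissible sets -/

/-- `U` is the universe or a transitive set, and a limit of admissible sets. -/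
class Lim (U : Set M) : Prop where
  cls : U = Set.univ ∨ ∃ P, U = ext P
  trans : TransC U
  om_mem : om M ∈ U
  adm : ∀ x ∈ U, ∀ y ∈ U, ∃ A ∈ U, ∃ S ∈ U, Mem x A ∧ Mem y A ∧ Adm A S

instance : Lim (Set.univ : Set M) where
  cls := Or.inl rfl
  trans := transC_univ
  om_mem := trivial
  adm x _ y _ := by
    obtain ⟨A, S, h1, h2⟩ := exists_adm (pr x y)
    exact ⟨A, trivial, S, trivial, h2.tr _ h1 _ (by simp), h2.tr _ h1 _ (by simp), h2⟩

theorem Lim.univC : ∀ U : Set M, Lim U → UnivC U := fun _ h => ⟨h.trans, h.om_mem⟩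

instance Lim.world {U : Set M} [hU : Lim U] : World U where
  cls := hU.cls
  trans := hU.trans
  om_mem := hU.om_mem
  pr_mem x hx y hy := by
    obtain ⟨A, hA, S, -, h1, h2, h⟩ := hU.adm x hx y hy
    exact hU.trans _ hA _ (h.pr _ h1 _ h2)
  sU_mem x hx := by
    obtain ⟨A, hA, S, -, h1, -, h⟩ := hU.adm x hx x hx
    exact hU.trans _ hA _ (h.sU _ h1)

section
variable {U : Set M} [hU : Lim U]

theorem Lim.exists_adm_of_mem {x : M} (hx : x ∈ U) : ∃ A ∈ U, ∃ S ∈ U, Mem x A ∧ Adm A S := by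
  obtain ⟨A, hA, S, hS, h, -, h'⟩ := hU.adm x hx x hx
  exact ⟨A, hA, S, hS, h, h'⟩

theorem Lim.exists_adm_tup {n : ℕ} {v : Fin n → M} (hv : ∀ i, v i ∈ U) :
    ∃ A ∈ U, ∃ S ∈ U, Adm A S ∧ ∀ i, Mem (v i) A := by
  cases n with
  | zero =>
    obtain ⟨A, hA, S, hS, -, h⟩ := Lim.exists_adm_of_mem (U := U) hU.om_mem
    exact ⟨A, hA, S, hS, h, fun i => i.elim0⟩
  | succ n =>
    obtain ⟨A, hA, S, hS, h1, h⟩ := Lim.exists_adm_of_mem (World.tup_mem (U := U) hv)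
    exact ⟨A, hA, S, hS, h, h.tr.transC.of_tup h1⟩

end

/-! ### Predicates that are absolute between worlds are `Δ₁` over limits of admissible sets -/

theorem dr_wAt_iff {m k : ℕ} {K : Fin m} {g : Fin k → Fin m} {φ : Fm k} {w : Fin m → M} {K' : M}
    {u : Fin k → M} (hK : w K = K') (hu : ∀ i, w (g i) = u i) :
    DR (.wAt K g φ) w ↔ World (ext K') ∧ ∃ h : ∀ i, Mem (u i) K',
      Tr φ (fun i => (⟨u i, h i⟩ : ↥(ext K'))) := by
  obtain rfl : u = fun i => w (g i) := funext fun i => (hu i).symm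
  subst hK
  exact dr_wAt

/-- The statement that `K` is a world in which `φ` holds is `Δ₀` in `K`. Hence a predicate is `Σ₁`
as soon as truth of `φ` in a world is sound for it and some world in `U` verifies each true
instance. Most complexity bounds below come from this. -/
theorem SiP.of_world {C : Set M → Prop} {n : ℕ} {R : (Fin n → M) → Prop} (φ : Fm n)
    (sound : ∀ (W : Set M) [World W] (v : Fin n → ↥W), Tr φ v → R (fun i => (v i : M)))
    (complete : ∀ U, C U → ∀ v : Fin n → M, (∀ i, v i ∈ U) → R v →
      ∃ K ∈ U, World (ext K) ∧ ∃ h : ∀ i, Mem (v i) K, Tr φ (fun i => (⟨v i, h i⟩ : ↥(ext K)))) :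
    SiP C 1 n fun _ v => R v := by
  refine SiP.congr (p := fun U v => ∃ K ∈ U, DR (D0.wAt (Fin.last n) Fin.castSucc φ)
    (Fin.snoc v K : Fin (n + 1) → M)) (SiP.ex (r := fun U v K => DR (D0.wAt (Fin.last n)
      Fin.castSucc φ) (Fin.snoc v K : Fin (n + 1) → M)) zero_lt_one
    (PiP.si (k := 0) (.d0 (.wAt (Fin.last n) Fin.castSucc φ) fun U hU v hv => ?_) zero_lt_one)) ?_
  · rw [Fin.snoc_init_self]
  · intro U hU v hv
    simp only [dr_wAt_iff (Fin.snoc_last _ _) (u := v) fun i => Fin.snoc_castSucc _ _ _]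
    constructor
    · exact complete U hU v hv
    · rintro ⟨K, hK, h1, h2, h3⟩
      exact sound (ext K) (fun i => ⟨v i, h2 i⟩) h3

/-- For an absolute formula any admissible set containing the arguments will do as the verifying
world; for the `Π₁` version the same is applied to the negation. -/
theorem SiP.of_abs {n : ℕ} {R : (Fin n → M) → Prop} (φ : Fm n)
    (abs : ∀ (W : Set M) [World W] (v : Fin n → ↥W), Tr φ v ↔ R (fun i => (v i : M))) :
    SiP Lim 1 n fun _ v => R v := by
  refine SiP.of_world φ (fun W _ v => (abs W v).1) fun U hU v hv hR => ?_
  obtain ⟨K, hK, S, hS, h1, h2⟩ := Lim.exists_adm_tup hv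
  have := h1.world
  exact ⟨K, hK, this, h2, (abs (ext K) _).2 hR⟩

theorem PiP.of_abs {n : ℕ} {R : (Fin n → M) → Prop} (φ : Fm n)
    (abs : ∀ (W : Set M) [World W] (v : Fin n → ↥W), Tr φ v ↔ R (fun i => (v i : M))) :
    PiP Lim 1 n fun _ v => R v :=
  PiP.congr (SiP.of_abs (SetTh.neg φ) (R := fun v => ¬ R v) fun W _ v => by rw [tr_neg, abs])
    fun U _ v _ => not_not.symm

/-! ### Reflection to limits of admissible sets -/

/-- Admissibility of `A` refers to a satisfaction relation outside `A`. Evaluating it in a world `K`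
that contains both makes the matrix `Δ₀`, so being a limit of admissible sets has the form ∀∃. -/
theorem pi_limit : PiP (M := M) UnivC 2 0 fun U _ => ∀ x ∈ U, ∀ y ∈ U, ∃ A ∈ U, ∃ K ∈ U,
    (Mem x A ∧ Mem y A) ∧ World (ext K) ∧ Mem A K ∧
      ∃ S, Mem S K ∧ Adm A S := by
  refine PiP.all two_pos (PiP.all two_pos (SiP.pi (k := 1) (SiP.ex one_pos (SiP.ex one_pos
    (PiP.si (k := 0) (.d0 (.and (.and (.mem 0 2) (.mem 1 2)) (.wAt 3 ![2] (isAdm (0 : Fin 1))))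
      fun U hU v hv => ?_) zero_lt_one))) one_lt_two))
  rw [dr_and, dr_and, dr_wAt_iff (K' := v 3) (u := fun _ => v 2) rfl
    (fun i => by rw [Fin.fin_one_eq_zero i]; rfl)]
  refine and_congr Iff.rfl (and_congr_right fun (hw : World (ext (v 3))) => ?_)
  simp only [tr_isAdm]
  exact ⟨fun ⟨h, h'⟩ => ⟨fun _ => h, h'⟩, fun ⟨h, h'⟩ => ⟨h 0, h'⟩⟩

theorem Lim.reflects {U : Set M} [hU : Lim U] : ∀ x ∈ U, ∀ y ∈ U, ∃ A ∈ U, ∃ K ∈ U,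
    (Mem x A ∧ Mem y A) ∧ World (ext K) ∧ Mem A K ∧
      ∃ S, Mem S K ∧ Adm A S := by
  intro x hx y hy
  obtain ⟨A, hA, S, hS, h1, h2, h3⟩ := hU.adm x hx y hy
  obtain ⟨K, hK, SK, hSK, h4, h5, h6⟩ := hU.adm A hA S hS
  have := h6.world
  exact ⟨A, hA, K, hK, ⟨h1, h2⟩, this, h4, S, h5, h3⟩

theorem Lim.of_reflects {Q : M} (hQ : UnivC (ext Q)) (h : ∀ x ∈ ext Q, ∀ y ∈ ext Q, ∃ A ∈ ext Q,
    ∃ K ∈ ext Q, (Mem x A ∧ Mem y A) ∧ World (ext K) ∧ Mem A K ∧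
      ∃ S, Mem S K ∧ Adm A S) : Lim (ext Q) where
  cls := Or.inr ⟨Q, rfl⟩
  trans := hQ.trans
  om_mem := hQ.om_mem
  adm x hx y hy := by
    obtain ⟨A, hA, K, hK, h1, h2, h3, S, hS, h5⟩ := h x hx y hy
    exact ⟨A, hA, S, hQ.trans _ hK _ hS, h1.1, h1.2, h5⟩

/-- Reflection for a class of universes that is itself `Πₖ`. -/
theorem Mahlo.reflect_class {C : Set M → Prop} {c : UPred M 0} {k : ℕ} (hc : PiP UnivC k 0 c)
    (h1 : ∀ U, C U → ∀ v, c U v) (h2 : ∀ Q, UnivC (ext Q) → (∀ v, c (ext Q) v) → C (ext Q))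
    (hk : 0 < k) {U : Set M} {X : M → Prop} (h : Mahlo k U X) [World U] (hU : C U) {n : ℕ}
    {p : UPred M n} (hp : PiP C k n p) {v : Fin n → M} (hv : ∀ i, v i ∈ U) (hpv : p U v) :
    ∃ Q ∈ U, C (ext Q) ∧ X Q ∧ (∀ i, Mem (v i) Q) ∧ p (ext Q) v := by
  -- The set obtained by reflection is at first only known to be transitive with ω as an element, so
  -- the formula has to make sense there before membership in `C` is established. Membership is
  -- reflected along with it.
  obtain ⟨p', h3, h4⟩ := hp.exists_extension
  obtain ⟨Q, hQ, h5, h6, h7, h8, h9⟩ := h.reflect_univ hk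
    ((hc.rename (Fin.elim0 : Fin 0 → Fin n)).and univC_self h3) hv
    ⟨h1 U hU _, (h4 U hU v hv).1 hpv⟩
  have : C (ext Q) := h2 Q h5 fun v' => by rwa [Subsingleton.elim v' (v ∘ Fin.elim0)]
  exact ⟨Q, hQ, this, h6, h7, (h4 _ this v h7).2 h9⟩

/-- Being a limit of admissible sets is `Π₂`, so for `2 ≤ k` it can be reflected together with any
`Πₖ`-predicate. All later reflection arguments have this form. -/
theorem Mahlo.reflect {k : ℕ} (hk : 2 ≤ k) {U : Set M} {X : M → Prop} (h : Mahlo k U X)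
    [hU : Lim U] {n : ℕ} {p : UPred M n} (hp : PiP Lim k n p) {v : Fin n → M}
    (hv : ∀ i, v i ∈ U) (hpv : p U v) :
    ∃ Q ∈ U, Lim (ext Q) ∧ X Q ∧ (∀ i, Mem (v i) Q) ∧ p (ext Q) v :=
  h.reflect_class ((pi_limit (M := M)).le hk) (fun U (hU : Lim U) _ => Lim.reflects)
    (fun Q hQ hc => Lim.of_reflects hQ (hc default)) (by omega) hU hp hv hpv

/-! ### Limits of admissible sets are models of `KPℓ` -/

theorem Dfb.ev {U : Set M} (hU : U = Set.univ ∨ ∃ P, U = ext P) {k : ℕ}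
    (φ : setLang.Formula (Fin (k + 1))) (v : Fin k → M) :
    Dfb fun x : M => x ∈ U → Ev U φ (Fin.cons x v : Fin (k + 1) → M) := by
  rcases hU with rfl | ⟨P, rfl⟩
  · refine ⟨k, relTo .L φ (Fin.cons (α := fun _ => Fin (k + 1)) (Fin.last k) Fin.castSucc),
      fun i => ⟨v i, trivial⟩, fun x => ?_⟩
    rw [tr_relTo transC_univ]
    simp only [Set.mem_univ, true_imp_iff, sem_L]
    apply iff_of_eq
    congr 1
    funext i
    refine Fin.cases ?_ (fun j => ?_) i <;> simp
  · refine ⟨k + 1, mem (Fin.last (k + 1)) (Fin.last k).castSucc ⟶ᶠ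
      relTo (.set (Fin.last k).castSucc) φ (Fin.cons (α := fun _ => Fin (k + 2))
        (Fin.last (k + 1)) fun i => i.castSucc.castSucc),
      Fin.snoc (fun i => ⟨v i, trivial⟩) ⟨P, trivial⟩, fun x => ?_⟩
    rw [tr_imp, tr_relTo transC_univ]
    simp only [tr_mem, mem_coe, sem_set, Fin.snoc_castSucc, Fin.snoc_last, mem_ext]
    refine imp_congr_right fun _ => ?_
    apply iff_of_eq
    congr 1
    funext i
    refine Fin.cases ?_ (fun j => ?_) i <;> simp

/-- `Δ₀`-Separation is available in an admissible element containing the parameters. Foundation is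
inherited from `M`, because truth in `U` is definable there. -/
theorem Lim.models {U : Set M} [hU : Lim U] : ∀ ψ ∈ KPl, Sentence.Realize ↥U ψ := by
  have hT := hU.trans
  rintro ψ ((h | ⟨k, φ, hφ, rfl⟩) | ⟨k, φ, rfl⟩)
  · rw [sentence_iff_tr ψ default]
    rcases h with rfl | rfl | rfl | rfl | rfl
    · simp only [extAx, tr_all, tr_imp, tr_iff, tr_mem, tr_eq, Fin.snoc_castSucc, Fin.snoc_last]
      intro x y h
      refine Subtype.ext (Mem.ext fun z => ?_)
      constructor
      · intro hz; exact mem_coe.1 ((h ⟨z, hT _ x.2 _ hz⟩).1 (mem_coe.2 hz))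
      · intro hz; exact mem_coe.1 ((h ⟨z, hT _ y.2 _ hz⟩).2 (mem_coe.2 hz))
    · simp only [pairAx, tr_all, tr_ex, tr_isPair, Fin.snoc_castSucc, Fin.snoc_last]
      exact fun x y => ⟨⟨_, Lim.world.pr_mem _ x.2 _ y.2⟩, rfl⟩
    · rw [unionAx, tr_all]
      intro x
      rw [tr_ex]
      refine ⟨⟨_, Lim.world.sU_mem _ x.2⟩, ?_⟩
      simpa using (tr_unionEq hT (v := Fin.snoc (Fin.snoc default x : Fin 1 → _)
        (⟨_, Lim.world.sU_mem _ x.2⟩ : ↥U)) (z := 1) (x := 0)).2 rfl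
    · simp only [infAx, tr_ex, tr_isOmega, Fin.snoc_last]
      exact ⟨⟨_, hU.om_mem⟩, rfl⟩
    · simp only [limAx, tr_all, tr_ex, tr_and, tr_mem, tr_isAdm, Fin.snoc_castSucc, Fin.snoc_last,
        mem_coe]
      intro x
      obtain ⟨A, hA, S, hS, h1, h2⟩ := Lim.exists_adm_of_mem x.2
      exact ⟨⟨A, hA⟩, h1, S, hS, h2⟩
  · rw [Sentence.Realize, sepAx, BoundedFormula.realize_alls]
    intro v
    rw [← Tr]
    simp only [tr_all, tr_ex, tr_iff, tr_and, tr_mem, tr_relTo hT, sem_L, Fin.snoc_castSucc,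
      Fin.snoc_last, mem_coe]
    intro a
    obtain ⟨d, hd⟩ := hφ.exists_D0 (M := M) (0 : Fin (k + 1))
      (Fin.cons (α := fun _ => Fin (k + 1)) (Fin.last k) Fin.castSucc) Fin.elim0
    obtain ⟨A, hA, S, hS, h1, h2⟩ := Lim.exists_adm_tup (U := U)
      (v := (Fin.snoc (fun i => (v i : M)) (a : M) : Fin (k + 1) → M))
      (forall_snoc_mem (fun i => (v i).2) a.2)
    obtain ⟨c, hc, hcm⟩ := h1.exists_sep d (fun i => (v i : M))
      (fun i => by simpa using h2 i.castSucc) (a := a) (by simpa using h2 (Fin.last k))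
    refine ⟨⟨c, hT _ hA _ hc⟩, fun x => ?_⟩
    rw [hcm, ← hd U hT _ (forall_snoc_mem (fun i => (v i).2) x.2)]
    refine and_congr_right fun _ => ?_
    unfold Ev
    apply iff_of_eq
    congr 1
    · funext i
      refine Fin.cases ?_ (fun j => ?_) i
      · simp
      · simp only [Function.comp, Fin.cons_succ]
        simp
    · exact Subsingleton.elim _ _
  · rw [sentence_iff_tr _ default, tr_foundAx hT]
    intro v H x
    have e : ∀ x : ↥U, (fun i => ((Fin.cons x v : Fin (k + 1) → ↥U) i : M)) =
        Fin.cons (x : M) (fun i => (v i : M)) := by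
      intro x; funext i; refine Fin.cases ?_ (fun j => ?_) i <;> simp
    rw [e]
    refine mem_induction (Dfb.ev hU.cls φ fun i => (v i : M)) (fun x ih hx => ?_) x x.2
    have := H ⟨x, hx⟩ (fun y hy => by rw [e]; exact ih y (mem_coe.1 hy) y.2)
    rwa [e] at this

/-- This transfers what KPℓ proves about <₁ to the relations <₁^U. -/
theorem Lim.tr_of_models {U : Set M} [hU : Lim U] {ψ : setLang.Sentence} (h : KPl ⊨ᵇ ψ)
    (v : Fin 0 → ↥U) : Tr (ψ : Fm 0) v := by
  have : Nonempty ↥U := ⟨⟨_, hU.om_mem⟩⟩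
  have : ↥U ⊨ KPl := ⟨fun ψ hψ => Lim.models ψ hψ⟩
  rw [← sentence_iff_tr]
  exact h.realize_sentence ↥U

end SetTh

namespace SetTh

variable {M : Type} [setLang.Structure M] [KPM M]

/-! ### Reflecting admissible sets are limits of admissible sets -/

/-- `U` is a limit of worlds, and all its transitive elements have satisfaction relations in `U`. -/
structure SatCl (U : Set M) : Prop where
  univC : UnivC U
  cls : U = Set.univ ∨ ∃ P, U = ext P
  wld : ∀ x ∈ U, ∀ y ∈ U, ∃ K ∈ U, World (ext K) ∧ Mem x K ∧ Mem y K
  sat : ∀ T ∈ U, IsTr T → ∃ S ∈ U, IsSat T S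

theorem World.of_wld {U : Set M} (hU : UnivC U) (cls : U = Set.univ ∨ ∃ P, U = ext P)
    (h : ∀ x ∈ U, ∀ y ∈ U, ∃ K ∈ U, World (ext K) ∧ Mem x K ∧ Mem y K) : World U where
  cls := cls
  trans := hU.trans
  om_mem := hU.om_mem
  pr_mem x hx y hy := by
    obtain ⟨K, hK, hw, h1, h2⟩ := h x hx y hy
    exact hU.trans _ hK _ (hw.pr_mem _ h1 _ h2)
  sU_mem x hx := by
    obtain ⟨K, hK, hw, h1, h2⟩ := h x hx x hx
    exact hU.trans _ hK _ (hw.sU_mem _ h1)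

theorem SatCl.world {U : Set M} (h : SatCl U) : World U := .of_wld h.univC h.cls h.wld

theorem SatCl.exists_sat {U : Set M} (hU : SatCl U) {n : ℕ} {v : Fin (n + 1) → M}
    (hv : ∀ i, v i ∈ U) : ∃ T ∈ U, World (ext T) ∧ (∀ i, Mem (v i) T) ∧ ∃ S ∈ U, IsSat T S ∧
      ∃ K ∈ U, World (ext K) ∧ Mem T K ∧ Mem S K := by
  have := hU.world
  obtain ⟨T, hT, hw, h1, -⟩ := hU.wld _ (World.tup_mem hv) _ (World.tup_mem hv)
  obtain ⟨S, hS, h2⟩ := hU.sat T hT fun x hx y hy => hw.trans x hx y hy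
  obtain ⟨K, hK, hw', h3, h4⟩ := hU.wld T hT S hS
  exact ⟨T, hT, hw, hw.trans.of_tup h1, S, hS, h2, K, hK, hw', h3, h4⟩

/-- The world `K` serves to bound the quantifiers in "is a satisfaction relation", which makes the
whole condition `Π₂`. -/
def satClP : UPred M 0 := fun U _ =>
  (∀ x ∈ U, ∀ y ∈ U, ∃ K ∈ U, World (ext K) ∧ Mem x K ∧ Mem y K) ∧
  ∀ T ∈ U, ∃ S ∈ U, ∃ K ∈ U, World (ext K) ∧ (Mem T K ∧ Mem S K) ∧ (IsTr T → IsSat T S)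

theorem pi_satClP : PiP (M := M) UnivC 2 0 satClP := by
  refine PiP.and univC_self (PiP.all two_pos (PiP.all two_pos (SiP.pi (k := 1) (SiP.ex one_pos
    (PiP.si (k := 0) (.d0 (.and (.world 2) (.and (.mem 0 2) (.mem 1 2))) fun U hU v hv => ?_)
      zero_lt_one)) one_lt_two))) (PiP.all two_pos (SiP.pi (k := 1) (SiP.ex one_pos (SiP.ex one_pos
    (PiP.si (k := 0) (.d0 (.wAt 2 ![0, 1] (isTrans (0 : Fin 2) ⟶ᶠ isSat 0 1)) fun U hU v hv => ?_)
      zero_lt_one))) one_lt_two))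
  · simp only [dr_and, dr_world]; rfl
  · rw [dr_wAt_iff (K' := v 2) (u := ![v 0, v 1]) rfl
      (fun i => by fin_cases i <;> rfl)]
    refine and_congr_right fun (hw : World (ext (v 2))) => ?_
    simp only [tr_imp, tr_isTrans, tr_isSat]
    exact ⟨fun ⟨h, h'⟩ => ⟨fun i => by fin_cases i; exacts [h.1, h.2], h'⟩,
      fun ⟨h, h'⟩ => ⟨⟨h 0, h 1⟩, h'⟩⟩

theorem SatCl.satClP {U : Set M} (h : SatCl U) (v : Fin 0 → M) : satClP U v := by
  refine ⟨h.wld, fun T hT => ?_⟩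
  by_cases hTr : IsTr T
  · obtain ⟨S, hS, h1⟩ := h.sat T hT hTr
    obtain ⟨K, hK, h2, h3, h4⟩ := h.wld T hT S hS
    exact ⟨S, hS, K, hK, h2, ⟨h3, h4⟩, fun _ => h1⟩
  · obtain ⟨K, hK, h2, h3, h4⟩ := h.wld T hT T hT
    exact ⟨T, hT, K, hK, h2, ⟨h3, h3⟩, fun h => (hTr h).elim⟩

theorem SatCl.of_satClP {Q : M} (hQ : UnivC (ext Q)) (h : ∀ v, SetTh.satClP (ext Q) v) :
    SatCl (ext Q) where
  univC := hQ
  cls := Or.inr ⟨Q, rfl⟩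
  wld := (h default).1
  sat T hT hTr := by
    obtain ⟨S, hS, K, hK, -, -, h1⟩ := (h default).2 T hT
    exact ⟨S, hS, h1 hTr⟩

/-- `c` consists of the `x ∈ a` of which `e` is true. -/
def SepT (e p a c : M) : Prop := ∀ x, Mem x c ↔ Mem x a ∧ Tru e (seq2 p x)

/-- `c` contains a witness for every `x ∈ a`. -/
def CollT (e p a c : M) : Prop := ∀ x, Mem x a → ∃ z, Mem z c ∧ Tru e (seq3 p x z)

section Formulas
variable {n : ℕ}

/-- `S` is a satisfaction relation for a transitive set `T` with the elements `e`, `p`, `a`. -/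
def satOn (T S e p a : Fin n) : Fm n := isTrans T ⋏ mem e T ⋏ mem p T ⋏ mem a T ⋏ isSat T S

def sepFm (e p a c : Fin n) : Fm n := ex fun T => ex fun S => satOn T S e p a ⋏
  all fun x => mem x c ⟷ᶠ (mem x a ⋏ ex fun s => isSeq2 s p x ⋏ pairIn S e s)

def truFm (e p x z : Fin n) : Fm n := ex fun T => ex fun S => satOn T S e p x ⋏
  mem z T ⋏ ex fun s => isSeq3 s p x z ⋏ pairIn S e s

def collFm (e p a c : Fin n) : Fm n := ex fun T => ex fun S => satOn T S e p a ⋏ mem c T ⋏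
  allIn a fun x => exIn c fun z => ex fun s => isSeq3 s p x z ⋏ pairIn S e s

variable {W : Set M} [hW : World W] {v : Fin n → ↥W}

theorem exists_coe_eq {y : M} (hy : y ∈ W) {r : M → Prop} :
    (∃ x : ↥W, (x : M) = y ∧ r x) ↔ r y :=
  ⟨fun ⟨x, h, h'⟩ => h ▸ h', fun h => ⟨⟨y, hy⟩, rfl, h⟩⟩

theorem tr_sepFm {e p a c : Fin n} : Tr (sepFm e p a c) v ↔ ∃ T ∈ W, ∃ S ∈ W, IsTr T ∧
    Mem (v e : M) T ∧ Mem (v p : M) T ∧ Mem (v a : M) T ∧ IsSat T S ∧ SepT (v e : M) (v p) (v a) (v c) := by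
  simp only [sepFm, satOn, tr_ex, tr_and, tr_all, tr_iff, tr_isTrans, tr_mem, tr_isSat, tr_isSeq2,
    tr_pairIn, Fin.snoc_castSucc, Fin.snoc_last, mem_coe]
  have e1 : ∀ S x : ↥W, (∃ s : ↥W, (s : M) = seq2 (v p : M) x ∧ Mem (op (v e : M) s) S) ↔
      Mem (op (v e : M) (seq2 (v p : M) x)) S := fun S x =>
    exists_coe_eq (World.seq2_mem (v p).2 x.2) (r := fun s => Mem (op (v e : M) s) S)
  simp only [e1]
  have key : ∀ T S : ↥W, (IsTr (T : M) ∧ Mem (v e : M) T ∧ Mem (v p : M) T ∧ Mem (v a : M) T ∧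
      IsSat (T : M) S) → ((∀ x : ↥W, Mem (x : M) (v c) ↔ Mem (x : M) (v a) ∧
        Mem (op (v e : M) (seq2 (v p : M) x)) S) ↔ SepT (v e : M) (v p) (v a) (v c)) := by
    rintro T S ⟨h1, h2, h3, h4, h5⟩
    rw [forall_iff_coe hW.trans (v c).2 (p := fun x => Mem x (v a : M) ∧
        Mem (op (v e : M) (seq2 (v p : M) x)) S) (fun x hx => hW.trans _ (v a).2 _ hx.1)]
    refine forall_congr' fun x => iff_congr Iff.rfl (and_congr_right fun hx => ?_)
    exact h5.tru_iff h1 h2 (seqIn_seq2 h3 (h1 _ h4 _ hx))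
  constructor
  · rintro ⟨T, S, h, h'⟩
    exact ⟨T, T.2, S, S.2, h.1, h.2.1, h.2.2.1, h.2.2.2.1, h.2.2.2.2, (key T S h).1 h'⟩
  · rintro ⟨T, hT, S, hS, h1, h2, h3, h4, h5, h6⟩
    exact ⟨⟨T, hT⟩, ⟨S, hS⟩, ⟨h1, h2, h3, h4, h5⟩,
      (key ⟨T, hT⟩ ⟨S, hS⟩ ⟨h1, h2, h3, h4, h5⟩).2 h6⟩

theorem tr_truFm {e p x z : Fin n} : Tr (truFm e p x z) v ↔ ∃ T ∈ W, ∃ S ∈ W, IsTr T ∧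
    Mem (v e : M) T ∧ Mem (v p : M) T ∧ Mem (v x : M) T ∧ IsSat T S ∧ Mem (v z : M) T ∧
      Tru (v e : M) (seq3 (v p) (v x) (v z)) := by
  simp only [truFm, satOn, tr_ex, tr_and, tr_all, tr_iff, tr_isTrans, tr_mem, tr_isSat, tr_isSeq3,
    tr_pairIn, Fin.snoc_castSucc, Fin.snoc_last, mem_coe]
  have e1 : ∀ S : ↥W, (∃ s : ↥W, (s : M) = seq3 (v p : M) (v x) (v z) ∧ Mem (op (v e : M) s) S) ↔
      Mem (op (v e : M) (seq3 (v p : M) (v x) (v z))) S := fun S =>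
    exists_coe_eq (World.seq3_mem (v p).2 (v x).2 (v z).2) (r := fun s => Mem (op (v e : M) s) S)
  simp only [e1]
  constructor
  · rintro ⟨T, S, ⟨h1, h2, h3, h4, h5⟩, h6, h7⟩
    exact ⟨T, T.2, S, S.2, h1, h2, h3, h4, h5, h6, (h5.tru_iff h1 h2 (seqIn_seq3 h3 h4 h6)).1 h7⟩
  · rintro ⟨T, hT, S, hS, h1, h2, h3, h4, h5, h6, h7⟩
    exact ⟨⟨T, hT⟩, ⟨S, hS⟩, ⟨h1, h2, h3, h4, h5⟩, h6,
      (h5.tru_iff h1 h2 (seqIn_seq3 h3 h4 h6)).2 h7⟩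

theorem tr_collFm {e p a c : Fin n} : Tr (collFm e p a c) v ↔ ∃ T ∈ W, ∃ S ∈ W, IsTr T ∧
    Mem (v e : M) T ∧ Mem (v p : M) T ∧ Mem (v a : M) T ∧ IsSat T S ∧ Mem (v c : M) T ∧
      CollT (v e : M) (v p) (v a) (v c) := by
  simp only [collFm, satOn, tr_ex, tr_and, tr_allIn, tr_exIn, tr_isTrans, tr_mem, tr_isSat,
    tr_isSeq3, tr_pairIn, Fin.snoc_castSucc, Fin.snoc_last, mem_coe]
  have e1 : ∀ S x z : ↥W, (∃ s : ↥W, (s : M) = seq3 (v p : M) x z ∧ Mem (op (v e : M) s) S) ↔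
      Mem (op (v e : M) (seq3 (v p : M) x z)) S := fun S x z =>
    exists_coe_eq (World.seq3_mem (v p).2 x.2 z.2) (r := fun s => Mem (op (v e : M) s) S)
  simp only [e1]
  have e2 : ∀ S x : ↥W, (∃ z : ↥W, Mem (z : M) (v c) ∧ Mem (op (v e : M) (seq3 (v p : M) x z)) S) ↔
      ∃ z, Mem z (v c : M) ∧ Mem (op (v e : M) (seq3 (v p : M) x z)) S := fun S x =>
    exists_mem_coe hW.trans (v c).2 (p := fun z => Mem (op (v e : M) (seq3 (v p : M) x z)) S)
  simp only [e2]
  have key : ∀ T S : ↥W, (IsTr (T : M) ∧ Mem (v e : M) T ∧ Mem (v p : M) T ∧ Mem (v a : M) T ∧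
      IsSat (T : M) S) → Mem (v c : M) T → ((∀ x : ↥W, Mem (x : M) (v a) → ∃ z, Mem z (v c : M) ∧
        Mem (op (v e : M) (seq3 (v p : M) x z)) S) ↔ CollT (v e : M) (v p) (v a) (v c)) := by
    rintro T S ⟨h1, h2, h3, h4, h5⟩ h6
    rw [forall_mem_coe hW.trans (v a).2 (p := fun x => ∃ z, Mem z (v c : M) ∧
        Mem (op (v e : M) (seq3 (v p : M) x z)) S)]
    refine forall₂_congr fun x hx => exists_congr fun z => and_congr_right fun hz => ?_
    exact h5.tru_iff h1 h2 (seqIn_seq3 h3 (h1 _ h4 _ hx) (h1 _ h6 _ hz))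
  constructor
  · rintro ⟨T, S, h, h6, h'⟩
    exact ⟨T, T.2, S, S.2, h.1, h.2.1, h.2.2.1, h.2.2.2.1, h.2.2.2.2, h6, (key T S h h6).1 h'⟩
  · rintro ⟨T, hT, S, hS, h1, h2, h3, h4, h5, h6, h7⟩
    exact ⟨⟨T, hT⟩, ⟨S, hS⟩, ⟨h1, h2, h3, h4, h5⟩, h6,
      (key ⟨T, hT⟩ ⟨S, hS⟩ ⟨h1, h2, h3, h4, h5⟩ h6).2 h7⟩

end Formulas

theorem si_sepT : SiP (M := M) SatCl 1 4 fun _ v => SepT (v 0) (v 1) (v 2) (v 3) := by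
  refine SiP.of_world (R := fun v => SepT (v 0) (v 1) (v 2) (v 3)) (sepFm 0 1 2 3) ?_ ?_
  · intro W _ v h
    obtain ⟨T, hT, S, hS, -, -, -, -, -, h⟩ := tr_sepFm.1 h
    exact h
  · intro U hU v hv h
    obtain ⟨T, hT, hw, h1, S, hS, h2, K, hK, hwK, h3, h4⟩ := hU.exists_sat hv
    exact ⟨K, hK, hwK, fun i => hwK.trans _ h3 _ (h1 i), tr_sepFm.2 ⟨T, h3, S, h4,
      fun x hx y hy => hw.trans x hx y hy, h1 0, h1 1, h1 2, h2, h⟩⟩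

theorem si_truT : SiP (M := M) SatCl 1 4 fun _ v => Tru (v 0) (seq3 (v 1) (v 2) (v 3)) := by
  refine SiP.of_world (R := fun v => Tru (v 0) (seq3 (v 1) (v 2) (v 3))) (truFm 0 1 2 3) ?_ ?_
  · intro W _ v h
    obtain ⟨T, hT, S, hS, -, -, -, -, -, -, h⟩ := tr_truFm.1 h
    exact h
  · intro U hU v hv h
    obtain ⟨T, hT, hw, h1, S, hS, h2, K, hK, hwK, h3, h4⟩ := hU.exists_sat hv
    exact ⟨K, hK, hwK, fun i => hwK.trans _ h3 _ (h1 i), tr_truFm.2 ⟨T, h3, S, h4,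
      fun x hx y hy => hw.trans x hx y hy, h1 0, h1 1, h1 2, h2, h1 3, h⟩⟩

theorem si_collT : SiP (M := M) SatCl 1 4 fun _ v => CollT (v 0) (v 1) (v 2) (v 3) := by
  refine SiP.of_world (R := fun v => CollT (v 0) (v 1) (v 2) (v 3)) (collFm 0 1 2 3) ?_ ?_
  · intro W _ v h
    obtain ⟨T, hT, S, hS, -, -, -, -, -, -, h⟩ := tr_collFm.1 h
    exact h
  · intro U hU v hv h
    obtain ⟨T, hT, hw, h1, S, hS, h2, K, hK, hwK, h3, h4⟩ := hU.exists_sat hv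
    exact ⟨K, hK, hwK, fun i => hwK.trans _ h3 _ (h1 i), tr_collFm.2 ⟨T, h3, S, h4,
      fun x hx y hy => hw.trans x hx y hy, h1 0, h1 1, h1 2, h2, h1 3, h⟩⟩

/-- Separation and collection for the codes in `U`. -/
def admP : UPred M 1 := fun U _ =>
  (∀ e ∈ U, ∀ p ∈ U, ∀ a ∈ U, ∃ c ∈ U, SepT e p a c) ∧
  ∀ e ∈ U, ∀ p ∈ U, ∀ a ∈ U, (∀ x ∈ U, Mem x a → ∃ z ∈ U, Tru e (seq3 p x z)) →
    ∃ c ∈ U, CollT e p a c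

/-- Over `SatCl`, the leaves `SepT`, `Tru` and `CollT` are `Σ₁`, being witnessed by a satisfaction
relation in `U`. Separation is then `Π₂`, while the premise of Collection is `Π₂`, which makes
Collection `Π₃`. This is why three quantifier blocks of reflection are needed to produce admissible
sets. -/
theorem pi_admP : PiP (M := M) SatCl 3 1 admP := by
  have hC : ∀ U : Set M, SatCl U → UnivC U := fun U h => h.univC
  refine PiP.and hC ?_ ?_
  · refine PiP.all three_pos (PiP.all three_pos (PiP.all three_pos (SiP.pi (k := 1) ?_
      (by omega))))
    exact SiP.ex one_pos (si_sepT.rename (![1, 2, 3, 4] : Fin 4 → Fin 5))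
  · refine PiP.all three_pos (PiP.all three_pos (PiP.all three_pos (PiP.imp hC
      (PiP.si (k := 2) (PiP.all two_pos (PiP.imp hC ?_ (SiP.pi (k := 1) (SiP.ex one_pos ?_)
        one_lt_two))) (by omega)) (SiP.pi (k := 1) (SiP.ex one_pos ?_) (by omega)))))
    · exact PiP.si (k := 0) (.d0 (.mem 4 3) fun U hU v hv => Iff.rfl) two_pos
    · exact si_truT.rename (![1, 2, 4, 5] : Fin 4 → Fin 6)
    · exact si_collT.rename (![1, 2, 3, 4] : Fin 4 → Fin 5)

theorem Adm.admP {P S : M} (h : Adm P S) (v : Fin 1 → M) : admP (ext P) v := by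
  constructor
  · intro e he p hp a ha
    obtain ⟨c, hc, h1⟩ := h.sep e he p hp a ha
    refine ⟨c, hc, fun x => (h1 x).trans (and_congr_right fun hx => ?_)⟩
    exact h.sat.tru_iff h.tr he (seqIn_seq2 hp (h.tr _ ha _ hx))
  · intro e he p hp a ha H
    obtain ⟨c, hc, h1⟩ := h.coll e he p hp a ha (fun x hx => by
      have hxP := h.tr _ ha _ hx
      obtain ⟨z, hz, h2⟩ := H x hxP hx
      exact ⟨z, hz, (h.sat.tru_iff h.tr he (seqIn_seq3 hp hxP hz)).2 h2⟩)
    refine ⟨c, hc, fun x hx => ?_⟩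
    obtain ⟨z, hz, h2⟩ := h1 x hx
    exact ⟨z, hz, (h.sat.tru_iff h.tr he (seqIn_seq3 hp (h.tr _ ha _ hx) (h.tr _ hc _ hz))).1 h2⟩

theorem Adm.of_admP {V S : M} (hV : SatCl (ext V)) (hS : IsSat V S) {v : Fin 1 → M}
    (h : SetTh.admP (ext V) v) : Adm V S := by
  have hw := hV.world
  have hT : IsTr V := fun x hx y hy => hw.trans x hx y hy
  refine ⟨hT, hw.om_mem, hw.pr_mem, hw.sU_mem, hS, ?_, ?_⟩
  · intro e he p hp a ha
    obtain ⟨c, hc, h1⟩ := h.1 e he p hp a ha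
    refine ⟨c, hc, fun x => (h1 x).trans (and_congr_right fun hx => ?_)⟩
    exact (hS.tru_iff hT he (seqIn_seq2 hp (hT _ ha _ hx))).symm
  · intro e he p hp a ha H
    obtain ⟨c, hc, h1⟩ := h.2 e he p hp a ha (fun x hxV hx => by
      obtain ⟨z, hz, h2⟩ := H x hx
      exact ⟨z, hz, (hS.tru_iff hT he (seqIn_seq3 hp hxV hz)).1 h2⟩)
    refine ⟨c, hc, fun x hx => ?_⟩
    obtain ⟨z, hz, h2⟩ := h1 x hx
    exact ⟨z, hz, (hS.tru_iff hT he (seqIn_seq3 hp (hT _ ha _ hx) (hT _ hc _ hz))).2 h2⟩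

/-- `z = ⋃ x` -/
def D0.unionEq {n : ℕ} (z x : Fin n) : D0 n :=
  .and (.allIn z fun u => .exIn x fun w => .mem u w) (.allIn x fun w => .allIn w fun u => .mem u z)

theorem dr_unionEq {n : ℕ} {z x : Fin n} {v : Fin n → M} :
    DR (.unionEq z x) v ↔ v z = sU (v x) := by
  simp only [D0.unionEq, dr_and, dr_allIn, dr_exIn, dr_mem, Fin.snoc_castSucc, Fin.snoc_last]
  constructor
  · rintro ⟨h1, h2⟩
    exact Mem.ext fun u => ⟨fun hu => mem_sU.2 (h1 u hu), fun hu => by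
      obtain ⟨w, hw, hu⟩ := mem_sU.1 hu
      exact h2 w hw u hu⟩
  · intro h; simp only [h, mem_sU]
    exact ⟨fun u hu => hu, fun w hw u hu => ⟨w, hw, hu⟩⟩

theorem pi_closed : PiP (M := M) UnivC 2 1 fun U _ =>
    (∀ x ∈ U, ∀ y ∈ U, ∃ z ∈ U, z = pr x y) ∧ ∀ x ∈ U, ∃ z ∈ U, z = sU x := by
  refine PiP.and univC_self (PiP.all two_pos (PiP.all two_pos (SiP.pi (k := 1) (SiP.ex one_pos
    (PiP.si (k := 0) (.d0 (.pair 3 1 2) fun U hU v hv => ?_) one_pos)) one_lt_two)))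
    (PiP.all two_pos (SiP.pi (k := 1) (SiP.ex one_pos
    (PiP.si (k := 0) (.d0 (.unionEq 2 1) fun U hU v hv => ?_) one_pos)) one_lt_two))
  · rw [dr_pair]; rfl
  · rw [dr_unionEq]; rfl

/-- Reflecting admissible sets are limits of admissible sets. -/
theorem Adm.lim {P S : M} (hP : Adm P S) {k : ℕ} (hk : 3 ≤ k) {X : M → Prop}
    (h : Mahlo k (ext P) X) : Lim (ext P) := by
  have hw := hP.world
  have hu : UnivC (ext P) := ⟨hw.trans, hw.om_mem⟩
  -- Closure under pairing and union is `Π₂`; reflecting it with the parameter {x, y} yields worlds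
  -- inside `P`.
  have wld : ∀ x ∈ ext P, ∀ y ∈ ext P, ∃ K ∈ ext P, World (ext K) ∧ Mem x K ∧ Mem y K := by
    intro x hx y hy
    obtain ⟨Q, hQ, h1, -, h2, h3, h4⟩ := h.reflect_univ (by omega)
      ((pi_closed (M := M)).le (by omega)) (v := ![SetTh.pr x y])
      (fun i => by fin_cases i; exact hP.pr _ hx _ hy)
      ⟨fun x hx y hy => ⟨_, hP.pr _ hx _ hy, rfl⟩, fun x hx => ⟨_, hP.sU _ hx, rfl⟩⟩
    refine ⟨Q, hQ, ⟨Or.inr ⟨Q, rfl⟩, h1.trans, fun x hx y hy => ?_, fun x hx => ?_, h1.om_mem⟩,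
      h1.trans _ (h2 0) _ (by simp), h1.trans _ (h2 0) _ (by simp)⟩
    · obtain ⟨z, hz, rfl⟩ := h3 x hx y hy; exact hz
    · obtain ⟨z, hz, rfl⟩ := h4 x hx; exact hz
  -- A transitive `T ∈ P` lies in a world `A ∈ P`, and the recursion that builds its satisfaction
  -- relation can be carried out in the admissible set `P`.
  have hsc : SatCl (ext P) := ⟨hu, Or.inr ⟨P, rfl⟩, wld, fun T hT hTr => by
    obtain ⟨A, hA, hwA, h1, -⟩ := wld T hT T hT
    exact hP.exists_isSat hA hTr h1⟩
  refine ⟨Or.inr ⟨P, rfl⟩, hw.trans, hw.om_mem, fun x hx y hy => ?_⟩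
  -- Separation and Collection are `Π₃` over `SatCl`. They reflect to an element `V`, whose
  -- satisfaction relation is found in `P`.
  obtain ⟨V, hV, h1, -, h2, h3⟩ := h.reflect_class ((pi_satClP (M := M)).le (by omega))
    (fun U hU v => hU.satClP v) (fun Q hQ hc => SatCl.of_satClP hQ hc) (by omega) hsc
    (pi_admP.le hk) (v := ![SetTh.pr x y]) (fun i => by fin_cases i; exact hP.pr _ hx _ hy) (hP.admP _)
  have hVT : IsTr V := fun x hx y hy => h1.univC.trans x hx y hy
  obtain ⟨SV, hSV, h4⟩ := hsc.sat V hV hVT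
  exact ⟨V, hV, SV, hSV, hVT _ (h2 0) _ (by simp), hVT _ (h2 0) _ (by simp), .of_admP h1 h4 h3⟩

end SetTh

namespace SetTh

variable {M : Type} [setLang.Structure M] [KPM M]

/-! ### The universal formula over limits of admissible sets -/

/-- An admissible set containing the code and the assignment comes with a satisfaction relation; a
world `K` containing both verifies truth. -/
theorem si_tru : SiP (M := M) Lim 1 2 fun _ v => Tru (v 0) (v 1) := by
  refine SiP.of_world (R := fun v => Tru (v 0) (v 1)) (isTrue 0 1) ?_ ?_
  · intro W _ v h; exact (tr_isTrue.1 h).tru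
  · intro U hU v hv h
    obtain ⟨A, hA, S, hS, h1, h2⟩ := Lim.exists_adm_tup hv
    obtain ⟨K, hK, SK, hSK, h3, h4, h5⟩ := hU.adm A hA S hS
    have hwA := h1.world
    have hwK := h5.world
    refine ⟨K, hK, hwK, fun i => h5.tr _ h3 _ (h2 i), tr_isTrue.2 ?_⟩
    obtain ⟨T, -, S', -, -, -, ⟨l, hl, -⟩, -⟩ := id h
    have h6 := seqIn_of_mem_world (U := ext A) (h2 1) hl
    exact ⟨A, h3, S, h4, h1.tr, h2 0, h6, h1.sat, (h1.sat.tru_iff h1.tr (h2 0) h6).2 h⟩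

def isFalse {n : ℕ} (e s : Fin n) : Fm n :=
  (ex fun l => isSeq s l) ⟶ᶠ
  ex fun T => ex fun S => isTrans T ⋏ mem e T ⋏ isSeqIn s T ⋏ isSat T S ⋏ neg (pairIn S e s)

/-- Falsity is witnessed by a satisfaction relation as well. If `s` is not a finite sequence,
nothing is true of it and no witness exists, whence the premise in `isFalse`. -/
theorem pi_tru : PiP (M := M) Lim 1 2 fun _ v => Tru (v 0) (v 1) := by
  refine PiP.congr (p := fun _ v => ¬ ¬ Tru (v 0) (v 1)) ?_ fun U _ v _ => not_not.symm
  refine SiP.of_world (R := fun v => ¬ Tru (v 0) (v 1)) (isFalse 0 1) ?_ ?_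
  · intro W _ v h ht
    obtain ⟨T', -, S', -, -, -, ⟨l, hl, -⟩, -⟩ := id ht
    simp only [isFalse, tr_imp, tr_ex, tr_and, tr_neg, tr_isSeq, tr_isTrans, tr_mem, tr_isSeqIn,
      tr_isSat, tr_pairIn, Fin.snoc_castSucc, Fin.snoc_last, mem_coe] at h
    obtain ⟨T, S, h1, h2, h3, h4, h5⟩ := h ⟨⟨l, World.nat_mem hl.1⟩, hl⟩
    exact h5 ((h4.tru_iff h1 h2 h3).2 ht)
  · intro U hU v hv h
    obtain ⟨A, hA, S, hS, h1, h2⟩ := Lim.exists_adm_tup hv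
    obtain ⟨K, hK, SK, hSK, h3, h4, h5⟩ := hU.adm A hA S hS
    have hwA := h1.world
    have hwK := h5.world
    refine ⟨K, hK, hwK, fun i => h5.tr _ h3 _ (h2 i), ?_⟩
    simp only [isFalse, tr_imp, tr_ex, tr_and, tr_neg, tr_isSeq, tr_isTrans, tr_mem, tr_isSeqIn,
      tr_isSat, tr_pairIn, Fin.snoc_castSucc, Fin.snoc_last, mem_coe]
    rintro ⟨l, hl⟩
    have h6 := seqIn_of_mem_world (U := ext A) (h2 1) hl
    exact ⟨⟨A, h3⟩, ⟨S, h4⟩, h1.tr, h2 0, h6, h1.sat, fun hm =>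
      h ((h1.sat.tru_iff h1.tr (h2 0) h6).1 hm)⟩

theorem Ext.seqIn {W : Set M} {t m s : M} (h : Ext W t m s) : SeqIn t W := ⟨m, h.1, h.2.1⟩

theorem ext_iff {U : Set M} [hU : World U] {t m s : M} (ht : t ∈ U) :
    Ext U t m s ↔ IsSeq t m ∧ ∀ z, Mem z s → Mem z t := by
  refine ⟨fun h => ⟨h.1, h.2.2⟩, fun h => ⟨h.1, fun j hj => ?_, h.2⟩⟩
  obtain ⟨x, hx⟩ := h.1.exists_val hj
  exact ⟨x, (seqIn_of_mem_world ht h.1).val_mem hx, hx⟩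

section Leaves

theorem si_op : SiP (M := M) Lim 1 3 fun _ v => v 0 = op (v 1) (v 2) :=
  (PiP.d0 (.opair 0 1 2) fun U hU v hv => dr_opair.symm).si one_pos

theorem pi_isOp : PiP (M := M) Lim 1 1 fun _ v => ∃ x y, v 0 = op x y := by
  refine PiP.of_abs (R := fun v => ∃ x y, v 0 = op x y)
    (ex fun x => ex fun y => isOPair ((0 : Fin 1) : Fin 2).castSucc x y) fun W hW v => ?_
  simp only [tr_ex, tr_isOPair, Fin.snoc_castSucc, Fin.snoc_last]
  constructor
  · rintro ⟨x, y, h⟩; exact ⟨x, y, h⟩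
  · rintro ⟨x, y, h⟩
    have := (v 0).2
    rw [h] at this
    exact ⟨⟨x, hW.trans.left_mem this⟩, ⟨y, hW.trans.right_mem this⟩, h⟩

theorem si_ext : SiP (M := M) Lim 1 3 fun _ v => IsSeq (v 0) (v 1) ∧ ∀ z, Mem z (v 2) → Mem z (v 0) := by
  refine SiP.of_abs (R := fun v => IsSeq (v 0) (v 1) ∧ ∀ z, Mem z (v 2) → Mem z (v 0))
    (isSeq 0 1 ⋏ allIn 2 fun z => mem z ((0 : Fin 3) : Fin 4)) fun W hW v => ?_
  simp only [tr_and, tr_isSeq, tr_allIn, tr_mem, Fin.snoc_castSucc, Fin.snoc_last, mem_coe]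
  rw [forall_mem_coe hW.trans (v 2).2 (p := fun z => Mem z (v 0 : M))]

theorem si_seq1 : SiP (M := M) Lim 1 2 fun _ v => v 0 = seq1 (v 1) :=
  SiP.of_abs (R := fun v => v 0 = seq1 (v 1)) (isSeq1 0 1) fun W hW v => tr_isSeq1

end Leaves

/-- The code determines its two components, so the existential quantifiers over them may be turned
into universal ones, which do not raise the complexity. -/
theorem piT_succ_iff {U : Set M} [hU : World U] {k : ℕ} {e s : M} (he : e ∈ U) :
    PiT (k + 1) U e s ↔ (∃ m e', e = op m e') ∧ ∀ m ∈ U, ∀ e' ∈ U, ∀ t ∈ U, e = op m e' →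
      (IsSeq t m ∧ ∀ z, Mem z s → Mem z t) → SigT k U e' t := by
  rw [PiT]
  constructor
  · rintro ⟨m, e', rfl, h⟩
    refine ⟨⟨m, e', rfl⟩, fun m' hm e'' he' t ht e0 h1 => ?_⟩
    rw [op_inj] at e0
    obtain ⟨rfl, rfl⟩ := e0
    exact h t ((ext_iff ht).2 h1)
  · rintro ⟨⟨m, e', rfl⟩, h⟩
    refine ⟨m, e', rfl, fun t ht => ?_⟩
    have htU := World.seq_mem ht.seqIn
    exact h m (hU.trans.left_mem he) e' (hU.trans.right_mem he) t htU rfl ((ext_iff htU).1 ht)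

theorem sigT_succ_iff {U : Set M} [hU : World U] {k : ℕ} {e s : M} (he : e ∈ U) :
    SigT (k + 1) U e s ↔ ∃ m ∈ U, ∃ e' ∈ U, ∃ t ∈ U, e = op m e' ∧
      (IsSeq t m ∧ ∀ z, Mem z s → Mem z t) ∧ PiT k U e' t := by
  rw [SigT]
  constructor
  · rintro ⟨m, e', rfl, t, h1, h2⟩
    have htU := World.seq_mem h1.seqIn
    exact ⟨m, hU.trans.left_mem he, e', hU.trans.right_mem he, t, htU, rfl, (ext_iff htU).1 h1, h2⟩
  · rintro ⟨m, hm, e', he', t, ht, rfl, h1, h2⟩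
    exact ⟨m, e', rfl, t, (ext_iff ht).2 h1, h2⟩

theorem pi_piT_succ {k : ℕ} (h : PiP (M := M) Lim (k + 1) 2 fun U v => SigT k U (v 0) (v 1)) :
    PiP (M := M) Lim (k + 1) 2 fun U v => PiT (k + 1) U (v 0) (v 1) := by
  refine PiP.congr (p := fun U v => (∃ m e', v 0 = op m e') ∧ ∀ m ∈ U, ∀ e' ∈ U, ∀ t ∈ U,
      v 0 = op m e' → (IsSeq t m ∧ ∀ z, Mem z (v 1) → Mem z t) → SigT k U e' t)
    (PiP.and Lim.univC ((pi_isOp.rename (![0] : Fin 1 → Fin 2)).le (by omega))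
    (PiP.all k.succ_pos (PiP.all k.succ_pos (PiP.all k.succ_pos (PiP.imp Lim.univC
      ((si_op.rename (![0, 2, 3] : Fin 3 → Fin 5)).le (by omega)) (PiP.imp Lim.univC
        ((si_ext.rename (![4, 2, 1] : Fin 3 → Fin 5)).le (by omega))
        (h.rename (![3, 4] : Fin 2 → Fin 5)))))))) ?_
  intro U hU v hv
  exact piT_succ_iff (hv 0)

theorem si_sigT_succ {k : ℕ} (h : SiP (M := M) Lim (k + 1) 2 fun U v => PiT k U (v 0) (v 1)) :
    SiP (M := M) Lim (k + 1) 2 fun U v => SigT (k + 1) U (v 0) (v 1) := by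
  refine SiP.congr (p := fun U v => ∃ m ∈ U, ∃ e' ∈ U, ∃ t ∈ U, v 0 = op m e' ∧
      (IsSeq t m ∧ ∀ z, Mem z (v 1) → Mem z t) ∧ PiT k U e' t) (SiP.ex k.succ_pos (SiP.ex k.succ_pos (SiP.ex k.succ_pos (SiP.and Lim.univC
      ((si_op.rename (![0, 2, 3] : Fin 3 → Fin 5)).le (by omega)) (SiP.and Lim.univC
        ((si_ext.rename (![4, 2, 1] : Fin 3 → Fin 5)).le (by omega))
        (h.rename (![3, 4] : Fin 2 → Fin 5))))))) ?_
  intro U hU v hv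
  exact sigT_succ_iff (hv 0)

/-- Truth of `Δ₀`-codes is only `Δ₁`, not `Δ₀`. Starting from this, the dual bounds, one level up,
are carried through the induction; they supply the matrices for `pi_piT_succ` and `si_sigT_succ`. -/
theorem pi_sigT_si_piT (k : ℕ) : PiP (M := M) Lim (k + 1) 2 (fun U v => SigT k U (v 0) (v 1)) ∧
    SiP (M := M) Lim (k + 1) 2 (fun U v => PiT k U (v 0) (v 1)) := by
  induction k with
  | zero => exact ⟨pi_tru.congr fun U _ v _ => by rw [SigT], si_tru.congr fun U _ v _ => by rw [PiT]⟩
  | succ k ih => exact ⟨(si_sigT_succ ih.2).pi (by omega), (pi_piT_succ ih.1).si (by omega)⟩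

/-- The universal `Πₖ`-formula is `Πₖ`. -/
theorem pi_uPi {k : ℕ} (hk : 0 < k) : PiP (M := M) Lim k 1 fun U v => UPi k U (v 0) := by
  obtain ⟨k, rfl⟩ : ∃ j, k = j + 1 := ⟨k - 1, by omega⟩
  refine PiP.congr (p := fun U v => (∃ x y, v 0 = op x y) ∧ ∀ e ∈ U, ∀ c ∈ U, ∀ s ∈ U,
      v 0 = op e c → s = seq1 c → PiT (k + 1) U e s) (PiP.and Lim.univC (pi_isOp.le (by omega))
    (PiP.all k.succ_pos (PiP.all k.succ_pos (PiP.all k.succ_pos (PiP.imp Lim.univC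
      ((si_op.rename (![0, 1, 2] : Fin 3 → Fin 4)).le (by omega)) (PiP.imp Lim.univC
        ((si_seq1.rename (![3, 2] : Fin 2 → Fin 4)).le (by omega))
        ((pi_piT_succ (pi_sigT_si_piT k).1).rename (![1, 3] : Fin 2 → Fin 4)))))))) ?_
  intro U hU v hv
  show UPi (k + 1) U (v 0) ↔ (∃ x y, v 0 = op x y) ∧ ∀ e ∈ U, ∀ c ∈ U, ∀ s ∈ U, v 0 = op e c →
    s = seq1 c → PiT (k + 1) U e s
  constructor
  · rintro ⟨e, c, h, h'⟩
    refine ⟨⟨e, c, h⟩, fun e₁ _ c₁ _ s _ h1 h2 => ?_⟩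
    rw [h, op_inj] at h1
    rw [h2, ← h1.1, ← h1.2]; exact h'
  · rintro ⟨⟨e, c, h⟩, h'⟩
    have hb := hv 0
    rw [h] at hb
    have hc := hU.trans.right_mem hb
    exact ⟨e, c, h, h' e (hU.trans.left_mem hb) c hc _ (World.seq1_mem hc) h rfl⟩

/-! ### Evaluating the universal formula and the Mahlo operation in worlds -/

/-- Truth of the codes in `X` is witnessed in `W`. -/
def TrOK (W X : Set M) : Prop := ∀ e ∈ X, ∀ s, SeqIn s X → (TrueIn W e s ↔ Tru e s)

theorem TrOK.univ (X : Set M) : TrOK Set.univ X := fun _ _ _ _ => Iff.rfl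

theorem TrOK.mono {W X Y : Set M} (h : TrOK W X) (hY : Y ⊆ X) : TrOK W Y :=
  fun e he s hs => h e (hY he) s (hs.mono hY)

theorem TrOK.of_sat {W : Set M} {T S : M} (hT : T ∈ W) (hS : S ∈ W) (hTr : IsTr T)
    (h : IsSat T S) : TrOK W (ext T) :=
  fun e he s hs => ⟨TrueIn.tru, fun ht =>
    ⟨T, hT, S, hS, hTr, he, hs, h, (h.tru_iff hTr he hs).2 ht⟩⟩

section Eval
variable {U : Set M} [hU : World U]

theorem tr_isExtension {n : ℕ} {v : Fin n → ↥U} {V : Univ n} {t m s : Fin n} :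
    Tr (isExtension V t m s) v ↔ Ext (Univ.sem v V) (v t : M) (v m) (v s) := by
  simp only [isExtension, tr_and, tr_isSeq, tr_allIn, tr_exU, tr_pairIn, tr_mem, sem_map,
    snoc_comp_castSucc, Fin.snoc_castSucc, Fin.snoc_last, mem_coe]
  have e : ∀ j : M, (∃ x : ↥U, (x : M) ∈ Univ.sem v V ∧ Mem (op j (x : M)) (v t)) ↔
      ∃ x ∈ Univ.sem v V, Mem (op j x) (v t : M) := fun j =>
    ⟨fun ⟨x, h⟩ => ⟨x, h⟩, fun ⟨x, h, h'⟩ => ⟨⟨x, sem_subset hU.trans _ _ h⟩, h, h'⟩⟩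
  simp only [e]
  rw [forall_mem_coe hU.trans (v m).2 (p := fun j => ∃ x ∈ Univ.sem v V, Mem (op j x) (v t : M)),
    forall_mem_coe hU.trans (v s).2 (p := fun z => Mem z (v t : M))]
  rfl

/-- Apart from the ranges of the block quantifiers, the evaluating world `U` enters only through
`Δ₀`-truth, which `TrOK` makes correct. All assignments needed lie in `U`, since worlds are closed
under finite sequences. -/
theorem tr_piTrue (k : ℕ) : ∀ {n : ℕ} {v : Fin n → ↥U} {V : Univ n} {e s : Fin n},
    TransC (Univ.sem v V) → TrOK U (Univ.sem v V) → (v e : M) ∈ Univ.sem v V →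
    SeqIn (v s : M) (Univ.sem v V) →
    (Tr (piTrue k V e s) v ↔ PiT k (Univ.sem v V) (v e) (v s)) ∧
    (Tr (sigmaTrue k V e s) v ↔ SigT k (Univ.sem v V) (v e) (v s)) := by
  induction k with
  | zero =>
    intro n v V e s hV ok he hs
    rw [piTrue, sigmaTrue, PiT, SigT, tr_isTrue]
    exact ⟨ok _ he _ hs, ok _ he _ hs⟩
  | succ k ih =>
    intro n v V e s hV ok he hs
    have key : ∀ m e' t : ↥U, (v e : M) = op (m : M) e' → SeqIn (t : M) (Univ.sem v V) →
        (Tr (piTrue k (V.map Fin.castSucc |>.map Fin.castSucc |>.map Fin.castSucc)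
          (Fin.last (n + 1)).castSucc (Fin.last (n + 2)))
          (Fin.snoc (Fin.snoc (Fin.snoc v m : Fin (n + 1) → ↥U) e' : Fin (n + 2) → ↥U) t) ↔
          PiT k (Univ.sem v V) e' t) ∧
        (Tr (sigmaTrue k (V.map Fin.castSucc |>.map Fin.castSucc |>.map Fin.castSucc)
          (Fin.last (n + 1)).castSucc (Fin.last (n + 2)))
          (Fin.snoc (Fin.snoc (Fin.snoc v m : Fin (n + 1) → ↥U) e' : Fin (n + 2) → ↥U) t) ↔
          SigT k (Univ.sem v V) e' t) := by
      intro m e' t h ht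
      have hsem : Univ.sem (Fin.snoc (Fin.snoc (Fin.snoc v m : Fin (n + 1) → ↥U) e' :
          Fin (n + 2) → ↥U) t : Fin (n + 3) → ↥U)
          (V.map Fin.castSucc |>.map Fin.castSucc |>.map Fin.castSucc) = Univ.sem v V := by
        simp
      have := ih (v := Fin.snoc (Fin.snoc (Fin.snoc v m : Fin (n + 1) → ↥U) e' :
          Fin (n + 2) → ↥U) t) (V := (V.map Fin.castSucc |>.map Fin.castSucc |>.map Fin.castSucc))
          (e := (Fin.last (n + 1)).castSucc) (s := Fin.last (n + 2))
          (by rw [hsem]; exact hV) (by rw [hsem]; exact ok)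
          (by rw [hsem, Fin.snoc_castSucc, Fin.snoc_last]; exact hV.right_mem (h ▸ he))
          (by rw [hsem, Fin.snoc_last]; exact ht)
      rwa [hsem, Fin.snoc_castSucc, Fin.snoc_last, Fin.snoc_last] at this
    rw [piTrue, sigmaTrue, PiT, SigT]
    simp only [tr_ex, tr_and, tr_all, tr_imp, tr_isOPair, tr_isExtension, sem_map,
      snoc_comp_castSucc, Fin.snoc_castSucc, Fin.snoc_last]
    have hm : ∀ {m e'}, (v e : M) = op m e' → m ∈ U ∧ e' ∈ U := fun {m e'} h => by
      have := (v e).2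
      rw [h] at this
      exact ⟨hU.trans.left_mem this, hU.trans.right_mem this⟩
    have htU : ∀ {t m}, Ext (Univ.sem v V) t m (v s) → t ∈ U := fun h =>
      World.seq_mem (h.seqIn.mono (sem_subset hU.trans _ _))
    constructor
    · constructor
      · rintro ⟨m, e', h, H⟩
        exact ⟨m, e', h, fun t ht => (key m e' ⟨t, htU ht⟩ h ht.seqIn).2.1 (H ⟨t, htU ht⟩ ht)⟩
      · rintro ⟨m, e', h, H⟩
        exact ⟨⟨m, (hm h).1⟩, ⟨e', (hm h).2⟩, h, fun t ht =>
          (key ⟨m, (hm h).1⟩ ⟨e', (hm h).2⟩ t h ht.seqIn).2.2 (H t ht)⟩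
    · constructor
      · rintro ⟨m, e', h, t, ht, H⟩
        exact ⟨m, e', h, t, ht, (key m e' t h ht.seqIn).1.1 H⟩
      · rintro ⟨m, e', h, t, ht, H⟩
        exact ⟨⟨m, (hm h).1⟩, ⟨e', (hm h).2⟩, h, ⟨t, htU ht⟩, ht,
          (key ⟨m, (hm h).1⟩ ⟨e', (hm h).2⟩ ⟨t, htU ht⟩ h ht.seqIn).1.2 H⟩

variable {n : ℕ} {v : Fin n → ↥U}

theorem tr_univPi {i : ℕ} {V : Univ n} {b : Fin n} (hV : TransC (Univ.sem v V))
    (ok : TrOK U (Univ.sem v V)) (hb : (v b : M) ∈ Univ.sem v V) :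
    Tr (univPi i V b) v ↔ UPi i (Univ.sem v V) (v b) := by
  have key : ∀ e c s : ↥U, (v b : M) = op (e : M) c → (s : M) = seq1 (c : M) →
      (Tr (piTrue i (V.map Fin.castSucc |>.map Fin.castSucc |>.map Fin.castSucc)
        (Fin.last n).castSucc.castSucc (Fin.last (n + 2)))
        (Fin.snoc (Fin.snoc (Fin.snoc v e : Fin (n + 1) → ↥U) c : Fin (n + 2) → ↥U) s) ↔
        PiT i (Univ.sem v V) e s) := by
    intro e c s h hs
    have hsem : Univ.sem (Fin.snoc (Fin.snoc (Fin.snoc v e : Fin (n + 1) → ↥U) c :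
        Fin (n + 2) → ↥U) s : Fin (n + 3) → ↥U)
        (V.map Fin.castSucc |>.map Fin.castSucc |>.map Fin.castSucc) = Univ.sem v V := by
      simp
    rw [h] at hb
    have := (tr_piTrue i (v := Fin.snoc (Fin.snoc (Fin.snoc v e : Fin (n + 1) → ↥U) c :
        Fin (n + 2) → ↥U) s) (V := (V.map Fin.castSucc |>.map Fin.castSucc |>.map Fin.castSucc))
        (e := (Fin.last n).castSucc.castSucc) (s := Fin.last (n + 2))
        (by rw [hsem]; exact hV) (by rw [hsem]; exact ok)
        (by rw [hsem, Fin.snoc_castSucc, Fin.snoc_castSucc, Fin.snoc_last]; exact hV.left_mem hb)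
        (by rw [hsem, Fin.snoc_last, hs]; exact seqIn_seq1 (hV.right_mem hb))).1
    rwa [hsem, Fin.snoc_castSucc, Fin.snoc_castSucc, Fin.snoc_last, Fin.snoc_last] at this
  rw [univPi, UPi]
  simp only [tr_ex, tr_and, tr_isOPair, tr_isSeq1, Fin.snoc_castSucc, Fin.snoc_last]
  constructor
  · rintro ⟨e, c, s, h1, h2, h3⟩
    exact ⟨e, c, h1, by rw [← h2]; exact (key e c s h1 h2).1 h3⟩
  · rintro ⟨e, c, h1, h2⟩
    have hbU := (v b).2
    rw [h1] at hbU
    have hc := hU.trans.right_mem hbU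
    exact ⟨⟨e, hU.trans.left_mem hbU⟩, ⟨c, hc⟩, ⟨_, World.seq1_mem hc⟩, h1, rfl,
      (key ⟨e, hU.trans.left_mem hbU⟩ ⟨c, hc⟩ ⟨_, World.seq1_mem hc⟩ h1 rfl).2 h2⟩

theorem tr_isUniv {Q : Fin n} : Tr (isUniv Q) v ↔ UnivC (ext (v Q : M)) := by
  simp only [isUniv, tr_and, tr_isTrans, tr_exIn, tr_isOmega, Fin.snoc_last, mem_coe]
  constructor
  · rintro ⟨h1, w, h2, h3⟩
    exact ⟨h1.transC, by rw [← h3]; exact h2⟩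
  · rintro ⟨h1, h2⟩
    exact ⟨fun x hx y hy => h1 x hx y hy, ⟨om M, hU.om_mem⟩, h2, rfl⟩

theorem tr_mahlo {i : ℕ} {V : Univ n} {X : Fin (n + 1 + 1) → Fm (n + 1 + 1)} {X' : M → Prop}
    (hV : TransC (Univ.sem v V)) (ok : TrOK U (Univ.sem v V))
    (hX : ∀ b Q : ↥U, (Q : M) ∈ Univ.sem v V → UnivC (ext (Q : M)) →
      (Tr (X (Fin.last (n + 1))) (Fin.snoc (Fin.snoc v b : Fin (n + 1) → ↥U) Q) ↔ X' Q)) :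
    Tr (mahlo i V X) v ↔ Mahlo i (Univ.sem v V) X' := by
  have hsub := sem_subset hU.trans v V
  simp only [mahlo, tr_allU, tr_imp, tr_exU, tr_and, tr_isUniv, tr_mem, Fin.snoc_castSucc,
    Fin.snoc_last, mem_coe, sem_map, snoc_comp_castSucc]
  have h1 : ∀ b : ↥U, (b : M) ∈ Univ.sem v V → (Tr (univPi i (V.map Fin.castSucc) (Fin.last n))
      (Fin.snoc v b) ↔ UPi i (Univ.sem v V) b) := by
    intro b hb
    have hsem : Univ.sem (Fin.snoc v b : Fin (n + 1) → ↥U) (V.map Fin.castSucc) = Univ.sem v V := by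
      simp
    have := tr_univPi (v := (Fin.snoc v b : Fin (n + 1) → ↥U)) (V := V.map Fin.castSucc) (i := i)
      (b := Fin.last n) (by rw [hsem]; exact hV) (by rw [hsem]; exact ok)
      (by rw [hsem, Fin.snoc_last]; exact hb)
    rwa [hsem, Fin.snoc_last] at this
  have h2 : ∀ b Q : ↥U, (Q : M) ∈ Univ.sem v V → UnivC (ext (Q : M)) → Mem (b : M) Q →
      (Tr (univPi i (.set (Fin.last (n + 1))) (Fin.last n).castSucc)
      (Fin.snoc (Fin.snoc v b : Fin (n + 1) → ↥U) Q) ↔ UPi i (ext (Q : M)) b) := by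
    intro b Q hQ hQu hb
    have hsem : Univ.sem (Fin.snoc (Fin.snoc v b : Fin (n + 1) → ↥U) Q : Fin (n + 2) → ↥U)
      (.set (Fin.last (n + 1))) = ext (Q : M) := by simp
    have := tr_univPi (v := (Fin.snoc (Fin.snoc v b : Fin (n + 1) → ↥U) Q : Fin (n + 2) → ↥U))
      (V := .set (Fin.last (n + 1))) (i := i) (b := (Fin.last n).castSucc)
      (by rw [hsem]; exact hQu.trans) (by rw [hsem]; exact ok.mono fun x hx => hV _ hQ _ hx)
      (by rw [hsem, Fin.snoc_castSucc, Fin.snoc_last]; exact hb)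
    rwa [hsem, Fin.snoc_castSucc, Fin.snoc_last] at this
  constructor
  · intro H b hb hpi
    obtain ⟨Q, hQ, h3, h4, h5, h6⟩ := H ⟨b, hsub hb⟩ hb ((h1 ⟨b, hsub hb⟩ hb).2 hpi)
    exact ⟨Q, hQ, h3, (hX _ Q hQ h3).1 h4, h5, (h2 _ Q hQ h3 h5).1 h6⟩
  · intro H b hb hpi
    obtain ⟨Q, hQ, h3, h4, h5, h6⟩ := H b hb ((h1 b hb).1 hpi)
    exact ⟨⟨Q, hsub hQ⟩, hQ, h3, (hX _ ⟨Q, hsub hQ⟩ hQ h3).2 h4, h5, (h2 _ ⟨Q, hsub hQ⟩ hQ h3 h5).2 h6⟩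

end Eval

theorem Mahlo.congr {i : ℕ} {U : Set M} {X Y : M → Prop}
    (h : ∀ Q ∈ U, UnivC (ext Q) → (X Q ↔ Y Q)) : Mahlo i U X ↔ Mahlo i U Y := by
  constructor
  · intro H b hb hpi
    obtain ⟨Q, hQ, h3, h4, h5⟩ := H b hb hpi
    exact ⟨Q, hQ, h3, (h Q hQ h3).1 h4, h5⟩
  · intro H b hb hpi
    obtain ⟨Q, hQ, h3, h4, h5⟩ := H b hb hpi
    exact ⟨Q, hQ, h3, (h Q hQ h3).2 h4, h5⟩

end SetTh

namespace SetTh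

variable {M : Type} [setLang.Structure M] [KPM M]

/-! ### Iterations of the Mahlo operation -/

/-- The definable relation `R` has the meaning `RS` in all worlds; its field is contained in the
class `Idx` defined by `F`, all elements of which belong to all worlds. -/
structure RelAbs (R : DefRel) (RS : Set M → M → M → Prop) (F : ∀ n : ℕ, Fin n → Fm n)
    (Idx : M → Prop) : Prop where
  tr : ∀ (U : Set M) [World U] {n : ℕ} (v : Fin n → ↥U) (V : Univ n) (x y : Fin n),
    UnivC (Univ.sem v V) → (Tr (R n V x y) v ↔ RS (Univ.sem v V) (v x) (v y))
  idx : ∀ {X d c}, RS X d c → Idx d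
  std : ∀ {c}, Idx c → Std c
  tr_idx : ∀ (U : Set M) [World U] {n : ℕ} (v : Fin n → ↥U) (x : Fin n),
    Tr (F n x) v ↔ Idx (v x)

/-- `H` is the relation `Q ∈ Mᵢ(c; ≺)` on `D × I`. -/
structure Hier (i : ℕ) (RS : Set M → M → M → Prop) (D I H : M) : Prop where
  tr : IsTr D
  closed : ∀ Q, Mem Q D → UnivC (ext Q) → ∀ c, Mem c I → ∀ d, RS (ext Q) d c → Mem d I
  step : ∀ Q, Mem Q D → UnivC (ext Q) → ∀ c, Mem c I → (Mem (op Q c) H ↔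
    ∀ d, RS (ext Q) d c → Mahlo i (ext Q) fun R => Mem (op R d) H)

/-- `Q ∈ Mᵢ(c; ≺)` -/
def Iter (i : ℕ) (RS : Set M → M → M → Prop) (Q c : M) : Prop :=
  ∃ D I H, Hier i RS D I H ∧ Mem Q D ∧ Mem c I ∧ Mem (op Q c) H

section
variable {R : DefRel} {RS : Set M → M → M → Prop} {F : ∀ n : ℕ, Fin n → Fm n} {Idx : M → Prop}

theorem tr_isHier (hR : RelAbs R RS F Idx) {U : Set M} [hU : World U] {n i : ℕ} {v : Fin n → ↥U}
    {D I H : Fin n} (ok : IsTr (v D : M) → TrOK U (ext (v D : M))) :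
    Tr (isHier i R D I H) v ↔ Hier i RS (v D : M) (v I) (v H) := by
  simp only [isHier, tr_and, tr_isTrans, tr_allIn, tr_all, tr_imp, tr_iff, tr_mem, tr_pairIn,
    tr_isUniv, Fin.snoc_castSucc, Fin.snoc_last, mem_coe]
  have hr : ∀ Q c d : ↥U, UnivC (ext (Q : M)) →
      (Tr (R (n + 1 + 1 + 1) (.set (Fin.last n).castSucc.castSucc) (Fin.last (n + 2))
        (Fin.last (n + 1)).castSucc) (Fin.snoc (Fin.snoc (Fin.snoc v Q : Fin (n + 1) → ↥U) c :
          Fin (n + 2) → ↥U) d) ↔ RS (ext (Q : M)) d c) := by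
    intro Q c d hQ
    have := hR.tr U (Fin.snoc (Fin.snoc (Fin.snoc v Q : Fin (n + 1) → ↥U) c :
      Fin (n + 2) → ↥U) d) (.set (Fin.last n).castSucc.castSucc) (Fin.last (n + 2))
      (Fin.last (n + 1)).castSucc (by simpa using hQ)
    simpa using this
  have hmah : ∀ (hD : IsTr (v D : M)) (Q c d : ↥U), UnivC (ext (Q : M)) → Mem (Q : M) (v D) →
      (Tr (mahlo i (.set (Fin.last n).castSucc.castSucc) fun Q' => pairIn
        H.castSucc.castSucc.castSucc.castSucc.castSucc Q' (Fin.last (n + 2)).castSucc.castSucc)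
        (Fin.snoc (Fin.snoc (Fin.snoc v Q : Fin (n + 1) → ↥U) c : Fin (n + 2) → ↥U) d) ↔
        Mahlo i (ext (Q : M)) fun Q' => Mem (op Q' (d : M)) (v H)) := by
    intro hD Q c d hQ hQD
    have hsem : Univ.sem (Fin.snoc (Fin.snoc (Fin.snoc v Q : Fin (n + 1) → ↥U) c :
      Fin (n + 2) → ↥U) d : Fin (n + 3) → ↥U) (.set (Fin.last n).castSucc.castSucc) =
      ext (Q : M) := by simp
    have := tr_mahlo (i := i) (v := (Fin.snoc (Fin.snoc (Fin.snoc v Q : Fin (n + 1) → ↥U) c :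
      Fin (n + 2) → ↥U) d : Fin (n + 3) → ↥U)) (V := .set (Fin.last n).castSucc.castSucc)
      (X := fun Q' => pairIn H.castSucc.castSucc.castSucc.castSucc.castSucc Q'
        (Fin.last (n + 2)).castSucc.castSucc) (X' := fun Q' => Mem (op Q' (d : M)) (v H))
      (by rw [hsem]; exact hQ.trans)
      (by rw [hsem]; exact (ok hD).mono fun x hx => hD _ hQD _ hx) (by simp)
    rwa [hsem] at this
  constructor
  · rintro ⟨h1, h2, h3⟩
    refine ⟨h1, fun Q hQ hu c hc d hd => ?_, fun Q hQ hu c hc => ?_⟩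
    · have hQU := hU.trans _ (v D).2 _ hQ
      have hcU := hU.trans _ (v I).2 _ hc
      have hdU := hR.std (hR.idx hd) U hU
      exact h2 ⟨Q, hQU⟩ hQ hu ⟨c, hcU⟩ hc ⟨d, hdU⟩ ((hr ⟨Q, hQU⟩ ⟨c, hcU⟩ ⟨d, hdU⟩ hu).2 hd)
    · have hQU := hU.trans _ (v D).2 _ hQ
      have hcU := hU.trans _ (v I).2 _ hc
      refine (h3 ⟨Q, hQU⟩ hQ hu ⟨c, hcU⟩ hc).trans ?_
      constructor
      · intro H d hd
        have hdU := hR.std (hR.idx hd) U hU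
        exact (hmah h1 ⟨Q, hQU⟩ ⟨c, hcU⟩ ⟨d, hdU⟩ hu hQ).1
          (H ⟨d, hdU⟩ ((hr ⟨Q, hQU⟩ ⟨c, hcU⟩ ⟨d, hdU⟩ hu).2 hd))
      · intro H d hd
        exact (hmah h1 ⟨Q, hQU⟩ ⟨c, hcU⟩ d hu hQ).2 (H d ((hr ⟨Q, hQU⟩ ⟨c, hcU⟩ d hu).1 hd))
  · rintro ⟨h1, h2, h3⟩
    refine ⟨h1, fun Q hQ hu c hc d hd => h2 Q hQ hu c hc d ((hr Q c d hu).1 hd),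
      fun Q hQ hu c hc => (h3 Q hQ hu c hc).trans ?_⟩
    constructor
    · intro H d hd
      exact (hmah h1 Q c d hu hQ).2 (H d ((hr Q c d hu).1 hd))
    · intro H d hd
      have hdU := hR.std (hR.idx hd) U hU
      exact (hmah h1 Q c ⟨d, hdU⟩ hu hQ).1 (H ⟨d, hdU⟩ ((hr Q c ⟨d, hdU⟩ hu).2 hd))

def D0.univ {n : ℕ} (Q w : Fin n) : D0 n :=
  .and (.allIn Q fun y => .allIn y fun z => .mem z Q) (.mem w Q)

theorem dr_univ {n : ℕ} {Q w : Fin n} {v : Fin n → M} (hw : v w = om M) :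
    DR (.univ Q w) v ↔ UnivC (ext (v Q)) := by
  simp only [D0.univ, dr_and, dr_allIn, dr_mem, Fin.snoc_castSucc, Fin.snoc_last, hw]
  exact ⟨fun h => ⟨h.1, h.2⟩, fun h => ⟨h.1, h.2⟩⟩

/-- The recursion at `Q` asks only about elements of `Q`, so ∈-induction applies. The parameter ω
makes "Q is a universe" `Δ₀`, as definability of the induction predicate requires. -/
theorem Hier.unique {i : ℕ} {D I H D' I' H' : M} (h : Hier i RS D I H) (h' : Hier i RS D' I' H') :
    ∀ Q, Mem Q D → Mem Q D' → UnivC (ext Q) → ∀ c, Mem c I → Mem c I' →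
      (Mem (op Q c) H ↔ Mem (op Q c) H') := by
  refine mem_induction (p := fun Q => Mem Q D → Mem Q D' → UnivC (ext Q) → ∀ c, Mem c I →
    Mem c I' → (Mem (op Q c) H ↔ Mem (op Q c) H')) ?_ ?_
  · have := Dfb.of_D0 (M := M) (n := 7) (.imp (.mem 7 0) (.imp (.mem 7 1) (.imp (.univ 7 2)
      (.allIn 3 fun c => .imp (.mem c (4 : Fin 8).castSucc)
      (.iff (.pairIn (5 : Fin 8).castSucc (7 : Fin 8).castSucc c)
        (.pairIn (6 : Fin 8).castSucc (7 : Fin 8).castSucc c)))))) ![D, D', om M, I, I', H, H']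
    have e : ∀ x : M, DR (.univ 7 2) (Fin.snoc ![D, D', om M, I, I', H, H'] x : Fin 8 → M) ↔
        UnivC (ext x) := fun x => dr_univ rfl
    simp only [dr_imp, dr_mem, dr_allIn, dr_iff, dr_pairIn, e, Fin.snoc_castSucc,
      Fin.snoc_last] at this
    exact this
  · intro Q ih hQ hQ' hu c hc hc'
    rw [h.step Q hQ hu c hc, h'.step Q hQ' hu c hc']
    refine forall₂_congr fun d hd => Mahlo.congr fun Q₁ hQ₁ hu₁ => ?_
    exact ih Q₁ hQ₁ (h.tr _ hQ _ hQ₁) (h'.tr _ hQ' _ hQ₁) hu₁ d (h.closed Q hQ hu c hc d hd)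
      (h'.closed Q hQ' hu c hc' d hd)

theorem Hier.iter_iff {i : ℕ} {D I H : M} (h : Hier i RS D I H) {Q c : M} (hQ : Mem Q D)
    (hu : UnivC (ext Q)) (hc : Mem c I) : Iter i RS Q c ↔ Mem (op Q c) H := by
  constructor
  · rintro ⟨D', I', H', h', hQ', hc', hm⟩
    exact (h.unique h' Q hQ hQ' hu c hc hc').2 hm
  · exact fun hm => ⟨D, I, H, h, hQ, hc, hm⟩

/-- The recursion step for `isHier`; `A` is a world, `w` is `ω`. -/
def D0.hierStep (i : ℕ) (R : DefRel) {m : ℕ} (A I w Q c H : Fin m) : D0 m :=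
  .imp (.univ Q w) (.allIn I fun d => .imp
    (relD0 (A : Fin (m + 1)) Empty.elim ![(Q : Fin (m + 1)), d, (c : Fin (m + 1))]
      (R 3 (.set 0) 1 2))
    (.allIn (Q : Fin (m + 1)) fun b => .imp
      (relD0 (A : Fin (m + 1)).castSucc Empty.elim ![(Q : Fin (m + 1)).castSucc, b]
        (univPi i (.set (0 : Fin 2)) 1))
      (.exIn (Q : Fin (m + 1)).castSucc fun Q' => .and
        (.and (.univ Q' (w : Fin (m + 1)).castSucc.castSucc) (.mem b Q'))
        (.and (relD0 (A : Fin (m + 1)).castSucc.castSucc Empty.elim ![Q', b.castSucc]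
          (univPi i (.set (0 : Fin 2)) 1)) (.pairIn H Q' d)))))

theorem dr_hierStep (hR : RelAbs R RS F Idx) {i m : ℕ} {A I w Q c H : Fin m} {v : Fin m → M}
    [hA : World (ext (v A))] (hw : v w = om M) (hQ : Mem (v Q) (v A)) (hc : Mem (v c) (v A))
    (hI : ∀ d, Mem d (v I) → Mem d (v A)) (ok : TransC (ext (v Q)) → TrOK (ext (v A)) (ext (v Q)))
    (hcl : UnivC (ext (v Q)) → ∀ d, RS (ext (v Q)) d (v c) → Mem d (v I)) :
    DR (.hierStep i R A I w Q c H) v ↔ (UnivC (ext (v Q)) → ∀ d, RS (ext (v Q)) d (v c) →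
      Mahlo i (ext (v Q)) fun Q' => Mem (op Q' d) (v H)) := by
  simp only [D0.hierStep, dr_imp, dr_univ hw, dr_allIn, dr_exIn, dr_and, dr_mem, dr_pairIn,
    Fin.snoc_castSucc, Fin.snoc_last]
  refine imp_congr_right fun hu => ?_
  have okQ := ok hu.trans
  have h1 : ∀ d, Mem d (v A) → (DR (relD0 (A : Fin (m + 1)) Empty.elim ![(Q : Fin (m + 1)),
      Fin.last m, (c : Fin (m + 1))] (R 3 (.set 0) 1 2)) (Fin.snoc v d) ↔
      RS (ext (v Q)) d (v c)) := by
    intro d hd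
    rw [dr_rel (M := M) _ _ _ _ (fun j => by fin_cases j <;> simp [hQ, hd, hc])]
    have : World (ext ((Fin.snoc v d : Fin (m + 1) → M) (A : Fin (m + 1)))) := by simpa using hA
    rw [hR.tr _ _ _ _ _ (by simpa using hu)]
    simp
  have h2 : ∀ d b, Mem b (v Q) → (DR (relD0 (A : Fin (m + 1)).castSucc Empty.elim
      ![(Q : Fin (m + 1)).castSucc, Fin.last (m + 1)] (univPi i (.set (0 : Fin 2)) 1))
      (Fin.snoc (Fin.snoc v d : Fin (m + 1) → M) b) ↔ UPi i (ext (v Q)) b) := by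
    intro d b hb
    have hbA : Mem b (v A) := hA.trans _ hQ _ hb
    rw [dr_rel (M := M) _ _ _ _ (fun j => by fin_cases j <;> simp [hQ, hbA])]
    have : World (ext ((Fin.snoc (Fin.snoc v d : Fin (m + 1) → M) b : Fin (m + 2) → M)
      (A : Fin (m + 1)).castSucc)) := by simpa using hA
    rw [tr_univPi (by simpa using hu.trans) (by simpa using okQ) (by simpa using hb)]
    simp
  have h3 : ∀ d b Q', Mem Q' (v Q) → UnivC (ext Q') → Mem b Q' →
      (DR (relD0 (A : Fin (m + 1)).castSucc.castSucc Empty.elim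
      ![Fin.last (m + 2), (Fin.last (m + 1)).castSucc] (univPi i (.set (0 : Fin 2)) 1))
      (Fin.snoc (Fin.snoc (Fin.snoc v d : Fin (m + 1) → M) b : Fin (m + 2) → M) Q') ↔
      UPi i (ext Q') b) := by
    intro d b Q' hQ' hu' hb
    have hQA : Mem Q' (v A) := hA.trans _ hQ _ hQ'
    have hbA : Mem b (v A) := hA.trans _ hQA _ hb
    have okQ' : TrOK (ext (v A)) (ext Q') := okQ.mono fun x hx => hu.trans _ hQ' _ hx
    rw [dr_rel (M := M) _ _ _ _ (fun j => by fin_cases j <;> simp [hQA, hbA])]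
    have : World (ext ((Fin.snoc (Fin.snoc (Fin.snoc v d : Fin (m + 1) → M) b :
      Fin (m + 2) → M) Q' : Fin (m + 3) → M)
      (A : Fin (m + 1)).castSucc.castSucc)) := by simpa using hA
    rw [tr_univPi (by simpa using hu'.trans)
      (by simpa using okQ') (by simpa using hb)]
    simp
  have h4 : ∀ d b Q', (DR (.univ (Fin.last (m + 2)) (w : Fin (m + 1)).castSucc.castSucc)
      (Fin.snoc (Fin.snoc (Fin.snoc v d : Fin (m + 1) → M) b : Fin (m + 2) → M) Q') ↔
      UnivC (ext Q')) := by
    intro d b Q'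
    rw [dr_univ (by simpa using hw)]
    simp
  simp only [h4]
  constructor
  · intro H d hd b hb hpi
    have hdI := hcl hu d hd
    obtain ⟨Q', hQ', ⟨h5, h6⟩, h7, h8⟩ := H d hdI ((h1 d (hI d hdI)).2 hd) b hb ((h2 d b hb).2 hpi)
    exact ⟨Q', hQ', h5, h8, h6, (h3 d b Q' hQ' h5 h6).1 h7⟩
  · intro H d hdI hd b hb hpi
    obtain ⟨Q', hQ', h5, h8, h6, h7⟩ := H d ((h1 d (hI d hdI)).1 hd) b hb ((h2 d b hb).1 hpi)
    exact ⟨Q', hQ', ⟨h5, h6⟩, (h3 d b Q' hQ' h5 h6).2 h7, h8⟩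

theorem exists_hier_of_adm (hR : RelAbs R RS F Idx) (i : ℕ) {A B SB D I : M} (hB : Adm B SB)
    [hA : World (ext A)] (hAB : Mem A B) (hD : Mem D A) (hTr : IsTr D) (hIB : Mem I B)
    (hI : ∀ c, Mem c I → Mem c A) (hIdx : ∀ c, Idx c → Mem c I) (ok : TrOK (ext A) (ext D)) :
    ∃ H, Mem H B ∧ Hier i RS D I H := by
  have hstep : ∀ Q, Mem Q D → ∀ c, Mem c I → ∀ H,
      (Step (D0.hierStep i R (0 : Fin 6) 1 2 3 4 5) ![A, I, om M] Q c H ↔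
        (UnivC (ext Q) → ∀ d, RS (ext Q) d c → Mahlo i (ext Q) fun Q' => Mem (op Q' d) H)) := by
    intro Q hQ c hc H
    have : World (ext ((Fin.snoc (Fin.snoc (Fin.snoc ![A, I, om M] Q : Fin 4 → M) c :
      Fin 5 → M) H : Fin 6 → M) 0)) := hA
    exact dr_hierStep hR (A := (0 : Fin 6)) (I := 1) (w := 2) (Q := 3) (c := 4) (H := 5)
      (v := Fin.snoc (Fin.snoc (Fin.snoc ![A, I, om M] Q : Fin 4 → M) c : Fin 5 → M) H) rfl
      (hA.trans _ hD _ hQ) (hI c hc) hI (fun _ => ok.mono fun x hx => hTr _ hQ _ hx)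
      (fun _ d hd => hIdx d (hR.idx hd))
  obtain ⟨H, hH, h⟩ := exists_recursion (step := D0.hierStep i R (0 : Fin 6) 1 2 3 4 5)
    (v := ![A, I, om M]) (D := D) (I := I) (by
      -- Locality: the Mahlo condition at `Q` reads the hierarchy only at elements of `Q` and at
      -- indices in `I`.
      intro Q hQ c hc H H' hHH
      rw [hstep Q hQ c hc, hstep Q hQ c hc]
      refine imp_congr_right fun hu => forall₂_congr fun d hd => Mahlo.congr fun Q' hQ' _ => ?_
      exact hHH Q' (hTr _ hQ _ hQ') (Or.inl hQ') d (hIdx d (hR.idx hd))) hB hAB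
    (fun j => by fin_cases j; exacts [hAB, hIB, hB.om]) hD hIB hI
  refine ⟨H, hH, hTr, fun Q hQ hu c hc d hd => hIdx d (hR.idx hd), fun Q hQ hu c hc => ?_⟩
  rw [h Q hQ c hc, hstep Q hQ c hc]
  exact ⟨fun h => h hu, fun h _ => h⟩

/-- Hierarchies exist in limits of admissible sets. -/
theorem Lim.exists_hier (hR : RelAbs R RS F Idx) (i : ℕ) {U : Set M} [hU : Lim U] {x : M}
    (hx : x ∈ U) : ∃ D ∈ U, ∃ I ∈ U, ∃ H ∈ U, Mem x D ∧ (∀ c, Mem c I ↔ Idx c) ∧ Hier i RS D I H ∧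
      ∃ S ∈ U, IsSat D S := by
  -- Three nested admissible sets are used. `D` contains `x`. `A` contains `D` with its satisfaction
  -- relation, so that Π_i-truth in elements of `D` is `Δ₀` in `A`. The recursion itself takes place
  -- in `B`, which has `A` as an element.
  obtain ⟨D, hD, S, hS, hxD, hDa⟩ := Lim.exists_adm_of_mem hx
  obtain ⟨A, hA, SA, hSA, h1, h2, hAa⟩ := hU.adm D hD S hS
  obtain ⟨B, hB, SB, hSB, hAB, hBa⟩ := Lim.exists_adm_of_mem hA
  have hAw := hAa.world
  obtain ⟨I, hI, hIm⟩ := hBa.exists_sep (n := 1) (relD0 0 Empty.elim ![1] (F 1 0)) ![A]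
    (fun i => by fin_cases i; exact hAB) hAB
  have hIm' : ∀ c, Mem c I ↔ Mem c A ∧ Idx c := by
    intro c
    rw [hIm]
    refine and_congr_right fun hc => ?_
    rw [dr_rel (M := M) _ _ _ _ (fun i => by rw [Fin.fin_one_eq_zero i]; exact hc)]
    have : World (ext ((Fin.snoc ![A] c : Fin 2 → M) 0)) := hAw
    rw [hR.tr_idx]
    rfl
  have hIm'' : ∀ c, Mem c I ↔ Idx c := fun c => (hIm' c).trans
    ⟨fun h => h.2, fun h => ⟨hR.std h (ext A) hAw, h⟩⟩
  obtain ⟨H, hH, h⟩ := exists_hier_of_adm hR i hBa hAB h1 hDa.tr hI (fun c hc => ((hIm' c).1 hc).1)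
    (fun c hc => (hIm'' c).2 hc) (TrOK.of_sat h1 h2 hDa.tr hDa.sat)
  exact ⟨D, hD, I, hU.trans _ hB _ hI, H, hU.trans _ hB _ hH, hxD, hIm'', h, S, hS, hDa.sat⟩

/-- The recursion equation for the iterated Mahlo operation. -/
theorem iter_rec (hR : RelAbs R RS F Idx) {i : ℕ} {Q c : M} (hQ : UnivC (ext Q)) (hc : Idx c) :
    Iter i RS Q c ↔ ∀ d, RS (ext Q) d c → Mahlo i (ext Q) fun Q' => Iter i RS Q' d := by
  obtain ⟨D, -, I, -, H, -, hQD, hI, h, -⟩ := Lim.exists_hier hR i (U := Set.univ) (x := Q) trivial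
  rw [h.iter_iff hQD hQ ((hI c).2 hc), h.step Q hQD hQ c ((hI c).2 hc)]
  refine forall₂_congr fun d hd => Mahlo.congr fun Q' hQ' hu' => ?_
  exact (h.iter_iff (h.tr _ hQD _ hQ') hu' ((hI d).2 (hR.idx hd))).symm

def iterF (i : ℕ) (R : DefRel) (F : ∀ n : ℕ, Fin n → Fm n) {n : ℕ} (Q c : Fin n) : Fm n :=
  isUniv Q ⋏ F n c ⋏ ex fun D => ex fun I => ex fun H => ex fun S =>
    isSat D S ⋏ isHier i R D I H ⋏ mem Q D ⋏ mem c I ⋏ pairIn H Q c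

theorem tr_iterF (hR : RelAbs R RS F Idx) {i : ℕ} {U : Set M} [hU : World U] {n : ℕ}
    {v : Fin n → ↥U} {Q c : Fin n} : Tr (iterF i R F Q c) v ↔ UnivC (ext (v Q : M)) ∧
      Idx (v c) ∧ ∃ D ∈ U, ∃ I ∈ U, ∃ H ∈ U, ∃ S ∈ U, IsSat D S ∧ Hier i RS D I H ∧
        Mem (v Q : M) D ∧ Mem (v c : M) I ∧ Mem (op (v Q : M) (v c)) H := by
  rw [iterF, tr_and, tr_and, tr_isUniv, hR.tr_idx]
  refine and_congr_right fun hu => and_congr_right fun hi => ?_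
  simp only [tr_ex, tr_and, tr_isSat, tr_mem, tr_pairIn, Fin.snoc_castSucc, Fin.snoc_last, mem_coe]
  have key : ∀ D I H S : ↥U, IsSat (D : M) S →
      (Tr (isHier i R (Fin.last n).castSucc.castSucc.castSucc (Fin.last (n + 1)).castSucc.castSucc
        (Fin.last (n + 2)).castSucc) (Fin.snoc (Fin.snoc (Fin.snoc (Fin.snoc v D :
          Fin (n + 1) → ↥U) I : Fin (n + 2) → ↥U) H : Fin (n + 3) → ↥U) S) ↔
        Hier i RS (D : M) I H) := by
    intro D I H S hs
    rw [tr_isHier hR]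
    · simp
    · intro hT
      simp only [Fin.snoc_castSucc, Fin.snoc_last] at hT ⊢
      exact TrOK.of_sat D.2 S.2 hT hs
  constructor
  · rintro ⟨D, I, H, S, h1, h2, h3⟩
    exact ⟨D, D.2, I, I.2, H, H.2, S, S.2, h1, (key D I H S h1).1 h2, h3⟩
  · rintro ⟨D, hD, I, hI, H, hH, S, hS, h1, h2, h3⟩
    exact ⟨⟨D, hD⟩, ⟨I, hI⟩, ⟨H, hH⟩, ⟨S, hS⟩, h1,
      (key ⟨D, hD⟩ ⟨I, hI⟩ ⟨H, hH⟩ ⟨S, hS⟩ h1).2 h2, h3⟩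

/-- A world containing a hierarchy, its domain and index set, and a satisfaction relation for the
domain is a witness. By uniqueness any hierarchy decides the matter, provided `Q` is a universe and
the index is admitted; hence the two extra conjuncts. -/
theorem si_iter (hR : RelAbs R RS F Idx) (i : ℕ) : SiP (M := M) Lim 1 2 fun _ v =>
    UnivC (ext (v 0)) ∧ Idx (v 1) ∧ Iter i RS (v 0) (v 1) := by
  refine SiP.of_world (R := fun v => UnivC (ext (v 0)) ∧ Idx (v 1) ∧ Iter i RS (v 0) (v 1))
    (iterF i R F 0 1) ?_ ?_
  · intro W _ v h
    obtain ⟨h1, h2, D, -, I, -, H, -, S, -, -, h⟩ := (tr_iterF hR).1 h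
    exact ⟨h1, h2, D, I, H, h⟩
  · rintro U hU v hv ⟨h1, h2, h3⟩
    obtain ⟨D, hD, I, hI, H, hH, hx, hIm, h, S, hS, hs⟩ := Lim.exists_hier hR i (hv 0)
    obtain ⟨K, hK, SK, -, h4, h5⟩ := Lim.exists_adm_tup (U := U) (v := ![D, I, H, S, v 0, v 1])
      (fun j => by fin_cases j; exacts [hD, hI, hH, hS, hv 0, hv 1])
    have hw := h4.world
    refine ⟨K, hK, hw, fun j => by fin_cases j; exacts [h5 4, h5 5], (tr_iterF hR).2
      ⟨h1, h2, D, h5 0, I, h5 1, H, h5 2, S, h5 3, hs, h, hx, (hIm _).2 h2, ?_⟩⟩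
    exact (h.iter_iff hx h1 ((hIm _).2 h2)).1 h3

theorem tr_iterMahloSet (hR : RelAbs R RS F Idx) {i n : ℕ}
    {v : Fin n → ↥(Set.univ : Set M)} {P a : Fin n} :
    Tr (iterMahloSet i R P a) v ↔ Iter i RS (v P : M) (v a) := by
  simp only [iterMahloSet, tr_ex, tr_and, tr_isHier hR (fun _ => TrOK.univ _), tr_mem, tr_pairIn,
    Fin.snoc_castSucc, Fin.snoc_last, mem_coe]
  constructor
  · rintro ⟨D, I, H, h⟩; exact ⟨D, I, H, h⟩
  · rintro ⟨D, I, H, h⟩; exact ⟨⟨D, trivial⟩, ⟨I, trivial⟩, ⟨H, trivial⟩, h⟩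

end

end SetTh

namespace SetTh

variable {M : Type} [setLang.Structure M] [KPM M]

/-! ### Syntactic `Σₖ`- and `Πₖ`-formulas -/

theorem evB_ex {W : Set M} {α : Type} {w : α → M} {k : ℕ} {φ : setLang.BoundedFormula α (k + 1)}
    {xs : Fin k → M} : EvB W w (∃' φ) xs ↔ ∃ x ∈ W, EvB W w φ (Fin.snoc xs x) := by
  show ((∀ x ∈ W, (EvB W w φ (Fin.snoc xs x) → False)) → False) ↔ _
  constructor
  · intro h
    by_contra hn
    exact h fun x hx hf => hn ⟨x, hx, hf⟩
  · rintro ⟨x, hx, h⟩ H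
    exact H x hx h

variable (M) in
mutual
theorem IsSigma.siP {α : Type} {n k : ℕ} {φ : setLang.BoundedFormula α n} (h : IsSigma k φ)
    {m : ℕ} (i0 : Fin m) (f : α → Fin m) (g : Fin n → Fin m) :
    SiP (M := M) UnivC k m fun U v => EvB U (v ∘ f) φ (v ∘ g) := by
  match h with
  | .delta0 hd =>
    obtain ⟨d, hd⟩ := hd.exists_D0 (M := M) i0 f g
    exact .d0 d.neg fun U hU v hv => by
      rw [dr_neg]; exact not_congr (hd U hU.trans v hv)
  | .ofPi hp => exact (IsPi.piP hp i0 f g).si (Nat.lt_succ_self _)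
  | .ex hs =>
    refine SiP.congr (p := fun U v => ∃ x ∈ U, _) (SiP.ex (Nat.succ_pos _)
      ((IsSigma.siP hs i0.castSucc (Fin.castSucc ∘ f)
        (Fin.snoc (α := fun _ => Fin (m + 1)) (Fin.castSucc ∘ g) (Fin.last m))).congr
        (q := fun U v => EvB U (Fin.init v ∘ f) _ (Fin.snoc (Fin.init v ∘ g) (v (Fin.last m))))
        fun U hU v hv => ?_)) fun U hU v hv => evB_ex
    apply iff_of_eq
    congr 1
    funext i
    refine Fin.lastCases ?_ (fun j => ?_) i <;> simp [Fin.init]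
theorem IsPi.piP {α : Type} {n k : ℕ} {φ : setLang.BoundedFormula α n} (h : IsPi k φ)
    {m : ℕ} (i0 : Fin m) (f : α → Fin m) (g : Fin n → Fin m) :
    PiP (M := M) UnivC k m fun U v => EvB U (v ∘ f) φ (v ∘ g) := by
  match h with
  | .delta0 hd =>
    obtain ⟨d, hd⟩ := hd.exists_D0 (M := M) i0 f g
    exact .d0 d fun U hU v hv => hd U hU.trans v hv
  | .ofSigma hp => exact (IsSigma.siP hp i0 f g).pi (Nat.lt_succ_self _)
  | .all hs =>
    refine PiP.congr (p := fun U v => ∀ x ∈ U, _) (PiP.all (Nat.succ_pos _)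
      ((IsPi.piP hs i0.castSucc (Fin.castSucc ∘ f)
        (Fin.snoc (α := fun _ => Fin (m + 1)) (Fin.castSucc ∘ g) (Fin.last m))).congr
        (q := fun U v => EvB U (Fin.init v ∘ f) _ (Fin.snoc (Fin.init v ∘ g) (v (Fin.last m))))
        fun U hU v hv => ?_)) fun U hU v hv => Iff.rfl
    apply iff_of_eq
    congr 1
    funext i
    refine Fin.lastCases ?_ (fun j => ?_) i <;> simp [Fin.init]
end

/-- `Σ₁`-predicates are upward persistent. -/
theorem SiP.persistent {n : ℕ} {p : UPred M n} (hp : SiP UnivC 1 n p) {X Y : Set M}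
    (hX : UnivC X) (hY : UnivC Y) (hXY : X ⊆ Y) {v : Fin n → M} (hv : ∀ i, v i ∈ X)
    (h : p X v) : p Y v := by
  have key : ∀ {k n : ℕ} {q : UPred M n}, PiP UnivC k n q → k ≤ 1 → ∀ v : Fin n → M,
      (∀ i, v i ∈ X) → q Y v → q X v := by
    intro k n q hq
    induction hq with
    | d0 d hd =>
      intro _ v hv h
      exact (hd X hX v hv).2 ((hd Y hY v fun i => hXY (hv i)).1 h)
    | @neg k n p q hq hd ih =>
      intro hk v hv h
      obtain rfl : k = 0 := by omega
      cases hq with | d0 d hd' =>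
      rw [hd X hX v hv, hd' X hX v hv]
      rw [hd Y hY v fun i => hXY (hv i), hd' Y hY v fun i => hXY (hv i)] at h
      exact h
    | allC hq hd ih =>
      intro hk v hv h
      rw [hd X hX v hv]
      rw [hd Y hY v fun i => hXY (hv i)] at h
      exact fun x hx => ih hk _ (forall_snoc_mem hv hx) (h x (hXY hx))
  by_contra hn
  exact key hp le_rfl v hv hn h

/-! ### Relations on `ω` -/

/-- The relation on `ω` defined by `φ` in `X`. -/
def NRel (φ : setLang.Formula (Fin 2)) (X : Set M) (x y : M) : Prop :=
  Mem x (om M) ∧ Mem y (om M) ∧ Ev X φ ![x, y]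

@[simp] theorem tr_natRel {φ : setLang.Formula (Fin 2)} {U : Set M} [hU : World U] {n : ℕ}
    {v : Fin n → ↥U} {V : Univ n} {x y : Fin n} :
    Tr (natRel φ n V x y) v ↔ NRel φ (Univ.sem v V) (v x : M) (v y) := by
  rw [natRel, tr_and, tr_and, tr_isNat, tr_isNat, tr_relTo hU.trans, NRel]
  have : (fun a => ((v (![x, y] a) : ↥U) : M)) = ![(v x : M), (v y : M)] := by
    funext a; fin_cases a <;> rfl
  rw [this]

theorem relAbs_natRel (φ : setLang.Formula (Fin 2)) :
    RelAbs (M := M) (natRel φ) (NRel φ) (fun _ x => isNat x) (fun x => Mem x (om M)) where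
  tr U hU n v V x y _ := tr_natRel
  idx h := h.1
  std h := fun W _ => World.nat_mem h
  tr_idx U hU n v x := tr_isNat

theorem abs_nat : SiP (M := M) Lim 1 1 (fun _ v => Mem (v 0) (om M)) ∧
    PiP (M := M) Lim 1 1 (fun _ v => Mem (v 0) (om M)) :=
  ⟨SiP.of_abs (R := fun v => Mem (v 0) (om M)) (isNat 0) fun W _ v => tr_isNat,
    PiP.of_abs (R := fun v => Mem (v 0) (om M)) (isNat 0) fun W _ v => tr_isNat⟩

theorem ev_iff_evB {φ : setLang.Formula (Fin 2)} {X : Set M} {v : Fin 2 → M} :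
    Ev X φ ![v 0, v 1] ↔ EvB X (v ∘ id) φ (v ∘ Fin.elim0) := by
  unfold Ev
  apply iff_of_eq
  congr 1
  · funext i; fin_cases i <;> rfl
  · exact Subsingleton.elim _ _

theorem si_nrel {φ : setLang.Formula (Fin 2)} {k : ℕ} (hk : 0 < k) (h : IsSigma k φ) :
    SiP (M := M) Lim k 2 fun U v => NRel φ U (v 0) (v 1) := by
  refine SiP.and Lim.univC ((abs_nat.1.rename (![0] : Fin 1 → Fin 2)).le hk)
    (SiP.and Lim.univC ((abs_nat.1.rename (![1] : Fin 1 → Fin 2)).le hk) ?_)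
  exact SiP.congr (PiP.mono (h.siP M (0 : Fin 2) id Fin.elim0) Lim.univC)
    fun U _ v _ => ev_iff_evB

theorem pi_nrel {φ : setLang.Formula (Fin 2)} {k : ℕ} (hk : 0 < k) (h : IsPi k φ) :
    PiP (M := M) Lim k 2 fun U v => NRel φ U (v 0) (v 1) := by
  refine PiP.and Lim.univC ((abs_nat.2.rename (![0] : Fin 1 → Fin 2)).le hk)
    (PiP.and Lim.univC ((abs_nat.2.rename (![1] : Fin 1 → Fin 2)).le hk) ?_)
  exact PiP.congr (PiP.mono (h.piP M (0 : Fin 2) id Fin.elim0) Lim.univC)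
    fun U _ v _ => ev_iff_evB

theorem NRel.mono {φ : setLang.Formula (Fin 2)} (h : IsSigma 1 φ) {X Y : Set M} (hX : UnivC X)
    (hY : UnivC Y) (hXY : X ⊆ Y) {x y : M} (hr : NRel φ X x y) : NRel φ Y x y := by
  refine ⟨hr.1, hr.2.1, ?_⟩
  have hom : ∀ i, ![x, y] i ∈ X := fun i => by
    fin_cases i
    · exact hX.trans _ hX.om_mem _ hr.1
    · exact hX.trans _ hX.om_mem _ hr.2.1
  have := SiP.persistent (h.siP M (0 : Fin 2) id Fin.elim0) hX hY hXY hom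
    ((ev_iff_evB (v := ![x, y])).1 hr.2.2)
  exact (ev_iff_evB (v := ![x, y])).2 this

theorem NRel.trans {φ : setLang.Formula (Fin 2)} (h : KPl ⊨ᵇ transSentence φ) {U : Set M}
    [hU : Lim U] {x y z : M} (h1 : NRel φ U x y) (h2 : NRel φ U y z) : NRel φ U x z := by
  have := Lim.tr_of_models (U := U) h default
  simp only [transSentence, tr_all, tr_imp, tr_and, tr_natRel, sem_L, Fin.snoc_castSucc,
    Fin.snoc_last] at this
  exact this ⟨x, World.nat_mem h1.1⟩ ⟨y, World.nat_mem h1.2.1⟩ ⟨z, World.nat_mem h2.2.1⟩ ⟨h1, h2⟩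

/-- `U` is itself a model of KPℓ, so the provable equivalence holds in `U`; this is what makes <₁^U
a `Π₂`-predicate as well as a `Σ₂`-predicate. -/
theorem NRel.iff_of_same {φ ψ : setLang.Formula (Fin 2)} (h : KPl ⊨ᵇ sameRelSentence φ ψ)
    {U : Set M} [hU : Lim U] {x y : M} : NRel φ U x y ↔ NRel ψ U x y := by
  have := Lim.tr_of_models (U := U) h default
  simp only [sameRelSentence, tr_all, tr_iff, tr_natRel, sem_L, Fin.snoc_castSucc,
    Fin.snoc_last] at this
  constructor
  · intro h1
    exact (this ⟨x, World.nat_mem h1.1⟩ ⟨y, World.nat_mem h1.2.1⟩).1 h1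
  · intro h1
    exact (this ⟨x, World.nat_mem h1.1⟩ ⟨y, World.nat_mem h1.2.1⟩).2 h1

/-! ### The exponential ordering -/

/-- `α(j) = (x, y)` -/
def Ent (α j x y : M) : Prop := Mem (op j (op x y)) α

/-- `α` is a finite sequence of pairs of natural numbers. -/
def PSeq (α : M) : Prop :=
  ∃ l, IsSeq α l ∧ ∀ j, Mem j l → ∃ x y, Mem x (om M) ∧ Mem y (om M) ∧ Ent α j x y

def isPSeq {n : ℕ} (α : Fin n) : Fm n :=
  ex fun l => isSeq α l ⋏
    allIn l fun j => ex fun x => ex fun y => isNat x ⋏ isNat y ⋏ entry α j x y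

/-- `α(j) = β(j)` for all `j ∈ k`. -/
def Agree (α β k : M) : Prop := ∀ j, Mem j k → ∃ p, Mem (op j p) α ∧ Mem (op j p) β

section Semantics
variable (σ₁ σ₀ : setLang.Formula (Fin 2)) (X : Set M)

def ExpSeq (α : M) : Prop :=
  PSeq α ∧ ∀ j x y x' y', Ent α j x y → Ent α (sc j) x' y' → NRel σ₁ X x' x

def Lex (x₁ x₀ y₁ y₀ : M) : Prop := NRel σ₁ X x₁ y₁ ∨ (x₁ = y₁ ∧ NRel σ₀ X x₀ y₀)

def ExpLt (α β : M) : Prop :=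
  ExpSeq σ₁ X α ∧ ExpSeq σ₁ X β ∧
  ((∃ k x₁ x₀ y₁ y₀, Agree α β k ∧ Ent α k x₁ x₀ ∧ Ent β k y₁ y₀ ∧ Lex σ₁ σ₀ X x₁ x₀ y₁ y₀) ∨
    ∃ l m, IsSeq α l ∧ IsSeq β m ∧ Mem l m ∧ Agree α β l)

/-- `a ∈ W^X(<₀)` -/
def Wf (a : M) : Prop := Mem a (om M) ∧ ∀ f ∈ X, Baire f → Mem (op (zero M) a) f →
  ∃ k u w, Mem k (om M) ∧ Mem (op k u) f ∧ Mem (op (sc k) w) f ∧ ¬ NRel σ₀ X w u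

def SecWf (α : M) : Prop := ∀ j x y, Ent α j x y → Wf σ₀ X y

def EW (α β : M) : Prop := ExpLt σ₁ σ₀ X α β ∧ SecWf σ₀ X α ∧ SecWf σ₀ X β

end Semantics

theorem TransC.of_ent {U : Set M} (hU : TransC U) {α j x y : M} (hα : α ∈ U) (h : Ent α j x y) :
    j ∈ U ∧ x ∈ U ∧ y ∈ U := by
  have h1 := hU _ hα _ h
  exact ⟨hU.left_mem h1, hU.left_mem (hU.right_mem h1), hU.right_mem (hU.right_mem h1)⟩

theorem PSeq.nat {α j x y : M} (h : PSeq α) (he : Ent α j x y) :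
    Mem j (om M) ∧ Mem x (om M) ∧ Mem y (om M) := by
  obtain ⟨l, hl, h⟩ := h
  have hj := hl.mem_len he
  obtain ⟨x', y', h1, h2, h3⟩ := h j hj
  have := hl.val_unique he h3
  rw [op_inj] at this
  rw [this.1, this.2]
  exact ⟨mem_om_of_mem hl.1 hj, h1, h2⟩

theorem PSeq.mem_world {α : M} (h : PSeq α) {W : Set M} [hW : World W] : α ∈ W := by
  obtain ⟨l, hl, h'⟩ := id h
  refine World.seq_mem ⟨l, hl, fun j hj => ?_⟩
  obtain ⟨x, y, h1, h2, h3⟩ := h' j hj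
  exact ⟨op x y, World.op_mem (World.nat_mem h1) (World.nat_mem h2), h3⟩

section Eval
variable {σ₁ σ₀ : setLang.Formula (Fin 2)} {U : Set M} [hU : World U] {n : ℕ} {v : Fin n → ↥U}

@[simp] theorem tr_entry {α j x y : Fin n} :
    Tr (entry α j x y) v ↔ Ent (v α : M) (v j) (v x) (v y) := by
  simp only [entry, tr_ex, tr_and, tr_isOPair, tr_pairIn, Fin.snoc_castSucc, Fin.snoc_last]
  exact exists_coe_eq (World.op_mem (v x).2 (v y).2) (r := fun p => Mem (op (v j : M) p) (v α))

@[simp] theorem tr_isPSeq {α : Fin n} : Tr (isPSeq α) v ↔ PSeq (v α : M) := by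
  simp only [isPSeq, tr_ex, tr_and, tr_isSeq, tr_allIn, tr_isNat, tr_entry, Fin.snoc_castSucc,
    Fin.snoc_last, mem_coe]
  constructor
  · rintro ⟨l, hl, h⟩
    refine ⟨l, hl, fun j hj => ?_⟩
    obtain ⟨x, y, h⟩ := h ⟨j, hU.trans _ l.2 _ hj⟩ hj
    exact ⟨x, y, h⟩
  · rintro ⟨l, hl, h⟩
    refine ⟨⟨l, World.nat_mem hl.1⟩, hl, fun j hj => ?_⟩
    obtain ⟨x, y, h1, h2, h3⟩ := h j hj
    exact ⟨⟨x, World.nat_mem h1⟩, ⟨y, World.nat_mem h2⟩, h1, h2, h3⟩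

@[simp] theorem tr_agreeAt {α β j : Fin n} : Tr (agreeAt α β j) v ↔
    ∃ p, Mem (op (v j : M) p) (v α) ∧ Mem (op (v j : M) p) (v β) := by
  simp only [agreeAt, tr_ex, tr_and, tr_pairIn, Fin.snoc_castSucc, Fin.snoc_last]
  constructor
  · rintro ⟨p, h⟩; exact ⟨p, h⟩
  · rintro ⟨p, h⟩
    exact ⟨⟨p, hU.trans.right_mem (hU.trans _ (v α).2 _ h.1)⟩, h⟩

@[simp] theorem tr_agree {α β k : Fin n} :
    Tr (allIn k fun j => agreeAt (α : Fin (n + 1)) β j) v ↔ Agree (v α : M) (v β) (v k) := by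
  simp only [tr_allIn, tr_agreeAt, Fin.snoc_castSucc, Fin.snoc_last, mem_coe]
  exact forall_mem_coe hU.trans (v k).2
    (p := fun j => ∃ p, Mem (op j p) (v α : M) ∧ Mem (op j p) (v β : M))

@[simp] theorem tr_isExpSeq {V : Univ n} {α : Fin n} :
    Tr (isExpSeq (natRel σ₁) V α) v ↔ ExpSeq σ₁ (Univ.sem v V) (v α : M) := by
  rw [isExpSeq, tr_and]
  refine and_congr tr_isPSeq ?_
  simp only [tr_all, tr_imp, tr_and, tr_isSucc, tr_entry, tr_natRel, sem_map, snoc_comp_castSucc,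
    Fin.snoc_castSucc, Fin.snoc_last]
  constructor
  · intro H j x y x' y' h h'
    obtain ⟨h1, h2, h3⟩ := hU.trans.of_ent (v α).2 h
    obtain ⟨h1', h2', h3'⟩ := hU.trans.of_ent (v α).2 h'
    exact H ⟨j, h1⟩ ⟨sc j, h1'⟩ ⟨x, h2⟩ ⟨y, h3⟩ ⟨x', h2'⟩ ⟨y', h3'⟩ ⟨rfl, h, h'⟩
  · rintro H j j' x y x' y' ⟨h, h1, h2⟩
    rw [h] at h2
    exact H j x y x' y' h1 h2

theorem tr_expRel {V : Univ n} {α β : Fin n} :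
    Tr (expRel (natRel σ₁) (natRel σ₀) V α β) v ↔ ExpLt σ₁ σ₀ (Univ.sem v V) (v α : M) (v β) := by
  rw [expRel, tr_and, tr_and, tr_isExpSeq, tr_isExpSeq, tr_or]
  refine and_congr Iff.rfl (and_congr Iff.rfl (or_congr ?_ ?_))
  · simp only [lexRel, tr_ex, tr_and, tr_agree, tr_or, tr_eq, tr_entry, tr_natRel, sem_map,
      snoc_comp_castSucc, Fin.snoc_castSucc, Fin.snoc_last, Subtype.ext_iff]
    constructor
    · rintro ⟨k, h1, x₁, x₀, y₁, y₀, h2⟩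
      exact ⟨k, x₁, x₀, y₁, y₀, h1, h2⟩
    · rintro ⟨k, x₁, x₀, y₁, y₀, h1, h2, h3, h4⟩
      obtain ⟨a1, a2, a3⟩ := hU.trans.of_ent (v α).2 h2
      obtain ⟨-, b2, b3⟩ := hU.trans.of_ent (v β).2 h3
      exact ⟨⟨k, a1⟩, h1, ⟨x₁, a2⟩, ⟨x₀, a3⟩, ⟨y₁, b2⟩, ⟨y₀, b3⟩, h2, h3, h4⟩
  · simp only [tr_ex, tr_and, tr_agree, tr_isSeq, tr_mem, Fin.snoc_castSucc, Fin.snoc_last, mem_coe]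
    constructor
    · rintro ⟨l, m, h⟩; exact ⟨l, m, h⟩
    · rintro ⟨l, m, h⟩
      exact ⟨⟨l, World.nat_mem h.1.1⟩, ⟨m, World.nat_mem h.2.1.1⟩, h⟩

@[simp] theorem tr_wfPart {V : Univ n} {a : Fin n} :
    Tr (wfPart (natRel σ₀) V a) v ↔ Wf σ₀ (Univ.sem v V) (v a : M) := by
  rw [wfPart, tr_and, tr_isNat, Wf]
  refine and_congr_right fun _ => ?_
  simp only [tr_allU, tr_imp, tr_ex, tr_and, tr_neg, tr_isBaire, tr_isNat, tr_isEmpty, tr_isSucc,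
    tr_pairIn, tr_natRel, sem_map, snoc_comp_castSucc, Fin.snoc_castSucc, Fin.snoc_last]
  have e : ∀ f : ↥U, (∃ z : ↥U, (z : M) = zero M ∧ Mem (op (z : M) (v a)) f) ↔
      Mem (op (zero M) (v a)) (f : M) := fun f =>
    exists_coe_eq World.zero_mem (r := fun z => Mem (op z (v a : M)) f)
  simp only [e]
  constructor
  · intro H f hf hb h0
    obtain ⟨k, hk, H⟩ := H ⟨f, sem_subset hU.trans _ _ hf⟩ hf hb
    obtain ⟨k', u, w, h1, h2, h3, h4⟩ := H h0
    rw [h1] at h3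
    exact ⟨k, u, w, hk, h2, h3, h4⟩
  · intro H f hf hb
    by_cases h0 : Mem (op (zero M) (v a)) (f : M)
    · obtain ⟨k, u, w, hk, h2, h3, h4⟩ := H f hf hb h0
      have g2 := hU.trans _ f.2 _ h2
      have g3 := hU.trans _ f.2 _ h3
      exact ⟨⟨k, hU.trans.left_mem g2⟩, hk, fun _ => ⟨⟨sc k, hU.trans.left_mem g3⟩,
        ⟨u, hU.trans.right_mem g2⟩, ⟨w, hU.trans.right_mem g3⟩, rfl, h2, h3, h4⟩⟩
    · exact ⟨⟨zero M, World.zero_mem⟩, zero_mem_om, fun h => (h0 h).elim⟩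

theorem tr_secondsWf {V : Univ n} {α : Fin n} :
    Tr (secondsWf (natRel σ₀) V α) v ↔ SecWf σ₀ (Univ.sem v V) (v α : M) := by
  simp only [secondsWf, tr_all, tr_imp, tr_entry, tr_wfPart, sem_map, snoc_comp_castSucc,
    Fin.snoc_castSucc, Fin.snoc_last]
  constructor
  · intro H j x y h
    obtain ⟨h1, h2, h3⟩ := hU.trans.of_ent (v α).2 h
    exact H ⟨j, h1⟩ ⟨x, h2⟩ ⟨y, h3⟩ h
  · exact fun H j x y h => H j x y h

end Eval

theorem relAbs_expWRel (σ₁ σ₀ : setLang.Formula (Fin 2)) :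
    RelAbs (M := M) (expWRel (natRel σ₁) (natRel σ₀)) (EW σ₁ σ₀) (fun _ x => isPSeq x) PSeq where
  tr U hU n v V x y _ := by
    rw [expWRel, tr_and, tr_and, tr_expRel, tr_secondsWf, tr_secondsWf, EW]
  idx h := h.1.1.1
  std h := fun W _ => h.mem_world
  tr_idx U hU n v x := tr_isPSeq

end SetTh

namespace SetTh

variable {M : Type} [setLang.Structure M] [KPM M]

/-! ### The complexity of the exponential ordering -/

section Leaves

theorem abs_ent : SiP (M := M) Lim 1 4 (fun _ v => Ent (v 0) (v 1) (v 2) (v 3)) ∧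
    PiP (M := M) Lim 1 4 (fun _ v => Ent (v 0) (v 1) (v 2) (v 3)) :=
  ⟨SiP.of_abs (R := fun v => Ent (v 0) (v 1) (v 2) (v 3)) (entry 0 1 2 3) fun W _ v => tr_entry,
    PiP.of_abs (R := fun v => Ent (v 0) (v 1) (v 2) (v 3)) (entry 0 1 2 3) fun W _ v => tr_entry⟩

theorem abs_ent_sc : SiP (M := M) Lim 1 4 (fun _ v => Ent (v 0) (sc (v 1)) (v 2) (v 3)) := by
  refine SiP.of_abs (R := fun v => Ent (v 0) (sc (v 1)) (v 2) (v 3))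
    (ex fun j => isSucc ((1 : Fin 4) : Fin 5) j ⋏ entry ((0 : Fin 4) : Fin 5) j
      ((2 : Fin 4) : Fin 5) ((3 : Fin 4) : Fin 5)) fun W hW v => ?_
  simp only [tr_ex, tr_and, tr_isSucc, tr_entry, Fin.snoc_castSucc, Fin.snoc_last]
  exact exists_coe_eq (World.sc_mem (v 1).2)
    (r := fun j => Ent (v 0 : M) j (v 2) (v 3))

theorem abs_mem : SiP (M := M) Lim 1 2 (fun _ v => Mem (v 0) (v 1)) ∧
    PiP (M := M) Lim 1 2 (fun _ v => Mem (v 0) (v 1)) :=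
  ⟨SiP.of_abs (R := fun v => Mem (v 0) (v 1)) (mem 0 1) fun W _ v => by rw [tr_mem, mem_coe],
    PiP.of_abs (R := fun v => Mem (v 0) (v 1)) (mem 0 1) fun W _ v => by rw [tr_mem, mem_coe]⟩

theorem si_eq : SiP (M := M) Lim 1 2 fun _ v => v 0 = v 1 :=
  SiP.of_abs (R := fun v => v 0 = v 1) (eq 0 1) fun W _ v => by rw [tr_eq, Subtype.ext_iff]

theorem pi_pSeq : PiP (M := M) Lim 1 1 fun _ v => PSeq (v 0) :=
  PiP.of_abs (R := fun v => PSeq (v 0)) (isPSeq 0) fun W _ v => tr_isPSeq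

theorem si_agree : SiP (M := M) Lim 1 3 fun _ v => Agree (v 0) (v 1) (v 2) :=
  SiP.of_abs (R := fun v => Agree (v 0) (v 1) (v 2))
    (allIn (2 : Fin 3) fun j => agreeAt ((0 : Fin 3) : Fin 4) ((1 : Fin 3) : Fin 4) j)
    fun W _ v => tr_agree

theorem si_isSeq : SiP (M := M) Lim 1 2 fun _ v => IsSeq (v 0) (v 1) :=
  SiP.of_abs (R := fun v => IsSeq (v 0) (v 1)) (isSeq 0 1) fun W _ v => tr_isSeq

end Leaves

section Firsts
variable {σ₁ π₁ : setLang.Formula (Fin 2)}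

theorem pi_rel₁ (hπ₁ : IsPi 2 π₁) (hΔ : KPl ⊨ᵇ sameRelSentence σ₁ π₁) :
    PiP (M := M) Lim 2 2 fun U v => NRel σ₁ U (v 0) (v 1) :=
  (pi_nrel two_pos hπ₁).congr fun U hU v hv => NRel.iff_of_same hΔ

theorem pi_expSeq (hπ₁ : IsPi 2 π₁) (hΔ : KPl ⊨ᵇ sameRelSentence σ₁ π₁) :
    PiP (M := M) Lim 2 1 fun U v => ExpSeq σ₁ U (v 0) := by
  refine PiP.congr (p := fun U v => PSeq (v 0) ∧ ∀ j ∈ U, ∀ x ∈ U, ∀ y ∈ U, ∀ x' ∈ U, ∀ y' ∈ U,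
    Ent (v 0) j x y → Ent (v 0) (sc j) x' y' → NRel σ₁ U x' x) (PiP.and Lim.univC
    (pi_pSeq.le one_le_two) (PiP.all two_pos (PiP.all two_pos (PiP.all two_pos (PiP.all two_pos
    (PiP.all two_pos (PiP.imp Lim.univC
      ((abs_ent.1.rename (![0, 1, 2, 3] : Fin 4 → Fin 6)).le one_le_two) (PiP.imp Lim.univC
      ((abs_ent_sc.rename (![0, 1, 4, 5] : Fin 4 → Fin 6)).le one_le_two)
      ((pi_rel₁ hπ₁ hΔ).rename (![4, 2] : Fin 2 → Fin 6)))))))))) ?_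
  intro U hU v hv
  refine and_congr_right fun _ => ⟨fun h j _ x _ y _ x' _ y' _ => h j x y x' y',
    fun h j x y x' y' h1 h2 => ?_⟩
  obtain ⟨a1, a2, a3⟩ := hU.trans.of_ent (hv 0) h1
  obtain ⟨b1, b2, b3⟩ := hU.trans.of_ent (hv 0) h2
  exact h j a1 x a2 y a3 x' b2 y' b3 h1 h2

end Firsts

/-- The first components of `δ` from the index `k` on are `<₁^X n`. -/
def FirstsLt (σ₁ : setLang.Formula (Fin 2)) (X : Set M) (δ k n : M) : Prop :=
  ∀ j x y, Ent δ j x y → ¬ Mem j k → NRel σ₁ X x n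

theorem pi_firstsLt {σ₁ π₁ : setLang.Formula (Fin 2)} (hπ₁ : IsPi 2 π₁)
    (hΔ : KPl ⊨ᵇ sameRelSentence σ₁ π₁) :
    PiP (M := M) Lim 2 3 fun U v => FirstsLt σ₁ U (v 0) (v 1) (v 2) := by
  refine PiP.congr (p := fun U v => ∀ j ∈ U, ∀ x ∈ U, ∀ y ∈ U,
    Ent (v 0) j x y → ¬ Mem j (v 1) → NRel σ₁ U x (v 2)) (PiP.all two_pos (PiP.all two_pos
    (PiP.all two_pos (PiP.imp Lim.univC
      ((abs_ent.1.rename (![0, 3, 4, 5] : Fin 4 → Fin 6)).le one_le_two) (PiP.imp Lim.univC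
      ((abs_mem.2.rename (![3, 1] : Fin 2 → Fin 6)).not.le one_le_two)
      ((pi_rel₁ hπ₁ hΔ).rename (![4, 2] : Fin 2 → Fin 6))))))) ?_
  intro U hU v hv
  refine ⟨fun h j _ x _ y _ => h j x y, fun h j x y h1 h2 => ?_⟩
  obtain ⟨a1, a2, a3⟩ := hU.trans.of_ent (hv 0) h1
  exact h j a1 x a2 y a3 h1 h2

/-- The comparison of entries is `Σ₂`, but membership in the domain is `Π₂`, so `Σ₃` is the common
bound. It fits into the premise of a `Πᵢ₊₁`-statement because `2 ≤ i`. -/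
theorem si_expLt {σ₁ π₁ σ₀ : setLang.Formula (Fin 2)} (hσ₁ : IsSigma 2 σ₁) (hπ₁ : IsPi 2 π₁)
    (hΔ : KPl ⊨ᵇ sameRelSentence σ₁ π₁) (hσ₀ : IsSigma 1 σ₀) :
    SiP (M := M) Lim 3 2 fun U v => ExpLt σ₁ σ₀ U (v 0) (v 1) := by
  have h3 : 0 < 3 := by norm_num
  have h13 : 1 ≤ 3 := by norm_num
  have e := (pi_expSeq (M := M) hπ₁ hΔ).si (l := 3) (by norm_num)
  refine SiP.congr (p := fun U v => ExpSeq σ₁ U (v 0) ∧ ExpSeq σ₁ U (v 1) ∧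
    ((∃ k ∈ U, ∃ x₁ ∈ U, ∃ x₀ ∈ U, ∃ y₁ ∈ U, ∃ y₀ ∈ U, Agree (v 0) (v 1) k ∧
      Ent (v 0) k x₁ x₀ ∧ Ent (v 1) k y₁ y₀ ∧
        (NRel σ₁ U x₁ y₁ ∨ (x₁ = y₁ ∧ NRel σ₀ U x₀ y₀))) ∨
    ∃ l ∈ U, ∃ m ∈ U, IsSeq (v 0) l ∧ IsSeq (v 1) m ∧ Mem l m ∧ Agree (v 0) (v 1) l))
    (SiP.and Lim.univC (e.rename (![0] : Fin 1 → Fin 2)) (SiP.and Lim.univC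
      (e.rename (![1] : Fin 1 → Fin 2)) (SiP.or Lim.univC
      (SiP.ex h3 (SiP.ex h3 (SiP.ex h3 (SiP.ex h3 (SiP.ex h3 (SiP.and Lim.univC
        ((si_agree.rename (![0, 1, 2] : Fin 3 → Fin 7)).le h13) (SiP.and Lim.univC
        ((abs_ent.1.rename (![0, 2, 3, 4] : Fin 4 → Fin 7)).le h13) (SiP.and Lim.univC
        ((abs_ent.1.rename (![1, 2, 5, 6] : Fin 4 → Fin 7)).le h13) (SiP.or Lim.univC
        (((si_nrel two_pos hσ₁).rename (![3, 5] : Fin 2 → Fin 7)).le (by norm_num))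
        (SiP.and Lim.univC ((si_eq.rename (![3, 5] : Fin 2 → Fin 7)).le h13)
        (((si_nrel one_pos hσ₀).rename (![4, 6] : Fin 2 → Fin 7)).le h13)))))))))))
      (SiP.ex h3 (SiP.ex h3 (SiP.and Lim.univC
        ((si_isSeq.rename (![0, 2] : Fin 2 → Fin 4)).le h13) (SiP.and Lim.univC
        ((si_isSeq.rename (![1, 3] : Fin 2 → Fin 4)).le h13) (SiP.and Lim.univC
        ((abs_mem.1.rename (![2, 3] : Fin 2 → Fin 4)).le h13)
        ((si_agree.rename (![0, 1, 2] : Fin 3 → Fin 4)).le h13))))))))) ?_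
  intro U hU v hv
  refine and_congr_right fun _ => and_congr_right fun _ => or_congr ?_ ?_
  · constructor
    · rintro ⟨k, x₁, x₀, y₁, y₀, h1, h2, h3, h4⟩
      obtain ⟨a1, a2, a3⟩ := hU.trans.of_ent (hv 0) h2
      obtain ⟨b1, b2, b3⟩ := hU.trans.of_ent (hv 1) h3
      exact ⟨k, a1, x₁, a2, x₀, a3, y₁, b2, y₀, b3, h1, h2, h3, h4⟩
    · rintro ⟨k, -, x₁, -, x₀, -, y₁, -, y₀, -, h⟩
      exact ⟨k, x₁, x₀, y₁, y₀, h⟩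
  · constructor
    · rintro ⟨l, m, h⟩
      exact ⟨l, World.nat_mem h.1.1, m, World.nat_mem h.2.1.1, h⟩
    · rintro ⟨l, -, m, -, h⟩; exact ⟨l, m, h⟩

/-! ### The wellfounded part, with bounded witnesses -/

/-- `f` is a sequence of natural numbers with `f(0) = a` that is descending in `<₀^X`. -/
def Desc (σ₀ : setLang.Formula (Fin 2)) (X : Set M) (f a : M) : Prop :=
  Baire f ∧ Mem (op (zero M) a) f ∧ ∀ k u w, Mem (op k u) f → Mem (op (sc k) w) f → NRel σ₀ X w u

theorem wf_iff {σ₀ : setLang.Formula (Fin 2)} {X : Set M} {a : M} :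
    Wf σ₀ X a ↔ Mem a (om M) ∧ ∀ f ∈ X, ¬ Desc σ₀ X f a := by
  refine and_congr_right fun _ => forall₂_congr fun f hf => ?_
  constructor
  · rintro H ⟨h1, h2, h3⟩
    obtain ⟨k, u, w, -, h4, h5, h6⟩ := H h1 h2
    exact h6 (h3 k u w h4 h5)
  · intro H h1 h2
    by_contra hn
    push Not at hn
    refine H ⟨h1, h2, fun k u w h4 h5 => hn k u w ?_ h4 h5⟩
    obtain ⟨k', m, h, -, e⟩ := h1.1 _ h4
    rw [op_inj] at e
    rw [e.1]; exact h

/-- A variant of `Wf` that refers to `<₀^c` for universes `c ∈ X` only. -/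
def WfB (σ₀ : setLang.Formula (Fin 2)) (X : Set M) (a : M) : Prop :=
  Mem a (om M) ∧ ∀ f ∈ X, ∀ c ∈ X, ¬ (UnivC (ext c) ∧ Desc σ₀ (ext c) f a)

theorem Desc.mono {σ₀ : setLang.Formula (Fin 2)} (h : IsSigma 1 σ₀) {X Y : Set M} (hX : UnivC X)
    (hY : UnivC Y) (hXY : X ⊆ Y) {f a : M} (hd : Desc σ₀ X f a) : Desc σ₀ Y f a :=
  ⟨hd.1, hd.2.1, fun k u w h1 h2 => (hd.2.2 k u w h1 h2).mono h hX hY hXY⟩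

/-- Since <₀ is `Σ₁`, it is persistent: a sequence descending for <₀^c also descends for <₀^U. -/
theorem Wf.wfB {σ₀ : setLang.Formula (Fin 2)} (h : IsSigma 1 σ₀) {U : Set M} (hU : UnivC U)
    {a : M} (hw : Wf σ₀ U a) : WfB σ₀ U a := by
  rw [wf_iff] at hw
  exact ⟨hw.1, fun f hf c hc hd => hw.2 f hf (hd.2.mono h hd.1 hU fun x hx => hU.trans _ hc _ hx)⟩

theorem abs_zero_pair : PiP (M := M) Lim 1 2 fun _ v => Baire (v 0) ∧ Mem (op (zero M) (v 1)) (v 0) := by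
  refine PiP.of_abs (R := fun v => Baire (v 0) ∧ Mem (op (zero M) (v 1)) (v 0))
    (isBaire 0 ⋏ ex fun z => isEmpty z ⋏ pairIn ((0 : Fin 2) : Fin 3) z ((1 : Fin 2) : Fin 3))
    fun W hW v => ?_
  simp only [tr_and, tr_isBaire, tr_ex, tr_isEmpty, tr_pairIn, Fin.snoc_castSucc, Fin.snoc_last]
  refine and_congr_right fun _ => ?_
  exact exists_coe_eq World.zero_mem (r := fun z => Mem (op z (v 1 : M)) (v 0))

theorem si_steps : SiP (M := M) Lim 1 4 fun _ v =>
    Mem (op (v 1) (v 2)) (v 0) ∧ Mem (op (sc (v 1)) (v 3)) (v 0) := by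
  refine SiP.of_abs (R := fun v => Mem (op (v 1) (v 2)) (v 0) ∧ Mem (op (sc (v 1)) (v 3)) (v 0))
    (pairIn 0 1 2 ⋏ ex fun j => isSucc ((1 : Fin 4) : Fin 5) j ⋏
      pairIn ((0 : Fin 4) : Fin 5) j ((3 : Fin 4) : Fin 5)) fun W hW v => ?_
  simp only [tr_and, tr_ex, tr_isSucc, tr_pairIn, Fin.snoc_castSucc, Fin.snoc_last]
  refine and_congr_right fun _ => ?_
  exact exists_coe_eq (World.sc_mem (v 1).2) (r := fun z => Mem (op z (v 3 : M)) (v 0))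

theorem pi_desc {σ₀ : setLang.Formula (Fin 2)} (h : IsSigma 1 σ₀) :
    PiP (M := M) Lim 2 2 fun U v => Desc σ₀ U (v 0) (v 1) := by
  refine PiP.congr (p := fun U v => (Baire (v 0) ∧ Mem (op (zero M) (v 1)) (v 0)) ∧
    ∀ k ∈ U, ∀ u ∈ U, ∀ w ∈ U, (Mem (op k u) (v 0) ∧ Mem (op (sc k) w) (v 0)) → NRel σ₀ U w u)
    (PiP.and Lim.univC (abs_zero_pair.le one_le_two) (PiP.all two_pos (PiP.all two_pos
      (PiP.all two_pos (PiP.imp Lim.univC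
        ((si_steps.rename (![0, 2, 3, 4] : Fin 4 → Fin 5)).le one_le_two)
        (((si_nrel one_pos h).rename (![4, 3] : Fin 2 → Fin 5)).pi one_lt_two)))))) ?_
  intro U hU v hv
  constructor
  · rintro ⟨h1, h2, h3⟩
    exact ⟨⟨h1, h2⟩, fun k _ u _ w _ h => h3 k u w h.1 h.2⟩
  · rintro ⟨⟨h1, h2⟩, h3⟩
    refine ⟨h1, h2, fun k u w h4 h5 => ?_⟩
    have g4 := hU.trans _ (hv 0) _ h4
    have g5 := hU.trans _ (hv 0) _ h5
    exact h3 k (hU.trans.left_mem g4) u (hU.trans.right_mem g4) w (hU.trans.right_mem g5) ⟨h4, h5⟩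

/-- That `f` descends in <₀^U is a `Π₂`-property of `U`. It reflects to some `Q ∈ U`, which then
plays the role of `c`. -/
theorem WfB.wf {σ₀ : setLang.Formula (Fin 2)} (h : IsSigma 1 σ₀) {U : Set M} [hU : Lim U] {k : ℕ}
    (hk : 2 ≤ k) {X : M → Prop} (hm : Mahlo k U X) {a : M} (hw : WfB σ₀ U a) : Wf σ₀ U a := by
  rw [wf_iff]
  refine ⟨hw.1, fun f hf hd => ?_⟩
  obtain ⟨Q, hQ, hL, -, h1, h2⟩ := hm.reflect hk ((pi_desc h).le hk) (v := ![f, a])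
    (fun i => by fin_cases i; exacts [hf, World.nat_mem hw.1]) hd
  exact hw.2 f hf Q hQ ⟨Lim.univC _ hL, h2⟩

def isDesc (σ₀ : setLang.Formula (Fin 2)) {n : ℕ} (V : Univ n) (f a : Fin n) : Fm n :=
  isBaire f ⋏ (ex fun z => isEmpty z ⋏ pairIn f z a) ⋏
    all fun k => all fun k' => all fun u => all fun w =>
      (isSucc k k' ⋏ pairIn f k u ⋏ pairIn f k' w) ⟶ᶠ natRel σ₀ _ V w u

theorem tr_isDesc {σ₀ : setLang.Formula (Fin 2)} {U : Set M} [hU : World U] {n : ℕ}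
    {v : Fin n → ↥U} {V : Univ n} {f a : Fin n} :
    Tr (isDesc σ₀ V f a) v ↔ Desc σ₀ (Univ.sem v V) (v f : M) (v a) := by
  simp only [isDesc, tr_and, tr_isBaire, tr_ex, tr_isEmpty, tr_pairIn, tr_all, tr_imp, tr_isSucc,
    tr_natRel, sem_map, snoc_comp_castSucc, Fin.snoc_castSucc, Fin.snoc_last]
  refine and_congr_right fun _ => and_congr
    (exists_coe_eq World.zero_mem (r := fun z => Mem (op z (v a : M)) (v f))) ?_
  constructor
  · intro H k u w h1 h2
    have g1 := hU.trans _ (v f).2 _ h1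
    have g2 := hU.trans _ (v f).2 _ h2
    exact H ⟨k, hU.trans.left_mem g1⟩ ⟨sc k, hU.trans.left_mem g2⟩ ⟨u, hU.trans.right_mem g1⟩
      ⟨w, hU.trans.right_mem g2⟩ ⟨rfl, h1, h2⟩
  · rintro H k k' u w ⟨h, h1, h2⟩
    rw [h] at h2
    exact H k u w h1 h2

/-- For a set `c` the relation <₀^c is absolute, so the matrix is `Δ₁` and the predicate `Π₁`. The
direct definition of `Wf` would only give `Π₃`, too much for the premise of a `Π₃`-statement when `i
= 2`. -/
theorem pi_wfB (σ₀ : setLang.Formula (Fin 2)) :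
    PiP (M := M) Lim 1 1 fun U v => WfB σ₀ U (v 0) := by
  have h : SiP (M := M) Lim 1 3 fun _ v => UnivC (ext (v 1)) ∧ Desc σ₀ (ext (v 1)) (v 0) (v 2) :=
    SiP.of_abs (R := fun v => UnivC (ext (v 1)) ∧ Desc σ₀ (ext (v 1)) (v 0) (v 2))
      (isUniv 1 ⋏ isDesc σ₀ (.set 1) 0 2) fun W _ v => by
        rw [tr_and, tr_isUniv, tr_isDesc, sem_set]
  exact PiP.and Lim.univC abs_nat.2 (PiP.all one_pos (PiP.all one_pos
    (h.rename (![1, 2, 0] : Fin 3 → Fin 3)).not))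

def SecWfB (σ₀ : setLang.Formula (Fin 2)) (X : Set M) (α : M) : Prop :=
  ∀ j x y, Ent α j x y → WfB σ₀ X y

theorem pi_secWfB (σ₀ : setLang.Formula (Fin 2)) :
    PiP (M := M) Lim 1 1 fun U v => SecWfB σ₀ U (v 0) := by
  refine PiP.congr (p := fun U v => ∀ j ∈ U, ∀ x ∈ U, ∀ y ∈ U, Ent (v 0) j x y → WfB σ₀ U y)
    (PiP.all one_pos (PiP.all one_pos (PiP.all one_pos (PiP.imp Lim.univC
      (abs_ent.1.rename (![0, 1, 2, 3] : Fin 4 → Fin 4))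
      ((pi_wfB σ₀).rename (![3] : Fin 1 → Fin 4)))))) ?_
  intro U hU v hv
  refine ⟨fun h j _ x _ y _ => h j x y, fun h j x y h1 => ?_⟩
  obtain ⟨a1, a2, a3⟩ := hU.trans.of_ent (hv 0) h1
  exact h j a1 x a2 y a3 h1

def EWB (σ₁ σ₀ : setLang.Formula (Fin 2)) (X : Set M) (α β : M) : Prop :=
  ExpLt σ₁ σ₀ X α β ∧ SecWfB σ₀ X α ∧ SecWfB σ₀ X β

theorem EW.ewB {σ₁ σ₀ : setLang.Formula (Fin 2)} (h : IsSigma 1 σ₀) {U : Set M} (hU : UnivC U)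
    {α β : M} (hw : EW σ₁ σ₀ U α β) : EWB σ₁ σ₀ U α β :=
  ⟨hw.1, fun j x y hj => (hw.2.1 j x y hj).wfB h hU, fun j x y hj => (hw.2.2 j x y hj).wfB h hU⟩

theorem EWB.ew {σ₁ σ₀ : setLang.Formula (Fin 2)} (h : IsSigma 1 σ₀) {U : Set M} [Lim U] {k : ℕ}
    (hk : 2 ≤ k) {X : M → Prop} (hm : Mahlo k U X) {α β : M} (hw : EWB σ₁ σ₀ U α β) :
    EW σ₁ σ₀ U α β :=
  ⟨hw.1, fun j x y hj => (hw.2.1 j x y hj).wf h hk hm, fun j x y hj => (hw.2.2 j x y hj).wf h hk hm⟩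

/-! ### `U ∈ Mᵢ(γ; <_EW)` as a `Πᵢ₊₁`-statement -/

/-- `b ∈ Q ⊨ Πᵢ(b)` -/
def modelsF (i : ℕ) : Fm 2 :=
  isUniv 0 ⋏ mem 1 0 ⋏ (ex fun D => ex fun S => isTrans (D : Fin 4) ⋏ isSat (D : Fin 4) S ⋏
    mem (0 : Fin 2).castSucc.castSucc D) ⋏ univPi i (.set 0) 1

theorem si_models (i : ℕ) : SiP (M := M) Lim 1 2 fun _ v =>
    UnivC (ext (v 0)) ∧ Mem (v 1) (v 0) ∧ UPi i (ext (v 0)) (v 1) := by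
  have key : ∀ (W : Set M) [World W] (v : Fin 2 → ↥W),
      Tr (modelsF i) v ↔
      UnivC (ext (v 0 : M)) ∧ Mem (v 1 : M) (v 0) ∧
        (∃ D ∈ W, ∃ S ∈ W, IsTr D ∧ IsSat D S ∧ Mem (v 0 : M) D) ∧ UPi i (ext (v 0 : M)) (v 1) := by
    intro W hW v
    rw [modelsF, tr_and, tr_and, tr_and, tr_isUniv, tr_mem, mem_coe]
    refine and_congr_right fun hu => and_congr_right fun hm => 
      (and_congr_left' ?_).trans (and_congr_right ?_)
    · simp only [tr_ex, tr_and, tr_isTrans, tr_isSat, tr_mem, Fin.snoc_castSucc, Fin.snoc_last,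
        mem_coe]
      exact ⟨fun ⟨D, S, h⟩ => ⟨D, D.2, S, S.2, h⟩, fun ⟨D, hD, S, hS, h⟩ => ⟨⟨D, hD⟩, ⟨S, hS⟩, h⟩⟩
    · rintro ⟨D, hD, S, hS, h1, h2, h3⟩
      rw [tr_univPi]
      · rfl
      · exact hu.trans
      · exact (TrOK.of_sat hD hS h1 h2).mono fun x hx => h1 _ h3 _ hx
      · exact hm
  refine SiP.of_world (R := fun v => UnivC (ext (v 0)) ∧ Mem (v 1) (v 0) ∧ UPi i (ext (v 0)) (v 1))
    (modelsF i) (fun W _ v h => ?_) fun U hU v hv h => ?_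
  · obtain ⟨h1, h2, -, h3⟩ := (key W v).1 h
    exact ⟨h1, h2, h3⟩
  · obtain ⟨D, hD, S, hS, h1, h2⟩ := Lim.exists_adm_of_mem (hv 0)
    obtain ⟨K, hK, SK, -, h3, h4⟩ := Lim.exists_adm_tup (U := U) (v := ![D, S, v 0, v 1])
      (fun j => by fin_cases j; exacts [hD, hS, hv 0, hv 1])
    have hw := h3.world
    exact ⟨K, hK, hw, fun j => by fin_cases j; exacts [h4 2, h4 3], (key _ _).2
      ⟨h.1, h.2.1, ⟨D, h4 0, S, h4 1, h2.tr, h2.sat, h1⟩, h.2.2⟩⟩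

/-- `U ∈ Mᵢ(γ; <_EW)`, in a form of low complexity. -/
def IterB (i : ℕ) (σ₁ σ₀ : setLang.Formula (Fin 2)) (U : Set M) (γ : M) : Prop :=
  ∀ δ ∈ U, ∀ b ∈ U, EWB σ₁ σ₀ U δ γ → UPi i U b → ∃ Q ∈ U,
    (UnivC (ext Q) ∧ PSeq δ ∧ Iter i (EW σ₁ σ₀) Q δ) ∧ UnivC (ext Q) ∧ Mem b Q ∧ UPi i (ext Q) b

/-- The premises are `Σ₃`, `Π₁` and `Πᵢ`, all within `Σᵢ₊₁` as `2 ≤ i`; the conclusion is `Σ₁`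
because the iteration and truth in `Q` have witnesses in `U`. -/
theorem pi_iterB {σ₁ π₁ σ₀ : setLang.Formula (Fin 2)} (hσ₁ : IsSigma 2 σ₁) (hπ₁ : IsPi 2 π₁)
    (hΔ : KPl ⊨ᵇ sameRelSentence σ₁ π₁) (hσ₀ : IsSigma 1 σ₀) {i : ℕ} (hi : 2 ≤ i) :
    PiP (M := M) Lim (i + 1) 1 fun U v => IterB i σ₁ σ₀ U (v 0) := by
  have h0 : 0 < i + 1 := by omega
  have h1 : 1 < i + 1 := by omega
  have h3 : 3 ≤ i + 1 := by omega
  refine PiP.all h0 (PiP.all h0 (PiP.imp Lim.univC (SiP.and Lim.univC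
    (((si_expLt hσ₁ hπ₁ hΔ hσ₀).rename (![1, 0] : Fin 2 → Fin 3)).le h3) (SiP.and Lim.univC
    (((pi_secWfB σ₀).rename (![1] : Fin 1 → Fin 3)).si h1)
    (((pi_secWfB σ₀).rename (![0] : Fin 1 → Fin 3)).si h1))) (PiP.imp Lim.univC
    (((pi_uPi (by omega : 0 < i)).rename (![2] : Fin 1 → Fin 3)).si (by omega))
    (SiP.pi (k := 1) (SiP.ex one_pos (SiP.and Lim.univC
      ((si_iter (relAbs_expWRel σ₁ σ₀) i).rename (![3, 1] : Fin 2 → Fin 4))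
      ((si_models i).rename (![3, 2] : Fin 2 → Fin 4)))) h1))))

/-- Only the inclusion of <_EW in its variant is used, so no reflection is required of `R`. This
matters where `R` has been obtained by reflection. -/
theorem IterB.iter {σ₁ σ₀ : setLang.Formula (Fin 2)} (hσ₀ : IsSigma 1 σ₀) {i : ℕ} {R γ : M}
    [hR : Lim (ext R)] (hγ : PSeq γ) (h : IterB i σ₁ σ₀ (ext R) γ) : Iter i (EW σ₁ σ₀) R γ := by
  rw [iter_rec (relAbs_expWRel σ₁ σ₀) (Lim.univC _ hR) hγ]
  intro δ hδ b hb hu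
  obtain ⟨Q, hQ, h1, h2⟩ := h δ hδ.1.1.1.mem_world b hb (hδ.ewB hσ₀ (Lim.univC _ hR)) hu
  exact ⟨Q, hQ, h1.1, h1.2.2, h2.2⟩

/-- Here predecessors in the variant must be genuine predecessors, and this uses that `Q` reflects.
-/
theorem Iter.iterB {σ₁ σ₀ : setLang.Formula (Fin 2)} (hσ₀ : IsSigma 1 σ₀) {i k : ℕ} (hk : 2 ≤ k)
    {Q γ : M} [hQ : Lim (ext Q)] {X : M → Prop} (hm : Mahlo k (ext Q) X) (hγ : PSeq γ)
    (h : Iter i (EW σ₁ σ₀) Q γ) : IterB i σ₁ σ₀ (ext Q) γ := by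
  rw [iter_rec (relAbs_expWRel σ₁ σ₀) (Lim.univC _ hQ) hγ] at h
  intro δ hδ b hb hw hu
  obtain ⟨R, hR, h1, h2, h3⟩ := h δ (hw.ew hσ₀ hk hm) b hb hu
  exact ⟨R, hR, ⟨h1, hw.1.1.1, h2⟩, h1, h3⟩

end SetTh

namespace SetTh

variable {M : Type} [setLang.Structure M] [KPM M]

/-! ### Dependent choices for relations on `ω` -/

theorem sc_inj {x y : M} (h : sc x = sc y) : x = y := by
  have h1 : Mem x (sc y) := by rw [← h]; simp
  have h2 : Mem y (sc x) := by rw [h]; simp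
  rcases mem_sc.1 h1 with h1 | h1
  · rcases mem_sc.1 h2 with h2 | h2
    · exact (not_mem_mem x y ⟨h1, h2⟩).elim
    · exact h2.symm
  · exact h1

/-- `z` is an `∈`-minimal set with `⟨z, y⟩ ∈ r`. -/
def IsMin (r y z : M) : Prop := Mem (op z y) r ∧ ∀ w, Mem w z → ¬ Mem (op w y) r

theorem exists_isMin {r y z : M} (h : Mem (op z y) r) : ∃ m, IsMin r y m := by
  refine mem_induction (p := fun z => Mem (op z y) r → ∃ m, IsMin r y m) ?_ ?_ z h
  · refine Dfb.mk3 (p := fun r y z => Mem (op z y) r → ∃ m, IsMin r y m)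
      (fun _ r y z => pairIn r z y ⟶ᶠ ex fun m => pairIn r m y ⋏ allIn m fun w =>
        neg (pairIn r w y)) ?_ r y
    intro n v r y z
    simp [IsMin]
  · intro z ih hz
    by_cases h : ∃ w, Mem w z ∧ Mem (op w y) r
    · obtain ⟨w, h1, h2⟩ := h
      exact ih w h1 h2
    · push Not at h
      exact ⟨z, hz, h⟩

theorem IsMin.unique {r y z w : M} (h : IsMin r y z) (hm : IsMin r y w) (hz : Mem z (om M))
    (hw : Mem w (om M)) : z = w := by
  rcases nat_trichotomy hz hw with h1 | h1 | h1
  · exact (hm.2 z h1 h.1).elim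
  · exact h1
  · exact (h.2 w h1 hm.1).elim

/-- One step of the recursion that chooses successive minimal elements. -/
def D0.chainStep : D0 6 :=
  .or (.and (.allIn 3 fun z => .neg (.eq z z)) (.eq 4 2))
    (.exIn 3 fun k => .and
      (.allIn (3 : Fin 6).castSucc fun z => .or (.mem z k.castSucc) (.eq z k.castSucc))
      (.exIn (1 : Fin 6).castSucc fun u => .and
        (.pairIn (5 : Fin 6).castSucc.castSucc k.castSucc u)
        (.and (.pairIn (0 : Fin 6).castSucc.castSucc (4 : Fin 6).castSucc.castSucc u)
          (.allIn (4 : Fin 6).castSucc.castSucc fun z =>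
            .neg (.pairIn (0 : Fin 6).castSucc.castSucc.castSucc z u.castSucc)))))

theorem step_chainStep {r x Q c h : M} (hQ : Mem Q (om M)) :
    Step D0.chainStep ![r, om M, x] Q c h ↔ (Q = zero M ∧ c = x) ∨
      ∃ k, Mem k Q ∧ Q = sc k ∧ ∃ u, Mem u (om M) ∧ Mem (op k u) h ∧ IsMin r u c := by
  have e : ∀ k, Mem k Q → (Q = sc k ↔ ∀ z, Mem z Q → Mem z k ∨ z = k) := by
    intro k hk
    constructor
    · intro h z hz; rw [h] at hz; exact mem_sc.1 hz
    · intro h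
      refine Mem.ext fun z => ⟨fun hz => mem_sc.2 (h z hz), fun hz => ?_⟩
      rcases mem_sc.1 hz with hz | rfl
      exacts [IsTr.of_om hQ _ hk _ hz, hk]
  simp only [Step, D0.chainStep, dr_or, dr_and, dr_allIn, dr_neg, dr_eq, dr_exIn, dr_mem, dr_pairIn,
    Fin.snoc_castSucc, Fin.snoc_last]
  refine or_congr (and_congr ?_ Iff.rfl) (exists_congr fun k => and_congr_right fun hk =>
    and_congr (e k hk).symm Iff.rfl)
  rw [eq_zero]
  simp

/-- Dependent choice is replaced by taking the ∈-least natural number at each step, which turns the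
construction into a recursion along ω inside an admissible element of `U`. -/
theorem Lim.exists_chain {U : Set M} [hU : Lim U] {r x : M} (hr : r ∈ U) (hx : Mem x (om M))
    (hnat : ∀ z y, Mem (op z y) r → Mem z (om M)) (h0 : ∃ z, Mem (op z x) r)
    (hs : ∀ z y, Mem (op z y) r → ∃ w, Mem (op w z) r) :
    ∃ f ∈ U, Baire f ∧ Mem (op (zero M) x) f ∧
      ∀ k u w, Mem (op k u) f → Mem (op (sc k) w) f → Mem (op w u) r := by
  obtain ⟨A, hA, SA, -, hrA, hAa⟩ := Lim.exists_adm_of_mem hr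
  obtain ⟨B, hB, SB, -, hAB, hBa⟩ := Lim.exists_adm_of_mem hA
  have hAw := hAa.world
  obtain ⟨H, hH, hstep⟩ := exists_recursion (step := D0.chainStep) (v := ![r, om M, x])
    (D := om M) (I := om M) (by
      intro Q hQ c hc h h' hh
      rw [step_chainStep hQ, step_chainStep hQ]
      refine or_congr Iff.rfl (exists_congr fun k => and_congr_right fun hk =>
        and_congr_right fun _ => exists_congr fun u => and_congr_right fun hu =>
          and_congr_left fun _ => ?_)
      exact hh k (mem_om_of_mem hQ hk) (Or.inl hk) u hu) hBa hAB
    (fun j => by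
      fin_cases j
      exacts [hBa.tr _ hAB _ hrA, hBa.om, hBa.tr _ hBa.om _ hx]) hAa.om hBa.om
    (fun c hc => hAa.tr _ hAa.om _ hc)
  have main : ∀ k, Mem k (om M) → ∃ u, Mem u (om M) ∧ (∃ z, Mem (op z u) r) ∧
      ∀ y, Mem y (om M) → (Mem (op k y) H ↔ y = u) := by
    refine nat_induction (Dfb.mk3 (p := fun r H k => ∃ u, Mem u (om M) ∧ (∃ z, Mem (op z u) r) ∧
      ∀ y, Mem y (om M) → (Mem (op k y) H ↔ y = u)) (fun _ r H k => ex fun u => isNat u ⋏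
        (ex fun z => pairIn r z u) ⋏ all fun y => isNat y ⟶ᶠ (pairIn H k y ⟷ᶠ eq y u)) ?_ r H) ?_ ?_
    · intro n v r H k
      simp [Subtype.ext_iff]
    · refine ⟨x, hx, h0, fun y hy => ?_⟩
      rw [hstep _ zero_mem_om _ hy, step_chainStep zero_mem_om]
      simp
    · rintro k hk ⟨u, hu, ⟨z, hz⟩, hy⟩
      obtain ⟨m, hm⟩ := exists_isMin hz
      have hmn := hnat _ _ hm.1
      refine ⟨m, hmn, hs _ _ hm.1, fun y hy' => ?_⟩
      rw [hstep _ (sc_mem_om hk) _ hy', step_chainStep (sc_mem_om hk)]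
      constructor
      · rintro (⟨h, -⟩ | ⟨k', -, e, u', hu', h1, h2⟩)
        · have : Mem k (sc k) := by simp
          rw [h] at this
          simp at this
        · rw [← sc_inj e, hy u' hu'] at h1
          rw [h1] at h2
          exact h2.unique hm hy' hmn
      · rintro rfl
        exact Or.inr ⟨k, by simp, rfl, u, hu, (hy u hu).2 rfl, hm⟩
  -- The recursion controls `H` only on ω × ω; other elements of `H` have to be discarded to get a
  -- function.
  obtain ⟨f, hf, hfm⟩ := hBa.exists_sep (n := 1) (.exIn 0 fun k => .exIn (0 : Fin 2).castSucc
    fun u => .opair (1 : Fin 2).castSucc.castSucc k.castSucc u) ![om M]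
    (fun j => by rw [Fin.fin_one_eq_zero j]; exact hBa.om) hH
  have hfm' : ∀ z, Mem z f ↔ Mem z H ∧ ∃ k, Mem k (om M) ∧ ∃ u, Mem u (om M) ∧ z = op k u := by
    intro z
    rw [hfm]
    simp only [dr_exIn, dr_opair, Fin.snoc_castSucc, Fin.snoc_last]
    exact Iff.rfl
  have hfop : ∀ k u, Mem (op k u) f ↔ Mem (op k u) H ∧ Mem k (om M) ∧ Mem u (om M) := by
    intro k u
    rw [hfm']
    refine and_congr_right fun _ => ⟨?_, fun h => ⟨k, h.1, u, h.2, rfl⟩⟩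
    rintro ⟨k', hk, u', hu, e⟩
    rw [op_inj] at e
    rw [e.1, e.2]; exact ⟨hk, hu⟩
  refine ⟨f, hU.trans _ hB _ hf, ⟨?_, ?_⟩, ?_, ?_⟩
  · intro z hz
    obtain ⟨-, k, hk, u, hu, e⟩ := (hfm' z).1 hz
    exact ⟨k, u, hk, hu, e⟩
  · intro k hk
    obtain ⟨u, hu, -, h⟩ := main k hk
    refine ⟨u, fun y => ?_⟩
    rw [hfop]
    exact ⟨fun hy => (h y hy.2.2).1 hy.1, fun e => by rw [e]; exact ⟨(h u hu).2 rfl, hk, hu⟩⟩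
  · rw [hfop]
    refine ⟨?_, zero_mem_om, hx⟩
    rw [hstep _ zero_mem_om _ hx, step_chainStep zero_mem_om]
    exact Or.inl ⟨rfl, rfl⟩
  · intro k u w h1 h2
    rw [hfop] at h1 h2
    obtain ⟨a, ha, -, h⟩ := main k h1.2.1
    rw [hstep _ h2.2.1 _ h2.2.2, step_chainStep h2.2.1] at h2
    rcases h2.1 with ⟨e, -⟩ | ⟨k', -, e, u', hu', h3, h4⟩
    · have : Mem k (sc k) := by simp
      rw [e] at this
      simp at this
    · rw [← sc_inj e, h u' hu'] at h3
      rw [(h u h1.2.2).1 h1.1, ← h3]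
      exact h4.1

/-! ### Initial segments -/

/-- `t` is the initial segment of `s` of length `k`. -/
def Pre (t s k : M) : Prop := IsSeq t k ∧ ∀ z, Mem z t → Mem z s

theorem Pre.unique {t t' s k l : M} (h : Pre t s k) (h' : Pre t' s k) (hs : IsSeq s l) : t = t' := by
  refine h'.1.eq_of_subset h.1 fun z hz => ?_
  obtain ⟨j, hj, x, rfl⟩ := h.1.2.1 z hz
  obtain ⟨y, hy⟩ := h'.1.exists_val hj
  rw [hs.val_unique (h.2 _ hz) (h'.2 _ hy)]
  exact hy

theorem IsSeq.exists_pre {s l k : M} (h : IsSeq s l) (hk : Mem k (sc l)) : ∃ t, Pre t s k := by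
  obtain ⟨t, -, h1, h2⟩ := World.exists_restrict (U := (Set.univ : Set M)) h (fun _ _ _ => trivial) hk
  exact ⟨t, h1, h2⟩

theorem Pre.pSeq {t s k : M} (h : Pre t s k) (hs : PSeq s) : PSeq t := by
  refine ⟨k, h.1, fun j hj => ?_⟩
  obtain ⟨p, hp⟩ := h.1.exists_val hj
  obtain ⟨l, hl, h'⟩ := hs
  obtain ⟨x, y, hx, hy, he⟩ := h' j (hl.mem_len (h.2 _ hp))
  refine ⟨x, y, hx, hy, ?_⟩
  rw [hl.val_unique (h.2 _ hp) he] at hp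
  exact hp

theorem Pre.expSeq {σ₁ : setLang.Formula (Fin 2)} {X : Set M} {t s k : M} (h : Pre t s k)
    (hs : ExpSeq σ₁ X s) : ExpSeq σ₁ X t :=
  ⟨h.pSeq hs.1, fun j x y x' y' h1 h2 => hs.2 j x y x' y' (h.2 _ h1) (h.2 _ h2)⟩

theorem pre_ap {s l : M} (h : IsSeq s l) (x : M) : Pre s (ap s l x) l :=
  ⟨h, fun z hz => mem_ap.2 (Or.inl hz)⟩

theorem PSeq.ap {γ m n x : M} (h : IsSeq γ m) (hγ : PSeq γ) (hn : Mem n (om M))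
    (hx : Mem x (om M)) : PSeq (ap γ m (op n x)) := by
  refine ⟨sc m, h.ap _, fun j hj => ?_⟩
  rcases mem_sc.1 hj with hj | rfl
  · obtain ⟨l, hl, h'⟩ := hγ
    rw [hl.len_unique h] at h'
    obtain ⟨x, y, hx, hy, he⟩ := h' j hj
    exact ⟨x, y, hx, hy, mem_ap.2 (Or.inl he)⟩
  · exact ⟨n, x, hn, hx, mem_ap.2 (Or.inr rfl)⟩

/-- Membership in the domain of the ordering constrains only the first components, so the last
second component may be any natural number. -/
theorem ExpSeq.ap_congr {σ₁ : setLang.Formula (Fin 2)} {X : Set M} {γ m n x x' : M}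
    (h : IsSeq γ m) (hs : ExpSeq σ₁ X (ap γ m (op n x))) (hx : Mem x' (om M)) :
    ExpSeq σ₁ X (ap γ m (op n x')) := by
  have hn : Mem n (om M) := (hs.1.nat (j := m) (x := n) (y := x) (mem_ap.2 (Or.inr rfl))).2.1
  refine ⟨PSeq.ap h ((pre_ap h _).pSeq hs.1) hn hx, fun j a b a' b' h1 h2 => ?_⟩
  have key : ∀ {j a b}, Ent (SetTh.ap γ m (op n x')) j a b →
      ∃ c, Ent (SetTh.ap γ m (op n x)) j a c := by
    intro j a b h
    rcases mem_ap.1 h with h | h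
    · exact ⟨b, mem_ap.2 (Or.inl h)⟩
    · rw [op_inj, op_inj] at h
      exact ⟨x, mem_ap.2 (Or.inr (by rw [h.1, h.2.1]))⟩
  obtain ⟨c, h3⟩ := key h1
  obtain ⟨c', h4⟩ := key h2
  exact hs.2 j a c a' c' h3 h4

/-- Names the class `X` by a term with one parameter, which makes statements about <₁^X definable
and so available for induction. -/
theorem exists_sem {X : Set M} (hX : X = Set.univ ∨ ∃ P, X = ext P) : ∃ (P : M) (V : Univ 1),
    ∀ w : Fin 1 → ↥(Set.univ : Set M), (w 0 : M) = P → Univ.sem w V = X := by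
  rcases hX with rfl | ⟨P, rfl⟩
  · exact ⟨om M, .L, fun w _ => rfl⟩
  · exact ⟨P, .set 0, fun w h => by rw [sem_set, h]⟩

/-- The first components decrease, so by transitivity of <₁^X a bound on the one at `k` bounds all
later ones; this is an induction along ω. -/
theorem FirstsLt.of_head {σ₁ : setLang.Formula (Fin 2)} (ht : KPl ⊨ᵇ transSentence σ₁) {X : Set M}
    [hX : Lim X] {δ k n : M} (hδ : ExpSeq σ₁ X δ) (hk : Mem k (om M))
    (h : ∀ x y, Ent δ k x y → NRel σ₁ X x n) : FirstsLt σ₁ X δ k n := by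
  have key : ∀ j, Mem j (om M) → ∀ x y, Ent δ j x y → ¬ Mem j k → NRel σ₁ X x n := by
    refine nat_induction ?_ ?_ ?_
    · obtain ⟨P, V, hV⟩ := exists_sem hX.cls
      refine ⟨4, all fun x => all fun y => entry ((0 : Fin 5) : Fin 6).castSucc
        ((4 : Fin 5) : Fin 6).castSucc x y ⟶ᶠ neg (mem ((4 : Fin 5) : Fin 6).castSucc
        ((1 : Fin 5) : Fin 6).castSucc) ⟶ᶠ natRel σ₁ _ (V.map fun _ => 3) x
        ((2 : Fin 5) : Fin 6).castSucc, ![⟨δ, trivial⟩, ⟨k, trivial⟩, ⟨n, trivial⟩, ⟨P, trivial⟩],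
        fun j => ?_⟩
      have e : ∀ x y : ↥(Set.univ : Set M), Univ.sem (Fin.snoc (Fin.snoc (Fin.snoc
          ![⟨δ, trivial⟩, ⟨k, trivial⟩, ⟨n, trivial⟩, ⟨P, trivial⟩] j : Fin 5 → ↥(Set.univ : Set M))
          x : Fin 6 → ↥(Set.univ : Set M)) y : Fin 7 → ↥(Set.univ : Set M))
          (V.map fun _ => 3) = X := by
        intro x y
        rw [sem_map]
        exact hV _ rfl
      simp only [tr_all, tr_imp, tr_neg, tr_entry, tr_mem, mem_coe, tr_natRel, e,
        Fin.snoc_castSucc, Fin.snoc_last]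
      exact ⟨fun h x y => h x y, fun h x y => h ⟨x, trivial⟩ ⟨y, trivial⟩⟩
    · intro x y he hn
      rcases zero_or_sc hk with rfl | ⟨k', hk', rfl⟩
      · exact h x y he
      · exact (hn (zero_mem_sc hk')).elim
    · intro j hj ih x y he hn
      by_cases hjk : Mem j k
      · have h1 := sc_mem_sc hk hjk
        rcases mem_sc.1 h1 with h1 | h1
        · exact (hn h1).elim
        · rw [h1] at he; exact h x y he
      · obtain ⟨l, hl, h'⟩ := id hδ.1
        have hj' : Mem j l := IsTr.of_om hl.1 _ (hl.mem_len he) _ (by simp)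
        obtain ⟨x', y', -, -, he'⟩ := h' j hj'
        exact (hδ.2 j x' y' x y he' he).trans ht (ih x' y' he' hjk)
  intro j x y he
  exact key j (hδ.1.nat he).1 x y he

/-! ### Predecessors in the exponential ordering -/

/-- This isolates the predecessors of γ⌢(n, x) that are not already predecessors of γ: they continue
γ, or γ⌢(n, y) with y <₀ x, by entries whose first components are <₁ n. -/
theorem EW.cases {σ₁ σ₀ : setLang.Formula (Fin 2)} (ht : KPl ⊨ᵇ transSentence σ₁) {X : Set M}
    [hX : Lim X] {γ m n x δ : M} (hγ : IsSeq γ m) (h : EW σ₁ σ₀ X δ (ap γ m (op n x))) :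
    EW σ₁ σ₀ X δ γ ∨ ∃ k γ', Pre γ' δ k ∧ FirstsLt σ₁ X δ k n ∧
      (γ' = γ ∨ ∃ y, NRel σ₀ X y x ∧ Wf σ₀ X y ∧ γ' = ap γ m (op n y)) := by
  obtain ⟨⟨hδ, hτ, h⟩, hw, hw'⟩ := h
  have hp := pre_ap hγ (op n x)
  have hτs := hγ.ap (op n x)
  have hgw : SecWf σ₀ X γ := fun j a b he => hw' j a b (hp.2 _ he)
  obtain ⟨l, hl, -⟩ := id hδ.1
  have agree : ∀ {k}, (∀ j, Mem j k → Mem j m) → Agree δ (ap γ m (op n x)) k → Agree δ γ k := by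
    intro k hk ha j hj
    obtain ⟨p, h1, h2⟩ := ha j hj
    refine ⟨p, h1, (mem_ap.1 h2).resolve_right fun e => ?_⟩
    rw [op_inj] at e
    exact not_mem_self m (e.1 ▸ hk j hj)
  have sub : Agree δ (ap γ m (op n x)) m → ∀ z, Mem z γ → Mem z δ := by
    intro ha z hz
    obtain ⟨j, hj, p, rfl⟩ := hγ.2.1 z hz
    obtain ⟨q, h1, h2⟩ := ha j hj
    rwa [hτs.val_unique (hp.2 _ hz) h2]
  rcases h with ⟨k, x₁, x₀, y₁, y₀, ha, h1, h2, h3⟩ | ⟨l', m', h1, h2, h3, ha⟩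
  · rcases mem_ap.1 h2 with h2 | h2
    · have hk := hγ.mem_len h2
      exact Or.inl ⟨⟨hδ, hp.expSeq hτ, Or.inl ⟨k, x₁, x₀, y₁, y₀,
        agree (fun j hj => IsTr.of_om hγ.1 _ hk _ hj) ha, h1, h2, h3⟩⟩, hw, hgw⟩
    -- The sequences first differ at the appended entry, so `δ` agrees with γ below it.
    · rw [op_inj, op_inj] at h2
      obtain ⟨rfl, rfl, rfl⟩ := h2
      right
      rcases h3 with h3 | ⟨rfl, h3⟩
      · refine ⟨k, γ, ⟨hγ, sub ha⟩, .of_head ht hδ hγ.1 fun a b hab => ?_, Or.inl rfl⟩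
        have := hl.val_unique h1 hab
        rw [op_inj] at this
        rw [← this.1]; exact h3
      -- With equal first components the entry (n, x₀) itself is made part of the initial segment,
      -- and the next entry is below `n` because first components decrease.
      · refine ⟨sc k, ap γ k (op x₁ x₀), ⟨hγ.ap _, fun z hz => ?_⟩,
          .of_head ht hδ (sc_mem_om hγ.1) fun a b hab => hδ.2 _ _ _ _ _ h1 hab,
          Or.inr ⟨x₀, h3, hw _ _ _ h1, rfl⟩⟩
        rcases mem_ap.1 hz with hz | rfl
        exacts [sub ha z hz, h1]
  · obtain rfl := h2.len_unique hτs
    rcases mem_sc.1 h3 with h3 | rfl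
    · exact Or.inl ⟨⟨hδ, hp.expSeq hτ, Or.inr ⟨l', m, h1, hγ, h3,
        agree (fun j hj => IsTr.of_om hγ.1 _ h3 _ hj) ha⟩⟩, hw, hgw⟩
    -- Here `δ` is γ itself, with no further entries, so the bound on later first components is
    -- vacuous.
    · exact Or.inr ⟨l', γ, ⟨hγ, sub ha⟩, fun j a b hab hj => (hj (h1.mem_len hab)).elim, Or.inl rfl⟩

end SetTh

namespace SetTh

variable {M : Type} [setLang.Structure M] [KPM M]

/-! ### Extending sequences -/

/-- Iterations of the Mahlo operation along `γ` extend to iterations along the end-extensions `β` of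
`γ` with first components below `a`. -/
def Extends (i : ℕ) (σ₁ σ₀ : setLang.Formula (Fin 2)) (U : Set M) : Prop :=
  ∀ Q a β k γ, Q ∈ U → Lim (ext Q) → Mem a (om M) → Iter (i + 1) (NRel σ₁) Q a →
    ExpSeq σ₁ (ext Q) β → Pre γ β k → Iter i (EW σ₁ σ₀) Q γ →
    (∀ j x y, Ent β j x y → ¬ Mem j k → NRel σ₁ (ext Q) x a ∧ Wf σ₀ U y) →
    Iter i (EW σ₁ σ₀) Q β

section
variable {σ₁ π₁ σ₀ : setLang.Formula (Fin 2)}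

/-- A predecessor `δ` that continues γ' is handled by reflecting the iteration along γ' from `Q` to
an `R` in M_{i+1}(n; <₁), and then letting `Extends` for `Q` lengthen γ' to `δ` at `R`. -/
theorem Extends.iter_ap (hσ₁ : IsSigma 2 σ₁) (hπ₁ : IsPi 2 π₁)
    (hΔ : KPl ⊨ᵇ sameRelSentence σ₁ π₁) (hσ₀ : IsSigma 1 σ₀) (ht : KPl ⊨ᵇ transSentence σ₁) {i : ℕ}
    (hi : 2 ≤ i) {Q n γ m x : M} [hQ : Lim (ext Q)] (hC : Extends i σ₁ σ₀ (ext Q))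
    (hm : Mahlo (i + 1) (ext Q) fun R => Iter (i + 1) (NRel σ₁) R n) (hγ : IsSeq γ m)
    (hit : Iter i (EW σ₁ σ₀) Q γ) (hτ : ExpSeq σ₁ (ext Q) (ap γ m (op n x)))
    (ih : ∀ y, NRel σ₀ (ext Q) y x → Wf σ₀ (ext Q) y → Iter i (EW σ₁ σ₀) Q (ap γ m (op n y))) :
    Iter i (EW σ₁ σ₀) Q (ap γ m (op n x)) := by
  have hu := Lim.univC _ hQ
  have hR := relAbs_expWRel (M := M) σ₁ σ₀
  have hn : Mem n (om M) := (hτ.1.nat (j := m) (x := n) (y := x) (mem_ap.2 (Or.inr rfl))).2.1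
  rw [iter_rec hR hu hτ.1]
  intro δ hδ
  rcases hδ.cases ht hγ with h | ⟨k, γ', hpre, hfst, hc⟩
  · exact (iter_rec hR hu ((pre_ap hγ _).pSeq hτ.1)).1 hit δ h
  have hit' : Iter i (EW σ₁ σ₀) Q γ' := by
    rcases hc with rfl | ⟨y, h1, h2, rfl⟩
    exacts [hit, ih y h1 h2]
  have hδs := hδ.1.1
  have hγ' := hpre.pSeq hδs.1
  intro b hb hub
  -- Besides the given Π_i-sentence and the iteration along γ', the facts about `δ` that mention
  -- <₁^Q are reflected too, since <₁^R need not be related to <₁^Q.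
  have hp : PiP (M := M) Lim (i + 1) 5 fun U v => UPi i U (v 0) ∧ IterB i σ₁ σ₀ U (v 1) ∧
      ExpSeq σ₁ U (v 2) ∧ FirstsLt σ₁ U (v 2) (v 3) (v 4) :=
    PiP.and Lim.univC (((pi_uPi (by omega : 0 < i)).rename (![0] : Fin 1 → Fin 5)).le (by omega))
      (PiP.and Lim.univC ((pi_iterB hσ₁ hπ₁ hΔ hσ₀ hi).rename (![1] : Fin 1 → Fin 5))
      (PiP.and Lim.univC (((pi_expSeq hπ₁ hΔ).rename (![2] : Fin 1 → Fin 5)).le (by omega))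
        (((pi_firstsLt hπ₁ hΔ).rename (![2, 3, 4] : Fin 3 → Fin 5)).le (by omega))))
  obtain ⟨R, hRQ, hRL, hRn, hRm, h1, h2, h3, h4⟩ := hm.reflect (by omega) hp
    (v := ![b, γ', δ, k, n]) (fun j => by
      fin_cases j
      exacts [hb, hγ'.mem_world, hδs.1.mem_world, World.nat_mem hpre.1.1, World.nat_mem hn])
    ⟨hub, hit'.iterB hσ₀ (by omega) hm hγ', hδs, hfst⟩
  refine ⟨R, hRQ, Lim.univC _ hRL, ?_, hRm 0, h1⟩
  -- The second components of `δ` lie in W^Q(<₀) because `δ` is in the field of <_EW^Q. This is what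
  -- `Extends` for `Q` requires, although the iteration concerns `R`.
  exact hC R n δ k γ' hRQ hRL hn hRn h3 hpre (IterB.iter hσ₀ hγ' h2) fun j a c he hj =>
    ⟨h4 j a c he hj, hδ.2.1 j a c he⟩

/-- The relation `z <₀^Q y`, restricted to those `z` for which `γ⌢⟨(n, z)⟩` is a counterexample. -/
theorem Lim.exists_failSet (σ₁ σ₀ : setLang.Formula (Fin 2)) (i : ℕ) {U : Set M} [hU : Lim U]
    {Q γ m n : M} (hQU : Q ∈ U) (hQ : UnivC (ext Q)) (hγ : IsSeq γ m) (hγ' : PSeq γ)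
    (hn : Mem n (om M)) : ∃ r ∈ U, ∀ z y, Mem (op z y) r ↔
      NRel σ₀ (ext Q) z y ∧ ¬ Iter i (EW σ₁ σ₀) Q (ap γ m (op n z)) := by
  obtain ⟨D, hD, I, hI, H, hH, hQD, hIm, hh, -⟩ :=
    Lim.exists_hier (relAbs_expWRel (M := M) σ₁ σ₀) i hQU
  obtain ⟨A, hA, SA, -, hAa, hv⟩ := Lim.exists_adm_tup (U := U) (v := ![Q, H]) (fun j => by
    fin_cases j; exacts [hQU, hH])
  obtain ⟨B, hB, SB, -, hAB, hBa⟩ := Lim.exists_adm_of_mem hA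
  have hAw := hAa.world
  have hQA : Mem Q A := hv 0
  have hHA : Mem H A := hv 1
  have hγA : Mem γ A := hγ'.mem_world (W := ext A)
  have hnA : Mem n A := World.nat_mem (U := ext A) hn
  obtain ⟨r, hr, hrm⟩ := hBa.exists_sep (n := 5) (relD0 0 Empty.elim ![1, 2, 3, 4, 5]
    (ex fun z => ex fun y => ex fun q => ex fun t =>
      isOPair (4 : Fin 5).castSucc.castSucc.castSucc.castSucc z y ⋏
      natRel σ₀ _ (.set (0 : Fin 5).castSucc.castSucc.castSucc.castSucc) z y ⋏
      isOPair q (3 : Fin 5).castSucc.castSucc.castSucc.castSucc z ⋏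
      isSnoc t (2 : Fin 5).castSucc.castSucc.castSucc.castSucc q ⋏
      neg (pairIn (1 : Fin 5).castSucc.castSucc.castSucc.castSucc
        (0 : Fin 5).castSucc.castSucc.castSucc.castSucc t))) ![A, Q, H, γ, n]
    (fun j => by
      have hT := hBa.tr _ hAB
      fin_cases j
      exacts [hAB, hT _ hQA, hT _ hHA, hT _ hγA, hT _ hnA]) hAB
  refine ⟨r, hU.trans _ hB _ hr, fun z y => ?_⟩
  have hiff : ∀ z, Mem z (om M) → (Iter i (EW σ₁ σ₀) Q (ap γ m (op n z)) ↔
      Mem (op Q (ap γ m (op n z))) H) := fun z hz =>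
    hh.iter_iff hQD hQ ((hIm _).2 (PSeq.ap hγ hγ' hn hz))
  rw [hrm]
  constructor
  · rintro ⟨hp, h⟩
    rw [dr_rel (M := M) _ _ _ _ (fun j => by
      fin_cases j
      exacts [hQA, hHA, hγA, hnA, hp])] at h
    have : World (ext ((Fin.snoc ![A, Q, H, γ, n] (op z y) : Fin 6 → M) 0)) := hAw
    simp only [tr_ex, tr_and, tr_isOPair, tr_natRel, tr_isSnoc, tr_neg, tr_pairIn, sem_set,
      Fin.snoc_castSucc, Fin.snoc_last] at h
    obtain ⟨z', y', q, t, h1, h2, h3, h4, h5⟩ := h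
    obtain ⟨ez, ey⟩ := op_inj.1 (show op z y = op (z' : M) y' from h1)
    rw [ez, ey]
    refine ⟨h2, ?_⟩
    rw [hiff _ h2.1]
    have h4' : IsSnoc (t : M) γ (op n z') := by rw [h3] at h4; exact h4
    rw [hγ.isSnoc_iff] at h4'
    rw [← h4']; exact h5
  · rintro ⟨h1, h2⟩
    have hz : z ∈ ext A := World.nat_mem h1.1
    have hy : y ∈ ext A := World.nat_mem h1.2.1
    have hp : Mem (op z y) A := World.op_mem (U := ext A) hz hy
    refine ⟨hp, ?_⟩
    rw [dr_rel (M := M) _ _ _ _ (fun j => by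
      fin_cases j
      exacts [hQA, hHA, hγA, hnA, hp])]
    have : World (ext ((Fin.snoc ![A, Q, H, γ, n] (op z y) : Fin 6 → M) 0)) := hAw
    simp only [tr_ex, tr_and, tr_isOPair, tr_natRel, tr_isSnoc, tr_neg, tr_pairIn, sem_set,
      Fin.snoc_castSucc, Fin.snoc_last]
    have hq : op n z ∈ ext A := World.op_mem hnA hz
    refine ⟨⟨z, hz⟩, ⟨y, hy⟩, ⟨op n z, hq⟩,
      ⟨ap γ m (op n z), World.ap_mem (U := ext A) hγA (World.nat_mem hγ.1) hq⟩, rfl, h1, rfl,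
      hγ.isSnoc_iff.2 rfl, ?_⟩
    rw [hiff _ h1.1] at h2
    exact h2

/-- Induction along <₀^Q below `x`, with wellfoundedness measured in the larger `U`: it contains the
set of counterexamples as well as any descending sequence through it. -/
theorem Extends.iter_ap_of_wf (hσ₁ : IsSigma 2 σ₁) (hπ₁ : IsPi 2 π₁)
    (hΔ : KPl ⊨ᵇ sameRelSentence σ₁ π₁) (hσ₀ : IsSigma 1 σ₀) (ht : KPl ⊨ᵇ transSentence σ₁) {i : ℕ}
    (hi : 2 ≤ i) {U : Set M} [hU : Lim U] {Q n γ m x : M} (hQU : Q ∈ U) [hQ : Lim (ext Q)]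
    (hC : Extends i σ₁ σ₀ (ext Q))
    (hm : Mahlo (i + 1) (ext Q) fun R => Iter (i + 1) (NRel σ₁) R n) (hγ : IsSeq γ m)
    (hit : Iter i (EW σ₁ σ₀) Q γ) (hτ : ExpSeq σ₁ (ext Q) (ap γ m (op n x)))
    (hx : Wf σ₀ U x) : Iter i (EW σ₁ σ₀) Q (ap γ m (op n x)) := by
  have hn : Mem n (om M) := (hτ.1.nat (j := m) (x := n) (y := x) (mem_ap.2 (Or.inr rfl))).2.1
  by_contra hfail
  obtain ⟨r, hr, hrm⟩ := Lim.exists_failSet σ₁ σ₀ i hQU (Lim.univC _ hQ) hγ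
    ((pre_ap hγ _).pSeq hτ.1) hn
  -- By the single step, a counterexample `y` has a smaller counterexample, so the relation on
  -- counterexamples can be followed downwards forever.
  have step : ∀ y, Mem y (om M) → ¬ Iter i (EW σ₁ σ₀) Q (ap γ m (op n y)) →
      ∃ z, Mem (op z y) r := by
    intro y hy hf
    by_contra hz
    push Not at hz
    refine hf (hC.iter_ap hσ₁ hπ₁ hΔ hσ₀ ht hi hm hγ hit (hτ.ap_congr hγ hy) fun z h1 _ => ?_)
    by_contra hf'
    exact hz z ((hrm z y).2 ⟨h1, hf'⟩)
  obtain ⟨f, hf, h1, h2, h3⟩ := Lim.exists_chain hr hx.1 (fun z y h => ((hrm z y).1 h).1.1)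
    (step x hx.1 hfail) (fun z y h => step z ((hrm z y).1 h).1.1 ((hrm z y).1 h).2)
  rw [wf_iff] at hx
  refine hx.2 f hf ⟨h1, h2, fun k u w h4 h5 => ?_⟩
  -- The sequence descends in <₀^Q, hence in <₀^U, as <₀ is `Σ₁` and Q ⊆ U.
  exact ((hrm w u).1 (h3 k u w h4 h5)).1.mono hσ₀ (Lim.univC _ hQ) (Lim.univC _ hU)
    fun z hz => hU.trans _ hQU _ hz

/-- Induction on the length of initial segments of β, starting at γ. The appended first component
`n` is <₁^Q a, so unfolding M_{i+1}(a; <₁) at `n` provides the reflection needed. -/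
theorem Extends.of_mem (hσ₁ : IsSigma 2 σ₁) (hπ₁ : IsPi 2 π₁)
    (hΔ : KPl ⊨ᵇ sameRelSentence σ₁ π₁) (hσ₀ : IsSigma 1 σ₀) (ht : KPl ⊨ᵇ transSentence σ₁) {i : ℕ}
    (hi : 2 ≤ i) {U : Set M} [hU : Lim U]
    (ih : ∀ Q ∈ U, Lim (ext Q) → Extends i σ₁ σ₀ (ext Q)) : Extends i σ₁ σ₀ U := by
  intro Q a β k γ hQU hQ ha hita hβ hγ hit hent
  obtain ⟨l, hl, -⟩ := id hβ.1
  have hk := hγ.1.1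
  have key : ∀ t, Mem t (om M) → ∀ τ, Pre τ β t → Mem k (sc t) → Iter i (EW σ₁ σ₀) Q τ := by
    refine nat_induction (Dfb.mk4 (p := fun Q β k t => ∀ τ, Pre τ β t → Mem k (sc t) →
      Iter i (EW σ₁ σ₀) Q τ) (fun _ Q β k t => all fun τ => (isSeq τ t ⋏ allIn τ fun z => mem z β) ⟶ᶠ
        (mem k t ⋎ eq k t) ⟶ᶠ iterMahloSet i (expWRel (natRel σ₁) (natRel σ₀)) Q τ) ?_ Q β k) ?_ ?_
    · intro n v Q β k t
      simp [tr_iterMahloSet (relAbs_expWRel σ₁ σ₀), Pre, Subtype.ext_iff]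
    · intro τ hτ hkt
      obtain rfl : k = zero M := by simpa using hkt
      rwa [hτ.unique hγ hl]
    · intro t ht' ih' τ hτ hkt
      rcases mem_sc.1 hkt with hkt | rfl
      · obtain ⟨τ', hτ'⟩ := hτ.1.exists_pre (k := t) (by simp)
        have hpre : Pre τ' β t := ⟨hτ'.1, fun z hz => hτ.2 _ (hτ'.2 z hz)⟩
        obtain ⟨p, hp⟩ := hτ.1.exists_val (i := t) (by simp)
        obtain ⟨l', hl', h'⟩ := id hβ.1
        obtain ⟨n, x, hn, hx, he⟩ := h' t (hl'.mem_len (hτ.2 _ hp))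
        obtain rfl := hl'.val_unique (hτ.2 _ hp) he
        have e : ap τ' t (op n x) = τ := hτ.1.eq_of_subset (hτ'.1.ap _) fun z hz => by
          rcases mem_ap.1 hz with hz | rfl
          exacts [hτ'.2 z hz, hp]
        have htk : ¬ Mem t k := fun h => by
          rcases mem_sc.1 hkt with h' | rfl
          · exact not_mem_mem _ _ ⟨h, h'⟩
          · exact not_mem_self _ h
        obtain ⟨h1, h2⟩ := hent t n x he htk
        rw [← e]
        refine (ih Q hQU hQ).iter_ap_of_wf hσ₁ hπ₁ hΔ hσ₀ ht hi hQU ?_ hτ'.1 (ih' τ' hpre hkt) ?_ h2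
        · exact (iter_rec (relAbs_natRel σ₁) (Lim.univC _ hQ) ha).1 hita n h1
        · rw [e]; exact hτ.expSeq hβ
      · rwa [hτ.unique hγ hl]
  exact key l hl.1 β ⟨hl, fun z hz => hz⟩ (mem_sc.2 (by
    rcases nat_trichotomy hk hl.1 with h | h | h
    · exact Or.inl h
    · exact Or.inr h
    · obtain ⟨p, hp⟩ := hγ.1.exists_val h
      exact (not_mem_self _ (hl.mem_len (hγ.2 _ hp))).elim))

end

/-- `P` is a limit of admissible sets; `w` is `ω`. -/
def D0.lim {n : ℕ} (P w : Fin n) : D0 n :=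
  .and (.univ P w) (.allIn P fun x => .allIn (P : Fin (n + 1)) fun y =>
    .exIn (P : Fin (n + 1)).castSucc fun A => .exIn (P : Fin (n + 1)).castSucc.castSucc fun K =>
      .and (.and (.mem x.castSucc.castSucc.castSucc A.castSucc)
        (.mem y.castSucc.castSucc A.castSucc)) (.wAt K ![A.castSucc] (isAdm (0 : Fin 1))))

theorem dr_lim {n : ℕ} {P w : Fin n} {v : Fin n → M} (hw : v w = om M) :
    DR (.lim P w) v ↔ Lim (ext (v P)) := by
  simp only [D0.lim, dr_and, dr_univ hw, dr_allIn, dr_exIn, dr_mem, Fin.snoc_castSucc,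
    Fin.snoc_last]
  have e : ∀ x y A K : M, DR (.wAt (Fin.last (n + 3)) ![(Fin.last (n + 2)).castSucc]
      (isAdm (0 : Fin 1))) (Fin.snoc (Fin.snoc (Fin.snoc (Fin.snoc v x : Fin (n + 1) → M) y :
        Fin (n + 2) → M) A : Fin (n + 3) → M) K) ↔
      World (ext K) ∧ Mem A K ∧ ∃ S, Mem S K ∧ Adm A S := by
    intro x y A K
    rw [dr_wAt_iff (K' := K) (u := fun _ => A) (by simp) (fun j => by
      rw [Fin.fin_one_eq_zero j]; simp)]
    refine and_congr_right fun hK => ?_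
    simp only [tr_isAdm]
    exact ⟨fun ⟨h, h'⟩ => ⟨h 0, h'⟩, fun ⟨h, h'⟩ => ⟨fun _ => h, h'⟩⟩
  simp only [e]
  constructor
  · rintro ⟨h1, h2⟩
    exact Lim.of_reflects h1 h2
  · intro h
    exact ⟨Lim.univC _ h, Lim.reflects (U := ext (v P))⟩

/-- A definition by a formula is needed because the main ∈-induction runs over sets that are limits
of admissible sets. -/
def isLim {n : ℕ} (P : Fin n) : Fm n :=
  ex fun w => isOmega w ⋏ (D0.lim (P : Fin (n + 1)) w).toFm

theorem tr_isLim {n : ℕ} {v : Fin n → ↥(Set.univ : Set M)} {P : Fin n} :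
    Tr (isLim P) v ↔ Lim (ext (v P : M)) := by
  simp only [isLim, tr_ex, tr_and, tr_isOmega, tr_toFm, Fin.snoc_last]
  constructor
  · rintro ⟨w, h1, h2⟩
    rw [dr_lim (by simpa using h1)] at h2
    simpa using h2
  · intro h
    refine ⟨⟨om M, trivial⟩, rfl, ?_⟩
    rw [dr_lim (by simp)]
    simpa using h

section
variable {σ₁ π₁ σ₀ : setLang.Formula (Fin 2)}

/-- ∈-induction covers sets only; since `U` may be the class L, the inductive step is applied once
more at the top. -/
theorem Lim.extends (hσ₁ : IsSigma 2 σ₁) (hπ₁ : IsPi 2 π₁)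
    (hΔ : KPl ⊨ᵇ sameRelSentence σ₁ π₁) (hσ₀ : IsSigma 1 σ₀) (ht : KPl ⊨ᵇ transSentence σ₁) {i : ℕ}
    (hi : 2 ≤ i) (U : Set M) [hU : Lim U] : Extends i σ₁ σ₀ U := by
  refine .of_mem hσ₁ hπ₁ hΔ hσ₀ ht hi fun Q _ => ?_
  refine mem_induction (p := fun P => Lim (ext P) → Extends i σ₁ σ₀ (ext P)) ?_ ?_ Q
  · refine Dfb.mk1 (fun _ P => isLim P ⟶ᶠ all fun Q => all fun a => all fun β => all fun k =>
      all fun γ => mem Q P ⟶ᶠ isLim Q ⟶ᶠ isNat a ⟶ᶠ iterMahloSet (i + 1) (natRel σ₁) Q a ⟶ᶠ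
        isExpSeq (natRel σ₁) (.set Q) β ⟶ᶠ (isSeq γ k ⋏ allIn γ fun z => mem z β) ⟶ᶠ
        iterMahloSet i (expWRel (natRel σ₁) (natRel σ₀)) Q γ ⟶ᶠ
        (all fun j => all fun x => all fun y => entry β j x y ⟶ᶠ neg (mem j k) ⟶ᶠ
          (natRel σ₁ _ (.set (Q : Fin _)) x a ⋏ wfPart (natRel σ₀) (.set (P : Fin _)) y)) ⟶ᶠ
        iterMahloSet i (expWRel (natRel σ₁) (natRel σ₀)) Q β) ?_
    intro n v P
    simp only [tr_imp, tr_isLim, tr_all, tr_mem, tr_isNat, tr_and, tr_isSeq, tr_allIn, tr_entry,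
      tr_neg, tr_natRel, tr_wfPart, tr_isExpSeq, tr_iterMahloSet (relAbs_expWRel σ₁ σ₀),
      tr_iterMahloSet (relAbs_natRel σ₁), sem_set, Fin.snoc_castSucc, Fin.snoc_last, mem_coe,
      Extends, Pre, mem_ext, Subtype.forall, Set.mem_univ, true_imp_iff, forall_true_left]
  · intro P ih hP
    exact .of_mem hσ₁ hπ₁ hΔ hσ₀ ht hi fun Q hQ hL => ih Q hQ hL

end

end SetTh

namespace SetTh

variable {M : Type} [setLang.Structure M] [KPM M]

/-! ### The exponential lemma -/

section
variable {σ₁ π₁ σ₀ : setLang.Formula (Fin 2)}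

/-- The empty sequence has no predecessors, so the condition is vacuous; this starts the extension
process. -/
theorem iter_zero (i : ℕ) (σ₁ σ₀ : setLang.Formula (Fin 2)) {R : M} (hR : UnivC (ext R)) :
    Iter i (EW σ₁ σ₀) R (zero M) := by
  rw [iter_rec (relAbs_expWRel σ₁ σ₀) hR ⟨zero M, .zero, fun j hj => by simp at hj⟩]
  intro d hd
  rcases hd.1.2.2 with ⟨k, x₁, x₀, y₁, y₀, -, -, h, -⟩ | ⟨l, m, -, h, hl, -⟩
  · exact (not_mem_zero h).elim
  · rw [h.len_unique .zero] at hl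
    exact (not_mem_zero hl).elim

/-- Passing to `<_EW`-predecessors preserves bounds on the first components. -/
theorem ExpLt.head_lt (ht : KPl ⊨ᵇ transSentence σ₁) {U : Set M} [Lim U] {δ α a : M}
    (h : ExpLt σ₁ σ₀ U δ α) (hα : ∀ x y, Ent α (zero M) x y → NRel σ₁ U x a) {x y : M}
    (he : Ent δ (zero M) x y) : NRel σ₁ U x a := by
  obtain ⟨hδ, -, h⟩ := h
  obtain ⟨l, hl, -⟩ := id hδ.1
  have agree : ∀ k, Mem (zero M) k → Agree δ α k → NRel σ₁ U x a := by
    intro k hk ha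
    obtain ⟨p, h1, h2⟩ := ha _ hk
    rw [hl.val_unique h1 he] at h2
    exact hα x y h2
  rcases h with ⟨k, x₁, x₀, y₁, y₀, ha, h1, h2, h3⟩ | ⟨l', m, h1, h2, h3, ha⟩
  · rcases zero_or_sc (hδ.1.nat h1).1 with rfl | ⟨k, hk, rfl⟩
    · have e := hl.val_unique h1 he
      rw [op_inj] at e
      rw [← e.1]
      rcases h3 with h3 | ⟨rfl, -⟩
      exacts [h3.trans ht (hα _ _ h2), hα _ _ h2]
    · exact agree _ (zero_mem_sc hk) ha
  · exact agree l' (h1.mem_len he) ha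

/-- A predecessor `δ` of α inherits the bound `a` on its first components. Reflection provides an
`R` in M_{i+1}(a; <₁) with the same bound for <₁^R, and `Extends` for `U` builds up `δ` from the
empty sequence. -/
theorem Mahlo.exponent (hσ₁ : IsSigma 2 σ₁) (hπ₁ : IsPi 2 π₁)
    (hΔ : KPl ⊨ᵇ sameRelSentence σ₁ π₁) (hσ₀ : IsSigma 1 σ₀) (ht : KPl ⊨ᵇ transSentence σ₁) {i : ℕ}
    (hi : 2 ≤ i) {U : Set M} [hU : Lim U] {a α : M} (ha : Mem a (om M))
    (hα : ∀ x y, Ent α (zero M) x y → NRel σ₁ U x a)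
    (hm : Mahlo (i + 1) U fun R => Iter (i + 1) (NRel σ₁) R a) {δ : M} (hδ : EW σ₁ σ₀ U δ α) :
    Mahlo i U fun R => Iter i (EW σ₁ σ₀) R δ := by
  intro b hb hub
  have hδs := hδ.1.1
  have hp : PiP (M := M) Lim (i + 1) 4 fun U v => UPi i U (v 0) ∧
      ExpSeq σ₁ U (v 1) ∧ FirstsLt σ₁ U (v 1) (v 2) (v 3) :=
    PiP.and Lim.univC (((pi_uPi (by omega : 0 < i)).rename (![0] : Fin 1 → Fin 4)).le (by omega))
      (PiP.and Lim.univC (((pi_expSeq hπ₁ hΔ).rename (![1] : Fin 1 → Fin 4)).le (by omega))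
        (((pi_firstsLt hπ₁ hΔ).rename (![1, 2, 3] : Fin 3 → Fin 4)).le (by omega)))
  obtain ⟨R, hRU, hRL, hRa, hRm, h1, h2, h3⟩ := hm.reflect (by omega) hp
    (v := ![b, δ, zero M, a]) (fun j => by
      fin_cases j
      exacts [hb, hδs.1.mem_world, World.zero_mem, World.nat_mem ha])
    ⟨hub, hδs, .of_head ht hδs zero_mem_om fun x y he => hδ.1.head_lt ht hα he⟩
  refine ⟨R, hRU, Lim.univC _ hRL, ?_, hRm 0, h1⟩
  exact Lim.extends hσ₁ hπ₁ hΔ hσ₀ ht hi U R a δ (zero M) (zero M) hRU hRL ha hRa h2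
    ⟨.zero, fun z hz => (not_mem_zero hz).elim⟩ (iter_zero i σ₁ σ₀ (Lim.univC _ hRL))
    fun j x y he hj => ⟨h3 j x y he hj, hδ.2.1 j x y he⟩

/-- Common to L and admissible sets. That the universe is a limit of admissible sets is only asked
for under the Mahlo premise, since an admissible set need not be one otherwise. -/
theorem tr_exponentFormula (hσ₁ : IsSigma 2 σ₁) (hπ₁ : IsPi 2 π₁)
    (hΔ : KPl ⊨ᵇ sameRelSentence σ₁ π₁) (hσ₀ : IsSigma 1 σ₀) (ht : KPl ⊨ᵇ transSentence σ₁) {i : ℕ}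
    (hi : 2 ≤ i) {n : ℕ} {v : Fin n → ↥(Set.univ : Set M)} {V : Univ n}
    (hV : UnivC (Univ.sem v V))
    (hL : ∀ X : M → Prop, Mahlo (i + 1) (Univ.sem v V) X → Lim (Univ.sem v V)) :
    Tr (exponentFormula i (natRel σ₁) (natRel σ₀) V) v := by
  simp only [exponentFormula, tr_all, tr_imp, tr_isNat, expBelow, tr_and, tr_isExpSeq, tr_entry,
    tr_isEmpty, tr_natRel, sem_map, snoc_comp_castSucc, Fin.snoc_castSucc, Fin.snoc_last]
  rintro a ha α ⟨hα, hα'⟩ hm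
  have hsem : Univ.sem (Fin.snoc (Fin.snoc v a : Fin (n + 1) → ↥(Set.univ : Set M)) α :
      Fin (n + 2) → ↥(Set.univ : Set M)) ((V.map Fin.castSucc).map Fin.castSucc) =
      Univ.sem v V := by
    simp only [sem_map, snoc_comp_castSucc]
  rw [tr_mahlo (X' := fun R : M => Iter (i + 1) (NRel σ₁) R (a : M)) (by rw [hsem]; exact hV.trans)
    (TrOK.univ _) (by
      intro b Q _ _
      rw [iterMahlo, tr_iterMahloSet (relAbs_natRel σ₁)]
      simp), hsem] at hm
  have := hL _ hm
  have key : ∀ δ : M, EW σ₁ σ₀ (Univ.sem v V) δ α →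
      Mahlo i (Univ.sem v V) fun R => Iter i (EW σ₁ σ₀) R δ := fun δ hδ =>
    Mahlo.exponent hσ₁ hπ₁ hΔ hσ₀ ht hi ha (fun x y he =>
      hα' ⟨zero M, trivial⟩ ⟨x, trivial⟩ ⟨y, trivial⟩ ⟨rfl, he⟩) hm hδ
  cases V with
  | L =>
    show Tr (iterMahlo i _ Univ.L _) _
    rw [iterMahlo, tr_all]
    intro d
    rw [tr_imp, (relAbs_expWRel (M := M) σ₁ σ₀).tr _ _ _ _ _ (by exact ⟨transC_univ, trivial⟩)]
    intro hd
    rw [tr_mahlo (X' := fun R : M => Iter i (EW σ₁ σ₀) R (d : M)) (by exact transC_univ) (TrOK.univ _) (by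
      intro b Q _ _
      rw [tr_iterMahloSet (relAbs_expWRel σ₁ σ₀)]
      simp)]
    refine key d ?_
    simpa using hd
  | set P =>
    show Tr (iterMahlo i _ (Univ.set _) _) _
    rw [iterMahlo, tr_iterMahloSet (relAbs_expWRel σ₁ σ₀)]
    simp only [Fin.snoc_castSucc, Fin.snoc_last]
    rw [iter_rec (relAbs_expWRel σ₁ σ₀) hV hα.1]
    exact key

theorem realize_exponentSentence (hσ₁ : IsSigma 2 σ₁) (hπ₁ : IsPi 2 π₁)
    (hΔ : KPl ⊨ᵇ sameRelSentence σ₁ π₁) (hσ₀ : IsSigma 1 σ₀) (ht : KPl ⊨ᵇ transSentence σ₁) {i : ℕ}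
    (hi : 2 ≤ i) : Sentence.Realize M (exponentSentence i (natRel σ₁) (natRel σ₀)) := by
  rw [sentence_iff_tr _ fun j => ((default : Fin 0 → ↥(Set.univ : Set M)) j : M)]
  refine (tr_univ_coe _ (default : Fin 0 → ↥(Set.univ : Set M))).1 ?_
  rw [exponentSentence, tr_and, tr_all]
  refine ⟨tr_exponentFormula hσ₁ hπ₁ hΔ hσ₀ ht hi (Lim.univC _ (inferInstanceAs (Lim (Set.univ : Set M)))) fun _ _ =>
    inferInstanceAs (Lim (Set.univ : Set M)), fun P => ?_⟩
  rw [tr_imp, tr_isAdm]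
  rintro ⟨S, -, hS⟩
  refine tr_exponentFormula hσ₁ hπ₁ hΔ hσ₀ ht hi ?_ fun X hX => ?_
  · exact ⟨hS.tr.transC, hS.om⟩
  -- `Adm.lim` needs `Π₃`-reflection, and 3 ≤ i + 1.
  · exact Adm.lim hS (by omega) hX

end

end SetTh

/-- Let `<₁` be a `Δ₂` relation on `ω` (defined by the `Σ₂`-formula `σ₁` and, provably in `KPℓ`,
also by the `Π₂`-formula `π₁`) and `<₀` a `Σ₁` relation on `ω` (defined by `σ₀`), both provably
transitive in `KPℓ`.  Then for each `i ≥ 2`, `KPℓ` proves that for all `P ∈ L ∪ {L}` (`P = L`,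
or `P` an admissible set), `a ∈ ω` and `α <^P a`, if `P ∈ M_{i+1}(M_{i+1}(a; <₁))`, then `P ∈ Mᵢ(α; <_EW)`. -/
theorem lemma3 (σ₁ π₁ σ₀ : SetTh.setLang.Formula (Fin 2))
    (hσ₁ : SetTh.IsSigma 2 σ₁) (hπ₁ : SetTh.IsPi 2 π₁)
    (hΔ : SetTh.KPl ⊨ᵇ SetTh.sameRelSentence σ₁ π₁)
    (hσ₀ : SetTh.IsSigma 1 σ₀)
    (htrans₁ : SetTh.KPl ⊨ᵇ SetTh.transSentence σ₁)
    (htrans₀ : SetTh.KPl ⊨ᵇ SetTh.transSentence σ₀)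
    (i : ℕ) (hi : 2 ≤ i) :
    SetTh.KPl ⊨ᵇ
      SetTh.exponentSentence i (SetTh.natRel σ₁) (SetTh.natRel σ₀) := by
  rw [FirstOrder.Language.Theory.models_sentence_iff]
  intro N
  have : SetTh.KPM N :=
    ⟨fun ψ hψ => FirstOrder.Language.Theory.realize_sentence_of_mem SetTh.KPl hψ⟩
  exact SetTh.realize_exponentSentence hσ₁ hπ₁ hΔ hσ₀ htrans₁ hi
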